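/- **Setting.** Let $\gamma\in\mathbb C$, $q=e^{-\gamma}$, $q^x=e^{-\gamma x}$, $T>0$, $h\neq h'$ real, $\alpha=(h-h')/(2\gamma T)$. Let $R(\lambda,\mu)$ be the six-vertex $R$-matrix on $\mathbb C^2\otimes\mathbb C^2$ (basis $++,+-,-+,--$) with non-zero entries $R^{++}_{++}=R^{--}_{--}=1$, $R^{+-}_{+-}=R^{-+}_{-+}=b(\lambda,\mu)=\frac{\sin(\mu-\lambda)}{\sin(\mu-\lambda+i\gamma)}$, $R^{+-}_{-+}=R^{-+}_{+-}=c(\lambda,\mu)=\frac{\sin(i\gamma)}{\sin(\mu-\lambda+i\gamma)}$ (upper indices: row, lower indices: column). For $K\ge1$, $\sigma\in\{\pm1\}^{2K}$ and $\nu\in\mathbb C^{2K}$ let $$T(\lambda|h)=e^{h\sigma^z_0/(2T)}R^{(\sigma_{2K})}_{0,2K}(\lambda,\nu_{2K})\cdots R^{(\sigma_1)}_{0,1}(\lambda,\nu_1),\qquad t(\lambda|h)=\operatorname{tr}_0T(\lambda|h),$$ where $R^{(1)}_{0,j}(\lambda,\nu_j)=R_{0,j}(\lambda,\nu_j)$ and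 $R^{(-1)}_{0,j}(\lambda,\nu_j)$ is the transpose in space $j$ of $R_{j,0}(\nu_j,\lambda)$. With $a(\lambda|h)=e^{h/2T}\prod_{\sigma_j=-1}b(\nu_j,\lambda)$, $d(\lambda|h)=e^{-h/2T}\prod_{\sigma_j=1}b(\lambda,\nu_j)$, the auxiliary function of $x_1,\dots,x_K$ is $$\mathfrak a(\lambda|h)=\frac{d(\lambda|h)}{a(\lambda|h)}\prod_{k=1}^K\frac{\sin(\lambda-x_k-i\gamma)}{\sin(\lambda-x_k+i\gamma)} .$$ Let $|0\rangle$ be the reference state ($e_+$ at sites with $\sigma_j=1$, $e_-$ at sites with $\sigma_j=-1$). A *Bethe eigenstate of pseudo-spin zero* at field $h$ consists of roots $x_1,\dots,x_K$, pairwise distinct modulo $\pi$, with $\mathfrak a(x_j|h)=-1$, and of non-zero right and left eigenvectors $|\Psi\rangle\propto T^+_-(x_1|h)\cdots T^+_-(x_K|h)|0\rangle$, $\langle\Psi|\propto\langle0|T^-_+(x_1|h)\cdots T^-_+(x_K|h)$ of $t(\lambda|h)$ for all $\lambda$, with common eigenvalue $\Lambda(\lambda|h)$. Let $\Psi_0(h)$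 and $\Psi_n(h')$ be two such states for the fields $h$ and $h'$, with eigenvalues $\Lambda_0(\lambda|h)$, $\Lambda_n(\lambda|h')$ and auxiliary functions $\mathfrak a_0(\lambda|h)$, $\mathfrak a_n(\lambda|h')$. Set $\rho_n(\lambda)=\Lambda_n(\lambda|h')/\Lambda_0(\lambda|h)$ and $$\mathcal F^{(+)}_{n;2}(\xi_1,\xi_2)=\frac{\langle\Psi_n(h')|T(\xi_1|h)\otimes T(\xi_2|h)|\Psi_0(h)\rangle}{\langle\Psi_n(h')|\Psi_0(h)\rangle\Lambda_0(\xi_1|h)\Lambda_0(\xi_2|h)},\qquad \mathcal F^{(-)}_{n;2}(\xi_1,\xi_2)=\frac{\langle\Psi_0(h)|T(\xi_1|h')\otimes T(\xi_2|h')|\Psi_n(h')\rangle}{\langle\Psi_0(h)|\Psi_n(h')\rangle\Lambda_n(\xi_1|h')\Lambda_n(\xi_2|h')},$$ assuming that the denominators do not vanish. Call $\Psi_0$ (for $+$), resp. $\Psi_n$ (for $-$), the right state and the other one the left state. Let $\mathcal C=\mathcal C^{(\pm)}_n$ be a simple closed, counterclockwise, piecewise $C^1$ contour such that: no two points of $\mathcal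 C\cup\operatorname{Int}\mathcal C$ differ by $i\gamma$ modulo $\pi$; no point of $\operatorname{Int}\mathcal C$ equals another point of $\mathcal C\cup\operatorname{Int}\mathcal C$ modulo $\pi$; all $\nu_j$ and the Bethe roots of the right state are in $\operatorname{Int}\mathcal C$; $1+\mathfrak a$ of the right state does not vanish on $\mathcal C$; the eigenvalue of the left state does not vanish on $\mathcal C\cup\operatorname{Int}\mathcal C$ (so the zeros, resp. poles, of $\rho_n$ are outside). Let $K_\beta(\lambda)=q^{-\beta}\operatorname{ctg}(\lambda-i\gamma)-q^{\beta}\operatorname{ctg}(\lambda+i\gamma)$, $$dm^{(+)}(\lambda)=\frac{d\lambda}{2\pi i\,\rho_n(\lambda)(1+\mathfrak a_0(\lambda|h))},\qquad dm^{(-)}(\lambda)=\frac{\rho_n(\lambda)\,d\lambda}{2\pi i\,(1+\mathfrak a_n(\lambda|h'))},$$ and for $\xi\in\{\xi_1,\xi_2\}$ let $G^{(\pm)}(\cdot,\xi)$ be the unique continuous solution on $\mathcal C$ (assumed to exist uniquely) of $$G^{(\pm)}(\lambda,\xi)=q^{\mp\alpha}\operatorname{ctg}(\lambda-\xi+i\gamma)-\rho_n^{\pm1}(\xi)\operatorname{ctg}(\lambda-\xi)-\int_{\mathcal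 C}dm^{(\pm)}(\mu)\,K_{\mp\alpha}(\lambda-\mu)\,G^{(\pm)}(\mu,\xi).$$ Put $$\Phi(\xi)=\int_{\mathcal C}dm^{(\pm)}(\lambda)\,G^{(\pm)}(\lambda,\xi),\qquad \Psi(\xi_1,\xi_2)=-i\int_{\mathcal C}dm^{(\pm)}(\lambda)\bigl(q^{\pm\alpha}\operatorname{ctg}(\lambda-\xi_1+i\gamma)-\rho_n^{\pm1}(\xi_1)\operatorname{ctg}(\lambda-\xi_1)\bigr)G^{(\pm)}(\lambda,\xi_2).$$ **Statement.** Let $\xi_1\ne\xi_2$ be in $\operatorname{Int}\mathcal C$, $\zeta=e^{i(\xi_1-\xi_2)}$, and assume $q^{1+\alpha}\ne q^{-1-\alpha}$, $q^{1-\alpha}\neq q^{-1+\alpha}$. Write $\Phi_j=\Phi(\xi_j)$, $\Psi_{jk}=\Psi(\xi_j,\xi_k)$, $d_\pm=q^{1\pm\alpha}-q^{-1\mp\alpha}$ and $d_\mp=q^{1\mp\alpha}-q^{-1\pm\alpha}$, $d_0=q^{\pm\alpha}-q^{\mp\alpha}$ (upper signs for $\mathcal F^{(+)}$, lower signs for $\mathcal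 F^{(-)}$), and $$M(x,z)=\begin{pmatrix}-x&&&\\&x&z^{-1}&\\&z&x^{-1}&\\&&&-x^{-1}\end{pmatrix}.$$ (1) For every such $K,\sigma,\nu$ and every such pair of states, the two-site form factors factorize: $$\begin{aligned}\mathcal F^{(\pm)}_{n;2}(\xi_1,\xi_2)={}&\frac1{2(\zeta-\zeta^{-1})}\Bigl\{-\frac{\zeta\Psi_{12}-\zeta^{-1}\Psi_{21}}{d_\pm}M(q,\zeta)+\frac{\Psi_{12}-\Psi_{21}}{d_0}\begin{pmatrix}-\zeta-\zeta^{-1}&&&\\&\zeta+\zeta^{-1}&q+q^{-1}&\\&q+q^{-1}&\zeta+\zeta^{-1}&\\&&&-\zeta-\zeta^{-1}\end{pmatrix}+\frac{\zeta^{-1}\Psi_{12}-\zeta\Psi_{21}}{d_\mp}M(q^{-1},\zeta^{-1})\Bigr\}\\ &+\frac{d_0}{2(\zeta-\zeta^{-1})}\Bigl\{\frac{\zeta\Phi_1(\Phi_2+1)-\zeta^{-1}\Phi_2(\Phi_1+1)}{d_\mp}M(q^{-1},\zeta^{-1})+\frac{\zeta^{-1}\Phi_1(\Phi_2+1)-\zeta\Phi_2(\Phi_1+1)}{d_\pm}M(q,\zeta)\Bigr\}\\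 &+\frac{\Phi_1-\Phi_2}{2(\zeta-\zeta^{-1})}\begin{pmatrix}\zeta-\zeta^{-1}&&&\\&\zeta^{-1}-\zeta&q-q^{-1}&\\&q^{-1}-q&\zeta-\zeta^{-1}&\\&&&\zeta^{-1}-\zeta\end{pmatrix}+\begin{pmatrix}-\Phi_1&&&\\&0&&\\&&0&\\&&&1+\Phi_1\end{pmatrix}.\end{aligned}$$ (2) The same holds in the Trotter limit of the XXZ chain with exchange coupling $J>0$. Let $\kappa=-i/(J(q-q^{-1}))$, let $N$ run through the even numbers, let $\sigma=(1,-1,1,-1,\dots)$, and let either $K=N$ and $\nu_{2k-1}=-\nu_{2k}=\frac{it}{\kappa N}$ for $k\le N/2$, $\nu_{2k-1}=-\nu_{2k}=(\frac1T-it)\frac1{\kappa N}$ for $N/2<k\le N$ (dynamical quantum transfer matrix, $t\in\mathbb R$), or $K=N/2$ and $\nu_{2k-1}=-\nu_{2k}=\frac1{T\kappa N}$ (static quantum transfer matrix). Suppose that for all large $N$ two states as above are given, that $\mathcal C$ satisfies the above conditions for all large $N$, and that as $N\to\infty$ the ratio $\rho_n$ converges uniformly on $\mathcal C$ and at $\xi_1,\xi_2$,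 and the auxiliary function of the right state converges uniformly on $\mathcal C$, the limits $\rho_n$ and $1+\mathfrak a$ having no zeros on $\mathcal C$ and $\rho_n(\xi_1),\rho_n(\xi_2)\neq0$. If $G^{(\pm)},\Phi,\Psi$ are defined by means of the limit functions, then $\lim_{N\to\infty}\mathcal F^{(\pm)}_{n;2}(\xi_1,\xi_2)$ exists and is equal to the right-hand side of the formula in (1). -/

import Mathlib

open Filter Topology

noncomputable section

namespace XXZ

/-! ### The six-vertex `R`-matrix and the staggered monodromy matrix

The local basis vectors `e_+`, `e_-` of `ℂ²` are indexed by `0, 1 : Fin 2`; the space of `M` sites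
is `(Fin M → Fin 2) → ℂ`; the auxiliary space is the first factor of
`Fin 2 × (Fin M → Fin 2)`. -/

/-- The weight `b(λ, μ)`. -/
def bWeight (γ lam mu : ℂ) : ℂ :=
  Complex.sin (mu - lam) / Complex.sin (mu - lam + Complex.I * γ)

/-- The weight `c(λ, μ)`. -/
def cWeight (γ lam mu : ℂ) : ℂ :=
  Complex.sin (Complex.I * γ) / Complex.sin (mu - lam + Complex.I * γ)

/-- A `4 × 4` array read as an operator on `ℂ² ⊗ ℂ²`, the basis being ordered
`++, +-, -+, --` (rows: upper indices, columns: lower indices). -/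
def ofArray (A : Matrix (Fin 4) (Fin 4) ℂ) : Matrix (Fin 2 × Fin 2) (Fin 2 × Fin 2) ℂ :=
  fun p q => A (finProdFinEquiv p) (finProdFinEquiv q)

/-- The `R`-matrix `R(λ, μ)` of the XXZ chain. -/
def rMatrix (γ lam mu : ℂ) : Matrix (Fin 2 × Fin 2) (Fin 2 × Fin 2) ℂ :=
  ofArray !![1, 0, 0, 0;
             0, bWeight γ lam mu, cWeight γ lam mu, 0;
             0, cWeight γ lam mu, bWeight γ lam mu, 0;
             0, 0, 0, 1]

/-- `R_{0,j}(λ, ν_j)` if `σ_j = 1`, and `R_{j,0}(ν_j, λ)` transposed in the space `j` if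
`σ_j = -1`, acting on the auxiliary space `0` and the sites `1, …, M`. -/
def siteOperator {M : ℕ} (γ : ℂ) (σ : Fin M → ℤˣ) (ν : Fin M → ℂ) (lam : ℂ) (j : Fin M) :
    Matrix (Fin 2 × (Fin M → Fin 2)) (Fin 2 × (Fin M → Fin 2)) ℂ :=
  fun p q =>
    if ∀ k, k ≠ j → p.2 k = q.2 k then
      if σ j = 1 then rMatrix γ lam (ν j) (p.1, p.2 j) (q.1, q.2 j)
      else rMatrix γ (ν j) lam (q.2 j, p.1) (p.2 j, q.1)
    else 0

/-- The twist `θ₀(τ) = exp(τ σᶻ / 2)` in the auxiliary space. -/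
def twist (M : ℕ) (τ : ℂ) :
    Matrix (Fin 2 × (Fin M → Fin 2)) (Fin 2 × (Fin M → Fin 2)) ℂ :=
  Matrix.diagonal fun p => if p.1 = 0 then Complex.exp (τ / 2) else Complex.exp (-τ / 2)

/-- The monodromy matrix
`T(λ|σ, ν, h) = θ₀(h/T) R_{0,M}^{(σ_M)}(λ, ν_M) ⋯ R_{0,1}^{(σ_1)}(λ, ν_1)`, with `τ = h/T`. -/
def monodromy {M : ℕ} (γ : ℂ) (σ : Fin M → ℤˣ) (ν : Fin M → ℂ) (τ lam : ℂ) :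
    Matrix (Fin 2 × (Fin M → Fin 2)) (Fin 2 × (Fin M → Fin 2)) ℂ :=
  twist M τ * (List.ofFn (siteOperator γ σ ν lam)).reverse.prod

/-- The entry `T^a_b(λ)` (row `a`, column `b` in the auxiliary space), an operator on the sites. -/
def monodromyEntry {M : ℕ} (γ : ℂ) (σ : Fin M → ℤˣ) (ν : Fin M → ℂ) (τ lam : ℂ) (a b : Fin 2) :
    Matrix (Fin M → Fin 2) (Fin M → Fin 2) ℂ :=
  fun s s' => monodromy γ σ ν τ lam (a, s) (b, s')

/-- The (quantum) transfer matrix `t(λ) = tr₀ T(λ)`. -/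
def transferMatrix {M : ℕ} (γ : ℂ) (σ : Fin M → ℤˣ) (ν : Fin M → ℂ) (τ lam : ℂ) :
    Matrix (Fin M → Fin 2) (Fin M → Fin 2) ℂ :=
  ∑ a : Fin 2, monodromyEntry γ σ ν τ lam a a

/-- `λ` is not a pole of any of the weights that enter the monodromy matrix. -/
def IsRegularPoint {M : ℕ} (γ : ℂ) (ν : Fin M → ℂ) (lam : ℂ) : Prop :=
  ∀ j, Complex.sin (lam - ν j + Complex.I * γ) ≠ 0 ∧
    Complex.sin (lam - ν j - Complex.I * γ) ≠ 0

/-! ### Bethe eigenstates of pseudo-spin zero -/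

/-- The reference state: `e_+` on the sites with `σ_j = 1`, `e_-` on those with `σ_j = -1`. -/
def refState {M : ℕ} (σ : Fin M → ℤˣ) : (Fin M → Fin 2) → ℂ :=
  fun s => if ∀ j, s j = if σ j = 1 then 0 else 1 then 1 else 0

/-- The eigenvalue of `T^+_+(λ)` on the reference state. -/
def vacA {M : ℕ} (γ : ℂ) (σ : Fin M → ℤˣ) (ν : Fin M → ℂ) (τ lam : ℂ) : ℂ :=
  Complex.exp (τ / 2) * ∏ j, if σ j = 1 then 1 else bWeight γ (ν j) lam

/-- The eigenvalue of `T^-_-(λ)` on the reference state. -/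
def vacD {M : ℕ} (γ : ℂ) (σ : Fin M → ℤˣ) (ν : Fin M → ℂ) (τ lam : ℂ) : ℂ :=
  Complex.exp (-τ / 2) * ∏ j, if σ j = 1 then bWeight γ lam (ν j) else 1

/-- The auxiliary function `𝔞(λ)` of the Bethe roots `x`. -/
def auxFun {M K : ℕ} (γ : ℂ) (σ : Fin M → ℤˣ) (ν : Fin M → ℂ) (τ : ℂ) (x : Fin K → ℂ)
    (lam : ℂ) : ℂ :=
  (vacD γ σ ν τ lam * ∏ k, Complex.sin (lam - x k - Complex.I * γ)) /
    (vacA γ σ ν τ lam * ∏ k, Complex.sin (lam - x k + Complex.I * γ))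

/-- A candidate eigenstate on `2K` sites: Bethe roots, right eigenvector `|Ψ⟩`, left
eigenvector `⟨Ψ|` and eigenvalue `Λ(λ)`. -/
structure StateData (K : ℕ) where
  roots : Fin K → ℂ
  ket : (Fin (2 * K) → Fin 2) → ℂ
  bra : (Fin (2 * K) → Fin 2) → ℂ
  eigenvalue : ℂ → ℂ

/-- `S` is an eigenstate of pseudo-spin zero of the commuting transfer matrices `t(λ)` that is
given by the algebraic Bethe ansatz, i.e. by pairwise distinct (modulo `π`) solutions `x` of the
Bethe equations `𝔞(x_j) = -1` through `|Ψ⟩ ∝ B(x_1)⋯B(x_K)|0⟩`, `⟨Ψ| ∝ ⟨0|C(x_1)⋯C(x_K)`, where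
`B = T^+_-` and `C = T^-_+`. -/
structure IsBetheEigenstate {K : ℕ} (γ : ℂ) (σ : Fin (2 * K) → ℤˣ) (ν : Fin (2 * K) → ℂ) (τ : ℂ)
    (S : StateData K) : Prop where
  distinct : ∀ i j, i ≠ j → Complex.sin (S.roots i - S.roots j) ≠ 0
  bethe : ∀ j, auxFun γ σ ν τ S.roots (S.roots j) = -1
  ket_ne : S.ket ≠ 0
  bra_ne : S.bra ≠ 0
  ket_bethe : ∃ c : ℂ, S.ket = c • Matrix.mulVec
    (List.ofFn fun j => monodromyEntry γ σ ν τ (S.roots j) 0 1).prod (refState σ)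
  bra_bethe : ∃ c : ℂ, S.bra = c • Matrix.vecMul (refState σ)
    (List.ofFn fun j => monodromyEntry γ σ ν τ (S.roots j) 1 0).prod
  ket_eigen : ∀ lam, IsRegularPoint γ ν lam →
    Matrix.mulVec (transferMatrix γ σ ν τ lam) S.ket = S.eigenvalue lam • S.ket
  bra_eigen : ∀ lam, IsRegularPoint γ ν lam →
    Matrix.vecMul S.bra (transferMatrix γ σ ν τ lam) = S.eigenvalue lam • S.bra

/-! ### Thermal form factors -/

/-- The label `±` of the two kinds of form factors. -/
inductive Sgn
  | plus
  | minus

/-- The number `±1`. -/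
def Sgn.toComplex : Sgn → ℂ
  | .plus => 1
  | .minus => -1

/-- Of the pair of data belonging to `Ψ_0(h)` and to `Ψ_n(h')`, the one that enters the form
factor as right vector. -/
def Sgn.right {A : Type*} : Sgn → A → A → A
  | .plus, x₀, _ => x₀
  | .minus, _, xn => xn

/-- Of the pair of data belonging to `Ψ_0(h)` and to `Ψ_n(h')`, the one that enters the form
factor as left vector. -/
def Sgn.left {A : Type*} : Sgn → A → A → A
  | .plus, _, xn => xn
  | .minus, x₀, _ => x₀

/-- `⟨Φ| T(ξ₁) ⊗ T(ξ₂) |Ψ⟩ / (⟨Φ|Ψ⟩ Λ(ξ₁) Λ(ξ₂))`, as a matrix on `ℂ² ⊗ ℂ²`. -/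
def normalizedElement {M : ℕ} (γ : ℂ) (σ : Fin M → ℤˣ) (ν : Fin M → ℂ) (τ : ℂ)
    (bra ket : (Fin M → Fin 2) → ℂ) (ev : ℂ → ℂ) (ξ₁ ξ₂ : ℂ) :
    Matrix (Fin 2 × Fin 2) (Fin 2 × Fin 2) ℂ :=
  fun a b =>
    dotProduct bra (Matrix.mulVec
      (monodromyEntry γ σ ν τ ξ₁ a.1 b.1 * monodromyEntry γ σ ν τ ξ₂ a.2 b.2) ket) /
    (dotProduct bra ket * (ev ξ₁ * ev ξ₂))

/-- The two-site thermal form factors `F^{(±)}_{n;2}(ξ₁, ξ₂|h, h')`; here `S₀` is the state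
`Ψ_0(h)`, `Sn` is the state `Ψ_n(h')`, and `τ = h/T`, `τ' = h'/T`. -/
def formFactor {K : ℕ} (s : Sgn) (γ : ℂ) (σ : Fin (2 * K) → ℤˣ) (ν : Fin (2 * K) → ℂ) (τ τ' : ℂ)
    (S₀ Sn : StateData K) (ξ₁ ξ₂ : ℂ) : Matrix (Fin 2 × Fin 2) (Fin 2 × Fin 2) ℂ :=
  match s with
  | .plus => normalizedElement γ σ ν τ Sn.bra S₀.ket S₀.eigenvalue ξ₁ ξ₂
  | .minus => normalizedElement γ σ ν τ' S₀.bra Sn.ket Sn.eigenvalue ξ₁ ξ₂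

/-- The eigenvalue ratio `ρ_n(λ|h, h') = Λ_n(λ|h') / Λ_0(λ|h)`. -/
def eigenvalueRatio {K : ℕ} (S₀ Sn : StateData K) (lam : ℂ) : ℂ :=
  Sn.eigenvalue lam / S₀.eigenvalue lam

/-! ### Contours -/

/-- `∫ f(z) dz` along a path parameterized by `[0, 1]`. -/
def pathIntegral (c : ℝ → ℂ) (f : ℂ → ℂ) : ℂ :=
  ∫ u in (0 : ℝ)..1, f (c u) * deriv c u

/-- The winding number of the closed path `c` around `w`. -/
def windingNumber (c : ℝ → ℂ) (w : ℂ) : ℂ :=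
  (2 * Real.pi * Complex.I)⁻¹ * pathIntegral c fun z => (z - w)⁻¹

/-- Simple closed piecewise `C¹` contours, oriented counterclockwise. -/
structure Contour where
  path : ℝ → ℂ
  continuous_path : ContinuousOn path (Set.Icc 0 1)
  closed : path 0 = path 1
  simple : Set.InjOn path (Set.Ico 0 1)
  piecewise : ∃ P : Finset ℝ, ∀ u v : ℝ, 0 ≤ u → u < v → v ≤ 1 → (∀ p ∈ P, p ∉ Set.Ioo u v) →
    ContDiffOn ℝ 1 path (Set.Icc u v)
  positive : ∀ w, w ∉ path '' Set.Icc 0 1 → windingNumber path w = 0 ∨ windingNumber path w = 1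

/-- The set of points on the contour. -/
def Contour.trace (C : Contour) : Set ℂ := C.path '' Set.Icc 0 1

/-- `Int C`. -/
def Contour.inside (C : Contour) : Set ℂ :=
  {w | w ∉ C.trace ∧ windingNumber C.path w = 1}

/-- `∫_C f(z) dz`. -/
def Contour.integral (C : Contour) (f : ℂ → ℂ) : ℂ := pathIntegral C.path f

/-- Admissibility of the contour `C = C_n^{(±)}` for a finite number of sites. On and inside `C`
no two points differ by `± iγ` modulo `π`; the interior contains no two points that are equal
modulo `π`; the interior contains the inhomogeneities and the Bethe roots of the right state, and
`1 + 𝔞` of that state does not vanish on `C`; the zeros of `ρ_n` (for `+`) or the poles of `ρ_n`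
(for `-`), i.e. the zeros of the eigenvalue of the left state, are outside. -/
structure IsAdmissibleContour {K : ℕ} (s : Sgn) (γ : ℂ) (σ : Fin (2 * K) → ℤˣ)
    (ν : Fin (2 * K) → ℂ) (τ τ' : ℂ) (S₀ Sn : StateData K) (C : Contour) : Prop where
  shift : ∀ z ∈ C.trace ∪ C.inside, ∀ w ∈ C.trace ∪ C.inside,
    Complex.sin (z - w + Complex.I * γ) ≠ 0
  period : ∀ z ∈ C.inside, ∀ w ∈ C.trace ∪ C.inside, Complex.sin (z - w) = 0 → z = w
  inhom : ∀ j, ν j ∈ C.inside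
  roots : ∀ j, (s.right S₀ Sn).roots j ∈ C.inside
  aux_ne : ∀ z ∈ C.trace, 1 + auxFun γ σ ν (s.right τ τ') (s.right S₀ Sn).roots z ≠ 0
  ratio_ne : ∀ z ∈ C.trace ∪ C.inside, (s.left S₀ Sn).eigenvalue z ≠ 0

/-! ### The functions `G`, `Φ`, `Ψ` and the factorized expression -/

/-- `q^x` with `q = e^{-γ}`. -/
def qPow (γ x : ℂ) : ℂ := Complex.exp (-(γ * x))

/-- `α = (h - h') / (2γT)`. -/
def alpha (γ : ℂ) (T h h' : ℝ) : ℂ := ((h : ℂ) - h') / (2 * γ * T)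

/-- The deformed kernel `K_β(λ)`. -/
def kernel (γ β lam : ℂ) : ℂ :=
  qPow γ (-β) * Complex.cot (lam - Complex.I * γ) - qPow γ β * Complex.cot (lam + Complex.I * γ)

/-- `ρ^{±1}`. -/
def Sgn.ratio : Sgn → ℂ → ℂ
  | .plus, r => r
  | .minus, r => r⁻¹

/-- The density of the 'measure' `dm^{(±)}`: `1 / (2πi ρ (1 + 𝔞))` for `+` and
`ρ / (2πi (1 + 𝔞))` for `-`; here `𝔞` is `𝔞_0(·|h)` for `+` and `𝔞_n(·|h')` for `-`. -/
def density (s : Sgn) (ρ 𝔞 : ℂ → ℂ) (mu : ℂ) : ℂ :=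
  match s with
  | .plus => 1 / (2 * Real.pi * Complex.I * ρ mu * (1 + 𝔞 mu))
  | .minus => ρ mu / (2 * Real.pi * Complex.I * (1 + 𝔞 mu))

/-- `g` is continuous on `C` and solves the linear integral equation for `G^{(±)}(·, ξ)`. -/
def IsGSolution (s : Sgn) (γ α : ℂ) (C : Contour) (ρ 𝔞 : ℂ → ℂ) (ξ : ℂ) (g : ℂ → ℂ) : Prop :=
  ContinuousOn g C.trace ∧ ∀ lam ∈ C.trace,
    g lam = qPow γ (-(s.toComplex * α)) * Complex.cot (lam - ξ + Complex.I * γ)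
      - s.ratio (ρ ξ) * Complex.cot (lam - ξ)
      - C.integral fun mu => density s ρ 𝔞 mu * kernel γ (-(s.toComplex * α)) (lam - mu) * g mu

/-- `g` is the function `G^{(±)}(·, ξ)` on `C`: the unique continuous solution of the linear
integral equation. -/
def IsG (s : Sgn) (γ α : ℂ) (C : Contour) (ρ 𝔞 : ℂ → ℂ) (ξ : ℂ) (g : ℂ → ℂ) : Prop :=
  IsGSolution s γ α C ρ 𝔞 ξ g ∧
    ∀ g', IsGSolution s γ α C ρ 𝔞 ξ g' → Set.EqOn g' g C.trace

/-- `Φ^{(±)}(ξ)`, where `G lam ξ` is `G^{(±)}(λ, ξ)`. -/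
def phiFun (s : Sgn) (C : Contour) (ρ 𝔞 : ℂ → ℂ) (G : ℂ → ℂ → ℂ) (ξ : ℂ) : ℂ :=
  C.integral fun lam => density s ρ 𝔞 lam * G lam ξ

/-- `Ψ^{(±)}(ξ₁, ξ₂)`. -/
def psiFun (s : Sgn) (γ α : ℂ) (C : Contour) (ρ 𝔞 : ℂ → ℂ) (G : ℂ → ℂ → ℂ) (ξ₁ ξ₂ : ℂ) : ℂ :=
  -Complex.I * C.integral fun lam => density s ρ 𝔞 lam *
    (qPow γ (s.toComplex * α) * Complex.cot (lam - ξ₁ + Complex.I * γ)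
      - s.ratio (ρ ξ₁) * Complex.cot (lam - ξ₁)) * G lam ξ₂

/-- The matrix with entries `-x, x, x⁻¹, -x⁻¹` on the diagonal and `z⁻¹`, `z` off it. -/
def blockMatrix (x z : ℂ) : Matrix (Fin 2 × Fin 2) (Fin 2 × Fin 2) ℂ :=
  ofArray !![-x, 0, 0, 0;
             0, x, z⁻¹, 0;
             0, z, x⁻¹, 0;
             0, 0, 0, -x⁻¹]

/-- The factorized two-site expression. Arguments: `q`, `ζ`, the three denominators
`d₊ = q^{1 ± α} - q^{-1 ∓ α}`, `d₀ = q^{± α} - q^{∓ α}`, `d₋ = q^{1 ∓ α} - q^{-1 ± α}`, and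
`Φ(ξ₁)`, `Φ(ξ₂)`, `Ψ(ξ₁, ξ₂)`, `Ψ(ξ₂, ξ₁)`. -/
def factorizedMatrix (q ζ dp d0 dm Φ₁ Φ₂ Ψ₁₂ Ψ₂₁ : ℂ) :
    Matrix (Fin 2 × Fin 2) (Fin 2 × Fin 2) ℂ :=
  (1 / (2 * (ζ - ζ⁻¹))) •
      (-((ζ * Ψ₁₂ - ζ⁻¹ * Ψ₂₁) / dp) • blockMatrix q ζ
        + ((Ψ₁₂ - Ψ₂₁) / d0) •
          ofArray !![-ζ - ζ⁻¹, 0, 0, 0;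
                     0, ζ + ζ⁻¹, q + q⁻¹, 0;
                     0, q + q⁻¹, ζ + ζ⁻¹, 0;
                     0, 0, 0, -ζ - ζ⁻¹]
        + ((ζ⁻¹ * Ψ₁₂ - ζ * Ψ₂₁) / dm) • blockMatrix q⁻¹ ζ⁻¹)
    + (d0 / (2 * (ζ - ζ⁻¹))) •
      (((ζ * (Φ₁ * (Φ₂ + 1)) - ζ⁻¹ * (Φ₂ * (Φ₁ + 1))) / dm) • blockMatrix q⁻¹ ζ⁻¹
        + ((ζ⁻¹ * (Φ₁ * (Φ₂ + 1)) - ζ * (Φ₂ * (Φ₁ + 1))) / dp) • blockMatrix q ζ)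
    + ((Φ₁ - Φ₂) / (2 * (ζ - ζ⁻¹))) •
      ofArray !![ζ - ζ⁻¹, 0, 0, 0;
                 0, ζ⁻¹ - ζ, q - q⁻¹, 0;
                 0, q⁻¹ - q, ζ - ζ⁻¹, 0;
                 0, 0, 0, ζ⁻¹ - ζ]
    + ofArray !![-Φ₁, 0, 0, 0;
                 0, 0, 0, 0;
                 0, 0, 0, 0;
                 0, 0, 0, 1 + Φ₁]

/-- The right-hand side of the two-site factorization formula, with `ζ = e^{i(ξ₁ - ξ₂)}`. -/
def factorizedFormFactor (s : Sgn) (γ α : ℂ) (C : Contour) (ρ 𝔞 : ℂ → ℂ) (G : ℂ → ℂ → ℂ)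
    (ξ₁ ξ₂ : ℂ) : Matrix (Fin 2 × Fin 2) (Fin 2 × Fin 2) ℂ :=
  factorizedMatrix (qPow γ 1) (Complex.exp (Complex.I * (ξ₁ - ξ₂)))
    (qPow γ (1 + s.toComplex * α) - qPow γ (-1 - s.toComplex * α))
    (qPow γ (s.toComplex * α) - qPow γ (-(s.toComplex * α)))
    (qPow γ (1 - s.toComplex * α) - qPow γ (-1 + s.toComplex * α))
    (phiFun s C ρ 𝔞 G ξ₁) (phiFun s C ρ 𝔞 G ξ₂)
    (psiFun s γ α C ρ 𝔞 G ξ₁ ξ₂) (psiFun s γ α C ρ 𝔞 G ξ₂ ξ₁)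

/-! ### The quantum transfer matrices of the XXZ chain and the Trotter limit -/

/-- A staggering `σ` and inhomogeneities `ν` on `2K` sites. -/
structure Columns where
  K : ℕ
  σ : Fin (2 * K) → ℤˣ
  ν : Fin (2 * K) → ℂ

/-- `κ = -i / (J (q - q⁻¹))`. -/
def kappa (γ : ℂ) (J : ℝ) : ℂ := -Complex.I / (J * (qPow γ 1 - qPow γ (-1)))

/-- The alternating staggering `1, -1, 1, -1, …`. -/
def alternating (K : ℕ) (j : Fin (2 * K)) : ℤˣ := if Even (j : ℕ) then 1 else -1

/-- The dynamical quantum transfer matrix of Trotter number `N` at time `t`: `2N` sites and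
`ν_{2k-1} = -ν_{2k}`, equal to `it/(κN)` for `k = 1, …, N/2` and to `(1/T - it)/(κN)` for
`k = N/2 + 1, …, N`. -/
def dynamicalColumns (γ : ℂ) (J T t : ℝ) (N : ℕ) : Columns where
  K := N
  σ := alternating N
  ν := fun j => (if Even (j : ℕ) then 1 else -1) *
    (if (j : ℕ) / 2 < N / 2 then Complex.I * t else 1 / (T : ℂ) - Complex.I * t) /
      (kappa γ J * N)

/-- The ordinary (static) quantum transfer matrix of Trotter number `N`: `N` sites and
`ν_{2k-1} = -ν_{2k} = 1/(TκN)` for `k = 1, …, N/2`. -/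
def staticColumns (γ : ℂ) (J T : ℝ) (N : ℕ) : Columns where
  K := N / 2
  σ := alternating (N / 2)
  ν := fun j => (if Even (j : ℕ) then 1 else -1) * (1 / (T : ℂ)) / (kappa γ J * N)

/-- `N → ∞` through the even numbers. -/
def trotter : Filter ℕ := atTop ⊓ 𝓟 {N | Even N}

end XXZ

end

/-! ### Contours: bounds for the speed and elementary properties of the integral -/

namespace XXZ

open MeasureTheory Set Metric

namespace Contour

variable (C : Contour)

/-! Both signs are one statement about a matrix element between a right Bethe vector at one twist
and a left eigenvector at another; `w = q^{±α}` is the ratio of the two twists. Let `Λ` and `L` be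
the eigenvalues of the right and of the left state. Join the two spectral parameters to the Bethe
roots of the right state to obtain one family `p` of `K + 2` points, and let `V_ab` be the vector
created by the operators `B` at all points except `p a` and `p b`. The right state is the vector
that omits the two spectral parameters. The exchange relations show that `A`, `D` and `C`, applied
at points of the family, only produce combinations of such vectors (`action_action`, `action_C`).

Let `φ` be the left eigenvector, so that `φ ∘ (w A + w⁻¹ D) = L φ`. Evaluating this at `p a` on
`V_ab` shows that the columns of the antisymmetric matrix `sin (p a - p b) φ(V_ab)` all solve one
linear system (`isColumn_overlapMatrix`). By the Bethe equations this system is the finite form of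
the integral equation for `G` (`column_eq`). Unique solvability leaves only the values at the two
spectral parameters free, so the matrix has rank two and satisfies a Plücker relation
(`overlapMatrix_plucker`). Every overlap in a two-site matrix element is therefore a `2 × 2`
determinant in the residues of `G(·, ξ₁) dm` and `G(·, ξ₂) dm`. This is the source of the
factorization.

The bridge to contour integrals is the identity `Λ / (1 + 𝔞) = a ∏ sin(λ - x_k + iγ) / sin(λ - x_k)`
on the contour (`one_add_auxFun`): the measure extends to the interior with simple poles only at the
Bethe roots, and `Φ`, `Ψ` become finite sums over residues (`integral_residueG`, `integral_psi`).

The elements of `A A` and `C B` are now antisymmetrized double sums. They reduce to sums of `cot(p c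
- p d + iγ)` with the weights `1`, `e^{2ip}`, `e^{-2ip}`. Antisymmetrizing the two equations for the
residues turns each of these into `Φ`, `Ψ` and single sums that cancel in the end (`bracket_cot`,
`bracket_weight`); the prefactors that have to be divided out are the three denominators of the
formula. The other non-zero entries follow from the eigenvector properties on both sides and from
the commutator of `C` and `B`.

Two continuity arguments remain: spectral parameters that coincide with a Bethe root, and the
Trotter limit. Both rest on Fredholm theory: unique solvability is stable under small perturbations
of density and source, and the solution depends continuously on them (`exists_tendsto_solution`).
The residue theorem for these contours is obtained from Dixon's proof of Cauchy's formula. -/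

theorem isCompact_trace : IsCompact C.trace :=
  isCompact_Icc.image_of_continuousOn C.continuous_path

theorem path_mem_trace {u : ℝ} (hu : u ∈ Icc (0 : ℝ) 1) : C.path u ∈ C.trace :=
  mem_image_of_mem _ hu

/-- There are finitely many break points, so a short interval to the right of `x` has none in its
interior. The path is `C¹` up to the closed end points of this interval, and compactness bounds the
derivative. One-sided statements are needed because `x` may itself be a break point. -/
theorem exists_bound_deriv_right {x : ℝ} (h0 : 0 ≤ x) (h1 : x < 1) :
    ∃ ε > 0, ∃ B : ℝ, ∀ u ∈ Ioo x (x + ε), ‖deriv C.path u‖ ≤ B := by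
  obtain ⟨P, hP⟩ := C.piecewise
  have hcl : IsClosed ((P : Set ℝ) \ {x}) := (P.finite_toSet.subset sdiff_subset).isClosed
  have hnh : ((P : Set ℝ) \ {x})ᶜ ∈ 𝓝 x := hcl.isOpen_compl.mem_nhds (by simp)
  obtain ⟨ε, hε, hb⟩ := Metric.mem_nhds_iff.1 hnh
  obtain ⟨δ, hδ, hδε, hδ1⟩ : ∃ δ > 0, δ < ε ∧ x + δ ≤ 1 :=
    ⟨min (ε / 2) (1 - x), by
      have : 0 < 1 - x := by linarith
      positivity, (min_le_left _ _).trans_lt (by linarith), by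
      linarith [min_le_right (ε / 2) (1 - x)]⟩
  have hc := hP x (x + δ) h0 (by linarith) hδ1 (by
    intro p hp hpx
    have : p ∈ ball x ε := by
      rw [Metric.mem_ball, Real.dist_eq, abs_lt]; constructor <;> linarith [hpx.1, hpx.2]
    exact hb this ⟨hp, by simpa using hpx.1.ne'⟩)
  have hcont := hc.continuousOn_derivWithin (uniqueDiffOn_Icc (by linarith)) le_rfl
  obtain ⟨B, hB⟩ := (isCompact_Icc.image_of_continuousOn hcont).isBounded.exists_norm_le
  refine ⟨δ, hδ, B, fun u hu => ?_⟩
  rw [← derivWithin_of_mem_nhds (Icc_mem_nhds hu.1 hu.2)]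
  exact hB _ (mem_image_of_mem _ (Ioo_subset_Icc_self hu))

theorem exists_bound_deriv_left {x : ℝ} (h0 : 0 < x) (h1 : x ≤ 1) :
    ∃ ε > 0, ∃ B : ℝ, ∀ u ∈ Ioo (x - ε) x, ‖deriv C.path u‖ ≤ B := by
  obtain ⟨P, hP⟩ := C.piecewise
  have hcl : IsClosed ((P : Set ℝ) \ {x}) := (P.finite_toSet.subset sdiff_subset).isClosed
  have hnh : ((P : Set ℝ) \ {x})ᶜ ∈ 𝓝 x := hcl.isOpen_compl.mem_nhds (by simp)
  obtain ⟨ε, hε, hb⟩ := Metric.mem_nhds_iff.1 hnh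
  obtain ⟨δ, hδ, hδε, hδ1⟩ : ∃ δ > 0, δ < ε ∧ 0 ≤ x - δ :=
    ⟨min (ε / 2) x, by positivity, (min_le_left _ _).trans_lt (by linarith), by
      linarith [min_le_right (ε / 2) x]⟩
  have hc := hP (x - δ) x hδ1 (by linarith) h1 (by
    intro p hp hpx
    have : p ∈ ball x ε := by
      rw [Metric.mem_ball, Real.dist_eq, abs_lt]; constructor <;> linarith [hpx.1, hpx.2]
    exact hb this ⟨hp, by simpa using hpx.2.ne⟩)
  have hcont := hc.continuousOn_derivWithin (uniqueDiffOn_Icc (by linarith)) le_rfl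
  obtain ⟨B, hB⟩ := (isCompact_Icc.image_of_continuousOn hcont).isBounded.exists_norm_le
  refine ⟨δ, hδ, B, fun u hu => ?_⟩
  rw [← derivWithin_of_mem_nhds (Icc_mem_nhds hu.1 hu.2)]
  exact hB _ (mem_image_of_mem _ (Ioo_subset_Icc_self hu))

/-- The derivative of the parametrization is essentially bounded. -/
theorem exists_bound_deriv :
    ∃ L : ℝ, 0 ≤ L ∧ ∀ᵐ u : ℝ, u ∈ Ioo (0 : ℝ) 1 → ‖deriv C.path u‖ ≤ L := by
  suffices h : ∃ L : ℝ, ∀ᵐ u : ℝ, u ∈ Icc (0 : ℝ) 1 → u ∈ Ioo (0 : ℝ) 1 →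
      ‖deriv C.path u‖ ≤ L by
    obtain ⟨L, hL⟩ := h
    refine ⟨max L 0, le_max_right _ _, ?_⟩
    filter_upwards [hL] with u hu hu'
    exact (hu (Ioo_subset_Icc_self hu') hu').trans (le_max_left _ _)
  refine isCompact_Icc.induction_on (p := fun s : Set ℝ => ∃ L : ℝ, ∀ᵐ u : ℝ, u ∈ s →
    u ∈ Ioo (0 : ℝ) 1 → ‖deriv C.path u‖ ≤ L) ⟨0, by simp⟩ ?_ ?_ ?_
  · rintro s t hst ⟨L, hL⟩
    exact ⟨L, hL.mono fun u hu hs => hu (hst hs)⟩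
  · rintro s t ⟨L, hL⟩ ⟨L', hL'⟩
    refine ⟨max L L', ?_⟩
    filter_upwards [hL, hL'] with u hu hu' hs h01
    rcases hs with hs | hs
    · exact (hu hs h01).trans (le_max_left _ _)
    · exact (hu' hs h01).trans (le_max_right _ _)
  · intro x hx
    have hr : ∃ ε > 0, ∃ B : ℝ, ∀ u ∈ Ioo x (x + ε), u ∈ Ioo (0 : ℝ) 1 →
        ‖deriv C.path u‖ ≤ B := by
      rcases hx.2.lt_or_eq with h | h
      · obtain ⟨ε, hε, B, hB⟩ := C.exists_bound_deriv_right hx.1 h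
        exact ⟨ε, hε, B, fun u hu _ => hB u hu⟩
      · exact ⟨1, one_pos, 0, fun u hu hu' => absurd hu.1 (by linarith [hu'.2])⟩
    have hl : ∃ ε > 0, ∃ B : ℝ, ∀ u ∈ Ioo (x - ε) x, u ∈ Ioo (0 : ℝ) 1 →
        ‖deriv C.path u‖ ≤ B := by
      rcases hx.1.lt_or_eq with h | h
      · obtain ⟨ε, hε, B, hB⟩ := C.exists_bound_deriv_left h hx.2
        exact ⟨ε, hε, B, fun u hu _ => hB u hu⟩
      · exact ⟨1, one_pos, 0, fun u hu hu' => absurd hu.2 (by linarith [hu'.1])⟩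
    obtain ⟨ε, hε, B, hB⟩ := hr
    obtain ⟨ε', hε', B', hB'⟩ := hl
    refine ⟨Ioo (x - ε') (x + ε), mem_nhdsWithin_of_mem_nhds
      (Ioo_mem_nhds (by linarith) (by linarith)), max B B', ?_⟩
    -- The one-sided bounds say nothing at `x` itself, which is a null set.
    have hne : ∀ᵐ u : ℝ, u ≠ x := by
      simp [ae_iff]
    filter_upwards [hne] with u hu hus h01
    rcases lt_or_gt_of_ne hu with h | h
    · exact (hB' u ⟨hus.1, h⟩ h01).trans (le_max_right _ _)
    · exact (hB u ⟨h, hus.2⟩ h01).trans (le_max_left _ _)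

/-- A bound for the length of the contour. -/
theorem exists_length : ∃ L : ℝ, 0 ≤ L ∧ ∀ᵐ u : ℝ, u ∈ uIoc (0 : ℝ) 1 →
    ‖deriv C.path u‖ ≤ L := by
  obtain ⟨L, hL0, hL⟩ := C.exists_bound_deriv
  refine ⟨L, hL0, ?_⟩
  have hne : ∀ᵐ u : ℝ, u ≠ 1 := by simp [ae_iff]
  filter_upwards [hL, hne] with u hu hu1 h
  rw [uIoc_of_le zero_le_one] at h
  exact hu ⟨h.1, lt_of_le_of_ne h.2 hu1⟩

/-- A bound for the length of the contour. -/
noncomputable def len : ℝ := C.exists_length.choose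

theorem len_nonneg : 0 ≤ C.len := C.exists_length.choose_spec.1

theorem ae_norm_deriv_le : ∀ᵐ u : ℝ, u ∈ uIoc (0 : ℝ) 1 → ‖deriv C.path u‖ ≤ C.len :=
  C.exists_length.choose_spec.2

variable {C}

theorem path_mem_trace_of_uIoc {u : ℝ} (hu : u ∈ uIoc (0 : ℝ) 1) : C.path u ∈ C.trace := by
  rw [uIoc_of_le zero_le_one] at hu
  exact C.path_mem_trace (Ioc_subset_Icc_self hu)

theorem aestronglyMeasurable_integrand {f : ℂ → ℂ} (hf : ContinuousOn f C.trace) :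
    AEStronglyMeasurable (fun u => f (C.path u) * deriv C.path u)
      (volume.restrict (uIoc (0 : ℝ) 1)) := by
  refine AEStronglyMeasurable.mul ?_ (measurable_deriv _).aestronglyMeasurable
  have : ContinuousOn (fun u => f (C.path u)) (uIoc (0 : ℝ) 1) := by
    rw [uIoc_of_le zero_le_one]
    exact (hf.comp C.continuous_path fun u hu => C.path_mem_trace hu).mono Ioc_subset_Icc_self
  exact this.aestronglyMeasurable measurableSet_uIoc

theorem ae_norm_integrand_le {f : ℂ → ℂ} {B : ℝ} (hB : ∀ z ∈ C.trace, ‖f z‖ ≤ B) :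
    ∀ᵐ u : ℝ, u ∈ uIoc (0 : ℝ) 1 → ‖f (C.path u) * deriv C.path u‖ ≤ B * C.len := by
  filter_upwards [C.ae_norm_deriv_le] with u hu h
  rw [norm_mul]
  have hb := hB _ (path_mem_trace_of_uIoc h)
  exact mul_le_mul hb (hu h) (norm_nonneg _) ((norm_nonneg _).trans hb)

theorem intervalIntegrable_integrand {f : ℂ → ℂ} (hf : ContinuousOn f C.trace) :
    IntervalIntegrable (fun u => f (C.path u) * deriv C.path u) volume 0 1 := by
  obtain ⟨B, hB⟩ := (C.isCompact_trace.image_of_continuousOn hf).isBounded.exists_norm_le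
  have hB' : ∀ z ∈ C.trace, ‖f z‖ ≤ B := fun z hz => hB _ (mem_image_of_mem _ hz)
  refine (intervalIntegrable_const (c := B * C.len)).mono_fun
    (aestronglyMeasurable_integrand hf) ?_
  rw [EventuallyLE, ae_restrict_iff' measurableSet_uIoc]
  filter_upwards [ae_norm_integrand_le hB'] with u hu h
  exact (hu h).trans (le_abs_self _)

theorem integral_def (f : ℂ → ℂ) :
    C.integral f = ∫ u in (0 : ℝ)..1, f (C.path u) * deriv C.path u := rfl

theorem norm_integral_le {f : ℂ → ℂ} {B : ℝ} (hB : ∀ z ∈ C.trace, ‖f z‖ ≤ B) :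
    ‖C.integral f‖ ≤ B * C.len := by
  have := intervalIntegral.norm_integral_le_of_norm_le_const_ae (ae_norm_integrand_le hB)
  simpa [integral_def] using this

theorem integral_congr {f g : ℂ → ℂ} (h : EqOn f g C.trace) : C.integral f = C.integral g := by
  rw [integral_def, integral_def]
  refine intervalIntegral.integral_congr fun u hu => ?_
  rw [uIcc_of_le zero_le_one] at hu
  simp [h (C.path_mem_trace hu)]

theorem integral_add {f g : ℂ → ℂ} (hf : ContinuousOn f C.trace) (hg : ContinuousOn g C.trace) :
    C.integral (fun z => f z + g z) = C.integral f + C.integral g := by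
  simp only [integral_def, add_mul]
  exact intervalIntegral.integral_add (intervalIntegrable_integrand hf)
    (intervalIntegrable_integrand hg)

theorem integral_const_mul (c : ℂ) (f : ℂ → ℂ) :
    C.integral (fun z => c * f z) = c * C.integral f := by
  simp only [integral_def, mul_assoc]
  exact intervalIntegral.integral_const_mul _ _

theorem integral_sub {f g : ℂ → ℂ} (hf : ContinuousOn f C.trace) (hg : ContinuousOn g C.trace) :
    C.integral (fun z => f z - g z) = C.integral f - C.integral g := by
  simp only [integral_def, sub_mul]
  exact intervalIntegral.integral_sub (intervalIntegrable_integrand hf)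
    (intervalIntegrable_integrand hg)

/-- Contour integrals depend holomorphically on a parameter. -/
theorem differentiableAt_integral {k : ℂ → ℂ → ℂ} {w₀ : ℂ} {r B : ℝ} (hr : 0 < r)
    (hcont : ∀ w ∈ ball w₀ r, ContinuousOn (k w) C.trace)
    (hdiff : ∀ z ∈ C.trace, DifferentiableOn ℂ (fun w => k w z) (ball w₀ r))
    (hB : ∀ w ∈ ball w₀ r, ∀ z ∈ C.trace, ‖k w z‖ ≤ B) :
    DifferentiableAt ℂ (fun w => C.integral (k w)) w₀ := by
  have hr2 : 0 < r / 2 := by positivity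
  have hsub : ∀ w ∈ ball w₀ (r / 2), ball w (r / 2) ⊆ ball w₀ r := fun w hw =>
    ball_subset_ball' (by rw [mem_ball] at hw; linarith)
  have hsub' : ∀ w ∈ ball w₀ (r / 2), closedBall w (r / 4) ⊆ ball w₀ r := fun w hw =>
    (closedBall_subset_ball (by linarith)).trans (hsub w hw)
  have hw0 : ball w₀ (r / 2) ∈ 𝓝 w₀ := ball_mem_nhds _ hr2
  have hss : ball w₀ (r / 2) ⊆ ball w₀ r := ball_subset_ball (by linarith)
  have hd : ∀ z ∈ C.trace, ∀ w ∈ ball w₀ (r / 2), HasDerivAt (fun w => k w z)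
      (deriv (fun w => k w z) w) w := fun z hz w hw =>
    ((hdiff z hz).differentiableAt (isOpen_ball.mem_nhds (hss hw))).hasDerivAt
  refine (intervalIntegral.hasDerivAt_integral_of_dominated_loc_of_deriv_le
    (F := fun w u => k w (C.path u) * deriv C.path u)
    (F' := fun w u => deriv (fun w => k w (C.path u)) w * deriv C.path u)
    (bound := fun _ => B / (r / 4) * C.len) hw0 ?_ ?_ ?_ ?_ ?_ ?_).2.differentiableAt
  · filter_upwards [ball_mem_nhds w₀ hr] with w hw
    exact aestronglyMeasurable_integrand (hcont w hw)
  · exact intervalIntegrable_integrand (hcont _ (mem_ball_self hr))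
  -- Measurability of the parameter derivative along the path: it is the pointwise limit of the
  -- difference quotients at `w₀ + 1/(n+1)`, each of which is continuous on the contour.
  · have hlim : Tendsto (fun n : ℕ => w₀ + (((n : ℂ) + 1)⁻¹)) atTop (𝓝[≠] w₀) := by
      have hz : Tendsto (fun n : ℕ => ((n : ℂ) + 1)⁻¹) atTop (𝓝 0) := by
        simpa [one_div] using tendsto_one_div_add_atTop_nhds_zero_nat (𝕜 := ℂ)
      refine tendsto_nhdsWithin_iff.2 ⟨by simpa using hz.const_add w₀, Eventually.of_forall ?_⟩
      intro n
      have : (n : ℂ) + 1 ≠ 0 := by exact_mod_cast n.succ_ne_zero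
      simpa using this
    have hev : ∀ᶠ n : ℕ in atTop, w₀ + (((n : ℂ) + 1)⁻¹) ∈ ball w₀ r :=
      (tendsto_nhdsWithin_iff.1 hlim).1.eventually (ball_mem_nhds w₀ hr)
    obtain ⟨n₀, hn₀⟩ := eventually_atTop.1 hev
    refine aestronglyMeasurable_of_tendsto_ae (u := (atTop : Filter ℕ))
      (f := fun n u => slope (fun w => k w (C.path u)) w₀ (w₀ + (((n + n₀ : ℕ) : ℂ) + 1)⁻¹)
        * deriv C.path u) ?_ ?_
    · intro n
      have hc : ContinuousOn (fun z => slope (fun w => k w z) w₀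
          (w₀ + (((n + n₀ : ℕ) : ℂ) + 1)⁻¹)) C.trace := by
        simp only [slope, vsub_eq_sub, smul_eq_mul]
        exact continuousOn_const.mul ((hcont _ (hn₀ _ (Nat.le_add_left _ _))).sub
          (hcont _ (mem_ball_self hr)))
      exact aestronglyMeasurable_integrand hc
    · refine (ae_restrict_iff' measurableSet_uIoc).2 (Eventually.of_forall fun u hu => ?_)
      refine Tendsto.mul_const _ ?_
      have h1 := (hasDerivAt_iff_tendsto_slope.1
        (hd _ (path_mem_trace_of_uIoc hu) w₀ (mem_ball_self hr2)))
      exact (h1.comp hlim).comp (tendsto_add_atTop_nat n₀)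
  · filter_upwards [C.ae_norm_deriv_le] with u hu h w hw
    rw [norm_mul]
    have hz : C.path u ∈ C.trace := path_mem_trace_of_uIoc h
    -- Cauchy's estimate on a circle of radius `r / 4`, which stays in the ball since `w` is within
    -- `r / 2` of the centre. It provides the dominating function.
    have hb : ‖deriv (fun w => k w (C.path u)) w‖ ≤ B / (r / 4) := by
      refine Complex.norm_deriv_le_of_forall_mem_sphere_norm_le (by positivity) ?_ ?_
      · refine DifferentiableOn.diffContOnCl ?_
        rw [closure_ball _ (by positivity)]
        exact (hdiff _ hz).mono (hsub' w hw)
      · intro v hv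
        exact hB v (hsub' w hw (sphere_subset_closedBall hv)) _ hz
    exact mul_le_mul hb (hu h) (norm_nonneg _) ((norm_nonneg _).trans hb)
  · exact intervalIntegrable_const
  · refine Eventually.of_forall fun u hu w hw => ?_
    exact (hd _ (path_mem_trace_of_uIoc hu) w hw).mul_const _

end Contour

end XXZ

/-! ### Cauchy's formula and the residue theorem -/

namespace XXZ

open MeasureTheory Set Metric

namespace Contour

variable {C : Contour}

/-- The Cauchy transform is holomorphic off the contour. -/
theorem differentiableAt_cauchyTransform {f : ℂ → ℂ} (hf : ContinuousOn f C.trace) {w₀ : ℂ}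
    (hw₀ : w₀ ∉ C.trace) :
    DifferentiableAt ℂ (fun w => C.integral fun z => f z / (z - w)) w₀ := by
  obtain ⟨B, hB⟩ := (C.isCompact_trace.image_of_continuousOn hf).isBounded.exists_norm_le
  obtain ⟨ε, hε, hball⟩ := Metric.mem_nhds_iff.1
    (C.isCompact_trace.isClosed.isOpen_compl.mem_nhds hw₀)
  have hdist : ∀ w ∈ ball w₀ (ε / 2), ∀ z ∈ C.trace, ε / 2 ≤ ‖z - w‖ := by
    intro w hw z hz
    have h1 : ε ≤ dist z w₀ := by
      by_contra! h
      exact hball h hz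
    have := dist_triangle z w w₀
    rw [mem_ball] at hw
    rw [← dist_eq_norm]; linarith
  have hne : ∀ w ∈ ball w₀ (ε / 2), ∀ z ∈ C.trace, z - w ≠ 0 := fun w hw z hz h => by
    have := hdist w hw z hz
    rw [h, norm_zero] at this; linarith
  refine differentiableAt_integral (r := ε / 2) (B := B / (ε / 2)) (by positivity) ?_ ?_ ?_
  · intro w hw
    exact hf.div (by fun_prop) (hne w hw)
  · intro z hz
    exact (differentiableOn_const _).div (by fun_prop) fun w hw => hne w hw z hz
  · intro w hw z hz
    rw [norm_div]
    have hb := hB _ (mem_image_of_mem f hz)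
    exact div_le_div₀ ((norm_nonneg _).trans hb) hb (by positivity) (hdist w hw z hz)

/-- The Cauchy transform vanishes at infinity. -/
theorem tendsto_cauchyTransform {f : ℂ → ℂ} (hf : ContinuousOn f C.trace) :
    Tendsto (fun w => C.integral fun z => f z / (z - w)) (cocompact ℂ) (𝓝 0) := by
  obtain ⟨B, hB⟩ := (C.isCompact_trace.image_of_continuousOn hf).isBounded.exists_norm_le
  obtain ⟨R, hR⟩ := C.isCompact_trace.isBounded.exists_norm_le
  have hev : ∀ᶠ w in cocompact ℂ, R < ‖w‖ :=
    (tendsto_norm_cocompact_atTop).eventually_gt_atTop R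
  have hlim : Tendsto (fun w : ℂ => B / (‖w‖ - R) * C.len) (cocompact ℂ) (𝓝 0) := by
    have h1 : Tendsto (fun w : ℂ => ‖w‖ - R) (cocompact ℂ) atTop :=
      tendsto_atTop_add_const_right _ _ tendsto_norm_cocompact_atTop
    simpa using (tendsto_const_nhds.div_atTop h1).mul_const C.len
  refine squeeze_zero_norm' ?_ hlim
  filter_upwards [hev] with w hw
  refine norm_integral_le fun z hz => ?_
  rw [norm_div]
  have hb := hB _ (mem_image_of_mem f hz)
  refine div_le_div₀ ((norm_nonneg _).trans hb) hb (by linarith) ?_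
  have := norm_sub_norm_le w z
  rw [norm_sub_rev w z] at this
  linarith [hR z hz]

theorem windingNumber_eq (w : ℂ) :
    windingNumber C.path w = (2 * Real.pi * Complex.I)⁻¹ * C.integral fun z => 1 / (z - w) := by
  simp [windingNumber, Contour.integral]

theorem integral_inv_sub (w : ℂ) :
    (C.integral fun z => 1 / (z - w)) = 2 * Real.pi * Complex.I * windingNumber C.path w := by
  rw [windingNumber_eq, mul_inv_cancel_left₀ Complex.two_pi_I_ne_zero]

theorem continuousAt_windingNumber {w : ℂ} (hw : w ∉ C.trace) :
    ContinuousAt (windingNumber C.path) w := by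
  have := (differentiableAt_cauchyTransform (C := C) (f := fun _ => 1)
    continuousOn_const hw).continuousAt
  refine (this.const_mul ((2 * Real.pi * Complex.I)⁻¹)).congr ?_
  exact Eventually.of_forall fun w => (windingNumber_eq w).symm

/-- Off the contour the winding number is continuous and takes only the values 0 and 1, hence it is
locally constant. -/
theorem eventually_windingNumber_eq {w : ℂ} (hw : w ∉ C.trace) :
    ∀ᶠ v in 𝓝 w, v ∉ C.trace ∧ windingNumber C.path v = windingNumber C.path w := by
  have h1 : ∀ᶠ v in 𝓝 w, v ∉ C.trace := C.isCompact_trace.isClosed.isOpen_compl.mem_nhds hw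
  have h2 : ∀ᶠ v in 𝓝 w, dist (windingNumber C.path v) (windingNumber C.path w) < 1 :=
    continuousAt_windingNumber hw (ball_mem_nhds _ one_pos)
  filter_upwards [h1, h2] with v hv hd
  refine ⟨hv, ?_⟩
  rcases C.positive v hv with h | h <;> rcases C.positive w hw with h' | h' <;>
    rw [h, h'] at hd ⊢ <;> simp at hd

theorem isOpen_inside : IsOpen C.inside := by
  rw [isOpen_iff_mem_nhds]
  rintro w ⟨hw, h1⟩
  filter_upwards [eventually_windingNumber_eq hw] with v hv
  exact ⟨hv.1, hv.2.trans h1⟩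

theorem windingNumber_eq_zero {w : ℂ} (hw : w ∉ C.trace ∪ C.inside) :
    windingNumber C.path w = 0 := by
  simp only [mem_union, not_or] at hw
  exact (C.positive w hw.1).resolve_right fun h => hw.2 ⟨hw.1, h⟩

/-- The winding number is a Cauchy transform and tends to 0 at infinity, so it cannot be 1 there:
the interior is bounded. -/
theorem eventually_cocompact_notMem : ∀ᶠ w in cocompact ℂ, w ∉ C.trace ∪ C.inside := by
  have h1 : ∀ᶠ w in cocompact ℂ, w ∉ C.trace :=
    C.isCompact_trace.compl_mem_cocompact
  have h2 := (tendsto_cauchyTransform (C := C) (f := fun _ => 1) continuousOn_const).eventually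
    (ball_mem_nhds (0 : ℂ) Real.two_pi_pos)
  filter_upwards [h1, h2] with w hw hw2 hw3
  rcases hw3 with h | h
  · exact hw h
  · rw [dist_zero_right, integral_inv_sub, h.2] at hw2
    simp [abs_of_pos Real.pi_pos] at hw2

/-- The difference quotients of a holomorphic function are locally bounded near the contour. -/
theorem exists_bound_dslope {U : Set ℂ} (hU : IsOpen U) (hCU : C.trace ⊆ U) {f : ℂ → ℂ}
    (hf : DifferentiableOn ℂ f U) {w₀ : ℂ} (hw₀ : w₀ ∈ U) :
    ∃ r > 0, ball w₀ r ⊆ U ∧ ∃ B : ℝ, ∀ w ∈ ball w₀ r, ∀ z ∈ C.trace, ‖dslope f w z‖ ≤ B := by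
  obtain ⟨ε, hε, hball⟩ := Metric.nhds_basis_closedBall.mem_iff.1 (hU.mem_nhds hw₀)
  have hcb : IsCompact (closedBall w₀ ε) := isCompact_closedBall _ _
  obtain ⟨M, hM⟩ := (hcb.image_of_continuousOn
    ((hf.deriv hU).continuousOn.mono hball)).isBounded.exists_norm_le
  obtain ⟨B, hB⟩ := ((C.isCompact_trace.union hcb).image_of_continuousOn
    (hf.continuousOn.mono (union_subset hCU hball))).isBounded.exists_norm_le
  refine ⟨ε / 2, by positivity, (ball_subset_closedBall.trans
    (closedBall_subset_closedBall (by linarith))).trans hball, max M (2 * B / (ε / 2)), ?_⟩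
  intro w hw z hz
  have hw' : w ∈ closedBall w₀ ε :=
    closedBall_subset_closedBall (by linarith) (ball_subset_closedBall hw)
  rcases eq_or_ne z w with rfl | hzw
  · rw [dslope_same]
    exact (hM _ (mem_image_of_mem _ hw')).trans (le_max_left _ _)
  have hpos : 0 < ‖z - w‖ := norm_pos_iff.2 (sub_ne_zero.2 hzw)
  rw [dslope_of_ne _ hzw, slope_def_field, norm_div]
  -- For `z` in the disc the quotient is bounded by the mean value inequality on a convex set; for
  -- `z` outside it the distance to `w` is at least `ε / 2`.
  by_cases hzb : z ∈ closedBall w₀ ε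
  · refine le_max_of_le_left ?_
    rw [div_le_iff₀ hpos]
    refine (convex_closedBall w₀ ε).norm_image_sub_le_of_norm_deriv_le (𝕜 := ℂ)
      (fun x hx => hf.differentiableAt (hU.mem_nhds (hball hx)))
      (fun x hx => hM _ (mem_image_of_mem _ hx)) hw' hzb
  · refine le_max_of_le_right ?_
    have h1 : ‖f z‖ ≤ B := hB _ (mem_image_of_mem _ (Or.inl hz))
    have h2 : ‖f w‖ ≤ B := hB _ (mem_image_of_mem _ (Or.inr hw'))
    have h3 : ‖f z - f w‖ ≤ 2 * B := (norm_sub_le _ _).trans (by linarith)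
    refine div_le_div₀ ((norm_nonneg _).trans h3) h3 (by positivity) ?_
    rw [mem_closedBall, not_le] at hzb
    rw [mem_ball] at hw
    have := dist_triangle z w w₀
    rw [← dist_eq_norm]; linarith

theorem dslope_comm (f : ℂ → ℂ) (a b : ℂ) : dslope f a b = dslope f b a := by
  rcases eq_or_ne a b with rfl | h
  · rfl
  · rw [dslope_of_ne _ h.symm, dslope_of_ne _ h, slope_comm]

/-- **Cauchy's integral formula** for a contour and a function that is holomorphic on it and in
its interior. -/
theorem integral_div_sub {f : ℂ → ℂ} (hf : ∀ z ∈ C.trace ∪ C.inside, AnalyticAt ℂ f z) {w : ℂ}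
    (hw : w ∈ C.inside) :
    (C.integral fun z => f z / (z - w)) = 2 * Real.pi * Complex.I * f w := by
  -- Dixon's proof: the integral of the difference quotients is holomorphic on the set of
  -- analyticity and is continued by the Cauchy transform of `f`. No homotopy or Jordan curve
  -- argument is needed.
  set U : Set ℂ := {z | AnalyticAt ℂ f z} with hUdef
  have hU : IsOpen U := isOpen_analyticAt ℂ f
  have hCU : C.trace ⊆ U := fun z hz => hf z (Or.inl hz)
  have hfU : DifferentiableOn ℂ f U := fun z hz => hz.differentiableAt.differentiableWithinAt
  have hfC : ContinuousOn f C.trace := hfU.continuousOn.mono hCU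
  have hdc : ∀ w ∈ U, DifferentiableOn ℂ (dslope f w) U := fun w hw =>
    (Complex.differentiableOn_dslope (hU.mem_nhds hw)).2 hfU
  have hdcC : ∀ w ∈ U, ContinuousOn (dslope f w) C.trace := fun w hw =>
    (hdc w hw).continuousOn.mono hCU
  classical
  have hrel : ∀ w ∈ U, w ∉ C.trace → (C.integral fun z => dslope f w z) =
      (C.integral fun z => f z / (z - w)) -
        f w * (2 * Real.pi * Complex.I * windingNumber C.path w) := by
    intro w hwU hw
    have hne : ∀ z ∈ C.trace, z - w ≠ 0 := fun z hz h => hw (by rwa [← sub_eq_zero.1 h])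
    rw [← integral_inv_sub, ← integral_const_mul, ← integral_sub]
    · refine integral_congr fun z hz => ?_
      have hzw : z ≠ w := fun h => hw (h ▸ hz)
      simp only [dslope_of_ne _ hzw, slope_def_field]
      ring
    · exact hfC.div (by fun_prop) hne
    · exact continuousOn_const.mul (continuousOn_const.div (by fun_prop) hne)
  -- The two branches agree wherever the winding number vanishes, so `H` is entire. It tends to 0 at
  -- infinity and is therefore identically zero.
  set H : ℂ → ℂ := fun w => if w ∈ U then C.integral fun z => dslope f w z
    else C.integral fun z => f z / (z - w) with hH
  have hHout : ∀ w, w ∉ C.trace ∪ C.inside → H w = C.integral fun z => f z / (z - w) := by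
    intro w hw
    by_cases hwU : w ∈ U
    · simp only [hH, if_pos hwU]
      rw [hrel w hwU fun h => hw (Or.inl h), windingNumber_eq_zero hw]
      ring
    · simp only [hH, if_neg hwU]
  have hHd : Differentiable ℂ H := by
    intro w₀
    by_cases hw₀ : w₀ ∈ U
    · obtain ⟨r, hr, hrU, B, hB⟩ := exists_bound_dslope hU hCU hfU hw₀
      have hd : DifferentiableAt ℂ (fun w => C.integral (dslope f w)) w₀ := by
        refine differentiableAt_integral hr (fun w hw => hdcC w (hrU hw)) ?_ hB
        intro z hz
        simp only [dslope_comm f _ z]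
        exact (hdc z (hCU hz)).mono hrU
      refine hd.congr_of_eventuallyEq ?_
      filter_upwards [hU.mem_nhds hw₀] with w hw
      simp only [hH, if_pos hw]
    · have hw0 : w₀ ∉ C.trace ∪ C.inside := fun h => hw₀ (hf _ h)
      have hw0' : w₀ ∉ C.trace := fun h => hw0 (Or.inl h)
      refine (differentiableAt_cauchyTransform hfC hw0').congr_of_eventuallyEq ?_
      filter_upwards [eventually_windingNumber_eq hw0'] with w hw
      refine hHout w ?_
      rintro (h | h)
      · exact hw.1 h
      · have h0 := h.2
        rw [hw.2, windingNumber_eq_zero hw0] at h0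
        exact zero_ne_one h0
  have hH0 : Tendsto H (cocompact ℂ) (𝓝 0) := by
    refine (tendsto_cauchyTransform hfC).congr' ?_
    filter_upwards [eventually_cocompact_notMem (C := C)] with w hw
    exact (hHout w hw).symm
  have hzero := hHd.apply_eq_of_tendsto_cocompact w hH0
  have hwU : w ∈ U := hf w (Or.inr hw)
  simp only [hH, if_pos hwU] at hzero
  rw [hrel w hwU hw.1, hw.2] at hzero
  linear_combination hzero

/-- **Cauchy's theorem**. -/
theorem integral_eq_zero {f : ℂ → ℂ} (hf : ∀ z ∈ C.trace ∪ C.inside, AnalyticAt ℂ f z)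
    (hne : C.inside.Nonempty) : C.integral f = 0 := by
  obtain ⟨w, hw⟩ := hne
  -- Cauchy's formula for `(z - w) f(z)`, whose value at `w` is 0.
  have := integral_div_sub (C := C) (f := fun z => (z - w) * f z)
    (fun z hz => (by fun_prop : AnalyticAt ℂ (fun z => z - w) z).mul (hf z hz)) hw
  rw [sub_self, zero_mul, mul_zero] at this
  rw [← this]
  refine integral_congr fun z hz => ?_
  have hzw : z - w ≠ 0 := fun h => hw.1 (by rwa [← sub_eq_zero.1 h])
  field_simp

/-- The **residue theorem** for a function with finitely many simple poles in the interior. -/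
theorem integral_eq_sum_residues {f : ℂ → ℂ} (P : Finset ℂ) (res : ℂ → ℂ)
    (hP : ∀ p ∈ P, p ∈ C.inside) (hne : C.inside.Nonempty)
    (hf : ∀ z ∈ C.trace ∪ C.inside, z ∉ P → AnalyticAt ℂ f z)
    (hres : ∀ p ∈ P, Tendsto (fun z => (z - p) * f z) (𝓝[≠] p) (𝓝 (res p))) :
    C.integral f = 2 * Real.pi * Complex.I * ∑ p ∈ P, res p := by
  classical
  -- One pole at a time: subtract the principal part `res p / (z - p)`, fill the removable
  -- singularity at `p` with the limit, and apply the hypothesis to the result. The principal part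
  -- itself integrates to `2πi` by the definition of the interior.
  induction P using Finset.induction_on generalizing f with
  | empty => simpa using integral_eq_zero (fun z hz => hf z hz (by simp)) hne
  | insert p P hp ih =>
    have hpin := hP p (Finset.mem_insert_self _ _)
    set g : ℂ → ℂ := fun z => f z - res p * (1 / (z - p)) with hg
    have hgan : ∀ z, z ≠ p → AnalyticAt ℂ f z → AnalyticAt ℂ g z := by
      intro z hz hfz
      have : z - p ≠ 0 := sub_ne_zero.2 hz
      exact hfz.sub (analyticAt_const.mul (analyticAt_const.div (by fun_prop) this))
    set G : ℂ → ℂ := Function.update g p (limUnder (𝓝[≠] p) g) with hG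
    have hGg : ∀ z, z ≠ p → G =ᶠ[𝓝 z] g := by
      intro z hz
      filter_upwards [isOpen_ne.mem_nhds hz] with v hv
      exact Function.update_of_ne hv _ _
    have hevan : ∀ᶠ z in 𝓝[≠] p, AnalyticAt ℂ f z := by
      have h1 : ∀ᶠ z in 𝓝 p, z ∈ C.inside ∧ z ∉ P :=
        (show ∀ᶠ z in 𝓝 p, z ∈ C.inside from isOpen_inside.mem_nhds hpin).and (P.finite_toSet.isClosed.isOpen_compl.mem_nhds hp)
      filter_upwards [h1.filter_mono nhdsWithin_le_nhds, self_mem_nhdsWithin] with z hz hzp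
      exact hf z (Or.inr hz.1) (by simpa [hz.2] using hzp)
    have hGp : AnalyticAt ℂ G p := by
      have hlo : Tendsto (fun z => (z - p) * g z) (𝓝[≠] p) (𝓝 0) := by
        have := (hres p (Finset.mem_insert_self _ _)).sub_const (res p)
        rw [sub_self] at this
        refine this.congr' ?_
        filter_upwards [self_mem_nhdsWithin] with z hz
        have : z - p ≠ 0 := sub_ne_zero.2 hz
        simp only [hg]; field_simp
      obtain ⟨s, hs, hsan⟩ := (eventually_nhdsWithin_iff.1 hevan).exists_mem
      have hsp : s \ {p} ∈ 𝓝[≠] p := sdiff_mem_nhdsWithin_compl hs _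
      have hdiff : DifferentiableOn ℂ g (s \ {p}) := fun z hz =>
        (hgan z hz.2 (hsan z hz.1 hz.2)).differentiableAt.differentiableWithinAt
      have hO : (fun z => g z - g p) =o[𝓝[≠] p] fun z => (z - p)⁻¹ := by
        rw [Asymptotics.isLittleO_iff_tendsto']
        · have h2 : Tendsto (fun z => (z - p) * g p) (𝓝[≠] p) (𝓝 0) := by
            have : Tendsto (fun z => (z - p) * g p) (𝓝 p) (𝓝 ((p - p) * g p)) := by
              apply Continuous.tendsto; fun_prop
            simpa using this.mono_left nhdsWithin_le_nhds
          have := hlo.sub h2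
          rw [sub_zero] at this
          refine this.congr' (Eventually.of_forall fun z => ?_)
          simp only [div_inv_eq_mul]; ring
        · filter_upwards [self_mem_nhdsWithin] with z hz h0
          exact absurd (inv_eq_zero.1 h0) (sub_ne_zero.2 hz)
      have := Complex.differentiableOn_update_limUnder_of_isLittleO hs hdiff hO
      exact this.analyticAt hs
    have hint : C.integral f = C.integral G + res p * (2 * Real.pi * Complex.I) := by
      have hcP : ∀ z ∈ C.trace, z ∉ insert p P := fun z hz h => (hP z h).1 hz
      have hzp : ∀ z ∈ C.trace, z ≠ p := fun z hz h => hpin.1 (h ▸ hz)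
      have h1 := integral_inv_sub (C := C) p
      rw [hpin.2, mul_one] at h1
      rw [← h1, ← integral_const_mul, ← integral_add]
      · refine integral_congr fun z hz => ?_
        simp only [hG, Function.update_of_ne (hzp z hz), hg]; ring
      · intro z hz
        have := hgan z (hzp z hz) (hf z (Or.inl hz) (hcP z hz))
        exact (this.congr (hGg z (hzp z hz)).symm).continuousAt.continuousWithinAt
      · exact continuousOn_const.mul (continuousOn_const.div (by fun_prop)
          fun z hz => sub_ne_zero.2 (hzp z hz))
    rw [hint, ih (f := G), Finset.sum_insert hp]
    · ring
    · exact fun q hq => hP q (Finset.mem_insert_of_mem hq)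
    · intro z hz hzP
      rcases eq_or_ne z p with rfl | hzp
      · exact hGp
      · exact (hgan z hzp (hf z hz (by simp [hzp, hzP]))).congr (hGg z hzp).symm
    · intro q hq
      have hqp : q ≠ p := fun h => hp (h ▸ hq)
      have h1 : Tendsto (fun z => (z - q) * (res p * (1 / (z - p)))) (𝓝[≠] q) (𝓝 0) := by
        have hc : ContinuousAt (fun z => (z - q) * (res p * (1 / (z - p)))) q := by
          have : q - p ≠ 0 := sub_ne_zero.2 hqp
          fun_prop (disch := assumption)
        have := hc.tendsto
        simp only [sub_self, zero_mul] at this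
        exact this.mono_left nhdsWithin_le_nhds
      have h2 := (hres q (Finset.mem_insert_of_mem hq)).sub h1
      rw [sub_zero] at h2
      refine h2.congr' ?_
      filter_upwards [(hGg q hqp).filter_mono nhdsWithin_le_nhds] with z hz
      rw [hz]; simp only [hg]; ring

end Contour

end XXZ

/-! ### Integral equations of the second kind on a contour -/

namespace XXZ

open MeasureTheory Set Metric

namespace Contour

variable {C : Contour}

/-- A continuous solution on `C` of a linear integral equation of the second kind. -/
def IsSolution (C : Contour) (k : ℂ → ℂ → ℂ) (δ f g : ℂ → ℂ) : Prop :=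
  ContinuousOn g C.trace ∧
    ∀ lam ∈ C.trace, g lam = f lam - C.integral fun mu => δ mu * k lam mu * g mu

/-- The extension by zero of a function on the contour. -/
noncomputable def zeroExtend (g : BoundedContinuousFunction C.trace ℂ) (z : ℂ) : ℂ :=
  open Classical in if h : z ∈ C.trace then g ⟨z, h⟩ else 0

theorem zeroExtend_apply (g : BoundedContinuousFunction C.trace ℂ) (z : C.trace) :
    zeroExtend g z = g z := by simp [zeroExtend]

theorem continuousOn_zeroExtend (g : BoundedContinuousFunction C.trace ℂ) :
    ContinuousOn (zeroExtend g) C.trace := by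
  rw [continuousOn_iff_continuous_domRestrict]
  refine g.continuous.congr fun z => ?_
  rw [domRestrict_apply, zeroExtend_apply]

theorem norm_zeroExtend_le (g : BoundedContinuousFunction C.trace ℂ) {z : ℂ}
    (hz : z ∈ C.trace) : ‖zeroExtend g z‖ ≤ ‖g‖ := by
  rw [zeroExtend_apply g ⟨z, hz⟩]
  exact g.norm_coe_le_norm _

theorem zeroExtend_add (g g' : BoundedContinuousFunction C.trace ℂ) {z : ℂ}
    (hz : z ∈ C.trace) : zeroExtend (g + g') z = zeroExtend g z + zeroExtend g' z := by
  simp [zeroExtend, hz]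

theorem zeroExtend_smul (c : ℂ) (g : BoundedContinuousFunction C.trace ℂ) {z : ℂ}
    (hz : z ∈ C.trace) : zeroExtend (c • g) z = c * zeroExtend g z := by
  simp [zeroExtend, hz]

instance : CompactSpace C.trace := isCompact_iff_compactSpace.1 C.isCompact_trace

/-- The restriction of a continuous function to the contour. -/
noncomputable def restrictBCF {f : ℂ → ℂ} (hf : ContinuousOn f C.trace) :
    BoundedContinuousFunction C.trace ℂ :=
  BoundedContinuousFunction.mkOfCompact ⟨C.trace.domRestrict f,
    continuousOn_iff_continuous_domRestrict.1 hf⟩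

theorem restrictBCF_apply {f : ℂ → ℂ} (hf : ContinuousOn f C.trace) (z : C.trace) :
    restrictBCF hf z = f z := rfl

theorem exists_bound {f : ℂ → ℂ} (hf : ContinuousOn f C.trace) :
    ∃ B : ℝ, 0 ≤ B ∧ ∀ z ∈ C.trace, ‖f z‖ ≤ B := by
  obtain ⟨B, hB⟩ := (C.isCompact_trace.image_of_continuousOn hf).isBounded.exists_norm_le
  exact ⟨max B 0, le_max_right _ _, fun z hz =>
    (hB _ (mem_image_of_mem f hz)).trans (le_max_left _ _)⟩

section Kernel

variable {k : ℂ → ℂ → ℂ} (hk : ContinuousOn (Function.uncurry k) (C.trace ×ˢ C.trace))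

include hk

theorem exists_bound_kernel : ∃ B : ℝ, 0 ≤ B ∧ ∀ z ∈ C.trace, ∀ w ∈ C.trace, ‖k z w‖ ≤ B := by
  obtain ⟨B, hB⟩ := ((C.isCompact_trace.prod C.isCompact_trace).image_of_continuousOn
    hk).isBounded.exists_norm_le
  exact ⟨max B 0, le_max_right _ _, fun z hz w hw =>
    (hB _ (mem_image_of_mem (Function.uncurry k) (mk_mem_prod hz hw))).trans (le_max_left _ _)⟩

theorem continuousOn_kernel_right {z : ℂ} (hz : z ∈ C.trace) : ContinuousOn (k z) C.trace :=
  hk.comp (f := fun w => (z, w)) (by fun_prop) fun _ hw => mk_mem_prod hz hw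

theorem equicontinuous_kernel {ε : ℝ} (hε : 0 < ε) :
    ∃ d > 0, ∀ z ∈ C.trace, ∀ z' ∈ C.trace, dist z z' < d → ∀ w ∈ C.trace,
      ‖k z w - k z' w‖ ≤ ε := by
  have := (C.isCompact_trace.prod C.isCompact_trace).uniformContinuousOn_of_continuous hk
  obtain ⟨d, hd, h⟩ := Metric.uniformContinuousOn_iff.1 this ε hε
  refine ⟨d, hd, fun z hz z' hz' hzz w hw => ?_⟩
  rw [← dist_eq_norm]
  refine (h (z, w) (mk_mem_prod hz hw) (z', w) (mk_mem_prod hz' hw) ?_).le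
  rw [Prod.dist_eq]
  exact max_lt hzz (by simpa using hd)

/-- The modulus of continuity comes from the kernel alone, so `d` depends on `g` only through the
bound `A`. This uniformity gives the equicontinuity in the Arzelà–Ascoli theorem. -/
theorem equicontinuous_integral {δ : ℂ → ℂ} (hδ : ContinuousOn δ C.trace) {A : ℝ} (hA : 0 ≤ A)
    {ε : ℝ} (hε : 0 < ε) :
    ∃ d > 0, ∀ g : ℂ → ℂ, ContinuousOn g C.trace → (∀ z ∈ C.trace, ‖g z‖ ≤ A) →
      ∀ z ∈ C.trace, ∀ z' ∈ C.trace, dist z z' < d →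
      dist (C.integral fun w => δ w * k z w * g w) (C.integral fun w => δ w * k z' w * g w)
        < ε := by
  obtain ⟨D, hD0, hD⟩ := exists_bound hδ
  -- The added 1 keeps the quotient below meaningful when the product of the bounds is zero.
  have hden : 0 < D * A * C.len + 1 := by have := C.len_nonneg; positivity
  obtain ⟨d, hd, h⟩ := equicontinuous_kernel hk (div_pos hε hden)
  refine ⟨d, hd, fun g hg hgA z hz z' hz' hzz => ?_⟩
  have hc : ∀ z ∈ C.trace, ContinuousOn (fun w => δ w * k z w * g w) C.trace := fun z hz =>
    (hδ.mul (continuousOn_kernel_right hk hz)).mul hg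
  rw [dist_eq_norm, ← integral_sub (hc z hz) (hc z' hz')]
  have hb : ‖C.integral fun w => δ w * k z w * g w - δ w * k z' w * g w‖ ≤
      D * (ε / (D * A * C.len + 1)) * A * C.len := by
    refine norm_integral_le fun w hw => ?_
    have : δ w * k z w * g w - δ w * k z' w * g w = δ w * (k z w - k z' w) * g w := by ring
    rw [this, norm_mul, norm_mul]
    have h1 := h z hz z' hz' hzz w hw
    have h2 := hD w hw
    have h3 := hgA w hw
    gcongr
  refine hb.trans_lt ?_
  have : D * (ε / (D * A * C.len + 1)) * A * C.len =
      ε * ((D * A * C.len) / (D * A * C.len + 1)) := by ring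
  rw [this]
  have h1 : (D * A * C.len) / (D * A * C.len + 1) < 1 := by
    rw [div_lt_one hden]; linarith
  nlinarith

theorem continuousOn_integral {δ g : ℂ → ℂ} (hδ : ContinuousOn δ C.trace)
    (hg : ContinuousOn g C.trace) :
    ContinuousOn (fun z => C.integral fun w => δ w * k z w * g w) C.trace := by
  obtain ⟨A, hA0, hA⟩ := exists_bound hg
  rw [Metric.continuousOn_iff]
  intro z hz ε hε
  obtain ⟨d, hd, h⟩ := equicontinuous_integral hk hδ hA0 hε
  exact ⟨d, hd, fun z' hz' hzz => h g hg hA z' hz' z hz hzz⟩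

/-- The integral operator with kernel `δ(μ) k(λ, μ)` on the continuous functions on `C`. -/
noncomputable def integralOperator {δ : ℂ → ℂ} (hδ : ContinuousOn δ C.trace) :
    BoundedContinuousFunction C.trace ℂ →L[ℂ] BoundedContinuousFunction C.trace ℂ :=
  LinearMap.mkContinuousOfExistsBound
    { toFun := fun g => restrictBCF (continuousOn_integral hk hδ (continuousOn_zeroExtend g))
      map_add' := fun g g' => by
        ext z
        have hc : ∀ g : BoundedContinuousFunction C.trace ℂ,
            ContinuousOn (fun w => δ w * k z w * zeroExtend g w) C.trace := fun g =>
          (hδ.mul (continuousOn_kernel_right hk z.2)).mul (continuousOn_zeroExtend g)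
        simp only [restrictBCF_apply, BoundedContinuousFunction.add_apply]
        rw [← integral_add (hc g) (hc g')]
        refine integral_congr fun w hw => ?_
        simp only [zeroExtend_add g g' hw]; ring
      map_smul' := fun c g => by
        ext z
        simp only [restrictBCF_apply, BoundedContinuousFunction.smul_apply, RingHom.id_apply,
          smul_eq_mul]
        rw [← integral_const_mul]
        refine integral_congr fun w hw => ?_
        simp only [zeroExtend_smul c g hw]; ring }
    (by
      obtain ⟨D, hD0, hD⟩ := exists_bound hδ
      obtain ⟨B, hB0, hB⟩ := exists_bound_kernel hk
      refine ⟨D * B * C.len, fun g => ?_⟩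
      have hl := C.len_nonneg
      refine (BoundedContinuousFunction.norm_le (by positivity)).2 fun z => ?_
      have : ‖C.integral fun w => δ w * k z w * zeroExtend g w‖ ≤ D * B * ‖g‖ * C.len := by
        refine norm_integral_le fun w hw => ?_
        rw [norm_mul, norm_mul]
        have h1 := hD w hw
        have h2 := hB z z.2 w hw
        have h3 := norm_zeroExtend_le g hw
        gcongr
      exact this.trans (le_of_eq (by ring)))

theorem integralOperator_apply {δ : ℂ → ℂ} (hδ : ContinuousOn δ C.trace)
    (g : BoundedContinuousFunction C.trace ℂ) (z : C.trace) :
    integralOperator hk hδ g z = C.integral fun w => δ w * k z w * zeroExtend g w := rfl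

/-- The image of the unit ball is bounded and equicontinuous on the compact contour, so the
Arzelà–Ascoli theorem applies. -/
theorem isCompactOperator_integralOperator {δ : ℂ → ℂ} (hδ : ContinuousOn δ C.trace) :
    IsCompactOperator (integralOperator hk hδ) := by
  refine (isCompactOperator_iff_isCompact_closure_image_closedBall
    (integralOperator hk hδ : BoundedContinuousFunction C.trace ℂ →ₗ[ℂ]
      BoundedContinuousFunction C.trace ℂ) zero_lt_one).2 ?_
  refine BoundedContinuousFunction.arzela_ascoli
    (closedBall 0 ‖integralOperator hk hδ‖) (isCompact_closedBall _ _) _ ?_ ?_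
  · rintro _ z ⟨g, hg, rfl⟩
    rw [mem_closedBall_zero_iff] at hg ⊢
    refine ((integralOperator hk hδ g).norm_coe_le_norm z).trans ?_
    refine ((integralOperator hk hδ).le_opNorm g).trans ?_
    exact mul_le_of_le_one_right (norm_nonneg _) hg
  · intro z
    rw [Metric.equicontinuousAt_iff]
    intro ε hε
    obtain ⟨d, hd, h⟩ := equicontinuous_integral hk hδ zero_le_one hε
    refine ⟨d, hd, ?_⟩
    rintro z' hzz ⟨_, g, hg, rfl⟩
    rw [mem_closedBall_zero_iff] at hg
    exact h (zeroExtend g) (continuousOn_zeroExtend g)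
      (fun w hw => (norm_zeroExtend_le g hw).trans hg) z z.2 z' z'.2 (by rwa [dist_comm] at hzz)

theorem isSolution_iff {δ f : ℂ → ℂ} (hδ : ContinuousOn δ C.trace) (hf : ContinuousOn f C.trace)
    {g : ℂ → ℂ} (hg : ContinuousOn g C.trace) :
    IsSolution C k δ f g ↔ (1 + integralOperator hk hδ) (restrictBCF hg) = restrictBCF hf := by
  have hint : ∀ z, (C.integral fun w => δ w * k z w * zeroExtend (restrictBCF hg) w) =
      C.integral fun w => δ w * k z w * g w := fun z => integral_congr fun w hw => by
    have := zeroExtend_apply (restrictBCF hg) ⟨w, hw⟩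
    rw [restrictBCF_apply] at this
    simp only [this]
  constructor
  · rintro ⟨-, h⟩
    ext z
    simp only [add_apply, one_apply_eq_self,
      BoundedContinuousFunction.add_apply, restrictBCF_apply, integralOperator_apply, hint]
    rw [h z z.2]; ring
  · intro h
    refine ⟨hg, fun z hz => ?_⟩
    have := DFunLike.congr_fun h ⟨z, hz⟩
    simp only [add_apply, one_apply_eq_self,
      BoundedContinuousFunction.add_apply, restrictBCF_apply, integralOperator_apply, hint] at this
    rw [← this]; ring

/-- Uniqueness of the solution for one inhomogeneity implies unique solvability. -/
theorem isUnit_one_add_integralOperator {δ f g : ℂ → ℂ} (hδ : ContinuousOn δ C.trace)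
    (hg : IsSolution C k δ f g)
    (huniq : ∀ g', IsSolution C k δ f g' → EqOn g' g C.trace) :
    IsUnit (1 + integralOperator hk hδ) := by
  -- Fredholm alternative for a compact operator at the non-zero number `-1`. An eigenvector could
  -- be added to `g` and would give a second solution, so `-1` lies in the resolvent set.
  have h := (isCompactOperator_integralOperator hk hδ).hasEigenvalue_or_mem_resolventSet
    (μ := (-1 : ℂ)) (by norm_num)
  rcases h with h | h
  · exfalso
    obtain ⟨v, hv, hv0⟩ := h.exists_hasEigenvector
    rw [Module.End.mem_eigenspace_iff] at hv
    apply hv0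
    have hs : IsSolution C k δ f fun z => g z + zeroExtend v z := by
      refine ⟨hg.1.add (continuousOn_zeroExtend v), fun z hz => ?_⟩
      have h1 := DFunLike.congr_fun hv ⟨z, hz⟩
      have h2 : integralOperator hk hδ v ⟨z, hz⟩ = -(v ⟨z, hz⟩) := by simpa using h1
      rw [integralOperator_apply] at h2
      have hc : ContinuousOn (fun w => δ w * k z w) C.trace :=
        hδ.mul (continuousOn_kernel_right hk hz)
      have h3 : (C.integral fun w => δ w * k z w * (g w + zeroExtend v w)) =
          (C.integral fun w => δ w * k z w * g w) +
          C.integral fun w => δ w * k z w * zeroExtend v w := by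
        rw [← integral_add (f := fun w => δ w * k z w * g w)
          (g := fun w => δ w * k z w * zeroExtend v w) (hc.mul hg.1)
          (hc.mul (continuousOn_zeroExtend v))]
        exact integral_congr fun w _ => by ring
      have h4 := zeroExtend_apply v ⟨z, hz⟩
      simp only at h2 h4
      rw [h3, h2]
      simp only [hg.2 z hz, h4]
      ring
    ext z
    have := huniq _ hs z.2
    rw [zeroExtend_apply] at this
    simpa using this
  · rw [spectrum.mem_resolventSet_iff] at h
    have := h.neg
    have e : -(algebraMap ℂ (BoundedContinuousFunction C.trace ℂ →L[ℂ]
        BoundedContinuousFunction C.trace ℂ) (-1) - integralOperator hk hδ) =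
        1 + integralOperator hk hδ := by
      rw [map_neg, map_one]; abel
    rwa [e] at this

theorem norm_integralOperator_sub_le {δ δ' : ℂ → ℂ} (hδ : ContinuousOn δ C.trace)
    (hδ' : ContinuousOn δ' C.trace) {B : ℝ} (hB0 : 0 ≤ B)
    (hB : ∀ z ∈ C.trace, ∀ w ∈ C.trace, ‖k z w‖ ≤ B) {ε : ℝ} (hε0 : 0 ≤ ε)
    (hε : ∀ z ∈ C.trace, ‖δ z - δ' z‖ ≤ ε) :
    ‖integralOperator hk hδ - integralOperator hk hδ'‖ ≤ ε * B * C.len := by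
  have hl := C.len_nonneg
  refine ContinuousLinearMap.opNorm_le_bound _ (by positivity) fun g => ?_
  refine (BoundedContinuousFunction.norm_le (by positivity)).2 fun z => ?_
  have hc : ∀ {δ : ℂ → ℂ}, ContinuousOn δ C.trace →
      ContinuousOn (fun w => δ w * k z w * zeroExtend g w) C.trace := fun hδ =>
    (hδ.mul (continuousOn_kernel_right hk z.2)).mul (continuousOn_zeroExtend g)
  rw [sub_apply, BoundedContinuousFunction.sub_apply,
    integralOperator_apply, integralOperator_apply, ← integral_sub (hc hδ) (hc hδ')]
  have : ‖C.integral fun w => δ w * k z w * zeroExtend g w - δ' w * k z w * zeroExtend g w‖ ≤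
      ε * B * ‖g‖ * C.len := by
    refine norm_integral_le fun w hw => ?_
    have e : δ w * k z w * zeroExtend g w - δ' w * k z w * zeroExtend g w =
      (δ w - δ' w) * k z w * zeroExtend g w := by ring
    rw [e, norm_mul, norm_mul]
    have h1 := hε w hw
    have h2 := hB z z.2 w hw
    have h3 := norm_zeroExtend_le g hw
    gcongr
  exact this.trans (le_of_eq (by ring))

/-- Stability of unique solvability, and continuous dependence of the solution on the density
and on the inhomogeneity. -/
theorem exists_tendsto_solution {ι : Type*} {l : Filter ι} [l.NeBot] {δ : ι → ℂ → ℂ}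
    {f : ι → ℂ → ℂ} {δ₀ f₀ g₀ : ℂ → ℂ}
    (hδ : ∀ᶠ i in l, ContinuousOn (δ i) C.trace) (hδ₀ : TendstoUniformlyOn δ δ₀ l C.trace)
    (hf : ∀ᶠ i in l, ContinuousOn (f i) C.trace) (hf₀ : TendstoUniformlyOn f f₀ l C.trace)
    (hg : IsSolution C k δ₀ f₀ g₀)
    (huniq : ∀ g', IsSolution C k δ₀ f₀ g' → EqOn g' g₀ C.trace) :
    ∃ g : ι → ℂ → ℂ, (∀ᶠ i in l, IsSolution C k (δ i) (f i) (g i) ∧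
      ∀ g', IsSolution C k (δ i) (f i) g' → EqOn g' (g i) C.trace) ∧
      TendstoUniformlyOn g g₀ l C.trace := by
  classical
  have hδ₀c : ContinuousOn δ₀ C.trace := hδ₀.continuousOn hδ.frequently
  have hf₀c : ContinuousOn f₀ C.trace := hf₀.continuousOn hf.frequently
  have hunit := isUnit_one_add_integralOperator hk hδ₀c hg huniq
  -- The default values of `T` and `F` concern only indices at which `δ i` or `f i` is not
  -- continuous; eventually there are none.
  set T : ι → BoundedContinuousFunction C.trace ℂ →L[ℂ] BoundedContinuousFunction C.trace ℂ :=
    fun i => if h : ContinuousOn (δ i) C.trace then 1 + integralOperator hk h else 1 with hT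
  set F : ι → BoundedContinuousFunction C.trace ℂ :=
    fun i => if h : ContinuousOn (f i) C.trace then restrictBCF h else 0 with hF
  obtain ⟨B, hB0, hB⟩ := exists_bound_kernel hk
  have hTlim : Tendsto T l (𝓝 (1 + integralOperator hk hδ₀c)) := by
    rw [Metric.tendsto_nhds]
    intro ε hε
    have hl := C.len_nonneg
    have hpos : 0 < B * C.len + 1 := by positivity
    have h1 := Metric.tendstoUniformlyOn_iff.1 hδ₀ (ε / (B * C.len + 1)) (div_pos hε hpos)
    filter_upwards [h1, hδ] with i hi hc
    simp only [hT, dif_pos hc]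
    rw [dist_eq_norm, add_sub_add_left_eq_sub]
    refine (norm_integralOperator_sub_le hk hc hδ₀c hB0 hB (div_pos hε hpos).le ?_).trans_lt ?_
    · intro z hz
      rw [← dist_eq_norm, dist_comm]; exact (hi z hz).le
    · have : ε / (B * C.len + 1) * B * C.len = ε * ((B * C.len) / (B * C.len + 1)) := by ring
      rw [this]
      have h1 : (B * C.len) / (B * C.len + 1) < 1 := by rw [div_lt_one hpos]; linarith
      nlinarith
  have hFlim : Tendsto F l (𝓝 (restrictBCF hf₀c)) := by
    rw [Metric.tendsto_nhds]
    intro ε hε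
    have h1 := Metric.tendstoUniformlyOn_iff.1 hf₀ (ε / 2) (half_pos hε)
    filter_upwards [h1, hf] with i hi hc
    refine lt_of_le_of_lt ?_ (half_lt_self hε)
    refine (BoundedContinuousFunction.dist_le (half_pos hε).le).2 fun z => ?_
    simp only [hF, dif_pos hc, restrictBCF_apply]
    rw [dist_comm]; exact (hi z z.2).le
  -- The units of the Banach algebra of operators form an open set on which inversion is continuous.
  -- This gives both the solvability for nearby data and the convergence of the solutions.
  have hinv : Tendsto (fun i => Ring.inverse (T i)) l
      (𝓝 (Ring.inverse (1 + integralOperator hk hδ₀c))) := by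
    obtain ⟨u, hu⟩ := hunit
    have := NormedRing.inverse_continuousAt
      (R := BoundedContinuousFunction C.trace ℂ →L[ℂ] BoundedContinuousFunction C.trace ℂ) u
    rw [← hu] at hTlim ⊢
    exact this.tendsto.comp hTlim
  have hsol : Tendsto (fun i => Ring.inverse (T i) (F i)) l
      (𝓝 (Ring.inverse (1 + integralOperator hk hδ₀c) (restrictBCF hf₀c))) :=
    (isBoundedBilinearMap_apply.continuous.tendsto (_, _)).comp (hinv.prodMk_nhds hFlim)
  have hunits : ∀ᶠ i in l, IsUnit (T i) :=
    hTlim.eventually (IsOpen.mem_nhds (Units.isOpen (R := BoundedContinuousFunction C.trace ℂ →L[ℂ]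
      BoundedContinuousFunction C.trace ℂ)) hunit)
  have hg₀ : Ring.inverse (1 + integralOperator hk hδ₀c) (restrictBCF hf₀c) =
      restrictBCF hg.1 := by
    have := (isSolution_iff hk hδ₀c hf₀c hg.1).1 hg
    rw [← this, ← mul_apply_eq_comp, Ring.inverse_mul_cancel _ hunit,
      one_apply_eq_self]
  rw [hg₀] at hsol
  refine ⟨fun i => zeroExtend (Ring.inverse (T i) (F i)), ?_, ?_⟩
  · filter_upwards [hunits, hδ, hf] with i hi hci hfi
    have hT' : T i = 1 + integralOperator hk hci := dif_pos hci
    have hF' : F i = restrictBCF hfi := dif_pos hfi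
    have key : ∀ g' : ℂ → ℂ, IsSolution C k (δ i) (f i) g' →
        EqOn g' (zeroExtend (Ring.inverse (T i) (F i))) C.trace := by
      intro g' hg' z hz
      have h1 := (isSolution_iff hk hci hfi hg'.1).1 hg'
      rw [hF', ← h1, ← hT', ← mul_apply_eq_comp, Ring.inverse_mul_cancel _ hi,
        one_apply_eq_self, zeroExtend_apply _ ⟨z, hz⟩, restrictBCF_apply]
    refine ⟨(isSolution_iff hk hci hfi (continuousOn_zeroExtend _)).2 ?_, key⟩
    have : restrictBCF (continuousOn_zeroExtend (Ring.inverse (T i) (F i))) =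
        Ring.inverse (T i) (F i) := by
      ext z; rw [restrictBCF_apply, zeroExtend_apply]
    rw [this, ← hT', ← hF', ← mul_apply_eq_comp, Ring.mul_inverse_cancel _ hi,
      one_apply_eq_self]
  · rw [Metric.tendstoUniformlyOn_iff]
    intro ε hε
    filter_upwards [Metric.tendsto_nhds.1 hsol ε hε] with i hi z hz
    rw [zeroExtend_apply _ ⟨z, hz⟩, dist_comm]
    have := (BoundedContinuousFunction.dist_coe_le_dist (f := Ring.inverse (T i) (F i))
      (g := restrictBCF hg.1) ⟨z, hz⟩)
    rw [restrictBCF_apply] at this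
    exact this.trans_lt hi

end Kernel

/-- Contour integrals are continuous with respect to uniform convergence. -/
theorem tendsto_integral {ι : Type*} {l : Filter ι} [l.NeBot] {f : ι → ℂ → ℂ} {f₀ : ℂ → ℂ}
    (hf : ∀ᶠ i in l, ContinuousOn (f i) C.trace) (hf₀ : TendstoUniformlyOn f f₀ l C.trace) :
    Tendsto (fun i => C.integral (f i)) l (𝓝 (C.integral f₀)) := by
  have hf₀c : ContinuousOn f₀ C.trace := hf₀.continuousOn hf.frequently
  rw [Metric.tendsto_nhds]
  intro ε hε
  have hl := C.len_nonneg
  have hpos : 0 < C.len + 1 := by positivity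
  filter_upwards [hf, Metric.tendstoUniformlyOn_iff.1 hf₀ (ε / (C.len + 1)) (div_pos hε hpos)]
    with i hc hi
  rw [dist_eq_norm, ← integral_sub hc hf₀c]
  have := norm_integral_le (C := C) (f := fun z => f i z - f₀ z) (B := ε / (C.len + 1))
    fun z hz => by rw [← dist_eq_norm, dist_comm]; exact (hi z hz).le
  refine this.trans_lt ?_
  rw [div_mul_eq_mul_div, div_lt_iff₀ hpos]
  nlinarith

theorem tendstoUniformlyOn_mul {ι : Type*} {l : Filter ι} {f g : ι → ℂ → ℂ} {f₀ g₀ : ℂ → ℂ}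
    (hf : TendstoUniformlyOn f f₀ l C.trace) (hf₀ : ContinuousOn f₀ C.trace)
    (hg : TendstoUniformlyOn g g₀ l C.trace) (hg₀ : ContinuousOn g₀ C.trace) :
    TendstoUniformlyOn (fun i z => f i z * g i z) (fun z => f₀ z * g₀ z) l C.trace := by
  rw [← tendstoLocallyUniformlyOn_iff_tendstoUniformlyOn_of_compact C.isCompact_trace] at *
  exact hf.mul₀ hg hf₀ hg₀

theorem tendstoUniformlyOn_inv {ι : Type*} {l : Filter ι} {f : ι → ℂ → ℂ} {f₀ : ℂ → ℂ}
    (hf : TendstoUniformlyOn f f₀ l C.trace) (hf₀ : ContinuousOn f₀ C.trace)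
    (hne : ∀ z ∈ C.trace, f₀ z ≠ 0) :
    TendstoUniformlyOn (fun i z => (f i z)⁻¹) (fun z => (f₀ z)⁻¹) l C.trace := by
  rw [← tendstoLocallyUniformlyOn_iff_tendstoUniformlyOn_of_compact C.isCompact_trace] at *
  exact hf.inv₀ hf₀ hne

end Contour

end XXZ

/-! ### Algebraic Bethe ansatz: action on Bethe vectors -/

namespace XXZ

open Complex Finset

/-- The Plücker relation for the sines of differences. -/
theorem sin_sub_plucker (a b c d : ℂ) :
    sin (a - b) * sin (c - d) - sin (a - c) * sin (b - d) + sin (a - d) * sin (b - c) = 0 := by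
  simp only [sin_sub]; ring

/-- The operators that enter the algebraic Bethe ansatz, acting on a space with a reference
state `Ω`, their quadratic exchange relations and their action on the reference state. The
relations hold for spectral parameters that satisfy `reg`. -/
structure BetheOperators (V : Type*) [AddCommGroup V] [Module ℂ V] (η : ℂ) (reg : ℂ → Prop) where
  A : ℂ → Module.End ℂ V
  B : ℂ → Module.End ℂ V
  C : ℂ → Module.End ℂ V
  D : ℂ → Module.End ℂ V
  Ω : V
  a : ℂ → ℂ
  d : ℂ → ℂ
  AA : ∀ z v, reg z → reg v → Commute (A z) (A v)
  BB : ∀ z v, reg z → reg v → Commute (B z) (B v)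
  AB : ∀ z v, reg z → reg v → sin (z - v) • (A z * B v) =
    sin (z - v + η) • (B v * A z) - sin η • (B z * A v)
  DB : ∀ z v, reg z → reg v → sin (z - v) • (D z * B v) =
    sin (z - v + -η) • (B v * D z) - sin (-η) • (B z * D v)
  CB : ∀ z v, reg z → reg v → sin (v - z) • (C z * B v - B v * C z) =
    sin η • (A v * D z - A z * D v)
  AΩ : ∀ z, reg z → A z Ω = a z • Ω
  DΩ : ∀ z, reg z → D z Ω = d z • Ω
  CΩ : ∀ z, reg z → C z Ω = 0

/-- The coefficient `x(p_c) ∏_{l ≠ c} sin(p_c - p_l + ε) / sin(p_c - p_l)`. -/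
noncomputable def actionCoeff {ι : Type*} [DecidableEq ι] (p : ι → ℂ) (ε : ℂ) (x : ℂ → ℂ)
    (S : Finset ι) (c : ι) : ℂ :=
  x (p c) * ∏ l ∈ S.erase c, (sin (p c - p l + ε) / sin (p c - p l))

section Coeff

variable {ι : Type*} [DecidableEq ι] {p : ι → ℂ} {ε : ℂ}
  (hs : ∀ i j, i ≠ j → sin (p i - p j) ≠ 0)
  (hε : ∀ i j, sin (p i - p j + ε) ≠ 0)

-- Erasing `b` removes the factor with `l = b`. The correcting factor on the right vanishes at `c =
-- b`, so a sum over `S.erase b` may be extended to all of `S`. In this way all sums below run over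
-- the same index set.
include hs hε in
theorem actionCoeff_erase (x : ℂ → ℂ) {S : Finset ι} {b c : ι} (hb : b ∈ S) (hbc : c ≠ b) :
    actionCoeff p ε x (S.erase b) c =
      actionCoeff p ε x S c * (sin (p c - p b) / sin (p c - p b + ε)) := by
  have hb' : b ∈ S.erase c := mem_erase.2 ⟨hbc.symm, hb⟩
  simp only [actionCoeff]
  rw [← mul_prod_erase _ _ hb', erase_right_comm (a := b)]
  have h1 := hs c b hbc
  have h2 := hε c b
  field_simp

end Coeff

namespace BetheOperators

variable {V : Type*} [AddCommGroup V] [Module ℂ V] {η : ℂ} {reg : ℂ → Prop}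
  (O : BetheOperators V η reg) {ι : Type*} [DecidableEq ι] (p : ι → ℂ)
  (hp : ∀ i, reg (p i))

include hp in
omit [DecidableEq ι] in
theorem pairwise_commute (S : Finset ι) :
    (S : Set ι).Pairwise (Function.onFun Commute fun i => O.B (p i)) :=
  fun i _ j _ _ => O.BB _ _ (hp i) (hp j)

/-- The vector `∏_{i ∈ S} B(p_i) Ω`. -/
noncomputable def betheVector (S : Finset ι) : V :=
  S.noncommProd (fun i => O.B (p i)) (O.pairwise_commute p hp S) O.Ω

variable {p}

omit [DecidableEq ι] in
theorem betheVector_empty : O.betheVector p hp ∅ = O.Ω := by simp [betheVector]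

theorem betheVector_insert {S : Finset ι} {i : ι} (hi : i ∉ S) :
    O.betheVector p hp (insert i S) = O.B (p i) (O.betheVector p hp S) := by
  rw [betheVector, noncommProd_insert_of_notMem _ _ _ _ hi]; rfl

theorem B_betheVector_erase {S : Finset ι} {i : ι} (hi : i ∈ S) :
    O.B (p i) (O.betheVector p hp (S.erase i)) = O.betheVector p hp S := by
  rw [← O.betheVector_insert hp (notMem_erase i S), insert_erase hi]

/-- An operator with the exchange relation of `A` and `D` with `B`, and with a vacuum
eigenvalue. -/
structure IsDiagonalEntry (ε : ℂ) (X : ℂ → Module.End ℂ V) (x : ℂ → ℂ) : Prop where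
  exchange : ∀ z v, reg z → reg v → sin (z - v) • (X z * O.B v) =
    sin (z - v + ε) • (O.B v * X z) - sin ε • (O.B z * X v)
  vacuum : ∀ z, reg z → X z O.Ω = x z • O.Ω

theorem isDiagonalEntry_A : O.IsDiagonalEntry η O.A O.a := ⟨O.AB, O.AΩ⟩

theorem isDiagonalEntry_D : O.IsDiagonalEntry (-η) O.D O.d := ⟨O.DB, O.DΩ⟩

section Action

variable {O} {ε : ℂ} {X : ℂ → Module.End ℂ V} {x : ℂ → ℂ} (hX : O.IsDiagonalEntry ε X x)
  (hs : ∀ i j, i ≠ j → sin (p i - p j) ≠ 0)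
  (hε : ∀ i j, sin (p i - p j + ε) ≠ 0)

include hX hs hε

/-- Wanted and unwanted terms have one common form: at `c = a` the last factor is 1, and for `c ≠ a`
it replaces the shifted sine with `l = a` by `sin ε`. In the induction the exchange relation moves
`X` past one `B`, which leaves `X (p a)` and `X (p v)` acting on the same shorter vector. The two
coefficients of each resulting vector are combined by the Plücker relation for sines. -/
theorem action_insert (s : Finset ι) : ∀ a ∉ s, X (p a) (O.betheVector p hp s) =
    ∑ c ∈ insert a s, (actionCoeff p ε x (insert a s) c * (sin ε / sin (p c - p a + ε))) •
      O.betheVector p hp ((insert a s).erase c) := by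
  induction s using Finset.induction_on with
  | empty =>
    intro a _
    have h := hε a a
    rw [sub_self, zero_add] at h
    simp [actionCoeff, betheVector_empty, hX.vacuum _ (hp a), h]
  | insert v s hv ih =>
    intro a ha
    rw [mem_insert, not_or] at ha
    obtain ⟨hav, has⟩ := ha
    set S := insert a (insert v s) with hS
    have haS : a ∈ S := mem_insert_self _ _
    have hvS : v ∈ S := mem_insert_of_mem (mem_insert_self _ _)
    have hSv : insert a s = S.erase v := by
      rw [hS, Finset.insert_comm, erase_insert]; simp [hv, Ne.symm hav]
    have hSa : insert v s = S.erase a := by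
      rw [hS, erase_insert]; simp [has, hav]
    -- Both uses of the induction hypothesis, with `v` and with `a` missing, are brought to sums
    -- over the full set `S`; the added term vanishes because it contains `sin 0`.
    have key : ∀ b ∈ S, ∀ e, e ≠ b →
        O.B (p b) (∑ c ∈ S.erase b, (actionCoeff p ε x (S.erase b) c *
          (sin ε / sin (p c - p e + ε))) • O.betheVector p hp ((S.erase b).erase c)) =
        ∑ c ∈ S, (actionCoeff p ε x S c * (sin (p c - p b) / sin (p c - p b + ε)) *
          (sin ε / sin (p c - p e + ε))) • O.betheVector p hp (S.erase c) := by
      intro b hb e _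
      rw [map_sum, ← add_sum_erase _ _ hb]
      simp only [sub_self, Complex.sin_zero, zero_div, mul_zero, zero_mul, zero_smul, zero_add]
      refine sum_congr rfl fun c hc => ?_
      rw [mem_erase] at hc
      rw [map_smul, actionCoeff_erase hs hε x hb hc.1, erase_right_comm,
        O.B_betheVector_erase hp (mem_erase.2 ⟨hc.1.symm, hb⟩)]
    have h1 := key v hvS a hav
    have h2 := key a haS v (Ne.symm hav)
    have hih1 := ih a has
    have hih2 := ih v hv
    rw [hSv] at hih1
    rw [hSa] at hih2
    rw [← hih1] at h1
    rw [← hih2] at h2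
    have hex := congrArg (fun F : Module.End ℂ V => F (O.betheVector p hp s))
      (hX.exchange (p a) (p v) (hp a) (hp v))
    simp only [LinearMap.smul_apply, LinearMap.sub_apply, Module.End.mul_apply] at hex
    rw [← O.betheVector_insert hp hv, h1, h2] at hex
    have hsav := hs a v hav
    have hfin : sin (p a - p v) • X (p a) (O.betheVector p hp (insert v s)) =
        sin (p a - p v) • ∑ c ∈ S, (actionCoeff p ε x S c * (sin ε / sin (p c - p a + ε))) •
          O.betheVector p hp (S.erase c) := by
      rw [hex, smul_sum, smul_sum, smul_sum, ← sum_sub_distrib]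
      refine sum_congr rfl fun c _ => ?_
      rw [smul_smul, smul_smul, smul_smul, ← sub_smul]
      congr 1
      have e1 := hε c v
      have e2 := hε c a
      -- The fourth argument `p v - ε` produces exactly the shifted sines of the exchange relation.
      have hpl := sin_sub_plucker (p a) (p v) (p c) (p v - ε)
      have r1 : p c - (p v - ε) = p c - p v + ε := by ring
      have r2 : p v - (p v - ε) = ε := by ring
      have r3 : p a - (p v - ε) = p a - p v + ε := by ring
      have r4 : sin (p v - p c) = -sin (p c - p v) := by rw [← Complex.sin_neg]; congr 1; ring
      have r5 : sin (p a - p c) = -sin (p c - p a) := by rw [← Complex.sin_neg]; congr 1; ring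
      rw [r1, r2, r3, r4, r5] at hpl
      field_simp
      linear_combination (-(actionCoeff p ε x S c * sin ε)) * hpl
    exact smul_right_injective V hsav hfin

/-- The action of a diagonal entry of the monodromy matrix on a Bethe vector. -/
theorem action {S : Finset ι} {a : ι} (ha : a ∈ S) :
    X (p a) (O.betheVector p hp (S.erase a)) =
      ∑ c ∈ S, (actionCoeff p ε x S c * (sin ε / sin (p c - p a + ε))) •
        O.betheVector p hp (S.erase c) := by
  have := action_insert hp hX hs hε (S.erase a) a (notMem_erase a S)
  rwa [insert_erase ha] at this

theorem action_erase {S : Finset ι} {a b : ι} (ha : a ∈ S) (hb : b ∈ S) (hab : a ≠ b) :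
    X (p a) (O.betheVector p hp ((S.erase b).erase a)) =
      ∑ c ∈ S, (actionCoeff p ε x S c * (sin (p c - p b) / sin (p c - p b + ε)) *
        (sin ε / sin (p c - p a + ε))) • O.betheVector p hp ((S.erase b).erase c) := by
  rw [action hp hX hs hε (mem_erase.2 ⟨hab, ha⟩), ← add_sum_erase _ _ hb]
  simp only [sub_self, Complex.sin_zero, zero_div, mul_zero, zero_mul, zero_smul, zero_add]
  refine sum_congr rfl fun c hc => ?_
  rw [actionCoeff_erase hs hε x hb (mem_erase.1 hc).1]

end Action

section Two

variable {O} {ε ε' : ℂ} {X X' : ℂ → Module.End ℂ V} {x x' : ℂ → ℂ}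
  (hX : O.IsDiagonalEntry ε X x) (hX' : O.IsDiagonalEntry ε' X' x')
  (hs : ∀ i j, i ≠ j → sin (p i - p j) ≠ 0)
  (hε : ∀ i j, sin (p i - p j + ε) ≠ 0) (hε' : ∀ i j, sin (p i - p j + ε') ≠ 0)

include hX hX' hs hε hε'

/-- The action of two diagonal entries of the monodromy matrix on a Bethe vector. -/
theorem action_action {S : Finset ι} {a b : ι} (ha : a ∈ S) (hb : b ∈ S) (hab : a ≠ b) :
    X (p a) (X' (p b) (O.betheVector p hp ((S.erase a).erase b))) =
      ∑ d ∈ S, ∑ c ∈ S, (actionCoeff p ε' x' S d * actionCoeff p ε x S c *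
        ((sin (p d - p a) / sin (p d - p a + ε')) * (sin ε' / sin (p d - p b + ε')) *
        ((sin (p c - p d) / sin (p c - p d + ε)) * (sin ε / sin (p c - p a + ε))))) •
        O.betheVector p hp ((S.erase c).erase d) := by
  rw [action_erase hp hX' hs hε' hb ha hab.symm, map_sum]
  refine sum_congr rfl fun d hd => ?_
  rw [map_smul]
  -- The formula for `X` at `p a` requires `a ≠ d`; for `d = a` the outer coefficient contains `sin
  -- 0`.
  rcases eq_or_ne d a with rfl | hda
  · simp
  rw [erase_right_comm, action_erase hp hX hs hε ha hd hda.symm, smul_sum]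
  refine sum_congr rfl fun c _ => ?_
  rw [smul_smul, erase_right_comm]
  congr 1
  ring

end Two

section ActionC

variable {O}

/-- The scalar content of the induction step for `C`: it compares the coefficient of one vector
before and after a further `B` is added. Two Plücker relations suffice, one for `c, v, d - η, v - η`
and one for `d, v, c + η, z`. -/
theorem action_C_identity {v c d z : ℂ} (hcv : sin (c - v + η) ≠ 0)
    (hdv : sin (d - v + -η) ≠ 0) (hcd : sin (c - d + η) ≠ 0) (hcz : sin (c - z + η) ≠ 0)
    (hdz : sin (d - z + -η) ≠ 0) :
    sin (v - z) * (sin (c - v) / sin (c - v + η) * (sin (d - v) / sin (d - v + -η)) *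
      (sin η ^ 2 * sin (c - d) / (sin (c - d + η) * sin (c - z + η) * sin (d - z + -η)))) -
    sin η * (sin (d - v) / sin (d - v + -η) * (sin (-η) / sin (d - z + -η)) *
        ((sin (c - d) / sin (c - d + η)) * (sin η / sin (c - v + η))) -
      sin (d - z) / sin (d - z + -η) * (sin (-η) / sin (d - v + -η)) *
        ((sin (c - d) / sin (c - d + η)) * (sin η / sin (c - z + η)))) =
    sin (v - z) *
      (sin η ^ 2 * sin (c - d) / (sin (c - d + η) * sin (c - z + η) * sin (d - z + -η))) := by
  have h1 := sin_sub_plucker c v (d - η) (v - η)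
  have h2 := sin_sub_plucker d v (c + η) z
  have e1 : d - η - (v - η) = d - v := by ring
  have e2 : c - (d - η) = c - d + η := by ring
  have e3 : v - (v - η) = η := by ring
  have e4 : c - (v - η) = c - v + η := by ring
  have e5 : sin (v - (d - η)) = -sin (d - v + -η) := by rw [← Complex.sin_neg]; congr 1; ring
  have e6 : c + η - z = c - z + η := by ring
  have e7 : sin (d - (c + η)) = -sin (c - d + η) := by rw [← Complex.sin_neg]; congr 1; ring
  have e8 : sin (v - (c + η)) = -sin (c - v + η) := by rw [← Complex.sin_neg]; congr 1; ring
  rw [e1, e2, e3, e4, e5] at h1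
  rw [e6, e7, e8] at h2
  rw [Complex.sin_neg]
  field_simp
  linear_combination (sin (c - d) * sin η ^ 2 * sin (v - z)) * h1 +
    (sin (c - d) * sin η ^ 3) * h2

variable (hs : ∀ i j, i ≠ j → sin (p i - p j) ≠ 0)
  (hη : ∀ i j, sin (p i - p j + η) ≠ 0) (hη' : ∀ i j, sin (p i - p j + -η) ≠ 0)

include hs hη hη'

/-- Induction with the relation `CB`, which moves `C` past one `B` at the cost of two products of
`A` and `D`; their action is known from `action_action`. In the empty case `C` annihilates the
reference state, in agreement with the single term, which contains `sin 0`. -/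
theorem action_C_insert (s : Finset ι) : ∀ z ∉ s, O.C (p z) (O.betheVector p hp s) =
    -∑ c ∈ insert z s, ∑ d ∈ insert z s, (actionCoeff p η O.a (insert z s) c *
      actionCoeff p (-η) O.d (insert z s) d * (sin η ^ 2 * sin (p c - p d) /
      (sin (p c - p d + η) * sin (p c - p z + η) * sin (p d - p z + -η)))) •
      O.betheVector p hp (((insert z s).erase c).erase d) := by
  induction s using Finset.induction_on with
  | empty =>
    intro z _
    simp [betheVector_empty, O.CΩ _ (hp z)]
  | insert v s hv ih =>
    intro z hz
    rw [mem_insert, not_or] at hz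
    obtain ⟨hzv, hzs⟩ := hz
    set S := insert z (insert v s) with hS
    have hzS : z ∈ S := mem_insert_self _ _
    have hvS : v ∈ S := mem_insert_of_mem (mem_insert_self _ _)
    have hSv : insert z s = S.erase v := by
      rw [hS, Finset.insert_comm, erase_insert]; simp [hv, Ne.symm hzv]
    have hs1 : s = (S.erase z).erase v := by
      rw [hS, erase_insert (by simp [hzs, hzv]), erase_insert hv]
    have hs2 : s = (S.erase v).erase z := by rw [hs1, erase_right_comm]
    have hih := congrArg (O.B (p v)) (ih z hzs)
    rw [hSv] at hih
    have h1 : O.B (p v) (O.C (p z) (O.betheVector p hp s)) =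
        -∑ c ∈ S, ∑ d ∈ S, (actionCoeff p η O.a S c * actionCoeff p (-η) O.d S d *
          (sin (p c - p v) / sin (p c - p v + η) * (sin (p d - p v) / sin (p d - p v + -η)) *
          (sin η ^ 2 * sin (p c - p d) /
          (sin (p c - p d + η) * sin (p c - p z + η) * sin (p d - p z + -η))))) •
          O.betheVector p hp ((S.erase c).erase d) := by
      rw [hih, map_neg, map_sum, ← add_sum_erase S _ hvS]
      simp only [sub_self, Complex.sin_zero, zero_div, mul_zero, zero_mul, zero_smul,
        sum_const_zero, zero_add]
      congr 1
      refine sum_congr rfl fun c hc => ?_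
      rw [mem_erase] at hc
      rw [map_sum, ← add_sum_erase S _ hvS]
      simp only [sub_self, Complex.sin_zero, zero_div, mul_zero, zero_mul, zero_smul, zero_add]
      refine sum_congr rfl fun d hd => ?_
      rw [mem_erase] at hd
      -- For `c = d` no two distinct points are erased and the factor `sin (p c - p d)` makes both
      -- sides zero.
      rcases eq_or_ne c d with rfl | hcd
      · simp
      rw [map_smul, actionCoeff_erase hs hη _ hvS hc.1, actionCoeff_erase hs hη' _ hvS hd.1,
        erase_right_comm (a := v), erase_right_comm (a := v),
        O.B_betheVector_erase hp (mem_erase.2 ⟨hd.1.symm, mem_erase.2 ⟨hc.1.symm, hvS⟩⟩)]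
      congr 1; ring
    have h2 := action_action hp O.isDiagonalEntry_A O.isDiagonalEntry_D hs hη hη' hvS hzS
      (Ne.symm hzv)
    have h3 := action_action hp O.isDiagonalEntry_A O.isDiagonalEntry_D hs hη hη' hzS hvS hzv
    rw [← hs2, sum_comm] at h2
    rw [← hs1, sum_comm] at h3
    have hex := congrArg (fun F : Module.End ℂ V => F (O.betheVector p hp s))
      (O.CB (p z) (p v) (hp z) (hp v))
    simp only [LinearMap.smul_apply, LinearMap.sub_apply, Module.End.mul_apply] at hex
    rw [← O.betheVector_insert hp hv, h1, h2, h3] at hex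
    have hinj : Function.Injective fun w : V => sin (p v - p z) • w :=
      smul_right_injective V (hs v z (Ne.symm hzv))
    refine hinj ?_
    simp only
    rw [smul_sub, sub_eq_iff_eq_add] at hex
    rw [hex, ← sum_sub_distrib, smul_sum, smul_neg, smul_neg, smul_sum, smul_sum,
      ← sub_eq_add_neg, ← sum_sub_distrib, ← sum_neg_distrib]
    refine sum_congr rfl fun c _ => ?_
    rw [← sum_sub_distrib, smul_sum, smul_sum, smul_sum, ← sum_sub_distrib, ← sum_neg_distrib]
    refine sum_congr rfl fun d _ => ?_
    simp only [smul_smul, ← sub_smul, ← neg_smul]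
    congr 1
    have key := action_C_identity (hη c v) (hη' d v) (hη c d)
      (hη c z) (hη' d z)
    linear_combination (-(actionCoeff p η O.a S c * actionCoeff p (-η) O.d S d)) * key

/-- The action of the lower left entry of the monodromy matrix on a Bethe vector. -/
theorem action_C {S : Finset ι} {z : ι} (hz : z ∈ S) :
    O.C (p z) (O.betheVector p hp (S.erase z)) =
    -∑ c ∈ S, ∑ d ∈ S, (actionCoeff p η O.a S c *
      actionCoeff p (-η) O.d S d * (sin η ^ 2 * sin (p c - p d) /
      (sin (p c - p d + η) * sin (p c - p z + η) * sin (p d - p z + -η)))) •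
      O.betheVector p hp ((S.erase c).erase d) := by
  have := action_C_insert (O := O) hp hs hη hη' (S.erase z) z (notMem_erase z S)
  rwa [insert_erase hz] at this

end ActionC

end BetheOperators

end XXZ

namespace XXZ

open Complex

/-! ### The Yang–Baxter relation -/

section RTT

/-- The unnormalized six-vertex matrix with weights `x, y, z` over an algebra. -/
noncomputable def sixVertex (𝓑 : Type*) [Ring 𝓑] [Algebra ℂ 𝓑] (x y z : ℂ) :
    Matrix (Fin 2 × Fin 2) (Fin 2 × Fin 2) 𝓑 :=
  fun p q => algebraMap ℂ 𝓑
    (if p = q then (if p.1 = p.2 then x else y) else if p = q.swap then z else 0)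

variable {𝓑 : Type*} [Ring 𝓑]

/-- `X ⊗ 1`. -/
def embLeft (X : Matrix (Fin 2) (Fin 2) 𝓑) : Matrix (Fin 2 × Fin 2) (Fin 2 × Fin 2) 𝓑 :=
  fun p q => if p.2 = q.2 then X p.1 q.1 else 0

/-- `1 ⊗ X`. -/
def embRight (X : Matrix (Fin 2) (Fin 2) 𝓑) : Matrix (Fin 2 × Fin 2) (Fin 2 × Fin 2) 𝓑 :=
  fun p q => if p.1 = q.1 then X p.2 q.2 else 0

theorem embLeft_mul (X Y : Matrix (Fin 2) (Fin 2) 𝓑) :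
    embLeft (X * Y) = embLeft X * embLeft Y := by
  ext ⟨a, b⟩ ⟨c, d⟩
  fin_cases b <;> fin_cases d <;>
    simp [embLeft, Matrix.mul_apply, Fintype.sum_prod_type]

theorem embRight_mul (X Y : Matrix (Fin 2) (Fin 2) 𝓑) :
    embRight (X * Y) = embRight X * embRight Y := by
  ext ⟨a, b⟩ ⟨c, d⟩
  fin_cases a <;> fin_cases c <;>
    simp [embRight, Matrix.mul_apply, Fintype.sum_prod_type]

theorem commute_emb {X Y : Matrix (Fin 2) (Fin 2) 𝓑}
    (h : ∀ a b c d, Commute (X a b) (Y c d)) : Commute (embLeft X) (embRight Y) := by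
  refine Matrix.ext ?_
  rintro ⟨a, b⟩ ⟨c, d⟩
  have := h a c b d
  fin_cases a <;> fin_cases c <;> fin_cases b <;> fin_cases d <;>
    simpa [embLeft, embRight, Matrix.mul_apply, Fintype.sum_prod_type, Commute, SemiconjBy]
      using this

variable [Algebra ℂ 𝓑]

/-- The quadratic exchange relation `R X₁ Y₂ = Y₂ X₁ R`. -/
def IsRTT (x y z : ℂ) (X Y : Matrix (Fin 2) (Fin 2) 𝓑) : Prop :=
  sixVertex 𝓑 x y z * (embLeft X * embRight Y) = embRight Y * embLeft X * sixVertex 𝓑 x y z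

/-- Entries belonging to different factors commute, so the products can be regrouped and the
six-vertex matrix is carried through one factor at a time. -/
theorem IsRTT.mul {x y z : ℂ} {X Y X' Y' : Matrix (Fin 2) (Fin 2) 𝓑} (h : IsRTT x y z X Y)
    (h' : IsRTT x y z X' Y') (hc : ∀ a b c d, Commute (X a b) (Y' c d))
    (hc' : ∀ a b c d, Commute (X' a b) (Y c d)) : IsRTT x y z (X * X') (Y * Y') := by
  have e1 : embLeft X' * embRight Y = embRight Y * embLeft X' := commute_emb hc'
  have e2 : embLeft X * embRight Y' = embRight Y' * embLeft X := commute_emb hc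
  unfold IsRTT at *
  rw [embLeft_mul, embRight_mul]
  calc sixVertex 𝓑 x y z * (embLeft X * embLeft X' * (embRight Y * embRight Y'))
      = sixVertex 𝓑 x y z * (embLeft X * (embLeft X' * embRight Y) * embRight Y') := by
        simp only [mul_assoc]
    _ = (sixVertex 𝓑 x y z * (embLeft X * embRight Y)) * (embLeft X' * embRight Y') := by
        rw [e1]; simp only [mul_assoc]
    _ = embRight Y * embLeft X * (sixVertex 𝓑 x y z * (embLeft X' * embRight Y')) := by
        rw [h]; simp only [mul_assoc]
    _ = embRight Y * (embLeft X * embRight Y') * embLeft X' * sixVertex 𝓑 x y z := by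
        rw [h']; simp only [mul_assoc]
    _ = _ := by rw [e2]; simp only [mul_assoc]

theorem isRTT_one (x y z : ℂ) : IsRTT x y z (1 : Matrix (Fin 2) (Fin 2) 𝓑) 1 := by
  have h1 : embLeft (1 : Matrix (Fin 2) (Fin 2) 𝓑) = 1 := by
    ext ⟨a, b⟩ ⟨c, d⟩
    fin_cases a <;> fin_cases c <;> fin_cases b <;> fin_cases d <;>
      simp [embLeft]
  have h2 : embRight (1 : Matrix (Fin 2) (Fin 2) 𝓑) = 1 := by
    ext ⟨a, b⟩ ⟨c, d⟩
    fin_cases a <;> fin_cases c <;> fin_cases b <;> fin_cases d <;>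
      simp [embRight]
  simp [IsRTT, h1, h2]

omit [Algebra ℂ 𝓑] in
theorem embLeft_mul_embRight_apply (X Y : Matrix (Fin 2) (Fin 2) 𝓑) (a₁ a₂ b₁ b₂ : Fin 2) :
    (embLeft X * embRight Y) (a₁, a₂) (b₁, b₂) = X a₁ b₁ * Y a₂ b₂ := by
  fin_cases a₂ <;> fin_cases b₁ <;>
    simp [embLeft, embRight, Matrix.mul_apply, Fintype.sum_prod_type]

omit [Algebra ℂ 𝓑] in
theorem embRight_mul_embLeft_apply (X Y : Matrix (Fin 2) (Fin 2) 𝓑) (a₁ a₂ b₁ b₂ : Fin 2) :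
    (embRight Y * embLeft X) (a₁, a₂) (b₁, b₂) = Y a₂ b₂ * X a₁ b₁ := by
  fin_cases a₁ <;> fin_cases b₂ <;>
    simp [embLeft, embRight, Matrix.mul_apply, Fintype.sum_prod_type]

theorem sixVertex_mul_apply (x y z : ℂ) (Z : Matrix (Fin 2 × Fin 2) (Fin 2 × Fin 2) 𝓑)
    (a₁ a₂ : Fin 2) (q : Fin 2 × Fin 2) :
    (sixVertex 𝓑 x y z * Z) (a₁, a₂) q = (if a₁ = a₂ then x else y) • Z (a₁, a₂) q +
      (if a₁ = a₂ then 0 else z) • Z (a₂, a₁) q := by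
  fin_cases a₁ <;> fin_cases a₂ <;>
    simp [sixVertex, Matrix.mul_apply, Fintype.sum_prod_type, Algebra.smul_def, add_comm]

theorem mul_sixVertex_apply (x y z : ℂ) (Z : Matrix (Fin 2 × Fin 2) (Fin 2 × Fin 2) 𝓑)
    (p : Fin 2 × Fin 2) (b₁ b₂ : Fin 2) :
    (Z * sixVertex 𝓑 x y z) p (b₁, b₂) = (if b₁ = b₂ then x else y) • Z p (b₁, b₂) +
      (if b₁ = b₂ then 0 else z) • Z p (b₂, b₁) := by
  fin_cases b₁ <;> fin_cases b₂ <;>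
    simp [sixVertex, Matrix.mul_apply, Fintype.sum_prod_type, Algebra.smul_def, add_comm,
      ← Algebra.commutes]

theorem isRTT_iff {x y z : ℂ} {X Y : Matrix (Fin 2) (Fin 2) 𝓑} :
    IsRTT x y z X Y ↔ ∀ a₁ a₂ b₁ b₂ : Fin 2,
      (if a₁ = a₂ then x else y) • (X a₁ b₁ * Y a₂ b₂) +
        (if a₁ = a₂ then 0 else z) • (X a₂ b₁ * Y a₁ b₂) =
      (if b₁ = b₂ then x else y) • (Y a₂ b₂ * X a₁ b₁) +
        (if b₁ = b₂ then 0 else z) • (Y a₂ b₁ * X a₁ b₂) := by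
  simp only [IsRTT, ← Matrix.ext_iff, Prod.forall, sixVertex_mul_apply, mul_sixVertex_apply,
    embLeft_mul_embRight_apply, embRight_mul_embLeft_apply]

theorem IsRTT.map {𝓒 : Type*} [Ring 𝓒] [Algebra ℂ 𝓒] (f : 𝓑 →ₐ[ℂ] 𝓒) {x y z : ℂ}
    {X Y : Matrix (Fin 2) (Fin 2) 𝓑} (h : IsRTT x y z X Y) :
    IsRTT x y z (X.map f) (Y.map f) := by
  rw [isRTT_iff] at h ⊢
  intro a₁ a₂ b₁ b₂
  have := congrArg f (h a₁ a₂ b₁ b₂)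
  simpa only [map_add, map_smul, map_mul, Matrix.map_apply] using this

end RTT

section Local

/-- The `L`-operator of a site with `σ = 1`. -/
def lPlus (b c : ℂ) : Matrix (Fin 2) (Fin 2) (Matrix (Fin 2) (Fin 2) ℂ) :=
  !![!![1, 0; 0, b], !![0, 0; c, 0]; !![0, c; 0, 0], !![b, 0; 0, 1]]

/-- The `L`-operator of a site with `σ = -1`. -/
def lMinus (b c : ℂ) : Matrix (Fin 2) (Fin 2) (Matrix (Fin 2) (Fin 2) ℂ) :=
  !![!![1, 0; 0, b], !![0, c; 0, 0]; !![0, 0; c, 0], !![b, 0; 0, 1]]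

/-- Written in components, the relation consists of trivial equations and of these three identities
between the weights, up to a sign. -/
theorem isRTT_lMinus {x y z b c b' c' : ℂ} (h₁ : x * c' = y * (b * c') + z * c)
    (h₂ : x * (c * b') = y * c + z * (b * c')) (h₃ : z * b' = y * (c * c') + z * b) :
    IsRTT x y z (lMinus b c) (lMinus b' c') := by
  rw [isRTT_iff]
  intro a1 a2 b1 b2
  fin_cases a1 <;> fin_cases a2 <;> fin_cases b1 <;> fin_cases b2 <;>
  · simp [lMinus]
    try refine ⟨?_, ?_⟩
    all_goals first
      | ring1
      | linear_combination h₁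
      | linear_combination -h₁
      | linear_combination h₂
      | linear_combination -h₂
      | linear_combination h₃
      | linear_combination -h₃
      | exact Or.inl (mul_comm _ _)
      | (ext i; fin_cases i <;> rfl)

theorem isRTT_lPlus {x y z b c b' c' : ℂ} (h₁ : x * c = y * (b' * c) + z * c')
    (h₂ : x * (c' * b) = y * c' + z * (b' * c)) (h₃ : z * b = y * (c * c') + z * b') :
    IsRTT x y z (lPlus b c) (lPlus b' c') := by
  rw [isRTT_iff]
  intro a1 a2 b1 b2
  fin_cases a1 <;> fin_cases a2 <;> fin_cases b1 <;> fin_cases b2 <;>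
  · simp [lPlus]
    try refine ⟨?_, ?_⟩
    all_goals first
      | ring1
      | linear_combination h₁
      | linear_combination -h₁
      | linear_combination h₂
      | linear_combination -h₂
      | linear_combination h₃
      | linear_combination -h₃
      | exact Or.inl (mul_comm _ _)
      | (ext i; fin_cases i <;> rfl)

theorem sin_add_mul_sin_add (u v η : ℂ) :
    sin (u + η) * sin (v + η) = sin u * sin v + sin η * sin (u + v + η) := by
  have h := Complex.sin_sq_add_cos_sq η
  simp only [sin_add, cos_add]
  linear_combination (sin u * sin v) * h

/-- The quadratic relations of the vertex weights `b` and `c`. -/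
theorem weight_relations (γ u v : ℂ) (hu : sin (u + I * γ) ≠ 0) (hv : sin (v + I * γ) ≠ 0) :
    let b := sin u / sin (u + I * γ)
    let c := sin (I * γ) / sin (u + I * γ)
    let b' := sin v / sin (v + I * γ)
    let c' := sin (I * γ) / sin (v + I * γ)
    sin (v - u + I * γ) * c' = sin (v - u) * (b * c') + sin (I * γ) * c ∧
    sin (v - u + I * γ) * (c * b') = sin (v - u) * c + sin (I * γ) * (b * c') ∧
    sin (I * γ) * b' = sin (v - u) * (c * c') + sin (I * γ) * b := by
  intro b c b' c'
  have h1 := sin_add_mul_sin_add (v - u) u (I * γ)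
  have h2 := sin_sub_plucker (v + I * γ) u v 0
  have h3 := sin_sub_plucker v 0 u (-(I * γ))
  have e1 : v - u + u + I * γ = v + I * γ := by ring
  have e2 : v + I * γ - u = v - u + I * γ := by ring
  have e3 : v + I * γ - v = I * γ := by ring
  have e4 : sin (u - v) = -sin (v - u) := by rw [← Complex.sin_neg, neg_sub]
  rw [e1] at h1
  rw [e2, e3, e4] at h2
  simp only [sub_zero, zero_sub, zero_add, sub_neg_eq_add, Complex.sin_neg] at h2 h3
  refine ⟨?_, ?_, ?_⟩
  · simp only [b, c, c']
    field_simp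
    linear_combination (sin (I * γ)) * h1
  · simp only [b, c, b', c']
    field_simp
    linear_combination (sin (I * γ)) * h2
  · simp only [b, c, b', c']
    field_simp
    linear_combination (sin (I * γ)) * h3

end Local

/-! ### Operators on the sites -/

section Sites

variable {M : ℕ}

/-- An operator on one site. -/
def siteHom (j : Fin M) :
    Matrix (Fin 2) (Fin 2) ℂ →ₐ[ℂ] Module.End ℂ ((Fin M → Fin 2) → ℂ) :=
  AlgHom.ofLinearMap
    { toFun := fun m =>
        { toFun := fun v s => ∑ t, m (s j) t * v (Function.update s j t)
          map_add' := fun v w => by ext s; simp [mul_add, Finset.sum_add_distrib]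
          map_smul' := fun c v => by
            ext s; simp only [Pi.smul_apply, smul_eq_mul, RingHom.id_apply, Finset.mul_sum]
            exact Finset.sum_congr rfl fun _ _ => by ring }
      map_add' := fun m m' => by
        ext v s; simp [add_mul, Finset.sum_add_distrib]
      map_smul' := fun c m => by
        refine LinearMap.ext fun v => funext fun s => ?_
        simp only [Matrix.smul_apply, smul_eq_mul, LinearMap.coe_mk, AddHom.coe_mk,
          RingHom.id_apply, LinearMap.smul_apply, Pi.smul_apply, Finset.mul_sum, mul_assoc] }
    (by
      refine LinearMap.ext fun v => funext fun s => ?_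
      simp only [LinearMap.coe_mk, AddHom.coe_mk, Matrix.one_apply, ite_mul, one_mul, zero_mul,
        Finset.sum_ite_eq, Finset.mem_univ, if_true, Function.update_eq_self, Module.End.one_apply])
    (by
      intro m m'
      refine LinearMap.ext fun v => funext fun s => ?_
      simp [Matrix.mul_apply, Fin.sum_univ_two]
      ring)

theorem siteHom_apply (j : Fin M) (m : Matrix (Fin 2) (Fin 2) ℂ) (v : (Fin M → Fin 2) → ℂ)
    (s : Fin M → Fin 2) :
    siteHom j m v s = ∑ t, m (s j) t * v (Function.update s j t) := rfl

theorem siteHom_commute {i j : Fin M} (h : i ≠ j) (m m' : Matrix (Fin 2) (Fin 2) ℂ) :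
    Commute (siteHom i m) (siteHom j m') := by
  refine LinearMap.ext fun v => funext fun s => ?_
  simp only [Module.End.mul_apply, siteHom_apply, Function.update_of_ne h,
    Function.update_of_ne h.symm, Finset.mul_sum]
  rw [Finset.sum_comm]
  refine Finset.sum_congr rfl fun t _ => Finset.sum_congr rfl fun t' _ => ?_
  rw [Function.update_comm h]
  ring

/-- The blocks of an operator on the auxiliary space and the sites. -/
def blocks : Matrix (Fin 2 × (Fin M → Fin 2)) (Fin 2 × (Fin M → Fin 2)) ℂ →*
    Matrix (Fin 2) (Fin 2) (Module.End ℂ ((Fin M → Fin 2) → ℂ)) where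
  toFun X := Matrix.of fun a b => Matrix.toLin' (Matrix.of fun s s' => X (a, s) (b, s'))
  map_one' := by
    refine Matrix.ext fun a b => ?_
    have : (Matrix.of fun s s' =>
        (1 : Matrix (Fin 2 × (Fin M → Fin 2)) (Fin 2 × (Fin M → Fin 2)) ℂ)
        (a, s) (b, s')) = if a = b then (1 : Matrix (Fin M → Fin 2) (Fin M → Fin 2) ℂ) else 0 := by
      ext s s'
      by_cases h : a = b <;> simp [Matrix.one_apply, h]
    rw [Matrix.of_apply, this, Matrix.one_apply]
    split_ifs
    · exact Matrix.toLin'_one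
    · exact map_zero _
  map_mul' X Y := by
    refine Matrix.ext fun a b => ?_
    rw [Matrix.mul_apply]
    simp only [Matrix.of_apply, Module.End.mul_eq_comp, ← Matrix.toLin'_mul]
    rw [← map_sum]
    congr 1
    ext s s'
    rw [Matrix.sum_apply]
    simp only [Matrix.mul_apply, Matrix.of_apply, Fintype.sum_prod_type]

theorem blocks_apply (X : Matrix (Fin 2 × (Fin M → Fin 2)) (Fin 2 × (Fin M → Fin 2)) ℂ)
    (a b : Fin 2) (v : (Fin M → Fin 2) → ℂ) (s : Fin M → Fin 2) :
    blocks X a b v s = ∑ s', X (a, s) (b, s') * v s' := rfl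

theorem sum_eq_off_site (j : Fin M) (s : Fin M → Fin 2) (f : (Fin M → Fin 2) → ℂ) :
    (∑ s', if ∀ k, k ≠ j → s k = s' k then f s' else 0) =
      ∑ t, f (Function.update s j t) := by
  rw [← Finset.sum_filter]
  refine Finset.sum_nbij' (fun s' => s' j) (fun t => Function.update s j t) ?_ ?_ ?_ ?_ ?_
  · intro s' _; exact Finset.mem_univ _
  · intro t _
    simp only [Finset.mem_filter, Finset.mem_univ, true_and]
    intro k hk
    rw [Function.update_of_ne hk]
  · intro s' hs'
    simp only [Finset.mem_filter, Finset.mem_univ, true_and] at hs'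
    ext k
    by_cases hk : k = j
    · subst hk; simp
    · rw [Function.update_of_ne hk, hs' k hk]
  · intro t _; simp
  · intro s' hs'
    simp only [Finset.mem_filter, Finset.mem_univ, true_and] at hs'
    congr 1
    ext k
    by_cases hk : k = j
    · subst hk; simp
    · rw [Function.update_of_ne hk, hs' k hk]

/-- The `L`-operator of a site. -/
noncomputable def lOperator (γ : ℂ) (σ : Fin M → ℤˣ) (ν : Fin M → ℂ) (lam : ℂ) (j : Fin M) :
    Matrix (Fin 2) (Fin 2) (Matrix (Fin 2) (Fin 2) ℂ) :=
  if σ j = 1 then lPlus (bWeight γ lam (ν j)) (cWeight γ lam (ν j))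
  else lMinus (bWeight γ (ν j) lam) (cWeight γ (ν j) lam)

theorem lOperator_apply (γ : ℂ) (σ : Fin M → ℤˣ) (ν : Fin M → ℂ) (lam : ℂ) (j : Fin M)
    (a b t t' : Fin 2) :
    lOperator γ σ ν lam j a b t t' =
      if σ j = 1 then rMatrix γ lam (ν j) (a, t) (b, t')
      else rMatrix γ (ν j) lam (t', a) (t, b) := by
  unfold lOperator
  split_ifs
  · fin_cases a <;> fin_cases b <;> fin_cases t <;> fin_cases t' <;>
      simp [lPlus, rMatrix, ofArray, finProdFinEquiv]
  · fin_cases a <;> fin_cases b <;> fin_cases t <;> fin_cases t' <;>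
      simp [lMinus, rMatrix, ofArray, finProdFinEquiv]

theorem blocks_siteOperator (γ : ℂ) (σ : Fin M → ℤˣ) (ν : Fin M → ℂ) (lam : ℂ) (j : Fin M) :
    blocks (siteOperator γ σ ν lam j) = (lOperator γ σ ν lam j).map (siteHom j) := by
  refine Matrix.ext fun a b => ?_
  refine LinearMap.ext fun v => funext fun s => ?_
  rw [blocks_apply, Matrix.map_apply, siteHom_apply]
  simp only [lOperator_apply]
  have := sum_eq_off_site j s fun s' => (if σ j = 1 then rMatrix γ lam (ν j) (a, s j) (b, s' j)
      else rMatrix γ (ν j) lam (s' j, a) (s j, b)) * v s'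
  simp only [Function.update_self] at this
  rw [← this]
  refine Finset.sum_congr rfl fun s' _ => ?_
  simp only [siteOperator]
  split_ifs <;> simp

/-- At a site with `σ = 1` the weights depend on `ν j - λ`, at a site with `σ = -1` on `λ - ν j`.
The sign reversal exchanges the roles of the two spectral parameters, so both kinds of sites have
the same exchange relation. -/
theorem isRTT_lOperator {γ : ℂ} {σ : Fin M → ℤˣ} {ν : Fin M → ℂ} {lam mu : ℂ}
    (hl : IsRegularPoint γ ν lam) (hm : IsRegularPoint γ ν mu) (j : Fin M) :
    IsRTT (sin (mu - lam + I * γ)) (sin (mu - lam)) (sin (I * γ))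
      (lOperator γ σ ν lam j) (lOperator γ σ ν mu j) := by
  have hflip : ∀ {x : ℂ}, sin (x - ν j - I * γ) ≠ 0 → sin (ν j - x + I * γ) ≠ 0 := by
    intro x hx h
    apply hx
    rw [← neg_eq_zero, ← Complex.sin_neg, ← h]; congr 1; ring
  unfold lOperator
  split_ifs with h
  · have := weight_relations γ (ν j - mu) (ν j - lam) (hflip (hm j).2) (hflip (hl j).2)
    rw [sub_sub_sub_cancel_left] at this
    obtain ⟨h1, h2, h3⟩ := this
    refine isRTT_lPlus h1 h2 ?_
    rw [bWeight, bWeight, cWeight, cWeight, h3]; ring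
  · have := weight_relations γ (lam - ν j) (mu - ν j) (hl j).1 (hm j).1
    rw [sub_sub_sub_cancel_right] at this
    exact isRTT_lMinus this.1 this.2.1 this.2.2

theorem commute_list_prod {l : List (Fin M)} {i : Fin M} (hi : i ∉ l)
    (X : Fin M → Matrix (Fin 2) (Fin 2) (Matrix (Fin 2) (Fin 2) ℂ))
    (m : Matrix (Fin 2) (Fin 2) ℂ) (a b : Fin 2) :
    Commute (siteHom i m) ((l.map fun j => (X j).map (siteHom j)).prod a b) := by
  induction l generalizing a b with
  | nil =>
    simp only [List.map_nil, List.prod_nil, Matrix.one_apply]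
    split_ifs
    · exact Commute.one_right _
    · exact Commute.zero_right _
  | cons j l ih =>
    rw [List.mem_cons, not_or] at hi
    rw [List.map_cons, List.prod_cons, Matrix.mul_apply]
    refine Commute.sum_right _ _ _ fun c _ => Commute.mul_right ?_ (ih hi.2 c b)
    exact siteHom_commute hi.1 _ _

theorem isRTT_list_prod {γ : ℂ} {σ : Fin M → ℤˣ} {ν : Fin M → ℂ} {lam mu : ℂ}
    (hl : IsRegularPoint γ ν lam) (hm : IsRegularPoint γ ν mu) {l : List (Fin M)}
    (hnd : l.Nodup) :
    IsRTT (sin (mu - lam + I * γ)) (sin (mu - lam)) (sin (I * γ))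
      (l.map fun j => (lOperator γ σ ν lam j).map (siteHom j)).prod
      (l.map fun j => (lOperator γ σ ν mu j).map (siteHom j)).prod := by
  induction l with
  | nil => exact isRTT_one _ _ _
  | cons j l ih =>
    rw [List.nodup_cons] at hnd
    simp only [List.map_cons, List.prod_cons]
    refine IsRTT.mul ((isRTT_lOperator hl hm j).map (siteHom j)) (ih hnd.2) ?_ ?_
    · intro a b c d
      exact commute_list_prod hnd.1 _ _ _ _
    · intro a b c d
      exact (commute_list_prod hnd.1 _ _ _ _).symm

/-- The blocks of the twist. -/
theorem blocks_twist (τ : ℂ) : blocks (twist M τ) =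
    Matrix.diagonal fun a => algebraMap ℂ _ (if a = 0 then exp (τ / 2) else exp (-τ / 2)) := by
  refine Matrix.ext fun a b => ?_
  refine LinearMap.ext fun v => funext fun s => ?_
  rw [blocks_apply, Matrix.diagonal_apply]
  by_cases h : a = b
  · subst h
    simp only [twist, Matrix.diagonal_apply, Prod.mk.injEq, true_and, ite_mul, zero_mul,
      Finset.sum_ite_eq, Finset.mem_univ, if_true, Module.algebraMap_end_apply, Pi.smul_apply,
      smul_eq_mul]
  · simp [twist, h]

theorem blocks_monodromy (γ : ℂ) (σ : Fin M → ℤˣ) (ν : Fin M → ℂ) (τ lam : ℂ) :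
    blocks (monodromy γ σ ν τ lam) = blocks (twist M τ) *
      ((List.finRange M).reverse.map fun j => (lOperator γ σ ν lam j).map (siteHom j)).prod := by
  rw [monodromy, map_mul, map_list_prod, List.ofFn_eq_map, ← List.map_reverse, List.map_map]
  simp only [Function.comp_def, blocks_siteOperator]

/-- The six-vertex matrix only keeps or exchanges the two indices and thus commutes with `f ⊗ f`.
Hence a diagonal twist may precede the product over the sites. -/
theorem isRTT_diagonal {𝓑 : Type*} [Ring 𝓑] [Algebra ℂ 𝓑] (f : Fin 2 → ℂ) (x y z : ℂ) :
    IsRTT x y z (Matrix.diagonal fun a => algebraMap ℂ 𝓑 (f a))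
      (Matrix.diagonal fun a => algebraMap ℂ 𝓑 (f a)) := by
  rw [isRTT_iff]
  have key : ∀ a b c d : Fin 2,
      Matrix.diagonal (fun a => algebraMap ℂ 𝓑 (f a)) a b *
      Matrix.diagonal (fun a => algebraMap ℂ 𝓑 (f a)) c d =
      algebraMap ℂ _ ((if a = b then f a else 0) * (if c = d then f c else 0)) := by
    intro a b c d
    rw [Matrix.diagonal_apply, Matrix.diagonal_apply, map_mul]
    split_ifs <;> simp
  intro a₁ a₂ b₁ b₂
  simp only [key, Algebra.smul_def, ← map_mul, ← map_add]
  congr 1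
  fin_cases a₁ <;> fin_cases a₂ <;> fin_cases b₁ <;> fin_cases b₂ <;>
    simp [mul_comm]

/-- The quadratic relations of the monodromy matrix. -/
theorem isRTT_monodromy {γ : ℂ} {σ : Fin M → ℤˣ} {ν : Fin M → ℂ} (τ : ℂ) {lam mu : ℂ}
    (hl : IsRegularPoint γ ν lam) (hm : IsRegularPoint γ ν mu) :
    IsRTT (sin (mu - lam + I * γ)) (sin (mu - lam)) (sin (I * γ))
      (blocks (monodromy γ σ ν τ lam)) (blocks (monodromy γ σ ν τ mu)) := by
  rw [blocks_monodromy, blocks_monodromy]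
  have hc : ∀ (Z : Matrix (Fin 2) (Fin 2) (Module.End ℂ ((Fin M → Fin 2) → ℂ))) (a b c d : Fin 2),
      Commute (blocks (twist M τ) a b) (Z c d) := by
    intro Z a b c d
    rw [blocks_twist, Matrix.diagonal_apply]
    split_ifs
    · exact Algebra.commutes _ _
    · exact Algebra.commutes _ _
    · exact Commute.zero_left _
  refine IsRTT.mul (by rw [blocks_twist]; exact isRTT_diagonal _ _ _ _) (isRTT_list_prod hl hm ?_) ?_ ?_
  · exact List.nodup_reverse.2 (List.nodup_finRange M)
  · exact fun a b c d => hc _ _ _ _ _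
  · exact fun a b c d => (hc _ _ _ _ _).symm

end Sites

end XXZ

/-! ### Reference state, Bethe operators of the monodromy matrix and the conserved charge -/

namespace XXZ

open Complex

section Vacuum

variable {M : ℕ}

/-- The spin of the reference state at the site `j`. -/
def refSpin (σ : Fin M → ℤˣ) (j : Fin M) : Fin 2 := if σ j = 1 then 0 else 1

theorem refState_apply (σ : Fin M → ℤˣ) (s : Fin M → Fin 2) :
    refState σ s = if ∀ j, s j = refSpin σ j then 1 else 0 := rfl

theorem siteHom_refState {σ : Fin M → ℤˣ} {j : Fin M} {m : Matrix (Fin 2) (Fin 2) ℂ} {e : ℂ}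
    (h : ∀ t, m t (refSpin σ j) = if t = refSpin σ j then e else 0) :
    siteHom j m (refState σ) = e • refState σ := by
  funext s
  rw [siteHom_apply, Finset.sum_eq_single (refSpin σ j), h, Pi.smul_apply, smul_eq_mul]
  · simp only [refState_apply]
    by_cases hs : ∀ k, s k = refSpin σ k
    · have : ∀ k, Function.update s j (refSpin σ j) k = refSpin σ k := by
        intro k
        by_cases hk : k = j
        · subst hk; simp
        · rw [Function.update_of_ne hk, hs]
      rw [if_pos hs, if_pos this, if_pos (hs j)]
    · rw [if_neg hs]
      by_cases hj : s j = refSpin σ j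
      · rw [← hj, Function.update_eq_self, if_neg hs, mul_zero, mul_zero]
      · rw [if_neg hj, zero_mul, mul_zero]
  · intro t _ ht
    rw [refState_apply, if_neg, mul_zero]
    intro h'
    have := h' j
    rw [Function.update_self] at this
    exact ht this
  · intro h'; exact absurd (Finset.mem_univ _) h'

variable (γ : ℂ) (σ : Fin M → ℤˣ) (ν : Fin M → ℂ) (lam : ℂ)

theorem lOperator_zero_zero (j : Fin M) :
    siteHom j (lOperator γ σ ν lam j 0 0) (refState σ) =
      (if σ j = 1 then 1 else bWeight γ (ν j) lam) • refState σ := by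
  refine siteHom_refState fun t => ?_
  unfold lOperator refSpin
  split_ifs <;> fin_cases t <;> simp_all [lPlus, lMinus]

theorem lOperator_one_one (j : Fin M) :
    siteHom j (lOperator γ σ ν lam j 1 1) (refState σ) =
      (if σ j = 1 then bWeight γ lam (ν j) else 1) • refState σ := by
  refine siteHom_refState fun t => ?_
  unfold lOperator refSpin
  split_ifs <;> fin_cases t <;> simp_all [lPlus, lMinus]

theorem lOperator_one_zero (j : Fin M) :
    siteHom j (lOperator γ σ ν lam j 1 0) (refState σ) = 0 := by
  rw [siteHom_refState (e := 0), zero_smul]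
  intro t
  unfold lOperator refSpin
  split_ifs <;> fin_cases t <;> simp_all [lPlus, lMinus]

/-- Every `L`-operator is triangular on the reference state, and so is the product. For the entry `1
1` there is an additional term, the lower left operator of the site `j` after the upper right entry
of the rest. It vanishes because that operator acts on a site absent from the rest and can be
commuted to the reference state. -/
theorem list_prod_refState {l : List (Fin M)} (hl : l.Nodup) :
    let P := (l.map fun j => (lOperator γ σ ν lam j).map (siteHom j)).prod
    P 0 0 (refState σ) =
      (l.map fun j => if σ j = 1 then (1 : ℂ) else bWeight γ (ν j) lam).prod • refState σ ∧
    P 1 1 (refState σ) =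
      (l.map fun j => if σ j = 1 then bWeight γ lam (ν j) else (1 : ℂ)).prod • refState σ ∧
    P 1 0 (refState σ) = 0 := by
  induction l with
  | nil => simp
  | cons j l ih =>
    rw [List.nodup_cons] at hl
    obtain ⟨h0, h1, h2⟩ := ih hl.2
    intro P
    have hP : ∀ a b, P a b (refState σ) =
        siteHom j (lOperator γ σ ν lam j a 0)
          ((l.map fun j => (lOperator γ σ ν lam j).map (siteHom j)).prod 0 b (refState σ)) +
        siteHom j (lOperator γ σ ν lam j a 1)
          ((l.map fun j => (lOperator γ σ ν lam j).map (siteHom j)).prod 1 b (refState σ)) := by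
      intro a b
      simp only [P, List.map_cons, List.prod_cons, Matrix.mul_apply, Fin.sum_univ_two]
      rfl
    refine ⟨?_, ?_, ?_⟩
    · rw [hP, h0, h2, map_zero, add_zero, map_smul, lOperator_zero_zero, smul_smul,
        List.map_cons, List.prod_cons, mul_comm]
    · have hc := commute_list_prod hl.1 (lOperator γ σ ν lam) (lOperator γ σ ν lam j 1 0) 0 1
      have hc' := LinearMap.congr_fun hc.eq (refState σ)
      rw [Module.End.mul_apply, Module.End.mul_apply, lOperator_one_zero, map_zero] at hc'
      rw [hP, hc', zero_add, h1, map_smul, lOperator_one_one, smul_smul,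
        List.map_cons, List.prod_cons, mul_comm]
    · rw [hP, h0, h2, map_zero, add_zero, map_smul, lOperator_one_zero, smul_zero]

theorem blocks_monodromy_apply (τ : ℂ) (a b : Fin 2) :
    blocks (monodromy γ σ ν τ lam) a b = (if a = 0 then exp (τ / 2) else exp (-τ / 2)) •
      ((List.finRange M).reverse.map fun j =>
        (lOperator γ σ ν lam j).map (siteHom j)).prod a b := by
  rw [blocks_monodromy, blocks_twist, Matrix.diagonal_mul, Algebra.smul_def]

theorem list_finRange_reverse_prod (f : Fin M → ℂ) :
    ((List.finRange M).reverse.map f).prod = ∏ j, f j := by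
  rw [List.map_reverse, List.prod_reverse, ← List.ofFn_eq_map, List.prod_ofFn]

theorem monodromy_refState (τ : ℂ) :
    blocks (monodromy γ σ ν τ lam) 0 0 (refState σ) = vacA γ σ ν τ lam • refState σ ∧
    blocks (monodromy γ σ ν τ lam) 1 1 (refState σ) = vacD γ σ ν τ lam • refState σ ∧
    blocks (monodromy γ σ ν τ lam) 1 0 (refState σ) = 0 := by
  have h := list_prod_refState γ σ ν lam (l := (List.finRange M).reverse)
    (List.nodup_reverse.2 (List.nodup_finRange M))
  obtain ⟨h0, h1, h2⟩ := h
  simp only [blocks_monodromy_apply, LinearMap.smul_apply, h0, h1, h2, smul_smul,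
    list_finRange_reverse_prod, vacA, vacD]
  simp

end Vacuum

section Bundle

variable {M : ℕ}

/-- The entries of the monodromy matrix as operators of the algebraic Bethe ansatz, with spectral
parameters in a set `U` of points that are not separated by `iγ`. -/
noncomputable def betheOperators (γ : ℂ) (σ : Fin M → ℤˣ) (ν : Fin M → ℂ) (τ : ℂ) (U : Set ℂ)
    (hU : ∀ z ∈ U, IsRegularPoint γ ν z) (hU' : ∀ z ∈ U, ∀ v ∈ U, sin (z - v + I * γ) ≠ 0) :
    BetheOperators ((Fin M → Fin 2) → ℂ) (I * γ) (· ∈ U) where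
  A z := blocks (monodromy γ σ ν τ z) 0 0
  B z := blocks (monodromy γ σ ν τ z) 0 1
  C z := blocks (monodromy γ σ ν τ z) 1 0
  D z := blocks (monodromy γ σ ν τ z) 1 1
  Ω := refState σ
  a := vacA γ σ ν τ
  d := vacD γ σ ν τ
  AA z v hz hv := by
    have h := isRTT_iff.1 (isRTT_monodromy (σ := σ) τ (hU z hz) (hU v hv)) 0 0 0 0
    simp only [if_true, zero_smul, add_zero] at h
    exact smul_right_injective _ (hU' v hv z hz) h
  BB z v hz hv := by
    have h := isRTT_iff.1 (isRTT_monodromy (σ := σ) τ (hU z hz) (hU v hv)) 0 0 1 1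
    simp only [if_true, zero_smul, add_zero] at h
    exact smul_right_injective _ (hU' v hv z hz) h
  AB z v hz hv := by
    have h := isRTT_iff.1 (isRTT_monodromy (σ := σ) τ (hU v hv) (hU z hz)) 0 0 1 0
    simp only [if_true, zero_smul, add_zero, one_ne_zero, if_false] at h
    rw [h]; abel
  DB z v hz hv := by
    have h := isRTT_iff.1 (isRTT_monodromy (σ := σ) τ (hU z hz) (hU v hv)) 1 0 1 1
    simp only [if_true, zero_smul, add_zero, one_ne_zero, if_false] at h
    have e1 : sin (z - v) = -sin (v - z) := by rw [← Complex.sin_neg, neg_sub]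
    have e2 : sin (z - v + -(I * γ)) = -sin (v - z + I * γ) := by
      rw [← Complex.sin_neg]; congr 1; ring
    rw [e1, e2, Complex.sin_neg]
    linear_combination (norm := module) (-1 : ℂ) • h
  CB z v hz hv := by
    have h := isRTT_iff.1 (isRTT_monodromy (σ := σ) τ (hU z hz) (hU v hv)) 1 0 0 1
    simp only [one_ne_zero, zero_ne_one, if_false] at h
    rw [smul_sub, smul_sub, sub_eq_sub_iff_add_eq_add, h, add_comm]
  AΩ z _ := (monodromy_refState γ σ ν z τ).1
  DΩ z _ := (monodromy_refState γ σ ν z τ).2.1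
  CΩ z _ := (monodromy_refState γ σ ν z τ).2.2

theorem transferMatrix_mulVec (γ : ℂ) (σ : Fin M → ℤˣ) (ν : Fin M → ℂ) (τ lam : ℂ)
    (v : (Fin M → Fin 2) → ℂ) :
    Matrix.mulVec (transferMatrix γ σ ν τ lam) v =
      blocks (monodromy γ σ ν τ lam) 0 0 v + blocks (monodromy γ σ ν τ lam) 1 1 v := by
  rw [transferMatrix, Fin.sum_univ_two, Matrix.add_mulVec]; rfl

/-- The dependence of the monodromy matrix on the twist. -/
theorem blocks_monodromy_twist (γ : ℂ) (σ : Fin M → ℤˣ) (ν : Fin M → ℂ) (τ τ' lam : ℂ) :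
    (∀ b, blocks (monodromy γ σ ν τ' lam) 0 b =
      exp ((τ' - τ) / 2) • blocks (monodromy γ σ ν τ lam) 0 b) ∧
    ∀ b, blocks (monodromy γ σ ν τ' lam) 1 b =
      (exp ((τ' - τ) / 2))⁻¹ • blocks (monodromy γ σ ν τ lam) 1 b := by
  constructor <;> intro b <;>
    simp only [blocks_monodromy_apply, smul_smul, if_true, one_ne_zero, if_false,
      ← Complex.exp_neg, ← Complex.exp_add] <;> congr 2 <;> ring

end Bundle

section Charge

variable {M : ℕ} (σ : Fin M → ℤˣ)

/-- The number of sites at which a configuration differs from the reference state. -/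
def charge (s : Fin M → Fin 2) : ℕ := (Finset.univ.filter fun j => s j ≠ refSpin σ j).card

theorem charge_eq_sum (s : Fin M → Fin 2) :
    charge σ s = ∑ j, if s j ≠ refSpin σ j then 1 else 0 := Finset.card_filter _ _

/-- An operator on the auxiliary space and the sites that conserves the total charge. -/
def ConservesCharge (X : Matrix (Fin 2 × (Fin M → Fin 2)) (Fin 2 × (Fin M → Fin 2)) ℂ) : Prop :=
  ∀ p q, X p q ≠ 0 → charge σ p.2 + p.1 = charge σ q.2 + q.1

variable {σ}

theorem ConservesCharge.mul {X Y : Matrix (Fin 2 × (Fin M → Fin 2)) (Fin 2 × (Fin M → Fin 2)) ℂ}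
    (hX : ConservesCharge σ X) (hY : ConservesCharge σ Y) : ConservesCharge σ (X * Y) := by
  intro p q h
  rw [Matrix.mul_apply] at h
  obtain ⟨r, -, hr⟩ := Finset.exists_ne_zero_of_sum_ne_zero h
  exact (hX p r (left_ne_zero_of_mul hr)).trans (hY r q (right_ne_zero_of_mul hr))

theorem conservesCharge_one : ConservesCharge σ 1 := by
  intro p q h
  rw [Matrix.one_apply] at h
  have : p = q := by by_contra hne; exact h (if_neg hne)
  rw [this]

theorem conservesCharge_list_prod
    {l : List (Matrix (Fin 2 × (Fin M → Fin 2)) (Fin 2 × (Fin M → Fin 2)) ℂ)}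
    (h : ∀ X ∈ l, ConservesCharge σ X) : ConservesCharge σ l.prod := by
  induction l with
  | nil => exact conservesCharge_one
  | cons X l ih =>
    rw [List.prod_cons]
    exact (h X List.mem_cons_self).mul (ih fun Y hY => h Y (List.mem_cons_of_mem _ hY))

/-- The partial transposition at sites with `σ = -1` reverses the sign with which the spin of the
site enters the ice rule. Counting deviations from the reference state instead of down spins
compensates this. -/
theorem conservesCharge_siteOperator (γ : ℂ) (ν : Fin M → ℂ) (lam : ℂ) (j : Fin M) :
    ConservesCharge σ (siteOperator γ σ ν lam j) := by
  rintro ⟨a, s⟩ ⟨b, s'⟩ h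
  simp only [siteOperator] at h
  split_ifs at h with h1 h2
  all_goals try exact absurd rfl h
  all_goals
    rw [charge_eq_sum, charge_eq_sum, ← Finset.add_sum_erase _ _ (Finset.mem_univ j),
      ← Finset.add_sum_erase (a := j) _ (fun j => if s' j ≠ refSpin σ j then 1 else 0)
        (Finset.mem_univ j)]
    have : ∑ x ∈ Finset.univ.erase j, (if s x ≠ refSpin σ x then 1 else 0) =
        ∑ x ∈ Finset.univ.erase j, if s' x ≠ refSpin σ x then 1 else 0 :=
      Finset.sum_congr rfl fun k hk => by rw [h1 k (Finset.ne_of_mem_erase hk)]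
    rw [this]
    have key : ((if s j ≠ refSpin σ j then 1 else 0) + (a : ℕ)) =
        (if s' j ≠ refSpin σ j then 1 else 0) + (b : ℕ) := by
      revert h
      generalize s j = t
      generalize s' j = t'
      simp only [refSpin, h2, if_true, if_false]
      fin_cases a <;> fin_cases b <;> fin_cases t <;> fin_cases t' <;>
        simp [rMatrix, ofArray, finProdFinEquiv]
    simp only [] at key ⊢
    omega

theorem conservesCharge_monodromy (γ : ℂ) (ν : Fin M → ℂ) (τ lam : ℂ) :
    ConservesCharge σ (monodromy γ σ ν τ lam) := by
  refine ConservesCharge.mul ?_ (conservesCharge_list_prod ?_)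
  · intro p q h
    rw [twist, Matrix.diagonal_apply] at h
    have : p = q := by by_contra hne; exact h (if_neg hne)
    rw [this]
  · intro X hX
    rw [List.mem_reverse, List.mem_ofFn] at hX
    obtain ⟨j, rfl⟩ := hX
    exact conservesCharge_siteOperator γ ν lam j

theorem charge_refState {s : Fin M → Fin 2} (h : refState σ s ≠ 0) : charge σ s = 0 := by
  rw [refState_apply] at h
  have : ∀ j, s j = refSpin σ j := by by_contra hne; exact h (if_neg hne)
  simp [charge, this]

/-- Every upper right entry raises the charge by one, and the reference state has charge 0. -/
theorem charge_mulVec_prod (γ : ℂ) (ν : Fin M → ℂ) (τ : ℂ) (l : List ℂ) (s : Fin M → Fin 2)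
    (h : Matrix.mulVec (l.map fun z => monodromyEntry γ σ ν τ z 0 1).prod (refState σ) s ≠ 0) :
    charge σ s = l.length := by
  induction l generalizing s with
  | nil =>
    simp only [List.map_nil, List.prod_nil, Matrix.one_mulVec] at h
    exact charge_refState h
  | cons z l ih =>
    rw [List.map_cons, List.prod_cons, ← Matrix.mulVec_mulVec, Matrix.mulVec, dotProduct] at h
    obtain ⟨s', -, hs'⟩ := Finset.exists_ne_zero_of_sum_ne_zero h
    have h1 := conservesCharge_monodromy γ ν τ z _ _ (left_ne_zero_of_mul hs')
    have h2 := ih s' (right_ne_zero_of_mul hs')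
    simp only [Fin.val_zero, Fin.val_one] at h1
    rw [List.length_cons]
    omega

theorem charge_vecMul_prod (γ : ℂ) (ν : Fin M → ℂ) (τ : ℂ) (l : List ℂ) (s : Fin M → Fin 2)
    (h : Matrix.vecMul (refState σ) (l.map fun z => monodromyEntry γ σ ν τ z 1 0).prod s ≠ 0) :
    charge σ s = l.length := by
  induction l using List.reverseRecOn generalizing s with
  | nil =>
    simp only [List.map_nil, List.prod_nil, Matrix.vecMul_one] at h
    exact charge_refState h
  | append_singleton l z ih =>
    rw [List.map_append, List.prod_append, ← Matrix.vecMul_vecMul, List.map_singleton,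
      List.prod_singleton, Matrix.vecMul, dotProduct] at h
    obtain ⟨s', -, hs'⟩ := Finset.exists_ne_zero_of_sum_ne_zero h
    have h1 := conservesCharge_monodromy γ ν τ z _ _ (right_ne_zero_of_mul hs')
    have h2 := ih s' (left_ne_zero_of_mul hs')
    simp only [Fin.val_zero, Fin.val_one] at h1
    rw [List.length_append, List.length_singleton]
    omega

/-- The ice rule for matrix elements between two vectors of equal charge. -/
theorem dotProduct_monodromy_eq_zero (γ : ℂ) (ν : Fin M → ℂ) (τ : ℂ) {n : ℕ}
    {bra ket : (Fin M → Fin 2) → ℂ} (hb : ∀ s, bra s ≠ 0 → charge σ s = n)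
    (hk : ∀ s, ket s ≠ 0 → charge σ s = n) (z₁ z₂ : ℂ) {a₁ b₁ a₂ b₂ : Fin 2}
    (h : (a₁ : ℕ) + a₂ ≠ b₁ + b₂) :
    dotProduct bra (Matrix.mulVec
      (monodromyEntry γ σ ν τ z₁ a₁ b₁ * monodromyEntry γ σ ν τ z₂ a₂ b₂) ket) = 0 := by
  by_contra hne
  rw [← Matrix.mulVec_mulVec, dotProduct] at hne
  obtain ⟨s, -, hs⟩ := Finset.exists_ne_zero_of_sum_ne_zero hne
  have h1 := hb s (left_ne_zero_of_mul hs)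
  have h2 := right_ne_zero_of_mul hs
  rw [Matrix.mulVec, dotProduct] at h2
  obtain ⟨s', -, hs'⟩ := Finset.exists_ne_zero_of_sum_ne_zero h2
  have h3 := conservesCharge_monodromy γ ν τ z₁ _ _ (left_ne_zero_of_mul hs')
  have h4 := right_ne_zero_of_mul hs'
  rw [Matrix.mulVec, dotProduct] at h4
  obtain ⟨s'', -, hs''⟩ := Finset.exists_ne_zero_of_sum_ne_zero h4
  have h5 := conservesCharge_monodromy γ ν τ z₂ _ _ (left_ne_zero_of_mul hs'')
  have h6 := hk s'' (right_ne_zero_of_mul hs'')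
  simp only [] at h3 h5
  omega

end Charge

end XXZ

/-! ### Analyticity in the spectral parameter -/

namespace XXZ

open Complex

section Analytic

variable {M : ℕ}

theorem analyticAt_rMatrix {γ : ℂ} {f g : ℂ → ℂ} {z : ℂ} (hf : AnalyticAt ℂ f z)
    (hg : AnalyticAt ℂ g z) (h : sin (g z - f z + I * γ) ≠ 0) (p q : Fin 2 × Fin 2) :
    AnalyticAt ℂ (fun u => rMatrix γ (f u) (g u) p q) z := by
  have hb : AnalyticAt ℂ (fun u => bWeight γ (f u) (g u)) z := by
    unfold bWeight; fun_prop (disch := assumption)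
  have hc : AnalyticAt ℂ (fun u => cWeight γ (f u) (g u)) z := by
    unfold cWeight; fun_prop (disch := assumption)
  obtain ⟨a, b⟩ := p
  obtain ⟨c, d⟩ := q
  fin_cases a <;> fin_cases b <;> fin_cases c <;> fin_cases d <;>
    first
      | exact analyticAt_const
      | exact hb
      | exact hc

theorem analyticAt_list_prod {n : Type*} [Fintype n] [DecidableEq n] {z : ℂ}
    {l : List (ℂ → Matrix n n ℂ)} (h : ∀ X ∈ l, ∀ p q, AnalyticAt ℂ (fun u => X u p q) z)
    (p q : n) : AnalyticAt ℂ (fun u => (l.map fun X => X u).prod p q) z := by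
  induction l generalizing p q with
  | nil => exact analyticAt_const
  | cons X l ih =>
    simp only [List.map_cons, List.prod_cons, Matrix.mul_apply]
    exact Finset.analyticAt_fun_sum _ fun r _ => (h X List.mem_cons_self p r).mul
      (ih (fun Y hY => h Y (List.mem_cons_of_mem _ hY)) r q)

theorem analyticAt_monodromyEntry {γ : ℂ} {σ : Fin M → ℤˣ} {ν : Fin M → ℂ} (τ : ℂ) {z : ℂ}
    (hz : IsRegularPoint γ ν z) (a b : Fin 2) (s s' : Fin M → Fin 2) :
    AnalyticAt ℂ (fun u => monodromyEntry γ σ ν τ u a b s s') z := by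
  have h : ∀ u, monodromyEntry γ σ ν τ u a b s s' =
      (if a = 0 then exp (τ / 2) else exp (-τ / 2)) *
        (((List.finRange M).reverse.map fun j u => siteOperator γ σ ν u j).map
          fun X => X u).prod (a, s) (b, s') := by
    intro u
    rw [monodromyEntry, monodromy, twist, Matrix.diagonal_mul, List.ofFn_eq_map,
      ← List.map_reverse, List.map_map]
    rfl
  simp only [h]
  refine analyticAt_const.mul (analyticAt_list_prod ?_ _ _)
  intro X hX p q
  obtain ⟨j, -, rfl⟩ := List.mem_map.1 hX
  simp only [siteOperator]
  by_cases h1 : ∀ k, k ≠ j → p.2 k = q.2 k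
  · simp only [if_pos h1]
    by_cases h2 : σ j = 1
    · simp only [if_pos h2]
      refine analyticAt_rMatrix analyticAt_id analyticAt_const ?_ _ _
      intro h0
      apply (hz j).2
      rw [← neg_eq_zero, ← Complex.sin_neg, ← h0]
      congr 1; simp only [id]; ring
    · simp only [if_neg h2]
      exact analyticAt_rMatrix analyticAt_const analyticAt_id (hz j).1 _ _
  · simp only [if_neg h1]
    exact analyticAt_const

theorem analyticAt_transferMatrix {γ : ℂ} {σ : Fin M → ℤˣ} {ν : Fin M → ℂ} (τ : ℂ) {z : ℂ}
    (hz : IsRegularPoint γ ν z) (s s' : Fin M → Fin 2) :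
    AnalyticAt ℂ (fun u => transferMatrix γ σ ν τ u s s') z := by
  simp only [transferMatrix, Fin.sum_univ_two, Matrix.add_apply]
  exact (analyticAt_monodromyEntry τ hz _ _ _ _).add (analyticAt_monodromyEntry τ hz _ _ _ _)

theorem isOpen_setOf_isRegularPoint (γ : ℂ) (ν : Fin M → ℂ) :
    IsOpen {z | IsRegularPoint γ ν z} := by
  simp only [IsRegularPoint, Set.ofPred_forall]
  refine isOpen_iInter_of_finite fun j => IsOpen.inter ?_ ?_
  · exact isOpen_ne_fun (by fun_prop) continuous_const
  · exact isOpen_ne_fun (by fun_prop) continuous_const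

/-- An eigenvalue of the transfer matrix is analytic if its eigenvector does not depend on the
spectral parameter. -/
theorem analyticAt_eigenvalue_of_ket {γ : ℂ} {σ : Fin M → ℤˣ} {ν : Fin M → ℂ} {τ : ℂ}
    {ket : (Fin M → Fin 2) → ℂ} {ev : ℂ → ℂ} (hk : ket ≠ 0)
    (h : ∀ z, IsRegularPoint γ ν z → Matrix.mulVec (transferMatrix γ σ ν τ z) ket = ev z • ket)
    {z : ℂ} (hz : IsRegularPoint γ ν z) : AnalyticAt ℂ ev z := by
  obtain ⟨s, hs⟩ := Function.ne_iff.1 hk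
  have h1 : AnalyticAt ℂ (fun u => (∑ s', transferMatrix γ σ ν τ u s s' * ket s') / ket s) z :=
    (Finset.analyticAt_fun_sum _ fun s' _ =>
      (analyticAt_transferMatrix τ hz s s').mul analyticAt_const).div analyticAt_const hs
  refine h1.congr ?_
  filter_upwards [(isOpen_setOf_isRegularPoint γ ν).mem_nhds hz] with u hu
  have := congrFun (h u hu) s
  rw [Pi.smul_apply, smul_eq_mul] at this
  rw [div_eq_iff hs, ← this]; rfl

theorem analyticAt_eigenvalue_of_bra {γ : ℂ} {σ : Fin M → ℤˣ} {ν : Fin M → ℂ} {τ : ℂ}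
    {bra : (Fin M → Fin 2) → ℂ} {ev : ℂ → ℂ} (hk : bra ≠ 0)
    (h : ∀ z, IsRegularPoint γ ν z → Matrix.vecMul bra (transferMatrix γ σ ν τ z) = ev z • bra)
    {z : ℂ} (hz : IsRegularPoint γ ν z) : AnalyticAt ℂ ev z := by
  obtain ⟨s, hs⟩ := Function.ne_iff.1 hk
  have h1 : AnalyticAt ℂ (fun u => (∑ s', bra s' * transferMatrix γ σ ν τ u s' s) / bra s) z :=
    (Finset.analyticAt_fun_sum _ fun s' _ =>
      analyticAt_const.mul (analyticAt_transferMatrix τ hz s' s)).div analyticAt_const hs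
  refine h1.congr ?_
  filter_upwards [(isOpen_setOf_isRegularPoint γ ν).mem_nhds hz] with u hu
  have := congrFun (h u hu) s
  rw [Pi.smul_apply, smul_eq_mul] at this
  rw [div_eq_iff hs, ← this]; rfl

/-- Needed to reach spectral parameters that coincide with a Bethe root as limits of generic ones.
-/
theorem continuousAt_normalizedElement {γ : ℂ} {σ : Fin M → ℤˣ} {ν : Fin M → ℂ} (τ : ℂ)
    {bra ket : (Fin M → Fin 2) → ℂ} {ev : ℂ → ℂ} {ξ₁ ξ₂ : ℂ} (h₁ : IsRegularPoint γ ν ξ₁)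
    (h₂ : IsRegularPoint γ ν ξ₂) (he₁ : ContinuousAt ev ξ₁) (he₂ : ContinuousAt ev ξ₂)
    (h0 : dotProduct bra ket ≠ 0) (h0₁ : ev ξ₁ ≠ 0) (h0₂ : ev ξ₂ ≠ 0) :
    ContinuousAt (fun ξ : ℂ × ℂ => normalizedElement γ σ ν τ bra ket ev ξ.1 ξ.2) (ξ₁, ξ₂) := by
  have c1 : ∀ a b s s', ContinuousAt (fun ξ : ℂ × ℂ => monodromyEntry γ σ ν τ ξ.1 a b s s')
      (ξ₁, ξ₂) := fun a b s s' =>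
    (analyticAt_monodromyEntry (σ := σ) τ h₁ a b s s').continuousAt.comp
      (f := fun ξ : ℂ × ℂ => ξ.1) (x := (ξ₁, ξ₂)) continuousAt_fst
  have c2 : ∀ a b s s', ContinuousAt (fun ξ : ℂ × ℂ => monodromyEntry γ σ ν τ ξ.2 a b s s')
      (ξ₁, ξ₂) := fun a b s s' =>
    (analyticAt_monodromyEntry (σ := σ) τ h₂ a b s s').continuousAt.comp
      (f := fun ξ : ℂ × ℂ => ξ.2) (x := (ξ₁, ξ₂)) continuousAt_snd
  have e1 : ContinuousAt (fun ξ : ℂ × ℂ => ev ξ.1) (ξ₁, ξ₂) :=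
    he₁.comp (f := fun ξ : ℂ × ℂ => ξ.1) (x := (ξ₁, ξ₂)) continuousAt_fst
  have e2 : ContinuousAt (fun ξ : ℂ × ℂ => ev ξ.2) (ξ₁, ξ₂) :=
    he₂.comp (f := fun ξ : ℂ × ℂ => ξ.2) (x := (ξ₁, ξ₂)) continuousAt_snd
  refine continuousAt_pi.2 fun a => continuousAt_pi.2 fun b => ?_
  refine ContinuousAt.div ?_ (continuousAt_const.mul (e1.mul e2))
    (mul_ne_zero h0 (mul_ne_zero h0₁ h0₂))
  simp only [dotProduct, Matrix.mulVec, Matrix.mul_apply]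
  refine tendsto_finsetSum _ fun s _ => Tendsto.mul tendsto_const_nhds ?_
  refine tendsto_finsetSum _ fun s' _ => Tendsto.mul ?_ tendsto_const_nhds
  exact tendsto_finsetSum _ fun r _ => Tendsto.mul (c1 _ _ _ _) (c2 _ _ _ _)

end Analytic

section Ket

variable {M : ℕ}

theorem betheVector_eq_mulVec {γ : ℂ} {σ : Fin M → ℤˣ} {ν : Fin M → ℂ} {τ : ℂ} {U : Set ℂ}
    (hU : ∀ z ∈ U, IsRegularPoint γ ν z) (hU' : ∀ z ∈ U, ∀ v ∈ U, sin (z - v + I * γ) ≠ 0)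
    {ι : Type*} [DecidableEq ι] {p : ι → ℂ} (hp : ∀ i, p i ∈ U) {l : List ι} (hl : l.Nodup) :
    (betheOperators γ σ ν τ U hU hU').betheVector p hp l.toFinset =
      Matrix.mulVec (l.map fun i => monodromyEntry γ σ ν τ (p i) 0 1).prod (refState σ) := by
  induction l with
  | nil =>
    rw [List.toFinset_nil, BetheOperators.betheVector_empty, List.map_nil, List.prod_nil,
      Matrix.one_mulVec]
    rfl
  | cons i l ih =>
    rw [List.nodup_cons] at hl
    rw [List.toFinset_cons, BetheOperators.betheVector_insert _ _ (by simpa using hl.1), ih hl.2,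
      List.map_cons, List.prod_cons, ← Matrix.mulVec_mulVec]
    rfl

end Ket

end XXZ

/-! ### Cotangent identities, antisymmetrized double sums and the finite linear systems -/

namespace XXZ

open Complex

section Trig

theorem cot_mul_sin {u : ℂ} (hu : sin u ≠ 0) : cot u * sin u = cos u := by
  rw [cot_eq_cos_div_sin, div_mul_cancel₀ _ hu]

theorem cot_neg' (u : ℂ) : cot (-u) = -cot u := by
  rw [cot_eq_cos_div_sin, cot_eq_cos_div_sin, Complex.cos_neg, Complex.sin_neg, div_neg]

theorem exp_mul_cot {u : ℂ} (hu : sin u ≠ 0) :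
    (exp (I * u) - exp (-(I * u))) * cot u = I * (exp (I * u) + exp (-(I * u))) := by
  have h := cot_mul_sin hu
  have h1 : exp (I * u) - exp (-(I * u)) = 2 * I * sin u := by
    rw [mul_comm I u, ← neg_mul, exp_mul_I, exp_mul_I, Complex.cos_neg, Complex.sin_neg]; ring
  have h2 : exp (I * u) + exp (-(I * u)) = 2 * cos u := by
    rw [mul_comm I u, ← neg_mul, exp_mul_I, exp_mul_I, Complex.cos_neg, Complex.sin_neg]; ring
  rw [h1, h2]
  linear_combination (2 * I) * h

/-- Interchange of an exponential with a cotangent. -/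
theorem exp_mul_cot_add {x y η : ℂ} (h : sin (x - y + η) ≠ 0) :
    (exp (2 * I * x) * exp (I * η) - exp (2 * I * y) * (exp (I * η))⁻¹) * cot (x - y + η) =
      I * (exp (2 * I * x) * exp (I * η) + exp (2 * I * y) * (exp (I * η))⁻¹) := by
  have h1 := exp_mul_cot h
  have e1 : exp (2 * I * x) * exp (I * η) = exp (I * (x + y)) * exp (I * (x - y + η)) := by
    rw [← Complex.exp_add, ← Complex.exp_add]; congr 1; ring
  have e2 : exp (2 * I * y) * (exp (I * η))⁻¹ = exp (I * (x + y)) * exp (-(I * (x - y + η))) := by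
    rw [← Complex.exp_neg, ← Complex.exp_add, ← Complex.exp_add]; congr 1; ring
  rw [e1, e2]
  linear_combination (exp (I * (x + y))) * h1

theorem exp_neg_mul_cot_add {x y η : ℂ} (h : sin (x - y + η) ≠ 0) :
    ((exp (2 * I * x))⁻¹ * (exp (I * η))⁻¹ - (exp (2 * I * y))⁻¹ * exp (I * η)) *
        cot (x - y + η) =
      -I * ((exp (2 * I * x))⁻¹ * (exp (I * η))⁻¹ + (exp (2 * I * y))⁻¹ * exp (I * η)) := by
  have h1 := exp_mul_cot_add h
  have e1 := exp_ne_zero (2 * I * x)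
  have e2 := exp_ne_zero (2 * I * y)
  have e3 := exp_ne_zero (I * η)
  field_simp at h1 ⊢
  linear_combination (-1 : ℂ) * h1

end Trig

section Bracket

variable {ι : Type*} [Fintype ι] (y₁ y₂ : ι → ℂ)

/-- The double sum `∑ (y₁(c) y₂(d) - y₂(c) y₁(d)) F(c, d)`. -/
def bracket (F : ι → ι → ℂ) : ℂ := ∑ c, ∑ d, (y₁ c * y₂ d - y₂ c * y₁ d) * F c d

theorem bracket_swap (F : ι → ι → ℂ) :
    bracket y₁ y₂ (fun c d => F d c) = -bracket y₁ y₂ F := by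
  rw [bracket, bracket, Finset.sum_comm, ← Finset.sum_neg_distrib]
  refine Finset.sum_congr rfl fun c _ => ?_
  rw [← Finset.sum_neg_distrib]
  exact Finset.sum_congr rfl fun d _ => by ring

theorem bracket_add (F G : ι → ι → ℂ) :
    bracket y₁ y₂ (fun c d => F c d + G c d) = bracket y₁ y₂ F + bracket y₁ y₂ G := by
  simp only [bracket, mul_add, Finset.sum_add_distrib]

theorem bracket_const_mul (k : ℂ) (F : ι → ι → ℂ) :
    bracket y₁ y₂ (fun c d => k * F c d) = k * bracket y₁ y₂ F := by
  simp only [bracket, Finset.mul_sum]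
  exact Finset.sum_congr rfl fun c _ => Finset.sum_congr rfl fun d _ => by ring

theorem bracket_congr {F G : ι → ι → ℂ} (h : ∀ c d, F c d = G c d) :
    bracket y₁ y₂ F = bracket y₁ y₂ G := by
  rw [show F = G from funext fun c => funext fun d => h c d]

/-- A weight that depends on one index only decouples the double sum into products of single sums.
-/
theorem bracket_left (f : ι → ℂ) : bracket y₁ y₂ (fun c _ => f c) =
    (∑ c, y₁ c * f c) * (∑ c, y₂ c) - (∑ c, y₂ c * f c) * ∑ c, y₁ c := by
  simp only [bracket, Finset.sum_mul_sum, ← Finset.sum_sub_distrib]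
  exact Finset.sum_congr rfl fun c _ => Finset.sum_congr rfl fun d _ => by ring

theorem bracket_const (k : ℂ) : bracket y₁ y₂ (fun _ _ => k) = 0 := by
  have := bracket_left y₁ y₂ fun _ => k
  rw [this, ← Finset.sum_mul, ← Finset.sum_mul]; ring

theorem bracket_right (f : ι → ℂ) : bracket y₁ y₂ (fun _ d => f d) =
    -((∑ c, y₁ c * f c) * (∑ c, y₂ c) - (∑ c, y₂ c * f c) * ∑ c, y₁ c) := by
  rw [← bracket_left, ← bracket_swap]

variable {y₁ y₂} (p : ι → ℂ) {η : ℂ}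

/-- Exchanging the summation indices changes the sign of the antisymmetric prefactor. The cotangent
is odd, so the net effect is that `η` becomes `-η` and the weight passes from `d` to `c`. -/
theorem bracket_mul_cot_neg (f : ι → ℂ) :
    bracket y₁ y₂ (fun c d => f d * cot (p c - p d + η)) =
      bracket y₁ y₂ (fun c d => f c * cot (p c - p d - η)) := by
  have h := bracket_swap y₁ y₂ fun c d => f d * cot (p c - p d + η)
  have h2 : bracket y₁ y₂ (fun c d => f c * cot (p d - p c + η)) =
      (-1) * bracket y₁ y₂ (fun c d => f c * cot (p c - p d - η)) := by
    rw [← bracket_const_mul]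
    refine bracket_congr _ _ fun c d => ?_
    rw [show p d - p c + η = -(p c - p d - η) by ring, cot_neg']; ring
  rw [h2] at h
  linear_combination (1 : ℂ) * h

theorem bracket_cot_neg :
    bracket y₁ y₂ (fun c d => cot (p c - p d - η)) =
      bracket y₁ y₂ (fun c d => cot (p c - p d + η)) := by
  have h := bracket_mul_cot_neg (y₁ := y₁) (y₂ := y₂) p (η := η) fun _ => 1
  simpa only [one_mul] using h.symm

/-- Antisymmetrization of a cotangent multiplied by an exponential weight `E`. -/
theorem bracket_weight_cot {E : ι → ℂ} {q κ : ℂ} (hq : q ≠ 0)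
    (hE : ∀ c d, (E c * q - E d * q⁻¹) * cot (p c - p d + η) = κ * (E c * q + E d * q⁻¹)) :
    bracket y₁ y₂ (fun c d => E d * cot (p c - p d + η)) =
      q ^ 2 * bracket y₁ y₂ (fun c d => E c * cot (p c - p d + η)) -
        κ * (q ^ 2 - 1) * bracket y₁ y₂ (fun c _ => E c) := by
  have h : bracket y₁ y₂ (fun c d => E d * cot (p c - p d + η)) =
      bracket y₁ y₂ (fun c d => q ^ 2 * (E c * cot (p c - p d + η)) +
        ((-(κ * q ^ 2)) * E c + (-κ) * E d)) := by
    refine bracket_congr _ _ fun c d => ?_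
    have := hE c d
    field_simp at this
    linear_combination (-1 : ℂ) * this
  rw [h, bracket_add, bracket_add, bracket_const_mul, bracket_const_mul, bracket_const_mul,
    bracket_left, bracket_right]
  ring

end Bracket

section FiniteSystem

variable {ι : Type*} [Fintype ι]

/-- The inhomogeneity of the equation for `G`. -/
noncomputable def source (w η ρ ξ z : ℂ) : ℂ := w⁻¹ * cot (z - ξ + η) - ρ * cot (z - ξ)

/-- The kernel of the equation for `G`. -/
noncomputable def cotKernel (w η u : ℂ) : ℂ := w * cot (u - η) - w⁻¹ * cot (u + η)

/-- The function `G` in terms of the residues `y` at the points `p`. -/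
noncomputable def residueG (w η ρ ξ : ℂ) (p y : ι → ℂ) (z : ℂ) : ℂ :=
  source w η ρ ξ z - ∑ c, cotKernel w η (z - p c) * y c

/-- The function `iΨ` in terms of the residues. -/
noncomputable def residuePsi (w η ρ ρ' m ξ ξ' : ℂ) (p y : ι → ℂ) : ℂ :=
  (∑ c, y c * (w * cot (p c - ξ + η) - ρ * cot (p c - ξ))) - m * residueG w η ρ' ξ' p y ξ

/-- The residues `y₁`, `y₂` at the points `p` of the solutions of the equations for `G` that belong
to the points `p i` and `p j`. -/
structure IsResiduePair (p : ι → ℂ) (w η : ℂ) (i j : ι) (ρ₁ ρ₂ m₁ m₂ : ℂ) (r y₁ y₂ : ι → ℂ) :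
    Prop where
  eq₁ : ∀ c, c ≠ i → c ≠ j → y₁ c = r c * residueG w η ρ₁ (p i) p y₁ (p c)
  eq₂ : ∀ c, c ≠ i → c ≠ j → y₂ c = r c * residueG w η ρ₂ (p j) p y₂ (p c)
  left₁ : y₁ i = -m₁
  right₁ : y₁ j = 0
  left₂ : y₂ i = 0
  right₂ : y₂ j = -m₂
  sum₁ : (w - w⁻¹) * ∑ c, y₁ c = w⁻¹ - ρ₁
  sum₂ : (w - w⁻¹) * ∑ c, y₂ c = w⁻¹ - ρ₂

variable [DecidableEq ι] {p : ι → ℂ} {w η : ℂ} {i j : ι} {ρ₁ ρ₂ m₁ m₂ : ℂ} {r y₁ y₂ : ι → ℂ}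
  (h : IsResiduePair p w η i j ρ₁ ρ₂ m₁ m₂ r y₁ y₂) (hij : i ≠ j)

namespace IsResiduePair

include h hij

/-- Each equation for the residues is multiplied by the other residue vector and the results are
subtracted. The terms containing values of `G` cancel at all points except `i` and `j`, where they
are precisely the pole contributions contained in `residuePsi`. A double sum over the kernel is
thereby exchanged for `Ψ` and single sums. -/
theorem bracket_kernel (f : ι → ℂ) :
    bracket y₁ y₂ (fun c d => f c * cotKernel w η (p c - p d)) +
      f i * residuePsi w η ρ₁ ρ₂ m₁ (p i) (p j) p y₂ -
      f j * residuePsi w η ρ₂ ρ₁ m₂ (p j) (p i) p y₁ =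
    (∑ c, y₁ c * (f c * source w η ρ₂ (p j) (p c) -
      f j * (w * cot (p c - p j + η) - ρ₂ * cot (p c - p j)))) -
    ∑ c, y₂ c * (f c * source w η ρ₁ (p i) (p c) -
      f i * (w * cot (p c - p i + η) - ρ₁ * cot (p c - p i))) := by
  have h1 : bracket y₁ y₂ (fun c d => f c * cotKernel w η (p c - p d)) =
      ∑ c, (y₁ c * (f c * source w η ρ₂ (p j) (p c)) - y₂ c * (f c * source w η ρ₁ (p i) (p c)) -
        f c * (y₁ c * residueG w η ρ₂ (p j) p y₂ (p c) -
          y₂ c * residueG w η ρ₁ (p i) p y₁ (p c))) := by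
    rw [bracket]
    refine Finset.sum_congr rfl fun c _ => ?_
    have : ∑ d, (y₁ c * y₂ d - y₂ c * y₁ d) * (f c * cotKernel w η (p c - p d)) =
        f c * (y₁ c * (∑ d, cotKernel w η (p c - p d) * y₂ d) -
          y₂ c * ∑ d, cotKernel w η (p c - p d) * y₁ d) := by
      rw [Finset.mul_sum, Finset.mul_sum, ← Finset.sum_sub_distrib, Finset.mul_sum]
      exact Finset.sum_congr rfl fun d _ => by ring
    rw [this, residueG, residueG]
    ring
  -- Away from `i` and `j` both residues are `r c` times the value of `G`, so the antisymmetric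
  -- combination vanishes; at `i` and `j` the prescribed values of the residues enter.
  have h2 : ∑ c, f c * (y₁ c * residueG w η ρ₂ (p j) p y₂ (p c) -
      y₂ c * residueG w η ρ₁ (p i) p y₁ (p c)) =
      -(f i * m₁ * residueG w η ρ₂ (p j) p y₂ (p i)) +
        f j * m₂ * residueG w η ρ₁ (p i) p y₁ (p j) := by
    rw [← Finset.add_sum_erase _ _ (Finset.mem_univ i),
      ← Finset.add_sum_erase (a := j) _ _ (Finset.mem_erase.2 ⟨hij.symm, Finset.mem_univ j⟩),
      Finset.sum_eq_zero, h.left₁, h.left₂, h.right₁, h.right₂]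
    · ring
    · intro c hc
      rw [Finset.mem_erase, Finset.mem_erase] at hc
      rw [h.eq₁ c hc.2.1 hc.1, h.eq₂ c hc.2.1 hc.1]
      ring
  rw [h1, Finset.sum_sub_distrib, h2, Finset.sum_sub_distrib]
  simp only [residuePsi, mul_sub, Finset.sum_sub_distrib, Finset.mul_sum]
  have e1 : ∑ x, f i * (y₂ x * (w * cot (p x - p i + η))) =
    ∑ x, y₂ x * (f i * (w * cot (p x - p i + η))) := Finset.sum_congr rfl fun _ _ => by ring
  have e2 : ∑ x, f i * (y₂ x * (ρ₁ * cot (p x - p i))) =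
    ∑ x, y₂ x * (f i * (ρ₁ * cot (p x - p i))) := Finset.sum_congr rfl fun _ _ => by ring
  have e3 : ∑ x, f j * (y₁ x * (w * cot (p x - p j + η))) =
    ∑ x, y₁ x * (f j * (w * cot (p x - p j + η))) := Finset.sum_congr rfl fun _ _ => by ring
  have e4 : ∑ x, f j * (y₁ x * (ρ₂ * cot (p x - p j))) =
    ∑ x, y₁ x * (f j * (ρ₂ * cot (p x - p j))) := Finset.sum_congr rfl fun _ _ => by ring
  rw [e1, e2, e3, e4]
  ring

/-- For a constant weight the shifts `η` and `-η` give the same bracket, so the kernel acts as `(w -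
w⁻¹)` times one cotangent. This factor becomes the denominator `q^{±α} - q^{∓α}`. -/
theorem bracket_cot :
    (w - w⁻¹) * bracket y₁ y₂ (fun c d => cot (p c - p d + η)) =
      -(residuePsi w η ρ₁ ρ₂ m₁ (p i) (p j) p y₂ - residuePsi w η ρ₂ ρ₁ m₂ (p j) (p i) p y₁) -
      (w - w⁻¹) * ((∑ c, y₁ c * cot (p c - p j + η)) - ∑ c, y₂ c * cot (p c - p i + η)) := by
  have hb := h.bracket_kernel hij fun _ => 1
  have e0 : bracket y₁ y₂ (fun c d => 1 * cotKernel w η (p c - p d)) =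
      (w - w⁻¹) * bracket y₁ y₂ (fun c d => cot (p c - p d + η)) := by
    rw [bracket_congr (G := fun c d => w * cot (p c - p d - η) + (-w⁻¹) * cot (p c - p d + η))
      _ _ fun c d => by rw [cotKernel]; ring]
    rw [bracket_add, bracket_const_mul, bracket_const_mul, bracket_cot_neg]
    ring
  have e1 : ∀ (y : ι → ℂ) (k : ι) (ρ : ℂ), ∑ c, y c * (1 * source w η ρ (p k) (p c) -
      1 * (w * cot (p c - p k + η) - ρ * cot (p c - p k))) =
      -(w - w⁻¹) * ∑ c, y c * cot (p c - p k + η) := by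
    intro y k ρ
    rw [Finset.mul_sum]
    exact Finset.sum_congr rfl fun c _ => by rw [source]; ring
  rw [e0, e1, e1] at hb
  linear_combination hb

/-- An exponential weight can be passed from one argument of the cotangent to the other, with a
factor `q²` and terms without cotangent. The kernel then contributes `w q² - w⁻¹`, which, for `q`
and for `q⁻¹` in its place, is up to a power of `q` and a sign one of the two remaining
denominators. -/
theorem bracket_weight {E : ι → ℂ} {q κ : ℂ} (hq : q ≠ 0)
    (hE : ∀ c d, (E c * q - E d * q⁻¹) * cot (p c - p d + η) = κ * (E c * q + E d * q⁻¹))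
    (hE₀ : ∀ c d, c ≠ d → (E c - E d) * cot (p c - p d) = κ * (E c + E d)) :
    (w * q ^ 2 - w⁻¹) * bracket y₁ y₂ (fun c d => E c * cot (p c - p d + η)) =
      -(E i * residuePsi w η ρ₁ ρ₂ m₁ (p i) (p j) p y₂) +
        E j * residuePsi w η ρ₂ ρ₁ m₂ (p j) (p i) p y₁ -
      (w - w⁻¹ * q⁻¹ ^ 2) * (E j * (∑ c, y₁ c * cot (p c - p j + η)) -
        E i * ∑ c, y₂ c * cot (p c - p i + η)) +
      κ * w⁻¹ * (q⁻¹ ^ 2 - 1) * (E j * (∑ c, y₁ c) - E i * ∑ c, y₂ c) +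
      κ * (w - w⁻¹) * (E j - E i) * ((∑ c, y₁ c) * ∑ c, y₂ c) +
      κ * (w * q ^ 2 - w⁻¹) * bracket y₁ y₂ (fun c _ => E c) := by
  have hb := h.bracket_kernel hij E
  have e0 : bracket y₁ y₂ (fun c d => E c * cotKernel w η (p c - p d)) =
      (w * q ^ 2 - w⁻¹) * bracket y₁ y₂ (fun c d => E c * cot (p c - p d + η)) -
        κ * w * (q ^ 2 - 1) * bracket y₁ y₂ (fun c _ => E c) := by
    rw [bracket_congr (G := fun c d => w * (E c * cot (p c - p d - η)) +
      (-w⁻¹) * (E c * cot (p c - p d + η))) _ _ fun c d => by rw [cotKernel]; ring]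
    rw [bracket_add, bracket_const_mul, bracket_const_mul, ← bracket_mul_cot_neg,
      bracket_weight_cot p hq hE]
    ring
  -- The rule `hE₀` for the unshifted cotangent is not available at `c = k`; the condition `y k = 0`
  -- disposes of this term.
  have e1 : ∀ (y : ι → ℂ) (k : ι) (ρ : ℂ), y k = 0 →
      ∑ c, y c * (E c * source w η ρ (p k) (p c) -
        E k * (w * cot (p c - p k + η) - ρ * cot (p c - p k))) =
      -(w - w⁻¹ * q⁻¹ ^ 2) * E k * (∑ c, y c * cot (p c - p k + η)) +
      κ * (w⁻¹ - ρ) * (∑ c, y c * E c) + κ * (w⁻¹ * q⁻¹ ^ 2 - ρ) * E k * ∑ c, y c := by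
    intro y k ρ hk
    rw [Finset.mul_sum, Finset.mul_sum, Finset.mul_sum, ← Finset.sum_add_distrib,
      ← Finset.sum_add_distrib]
    refine Finset.sum_congr rfl fun c _ => ?_
    rcases eq_or_ne c k with rfl | hc
    · rw [hk]; ring
    · have a1 : E c * cot (p c - p k + η) =
          q⁻¹ ^ 2 * E k * cot (p c - p k + η) + κ * (E c + q⁻¹ ^ 2 * E k) := by
        have := hE c k
        field_simp at this ⊢
        linear_combination this
      rw [source]
      linear_combination (y c * w⁻¹) * a1 - (y c * ρ) * hE₀ c k hc
  rw [e0, e1 y₁ j ρ₂ h.right₁, e1 y₂ i ρ₁ h.left₂] at hb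
  rw [bracket_left] at hb ⊢
  -- The sums of `y c * E c` are not expressible through `Φ` and `Ψ`. They combine, by the two sum
  -- rules, into the bracket of `E` alone.
  linear_combination hb - (κ * (∑ c, y₁ c * E c) + κ * E j * ∑ c, y₁ c) * h.sum₂ +
    (κ * (∑ c, y₂ c * E c) + κ * E i * ∑ c, y₂ c) * h.sum₁

end IsResiduePair

end FiniteSystem

end XXZ

/-! ### Algebra of the factorized two-site matrix -/

namespace XXZ

open Complex

theorem factorizedMatrix_eq_ofArray {q ζ dp d0 dm Φ₁ Φ₂ Ψ₁₂ Ψ₂₁ a b c e : ℂ}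
    (ha : a = 1 / (2 * (ζ - ζ⁻¹)) * ((-(ζ * Ψ₁₂ - ζ⁻¹ * Ψ₂₁) +
      d0 * (ζ⁻¹ * (Φ₁ * (Φ₂ + 1)) - ζ * (Φ₂ * (Φ₁ + 1)))) / dp))
    (hb : b = 1 / (2 * (ζ - ζ⁻¹)) * ((ζ⁻¹ * Ψ₁₂ - ζ * Ψ₂₁ +
      d0 * (ζ * (Φ₁ * (Φ₂ + 1)) - ζ⁻¹ * (Φ₂ * (Φ₁ + 1)))) / dm))
    (hc : c = 1 / (2 * (ζ - ζ⁻¹)) * ((Ψ₁₂ - Ψ₂₁) / d0))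
    (he : e = 1 / (2 * (ζ - ζ⁻¹)) * (Φ₁ - Φ₂)) :
    factorizedMatrix q ζ dp d0 dm Φ₁ Φ₂ Ψ₁₂ Ψ₂₁ =
    ofArray !![-(a * q) - b * q⁻¹ - c * (ζ + ζ⁻¹) + e * (ζ - ζ⁻¹) - Φ₁, 0, 0, 0;
      0, a * q + b * q⁻¹ + c * (ζ + ζ⁻¹) - e * (ζ - ζ⁻¹),
        a * ζ⁻¹ + b * ζ + c * (q + q⁻¹) + e * (q - q⁻¹), 0;
      0, a * ζ + b * ζ⁻¹ + c * (q + q⁻¹) - e * (q - q⁻¹),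
        a * q⁻¹ + b * q + c * (ζ + ζ⁻¹) + e * (ζ - ζ⁻¹), 0;
      0, 0, 0, -(a * q⁻¹) - b * q - c * (ζ + ζ⁻¹) - e * (ζ - ζ⁻¹) + 1 + Φ₁] := by
  refine Matrix.ext ?_
  rintro ⟨i, j⟩ ⟨i', j'⟩
  subst ha hb hc he
  fin_cases i <;> fin_cases j <;> fin_cases i' <;> fin_cases j' <;>
    simp [factorizedMatrix, blockMatrix, ofArray, finProdFinEquiv, div_eq_mul_inv] <;> ring

section Entries

variable {q w u v : ℂ}

/-- The quantities from which the entries of the two-site matrix are built. Here `x`, `hp`, `hm`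
are the antisymmetrized double sums with the weights `1`, `E`, `E⁻¹`. -/
structure IsEntryData (q w u v Φ₁ Φ₂ Ψ₁₂ Ψ₂₁ z₁₂ z₂₁ x hp hm aa cb cb' : ℂ) : Prop where
  hx : (w ^ 2 - 1) * x = -(w * (Ψ₁₂ - Ψ₂₁)) - (w ^ 2 - 1) * (z₁₂ - z₂₁)
  hhp : (w ^ 2 * q ^ 2 - 1) * q ^ 2 * hp = w * q ^ 2 * (-(u ^ 2 * Ψ₁₂) + v ^ 2 * Ψ₂₁) -
    (w ^ 2 * q ^ 2 - 1) * (v ^ 2 * z₁₂ - u ^ 2 * z₂₁) +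
    (1 - q ^ 2) * (v ^ 2 * Φ₁ - u ^ 2 * Φ₂) +
    q ^ 2 * (w ^ 2 - 1) * (v ^ 2 - u ^ 2) * (Φ₁ * Φ₂)
  hhm : (w ^ 2 - q ^ 2) * (u ^ 2 * v ^ 2) * hm =
    w * q ^ 2 * (-(v ^ 2 * Ψ₁₂) + u ^ 2 * Ψ₂₁) -
    q ^ 2 * (w ^ 2 - q ^ 2) * (u ^ 2 * z₁₂ - v ^ 2 * z₂₁) -
    q ^ 2 * (q ^ 2 - 1) * (u ^ 2 * Φ₁ - v ^ 2 * Φ₂) -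
    q ^ 2 * (w ^ 2 - 1) * (u ^ 2 - v ^ 2) * (Φ₁ * Φ₂)
  haa : (u / v - v / u) * aa = 1 / 2 * ((u / v + v / u) * x - q ^ 2 / (u * v) * hp -
    u * v / q ^ 2 * hm)
  hcb : (u / v - v / u) * cb = -(1 / 2) * ((q + q⁻¹) * x - q / v ^ 2 * hp - v ^ 2 / q * hm) -
    1 / 2 * (u / (v * q) - v * q / u) * ((u / v + v / u) * Φ₂ + (u / v - v / u) * z₂₁) -
    (q - q⁻¹) * Φ₁
  hcb' : (v / u - u / v) * cb' = 1 / 2 * ((q + q⁻¹) * x - q / u ^ 2 * hp - u ^ 2 / q * hm) -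
    1 / 2 * (v / (u * q) - u * q / v) * ((u / v + v / u) * Φ₁ + (v / u - u / v) * z₁₂) -
    (q - q⁻¹) * Φ₂

variable (hq : q ≠ 0) (hw : w ≠ 0) (hu : u ≠ 0) (hv : v ≠ 0) (huv : u ^ 2 - v ^ 2 ≠ 0)
  (h0 : w ^ 2 - 1 ≠ 0) (hp0 : w ^ 2 * q ^ 2 - 1 ≠ 0) (hm0 : w ^ 2 - q ^ 2 ≠ 0)
  {Φ₁ Φ₂ Ψ₁₂ Ψ₂₁ z₁₂ z₂₁ x hp hm aa cb cb' : ℂ}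
  (h : IsEntryData q w u v Φ₁ Φ₂ Ψ₁₂ Ψ₂₁ z₁₂ z₂₁ x hp hm aa cb cb')

include hq hu hv huv h0 hp0 hm0 h

/-- The relations are triangular: the first three determine the double sums, the last three the
entries. The only divisions are by the three denominators of the formula and by `u ² - v ²`, apart
from powers of units. -/
theorem IsEntryData.solve :
    x = (-(w * (Ψ₁₂ - Ψ₂₁)) - (w ^ 2 - 1) * (z₁₂ - z₂₁)) / (w ^ 2 - 1) ∧
    hp = (w * q ^ 2 * (-(u ^ 2 * Ψ₁₂) + v ^ 2 * Ψ₂₁) -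
      (w ^ 2 * q ^ 2 - 1) * (v ^ 2 * z₁₂ - u ^ 2 * z₂₁) + (1 - q ^ 2) * (v ^ 2 * Φ₁ - u ^ 2 * Φ₂) +
      q ^ 2 * (w ^ 2 - 1) * (v ^ 2 - u ^ 2) * (Φ₁ * Φ₂)) / ((w ^ 2 * q ^ 2 - 1) * q ^ 2) ∧
    hm = (w * q ^ 2 * (-(v ^ 2 * Ψ₁₂) + u ^ 2 * Ψ₂₁) -
      q ^ 2 * (w ^ 2 - q ^ 2) * (u ^ 2 * z₁₂ - v ^ 2 * z₂₁) -
      q ^ 2 * (q ^ 2 - 1) * (u ^ 2 * Φ₁ - v ^ 2 * Φ₂) -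
      q ^ 2 * (w ^ 2 - 1) * (u ^ 2 - v ^ 2) * (Φ₁ * Φ₂)) /
        ((w ^ 2 - q ^ 2) * (u ^ 2 * v ^ 2)) ∧
    aa = (1 / 2 * ((u / v + v / u) * x - q ^ 2 / (u * v) * hp - u * v / q ^ 2 * hm)) /
      ((u ^ 2 - v ^ 2) / (u * v)) ∧
    cb = (-(1 / 2) * ((q + q⁻¹) * x - q / v ^ 2 * hp - v ^ 2 / q * hm) -
      1 / 2 * (u / (v * q) - v * q / u) * ((u / v + v / u) * Φ₂ + (u / v - v / u) * z₂₁) -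
      (q - q⁻¹) * Φ₁) / ((u ^ 2 - v ^ 2) / (u * v)) ∧
    cb' = -(1 / 2 * ((q + q⁻¹) * x - q / u ^ 2 * hp - u ^ 2 / q * hm) -
      1 / 2 * (v / (u * q) - u * q / v) * ((u / v + v / u) * Φ₁ + (v / u - u / v) * z₁₂) -
      (q - q⁻¹) * Φ₂) / ((u ^ 2 - v ^ 2) / (u * v)) := by
  have e1 : u / v - v / u = (u ^ 2 - v ^ 2) / (u * v) := by field_simp
  have hz : (u ^ 2 - v ^ 2) / (u * v) ≠ 0 := div_ne_zero huv (mul_ne_zero hu hv)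
  refine ⟨?_, ?_, ?_, ?_, ?_, ?_⟩
  · rw [eq_div_iff h0, ← h.hx]; ring
  · exact eq_div_of_mul_eq (mul_ne_zero hp0 (pow_ne_zero 2 hq)) ((mul_comm _ _).trans h.hhp)
  · exact eq_div_of_mul_eq (mul_ne_zero hm0 (mul_ne_zero (pow_ne_zero 2 hu)
      (pow_ne_zero 2 hv))) ((mul_comm _ _).trans h.hhm)
  · rw [eq_div_iff hz, ← h.haa, e1]; ring
  · rw [eq_div_iff hz, ← h.hcb, e1]; ring
  · rw [eq_div_iff hz, ← h.hcb', ← e1]; ring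

include hw

/-- The factorized two-site matrix in terms of the double sums. -/
theorem IsEntryData.factorizedMatrix_eq :
    factorizedMatrix q (u / v) (w * q - w⁻¹ * q⁻¹) (w - w⁻¹) (q * w⁻¹ - q⁻¹ * w)
      Φ₁ Φ₂ Ψ₁₂ Ψ₂₁ =
    ofArray !![aa, 0, 0, 0;
               0, -Φ₁ - aa, cb' - (q - q⁻¹) / (u / v - v / u) * (Φ₂ - Φ₁), 0;
               0, cb, -(w ^ 2 * aa) - (1 - (w ^ 2 - 1) * Φ₁) * Φ₂, 0;
               0, 0, 0, 1 + Φ₁ + (w ^ 2 * aa) + (1 - (w ^ 2 - 1) * Φ₁) * Φ₂] := by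
  obtain ⟨e2, e3, e4, e5, e6, e7⟩ := h.solve hq hu hv huv h0 hp0 hm0
  have d0 : (u / v)⁻¹ = v / u := inv_div u v
  have d1 : u / v - v / u = (u ^ 2 - v ^ 2) / (u * v) := by field_simp
  have d2 : w * q - w⁻¹ * q⁻¹ = (w ^ 2 * q ^ 2 - 1) / (w * q) := by field_simp
  have d3 : w - w⁻¹ = (w ^ 2 - 1) / w := by field_simp
  have d4 : q * w⁻¹ - q⁻¹ * w = (w ^ 2 - q ^ 2) / (-(w * q)) := by field_simp; ring
  obtain ⟨a, ha⟩ : ∃ a, a = 1 / (2 * (u / v - (u / v)⁻¹)) * ((-(u / v * Ψ₁₂ - (u / v)⁻¹ * Ψ₂₁) +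
      (w - w⁻¹) * ((u / v)⁻¹ * (Φ₁ * (Φ₂ + 1)) - u / v * (Φ₂ * (Φ₁ + 1)))) /
        (w * q - w⁻¹ * q⁻¹)) := ⟨_, rfl⟩
  obtain ⟨b, hb⟩ : ∃ b, b = 1 / (2 * (u / v - (u / v)⁻¹)) * (((u / v)⁻¹ * Ψ₁₂ - u / v * Ψ₂₁ +
      (w - w⁻¹) * (u / v * (Φ₁ * (Φ₂ + 1)) - (u / v)⁻¹ * (Φ₂ * (Φ₁ + 1)))) /
        (q * w⁻¹ - q⁻¹ * w)) := ⟨_, rfl⟩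
  obtain ⟨c, hc⟩ : ∃ c, c = 1 / (2 * (u / v - (u / v)⁻¹)) * ((Ψ₁₂ - Ψ₂₁) / (w - w⁻¹)) := ⟨_, rfl⟩
  obtain ⟨e, he⟩ : ∃ e, e = 1 / (2 * (u / v - (u / v)⁻¹)) * (Φ₁ - Φ₂) := ⟨_, rfl⟩
  rw [factorizedMatrix_eq_ofArray ha hb hc he]
  rw [d0, d1, d2, d3] at ha
  rw [d0, d1, d3, d4] at hb
  rw [d0, d1, d3] at hc
  rw [d0, d1] at he
  rw [d0]
  -- The single sums `z₁₂` and `z₂₁` cancel in this and the following three identities, as they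
  -- must, since the factorized matrix contains only `Φ` and `Ψ`.
  have haa : -(a * q) - b * q⁻¹ - c * (u / v + v / u) + e * (u / v - v / u) - Φ₁ = aa := by
    rw [ha, hb, hc, he, d1, e5, e2, e3, e4]
    field_simp
    ring
  have hdd : a * q⁻¹ + b * q + c * (u / v + v / u) + e * (u / v - v / u) =
      -(w ^ 2 * aa) - (1 - (w ^ 2 - 1) * Φ₁) * Φ₂ := by
    rw [ha, hb, hc, he, d1, e5, e2, e3, e4]
    field_simp
    ring
  have hbc : a * (v / u) + b * (u / v) + c * (q + q⁻¹) + e * (q - q⁻¹) =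
      cb' - (q - q⁻¹) / (u / v - v / u) * (Φ₂ - Φ₁) := by
    rw [ha, hb, hc, he, d1, e7, e2, e3, e4]
    field_simp
    ring
  have hcb : a * (u / v) + b * (v / u) + c * (q + q⁻¹) - e * (q - q⁻¹) = cb := by
    rw [ha, hb, hc, he, e6, e2, e3, e4]
    field_simp
    ring
  have haa' : a * q + b * q⁻¹ + c * (u / v + v / u) - e * (u / v - v / u) = -Φ₁ - aa := by
    linear_combination (-1 : ℂ) * haa
  have hdd' : -(a * q⁻¹) - b * q - c * (u / v + v / u) - e * (u / v - v / u) + 1 + Φ₁ =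
      1 + Φ₁ + w ^ 2 * aa + (1 - (w ^ 2 - 1) * Φ₁) * Φ₂ := by
    linear_combination (-1 : ℂ) * hdd
  rw [haa, haa', hdd, hdd', hbc, hcb]

end Entries

section DoubleSums

variable {ι : Type*} [Fintype ι] {y₁ y₂ : ι → ℂ} {p : ι → ℂ} {η : ℂ}

/-- A double sum with exponential weights. -/
theorem bracket_expand (hη : ∀ c d, sin (p c - p d + η) ≠ 0) (k k₀ a b : ℂ) :
    bracket y₁ y₂ (fun c d => k₀ +
      (a * exp (2 * I * p d) - b * (exp (2 * I * p d))⁻¹) / (4 * I) +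
      (k - a * exp (2 * I * p d) - b * (exp (2 * I * p d))⁻¹) / 4 * cot (p c - p d + η)) =
    1 / 4 * (k * bracket y₁ y₂ (fun c d => cot (p c - p d + η)) -
      a * exp (I * η) ^ 2 * (bracket y₁ y₂ (fun c d => exp (2 * I * p c) * cot (p c - p d + η)) -
        I * bracket y₁ y₂ (fun c _ => exp (2 * I * p c))) -
      b * (exp (I * η))⁻¹ ^ 2 *
        (bracket y₁ y₂ (fun c d => (exp (2 * I * p c))⁻¹ * cot (p c - p d + η)) +
        I * bracket y₁ y₂ (fun c _ => (exp (2 * I * p c))⁻¹))) := by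
  have hp := bracket_weight_cot (y₁ := y₁) (y₂ := y₂) p (E := fun c => exp (2 * I * p c))
    (κ := I) (exp_ne_zero (I * η)) fun c d => exp_mul_cot_add (hη c d)
  have hm := bracket_weight_cot (y₁ := y₁) (y₂ := y₂) p (E := fun c => (exp (2 * I * p c))⁻¹)
    (κ := -I) (inv_ne_zero (exp_ne_zero (I * η))) fun c d => by
      rw [inv_inv]; exact exp_neg_mul_cot_add (hη c d)
  rw [bracket_congr (G := fun c d => k₀ + (a / (4 * I) * exp (2 * I * p d) +
    (-b / (4 * I)) * (exp (2 * I * p d))⁻¹ + ((k / 4) * cot (p c - p d + η) +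
    ((-a / 4) * (exp (2 * I * p d) * cot (p c - p d + η)) +
    (-b / 4) * ((exp (2 * I * p d))⁻¹ * cot (p c - p d + η)))))) _ _ fun c d => by ring]
  simp only [bracket_add, bracket_const_mul, bracket_const, bracket_right]
  rw [hp, hm]
  simp only [bracket_left]
  have hI : (4 * I)⁻¹ = -I / 4 := by
    rw [mul_inv, Complex.inv_I]; ring
  simp only [div_eq_mul_inv, hI]
  ring

theorem sin_eq_exp (u : ℂ) : sin u = (exp (I * u) - (exp (I * u))⁻¹) / (2 * I) := by
  rw [← Complex.exp_neg, mul_comm I u, ← neg_mul, exp_mul_I, exp_mul_I, Complex.cos_neg,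
    Complex.sin_neg]
  field_simp
  ring

theorem cos_eq_exp (u : ℂ) : cos u = (exp (I * u) + (exp (I * u))⁻¹) / 2 := by
  rw [← Complex.exp_neg, mul_comm I u, ← neg_mul, exp_mul_I, exp_mul_I, Complex.cos_neg,
    Complex.sin_neg]
  ring

theorem exp_two_mul_I (u : ℂ) : exp (2 * I * u) = exp (I * u) ^ 2 := by
  rw [← Complex.exp_nat_mul]; congr 1; push_cast; ring

end DoubleSums

end XXZ

/-! ### Matrix entries as antisymmetrized double sums -/

namespace XXZ

open Complex

section Entries

theorem sin_sub_eq_exp (a b : ℂ) :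
    sin (a - b) = -I / 2 * (exp (I * a) * (exp (I * b))⁻¹ - exp (I * b) * (exp (I * a))⁻¹) := by
  rw [sin_eq_exp, mul_sub, Complex.exp_sub, inv_div, div_eq_mul_inv (_ - _), mul_inv, inv_I]
  ring

theorem cos_sub_eq_exp (a b : ℂ) :
    cos (a - b) = 1 / 2 * (exp (I * a) * (exp (I * b))⁻¹ + exp (I * b) * (exp (I * a))⁻¹) := by
  rw [cos_eq_exp, mul_sub, Complex.exp_sub, inv_div]
  ring

/-- The addition theorem isolates the dependence on `a` in a cotangent. This is how quotients of
sines in the double sums are reduced to the brackets that are already known. -/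
theorem sin_ratio {a b c η : ℂ} (h : sin (a - b + η) ≠ 0) :
    sin (a - c + η) / sin (a - b + η) = cos (b - c) + cot (a - b + η) * sin (b - c) := by
  rw [cot_eq_cos_div_sin, show a - c + η = (a - b + η) + (b - c) by ring, sin_add]
  field_simp

variable {ι : Type*} [Fintype ι] [DecidableEq ι]

/-- The sum that represents the entry `++, ++`. -/
noncomputable def entrySumA (p : ι → ℂ) (η : ℂ) (i j : ι) (y₁ y₂ : ι → ℂ) : ℂ :=
  (sin (p i - p j))⁻¹ * ∑ c, ∑ d, (y₂ c * y₁ d - y₁ c * y₂ d) *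
    (sin (p d - p i) * sin (p c - p j + η) / sin (p c - p d + η))

/-- The sum that represents the entry `-+, +-`. -/
noncomputable def entrySumC (p : ι → ℂ) (η : ℂ) (i j : ι) (y₁ y₂ : ι → ℂ) : ℂ :=
  -((sin (p i - p j))⁻¹ * ∑ c, ∑ d,
    (y₂ c * (y₁ d + if d = i then 1 else 0) - y₁ c * (y₂ d + if d = j then 1 else 0)) *
    (sin (p c - p j + η) * sin (p d - p j - η) / sin (p c - p d + η)))

variable {p : ι → ℂ} {w η : ℂ} {i j : ι} {ρ₁ ρ₂ m₁ m₂ : ℂ} {r y₁ y₂ : ι → ℂ}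

-- After `sin_ratio` the summand is a constant or a combination of `e^{2ip_d}` and `e^{-2ip_d}`,
-- multiplied by 1 or by `cot(p c - p d + η)`. Hence the brackets with the weights `1`, `E`, `E⁻¹`
-- suffice.
omit [DecidableEq ι] in
theorem doubleSumA_eq (hη : ∀ c d, sin (p c - p d + η) ≠ 0) {q u v : ℂ} (hq : q = exp (I * η))
    (hu : u = exp (I * p i)) (hv : v = exp (I * p j)) :
    (∑ c, ∑ d, (y₂ c * y₁ d - y₁ c * y₂ d) *
      (sin (p d - p i) * sin (p c - p j + η) / sin (p c - p d + η))) =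
    -(1 / 4 *
      ((u / v + v / u) * bracket y₁ y₂ (fun c d => cot (p c - p d + η)) -
      1 / (u * v) * q ^ 2 * (bracket y₁ y₂ (fun c d => exp (2 * I * p c) * cot (p c - p d + η)) -
        I * bracket y₁ y₂ (fun c _ => exp (2 * I * p c))) -
      u * v * q⁻¹ ^ 2 *
        (bracket y₁ y₂ (fun c d => (exp (2 * I * p c))⁻¹ * cot (p c - p d + η)) +
        I * bracket y₁ y₂ (fun c _ => (exp (2 * I * p c))⁻¹)))) := by
  rw [hq, ← bracket_expand hη (u / v + v / u) ((v / u - u / v) / (4 * I)) (1 / (u * v)) (u * v)]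
  rw [bracket, ← Finset.sum_neg_distrib]
  refine Finset.sum_congr rfl fun c _ => ?_
  rw [← Finset.sum_neg_distrib]
  refine Finset.sum_congr rfl fun d _ => ?_
  have h1 : sin (p d - p i) * sin (p c - p j + η) / sin (p c - p d + η) =
      sin (p d - p i) * cos (p d - p j) +
        sin (p d - p i) * sin (p d - p j) * cot (p c - p d + η) := by
    rw [mul_div_assoc, sin_ratio (hη c d)]; ring
  have h2 : sin (p d - p i) * cos (p d - p j) = (v / u - u / v) / (4 * I) +
      (1 / (u * v) * exp (2 * I * p d) - u * v * (exp (2 * I * p d))⁻¹) / (4 * I) := by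
    rw [sin_sub_eq_exp, cos_sub_eq_exp, exp_two_mul_I, div_eq_mul_inv _ (4 * I),
      div_eq_mul_inv _ (4 * I), mul_inv, inv_I]
    have e1 := exp_ne_zero (I * p d)
    have e2 := exp_ne_zero (I * p i)
    have e3 := exp_ne_zero (I * p j)
    rw [hu, hv]
    field_simp
    ring
  have h3 : sin (p d - p i) * sin (p d - p j) =
      (u / v + v / u - 1 / (u * v) * exp (2 * I * p d) - u * v * (exp (2 * I * p d))⁻¹) / 4 := by
    rw [sin_sub_eq_exp, sin_sub_eq_exp, exp_two_mul_I]
    have e1 := exp_ne_zero (I * p d)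
    have e2 := exp_ne_zero (I * p i)
    have e3 := exp_ne_zero (I * p j)
    rw [hu, hv]
    field_simp
    rw [I_sq]
    ring
  rw [h1, h2, h3]
  ring

omit [DecidableEq ι] in
theorem doubleSumC_eq (hη : ∀ c d, sin (p c - p d + η) ≠ 0) {q v : ℂ} (hq : q = exp (I * η))
    (hv : v = exp (I * p j)) :
    (∑ c, ∑ d, (y₂ c * y₁ d - y₁ c * y₂ d) *
      (sin (p c - p j + η) * sin (p d - p j - η) / sin (p c - p d + η))) =
    -(1 / 4 *
      ((q + q⁻¹) * bracket y₁ y₂ (fun c d => cot (p c - p d + η)) -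
      1 / (v ^ 2 * q) * q ^ 2 *
        (bracket y₁ y₂ (fun c d => exp (2 * I * p c) * cot (p c - p d + η)) -
        I * bracket y₁ y₂ (fun c _ => exp (2 * I * p c))) -
      v ^ 2 * q * q⁻¹ ^ 2 *
        (bracket y₁ y₂ (fun c d => (exp (2 * I * p c))⁻¹ * cot (p c - p d + η)) +
        I * bracket y₁ y₂ (fun c _ => (exp (2 * I * p c))⁻¹)))) := by
  have hq0 := exp_ne_zero (I * η)
  rw [← hq] at hq0
  have h := bracket_expand (y₁ := y₁) (y₂ := y₂) hη (q + q⁻¹) ((q⁻¹ - q) / (4 * I))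
    (1 / (v ^ 2 * q)) (v ^ 2 * q)
  rw [← hq] at h
  rw [← h]
  rw [bracket, ← Finset.sum_neg_distrib]
  refine Finset.sum_congr rfl fun c _ => ?_
  rw [← Finset.sum_neg_distrib]
  refine Finset.sum_congr rfl fun d _ => ?_
  have h1 : sin (p c - p j + η) * sin (p d - p j - η) / sin (p c - p d + η) =
      sin (p d - p j - η) * cos (p d - p j) +
        sin (p d - p j - η) * sin (p d - p j) * cot (p c - p d + η) := by
    rw [mul_comm, mul_div_assoc, sin_ratio (hη c d)]; ring
  have e1 := exp_ne_zero (I * p d)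
  have e3 := exp_ne_zero (I * p j)
  have e4 : exp (I * (p j + η)) = v * q := by rw [mul_add, Complex.exp_add, hq, hv]
  rw [← hv] at e3
  have h2 : sin (p d - p j - η) * cos (p d - p j) = (q⁻¹ - q) / (4 * I) +
      (1 / (v ^ 2 * q) * exp (2 * I * p d) - v ^ 2 * q * (exp (2 * I * p d))⁻¹) / (4 * I) := by
    rw [sub_sub, sin_sub_eq_exp, cos_sub_eq_exp, exp_two_mul_I, div_eq_mul_inv _ (4 * I),
      div_eq_mul_inv _ (4 * I), mul_inv, inv_I, e4, ← hv]
    field_simp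
    ring
  have h3 : sin (p d - p j - η) * sin (p d - p j) =
      (q + q⁻¹ - 1 / (v ^ 2 * q) * exp (2 * I * p d) -
        v ^ 2 * q * (exp (2 * I * p d))⁻¹) / 4 := by
    rw [sub_sub, sin_sub_eq_exp, sin_sub_eq_exp, exp_two_mul_I, e4, ← hv]
    field_simp
    rw [I_sq]
    ring
  rw [h1, h2, h3]
  ring

omit [DecidableEq ι] in
theorem bracket_comm (F : ι → ι → ℂ) : bracket y₂ y₁ F = -bracket y₁ y₂ F := by
  simp only [bracket, ← Finset.sum_neg_distrib]
  exact Finset.sum_congr rfl fun c _ => Finset.sum_congr rfl fun d _ => by ring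

theorem entrySumC_eq (p : ι → ℂ) (η : ℂ) (i j : ι) (y₁ y₂ : ι → ℂ) :
    entrySumC p η i j y₁ y₂ = -((sin (p i - p j))⁻¹ *
    ((∑ c, ∑ d, (y₂ c * y₁ d - y₁ c * y₂ d) *
      (sin (p c - p j + η) * sin (p d - p j - η) / sin (p c - p d + η))) +
    (∑ c, ∑ d, (y₂ c * (if d = i then 1 else 0) - y₁ c * if d = j then 1 else 0) *
      (sin (p c - p j + η) * sin (p d - p j - η) / sin (p c - p d + η))))) := by
  rw [entrySumC, ← Finset.sum_add_distrib]
  congr 2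
  refine Finset.sum_congr rfl fun c _ => ?_
  rw [← Finset.sum_add_distrib]
  exact Finset.sum_congr rfl fun d _ => by ring

/-- The contribution of the two Kronecker symbols in `entrySumC`. It is a single sum and brings in
`Φ` and the auxiliary cotangent sum. -/
theorem singleSumC_eq (hη : ∀ c d, sin (p c - p d + η) ≠ 0) :
    (∑ c, ∑ d, (y₂ c * (if d = i then 1 else 0) - y₁ c * if d = j then 1 else 0) *
      (sin (p c - p j + η) * sin (p d - p j - η) / sin (p c - p d + η))) =
    sin (p i - p j - η) * (cos (p i - p j) * (∑ c, y₂ c) +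
      sin (p i - p j) * ∑ c, y₂ c * cot (p c - p i + η)) + sin η * ∑ c, y₁ c := by
  simp only [Finset.mul_sum, ← Finset.sum_add_distrib]
  refine Finset.sum_congr rfl fun c _ => ?_
  simp only [sub_mul, Finset.sum_sub_distrib, mul_ite, mul_one, mul_zero, ite_mul, zero_mul,
    Finset.sum_ite_eq', Finset.mem_univ, if_true]
  have h1 := sin_ratio (c := p j) (hη c i)
  have h2 := hη c j
  rw [mul_comm (sin _) (sin (p i - _ - _)), mul_div_assoc, h1, sub_self, zero_sub, Complex.sin_neg]
  field_simp
  ring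

/-- The double sums of a residue pair satisfy the relations that determine the two-site matrix. -/
theorem IsResiduePair.isEntryData (h : IsResiduePair p w η i j ρ₁ ρ₂ m₁ m₂ r y₁ y₂) (hij : i ≠ j)
    (hw : w ≠ 0) (hs : ∀ c d, c ≠ d → sin (p c - p d) ≠ 0)
    (hη : ∀ c d, sin (p c - p d + η) ≠ 0) {q u v : ℂ} (hq : q = exp (I * η))
    (hu : u = exp (I * p i)) (hv : v = exp (I * p j)) :
    IsEntryData q w u v (∑ c, y₁ c) (∑ c, y₂ c)
      (-I * residuePsi w η ρ₁ ρ₂ m₁ (p i) (p j) p y₂)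
      (-I * residuePsi w η ρ₂ ρ₁ m₂ (p j) (p i) p y₁)
      (-I * ∑ c, y₁ c * cot (p c - p j + η)) (-I * ∑ c, y₂ c * cot (p c - p i + η))
      (-I * bracket y₁ y₂ (fun c d => cot (p c - p d + η)))
      (-I * (bracket y₁ y₂ (fun c d => exp (2 * I * p c) * cot (p c - p d + η)) -
        I * bracket y₁ y₂ (fun c _ => exp (2 * I * p c))))
      (-I * (bracket y₁ y₂ (fun c d => (exp (2 * I * p c))⁻¹ * cot (p c - p d + η)) +
        I * bracket y₁ y₂ (fun c _ => (exp (2 * I * p c))⁻¹)))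
      (entrySumA p η i j y₁ y₂) (entrySumC p η i j y₁ y₂) (entrySumC p η j i y₂ y₁) := by
  have hq0 := exp_ne_zero (I * η)
  have hu0 := exp_ne_zero (I * p i)
  have hv0 := exp_ne_zero (I * p j)
  rw [← hq] at hq0
  rw [← hu] at hu0
  rw [← hv] at hv0
  have hE : ∀ c d, (exp (2 * I * p c) * q - exp (2 * I * p d) * q⁻¹) * cot (p c - p d + η) =
      I * (exp (2 * I * p c) * q + exp (2 * I * p d) * q⁻¹) := by
    intro c d; rw [hq]; exact exp_mul_cot_add (hη c d)
  have hE' : ∀ c d, ((exp (2 * I * p c))⁻¹ * q⁻¹ - (exp (2 * I * p d))⁻¹ * q⁻¹⁻¹) *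
      cot (p c - p d + η) = -I * ((exp (2 * I * p c))⁻¹ * q⁻¹ + (exp (2 * I * p d))⁻¹ * q⁻¹⁻¹) := by
    intro c d; rw [hq, inv_inv]; exact exp_neg_mul_cot_add (hη c d)
  have hE₀ : ∀ c d, c ≠ d → (exp (2 * I * p c) - exp (2 * I * p d)) * cot (p c - p d) =
      I * (exp (2 * I * p c) + exp (2 * I * p d)) := by
    intro c d hcd
    have := exp_mul_cot_add (x := p c) (y := p d) (η := 0) (by rw [add_zero]; exact hs c d hcd)
    simpa using this
  have hE₀' : ∀ c d, c ≠ d → ((exp (2 * I * p c))⁻¹ - (exp (2 * I * p d))⁻¹) * cot (p c - p d) =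
      -I * ((exp (2 * I * p c))⁻¹ + (exp (2 * I * p d))⁻¹) := by
    intro c d hcd
    have := exp_neg_mul_cot_add (x := p c) (y := p d) (η := 0)
      (by rw [add_zero]; exact hs c d hcd)
    simpa using this
  -- The three brackets, with the weights `1`, `e^{2ip}` and `e^{-2ip}`. The last case is the second
  -- one with `q` replaced by `q⁻¹` and `κ = I` by `-I`.
  have hX := h.bracket_cot hij
  have hP := h.bracket_weight hij hq0 hE hE₀
  have hM := h.bracket_weight hij (inv_ne_zero hq0) hE' hE₀'
  have hui : exp (2 * I * p i) = u ^ 2 := by rw [hu, exp_two_mul_I]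
  have hvj : exp (2 * I * p j) = v ^ 2 := by rw [hv, exp_two_mul_I]
  have hss := hs i j hij
  have hsin : sin (p i - p j) = -I / 2 * (u / v - v / u) := by
    rw [sin_sub_eq_exp, hu, hv]; ring
  have hzne : u / v - v / u ≠ 0 := by
    intro h0; rw [h0, mul_zero] at hsin; exact hss hsin
  have hcos : cos (p i - p j) = 1 / 2 * (u / v + v / u) := by
    rw [cos_sub_eq_exp, hu, hv]; ring
  have hsin' : sin (p i - p j - η) = -I / 2 * (u / (v * q) - v * q / u) := by
    rw [sub_sub, sin_sub_eq_exp, mul_add, Complex.exp_add, hu, hv, hq]; ring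
  have hsin'' : sin (p j - p i - η) = -I / 2 * (v / (u * q) - u * q / v) := by
    rw [sub_sub, sin_sub_eq_exp, mul_add, Complex.exp_add, hu, hv, hq]; ring
  have hsη : sin η = -I / 2 * (q - q⁻¹) := by
    have := sin_sub_eq_exp η 0
    rw [sub_zero, mul_zero, Complex.exp_zero, ← hq] at this
    rw [this]; ring
  have hA := doubleSumA_eq (y₁ := y₁) (y₂ := y₂) hη hq hu hv
  have hC := doubleSumC_eq (y₁ := y₁) (y₂ := y₂) hη hq hv
  have hC' := doubleSumC_eq (y₁ := y₂) (y₂ := y₁) hη hq hu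
  have hS := singleSumC_eq (y₁ := y₁) (y₂ := y₂) (i := i) (j := j) hη
  have hS' := singleSumC_eq (y₁ := y₂) (y₂ := y₁) (i := j) (j := i) hη
  have hflip : sin (p j - p i) = -sin (p i - p j) := by rw [← Complex.sin_neg, neg_sub]
  have hcflip : cos (p j - p i) = cos (p i - p j) := by rw [← Complex.cos_neg, neg_sub]
  rw [hflip, hcflip] at hS'
  have hc1 := entrySumC_eq p η i j y₁ y₂
  have hc2 := entrySumC_eq p η j i y₂ y₁
  have hc0 : entrySumA p η i j y₁ y₂ = (sin (p i - p j))⁻¹ *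
      ∑ c, ∑ d, (y₂ c * y₁ d - y₁ c * y₂ d) *
        (sin (p d - p i) * sin (p c - p j + η) / sin (p c - p d + η)) := rfl
  rw [hC, hS] at hc1
  rw [hC', hS', hflip] at hc2
  rw [hA] at hc0
  simp only [bracket_comm (y₁ := y₁) (y₂ := y₂)] at hc2
  simp only [hui, hvj, inv_inv] at hP hM
  generalize bracket y₁ y₂ (fun c d => cot (p c - p d + η)) = X at *
  generalize bracket y₁ y₂ (fun c d => exp (2 * I * p c) * cot (p c - p d + η)) = Jp at *
  generalize bracket y₁ y₂ (fun c d => (exp (2 * I * p c))⁻¹ * cot (p c - p d + η)) = Jm at *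
  generalize bracket y₁ y₂ (fun c _ => exp (2 * I * p c)) = Ep at *
  generalize bracket y₁ y₂ (fun c _ => (exp (2 * I * p c))⁻¹) = Em at *
  generalize residuePsi w η ρ₁ ρ₂ m₁ (p i) (p j) p y₂ = P₁ at *
  generalize residuePsi w η ρ₂ ρ₁ m₂ (p j) (p i) p y₁ = P₂ at *
  generalize ∑ c, y₁ c * cot (p c - p j + η) = Z₁ at *
  generalize ∑ c, y₂ c * cot (p c - p i + η) = Z₂ at *
  generalize ∑ c, y₁ c = F₁ at *
  generalize ∑ c, y₂ c = F₂ at *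
  generalize entrySumA p η i j y₁ y₂ = aa at *
  generalize entrySumC p η i j y₁ y₂ = cb at *
  generalize entrySumC p η j i y₂ y₁ = cb' at *
  rw [hsin] at hc0 hc1 hc2
  rw [hcos] at hc1 hc2
  rw [hsin', hsη] at hc1
  rw [hsin'', hsη] at hc2
  have hI := I_sq
  have hI₃ : I ^ 3 = -I := by rw [pow_succ, I_sq]; ring
  clear hA hC hC' hS hS' hE hE' hE₀ hE₀'
  have hzinv : ∀ z : ℂ, z ≠ 0 → z * (-I / 2 * z)⁻¹ = 2 * I := by
    intro z hz
    rw [mul_inv, mul_left_comm, mul_inv_cancel₀ hz, mul_one, inv_div, div_neg, div_eq_mul_inv,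
      inv_I]
    ring
  refine ⟨?_, ?_, ?_, ?_, ?_, ?_⟩
  · field_simp at hX
    linear_combination (-I) * hX
  · field_simp at hP
    linear_combination (-I) * hP - ((1 - q ^ 2) * (v ^ 2 * F₁ - u ^ 2 * F₂) +
      q ^ 2 * (w ^ 2 - 1) * (v ^ 2 - u ^ 2) * (F₁ * F₂)) * hI
  · field_simp at hM
    linear_combination (-I) * hM + (q ^ 2 * (q ^ 2 - 1) * (u ^ 2 * F₁ - v ^ 2 * F₂) +
      q ^ 2 * (w ^ 2 - 1) * (u ^ 2 - v ^ 2) * (F₁ * F₂)) * hI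
  · rw [hc0]
    have : (u / v - v / u) * (-I / 2 * (u / v - v / u))⁻¹ = 2 * I := hzinv _ hzne
    rw [← mul_assoc, this]
    field_simp
    ring
  · rw [hc1]
    have : (u / v - v / u) * (-I / 2 * (u / v - v / u))⁻¹ = 2 * I := hzinv _ hzne
    rw [mul_neg, ← mul_assoc, this]
    field_simp
    ring_nf
    simp only [I_sq, hI₃]
    ring
  · rw [hc2]
    have : (v / u - u / v) * (-(-I / 2 * (u / v - v / u)))⁻¹ = 2 * I := by
      rw [← mul_neg, neg_sub]
      exact hzinv _ (by rw [← neg_sub]; exact neg_ne_zero.2 hzne)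
    rw [mul_neg, ← mul_assoc, this]
    field_simp
    ring_nf
    simp only [I_sq, hI₃]
    ring

end Entries

end XXZ

/-! ### Linear relations for a column of overlaps -/

namespace XXZ

open Complex

section Column

variable {ι : Type*} [Fintype ι] [DecidableEq ι] {p : ι → ℂ} {w η : ℂ} {i j : ι}
  {al de L v : ι → ℂ} {t Λi Λj : ℂ}

theorem cot_sub_cot {x y : ℂ} (hx : sin x ≠ 0) (hy : sin y ≠ 0) :
    cot x - cot y = sin (y - x) / (sin x * sin y) := by
  rw [cot_eq_cos_div_sin, cot_eq_cos_div_sin, sin_sub]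
  field_simp

/-- The rescaled entry `v(c) x(c) sin η / (sin(c - ξ₁ + ε) sin(c - ξ₂ + ε))`. -/
noncomputable def columnWeight (p : ι → ℂ) (η ε : ℂ) (i j : ι) (x v : ι → ℂ) (c : ι) : ℂ :=
  v c * x c * sin η / (sin (p c - p i + ε) * sin (p c - p j + ε))

variable (hη : ∀ c d, sin (p c - p d + η) ≠ 0) (hη' : ∀ c d, sin (p c - p d + -η) ≠ 0)

-- By the Bethe equations the rescaled contributions of `A` and `D` agree at every Bethe root. They
-- differ only at `i` and `j`, where `sin (-η) = -sin η` turns the difference into the sum that is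
-- an eigenvalue of the right state.
include hη hη' in
theorem column_diff (hij : i ≠ j)
    (hB : ∀ c, c ≠ i → c ≠ j → al c / (sin (p c - p i + η) * sin (p c - p j + η)) =
      de c / (sin (p c - p i + -η) * sin (p c - p j + -η)))
    (hΛi : al i / sin (p i - p j + η) + de i / sin (p i - p j + -η) = Λi / sin (p i - p j))
    (hΛj : al j / sin (p j - p i + η) + de j / sin (p j - p i + -η) = -(Λj / sin (p i - p j)))
    (f : ι → ℂ) :
    ∑ c, columnWeight p η (-η) i j de v c * f c =
      (∑ c, columnWeight p η η i j al v c * f c) - v i * Λi / sin (p i - p j) * f i +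
        v j * Λj / sin (p i - p j) * f j := by
  have h0 : sin η ≠ 0 := by simpa using hη i i
  have key : ∑ c, (columnWeight p η η i j al v c - columnWeight p η (-η) i j de v c) * f c =
      v i * Λi / sin (p i - p j) * f i - v j * Λj / sin (p i - p j) * f j := by
    rw [← Finset.add_sum_erase _ _ (Finset.mem_univ i),
      ← Finset.add_sum_erase (a := j) _ _ (Finset.mem_erase.2 ⟨hij.symm, Finset.mem_univ j⟩),
      Finset.sum_eq_zero]
    · have a1 := hη i j
      have a2 := hη' i j
      have a3 := hη j i
      have a4 := hη' j i
      have e1 : columnWeight p η η i j al v i - columnWeight p η (-η) i j de v i =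
          v i * (al i / sin (p i - p j + η) + de i / sin (p i - p j + -η)) := by
        simp only [columnWeight, sub_self, zero_add, Complex.sin_neg]
        field_simp
        ring
      have e2 : columnWeight p η η i j al v j - columnWeight p η (-η) i j de v j =
          v j * (al j / sin (p j - p i + η) + de j / sin (p j - p i + -η)) := by
        simp only [columnWeight, sub_self, zero_add, Complex.sin_neg]
        field_simp
        ring
      rw [e1, e2, hΛi, hΛj]
      ring
    · intro c hc
      rw [Finset.mem_erase, Finset.mem_erase] at hc
      have := hB c hc.2.1 hc.1
      simp only [columnWeight]
      rw [mul_right_comm, mul_div_assoc, mul_right_comm, mul_div_assoc, this]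
      ring
  simp only [sub_mul, Finset.sum_sub_distrib] at key
  linear_combination (-1 : ℂ) * key

-- Subtracting the relation at `i` eliminates the constant `t`. The differences of cotangents are
-- then split in such a way that the sums over the kernel carry the prefactor `sin (p a - p i) sin
-- (p a - p j)`.
omit [DecidableEq ι] in
include hη hη' in
theorem column_star
    (hcol : ∀ a, L a * v a = sin η * (∑ c, (w * al c * cot (p c - p a + η) -
      w⁻¹ * de c * cot (p c - p a + -η)) * v c) + t) (a : ι) :
    L a * v a = L i * v i + sin (p a - p i) * cos (p a - p j) *
        (w * (∑ c, columnWeight p η η i j al v c) -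
          w⁻¹ * ∑ c, columnWeight p η (-η) i j de v c) +
      sin (p a - p i) * sin (p a - p j) *
        (w * (∑ c, columnWeight p η η i j al v c * cot (p c - p a + η)) -
          w⁻¹ * ∑ c, columnWeight p η (-η) i j de v c * cot (p c - p a + -η)) := by
  have h1 : ∀ (ε : ℂ) (x : ι → ℂ), (∀ c d, sin (p c - p d + ε) ≠ 0) → ∀ c,
      sin η * (x c * v c * (cot (p c - p a + ε) - cot (p c - p i + ε))) =
      sin (p a - p i) * cos (p a - p j) * columnWeight p η ε i j x v c +
      sin (p a - p i) * sin (p a - p j) * (columnWeight p η ε i j x v c *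
        cot (p c - p a + ε)) := by
    intro ε x hε c
    have e1 := sin_ratio (c := p j) (hε c a)
    have e2 : sin (p a - p i) * cos (p a - p j) * columnWeight p η ε i j x v c +
      sin (p a - p i) * sin (p a - p j) * (columnWeight p η ε i j x v c *
        cot (p c - p a + ε)) = sin (p a - p i) * columnWeight p η ε i j x v c *
          (sin (p c - p j + ε) / sin (p c - p a + ε)) := by rw [e1]; ring
    have b1 := hε c a
    have b2 := hε c i
    have b3 := hε c j
    rw [e2, cot_sub_cot b1 b2, columnWeight,
      show p c - p i + ε - (p c - p a + ε) = p a - p i by ring]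
    field_simp
  have h2 : L a * v a - L i * v i = ∑ c, (w * (sin η * (al c * v c *
      (cot (p c - p a + η) - cot (p c - p i + η)))) -
      w⁻¹ * (sin η * (de c * v c * (cot (p c - p a + -η) - cot (p c - p i + -η))))) := by
    rw [hcol a, hcol i, add_sub_add_right_eq_sub, ← mul_sub, ← Finset.sum_sub_distrib,
      Finset.mul_sum]
    exact Finset.sum_congr rfl fun c _ => by ring
  simp only [h1 η al hη, h1 (-η) de hη'] at h2
  rw [Finset.sum_sub_distrib, ← Finset.mul_sum, ← Finset.mul_sum, Finset.sum_add_distrib,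
    Finset.sum_add_distrib, ← Finset.mul_sum, ← Finset.mul_sum, ← Finset.mul_sum,
    ← Finset.mul_sum] at h2
  linear_combination h2

variable (hij : i ≠ j) (hs : ∀ c d, c ≠ d → sin (p c - p d) ≠ 0)
  (hB : ∀ c, c ≠ i → c ≠ j → al c / (sin (p c - p i + η) * sin (p c - p j + η)) =
    de c / (sin (p c - p i + -η) * sin (p c - p j + -η)))
  (hΛi : al i / sin (p i - p j + η) + de i / sin (p i - p j + -η) = Λi / sin (p i - p j))
  (hΛj : al j / sin (p j - p i + η) + de j / sin (p j - p i + -η) = -(Λj / sin (p i - p j)))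
  (hcol : ∀ a, L a * v a = sin η * (∑ c, (w * al c * cot (p c - p a + η) -
      w⁻¹ * de c * cot (p c - p a + -η)) * v c) + t)

include hη hη' hij hs hB hΛi hΛj hcol

/-- The relation `column_star` at `a = j`: the prefactor `sin (p a - p j)` removes the sums over
cotangents and only the sums of the weights remain. -/
theorem column_sum :
    (w - w⁻¹) * ∑ c, columnWeight p η η i j al v c =
      (v i * (L i - w⁻¹ * Λi) - v j * (L j - w⁻¹ * Λj)) / sin (p i - p j) := by
  have h1 := column_star (i := i) (j := j) hη hη' hcol j
  have h2 := column_diff (v := v) hη hη' hij hB hΛi hΛj fun _ => 1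
  simp only [sub_self, Complex.cos_zero, Complex.sin_zero, mul_one, mul_zero, zero_mul,
    add_zero] at h1 h2
  have h3 : sin (p j - p i) = -sin (p i - p j) := by rw [← Complex.sin_neg, neg_sub]
  have h4 := hs i j hij
  rw [h2, h3] at h1
  rw [eq_div_iff h4]
  have eA := div_mul_cancel₀ (v i * Λi) h4
  have eB := div_mul_cancel₀ (v j * Λj) h4
  linear_combination h1 - w⁻¹ * eA + w⁻¹ * eB

/-- Dividing `column_star` by `sin (p a - p i) sin (p a - p j)` gives the finite form of the
integral equation. Partial fractions in cotangents distribute the inhomogeneity over the sources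
that belong to the two spectral parameters, in proportion to `v i` and `v j`. -/
theorem column_eq {a : ι} (hai : a ≠ i) (haj : a ≠ j) (hΛi0 : Λi ≠ 0) (hΛj0 : Λj ≠ 0) :
    L a * v a / (sin (p a - p i) * sin (p a - p j)) =
      -(v i * Λi / sin (p i - p j)) * source w η (L i / Λi) (p i) (p a) +
      v j * Λj / sin (p i - p j) * source w η (L j / Λj) (p j) (p a) -
      ∑ c, cotKernel w η (p a - p c) * columnWeight p η η i j al v c := by
  have h1 := column_star (i := i) (j := j) hη hη' hcol a
  have h2 := column_diff (v := v) hη hη' hij hB hΛi hΛj fun _ => 1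
  have h3 := column_diff (v := v) hη hη' hij hB hΛi hΛj fun c => cot (p c - p a + -η)
  have h4 := column_sum hη hη' hij hs hB hΛi hΛj hcol
  have h5 : ∑ c, cotKernel w η (p a - p c) * columnWeight p η η i j al v c =
      -(w * ∑ c, columnWeight p η η i j al v c * cot (p c - p a + η)) +
        w⁻¹ * ∑ c, columnWeight p η η i j al v c * cot (p c - p a + -η) := by
    rw [Finset.mul_sum, Finset.mul_sum, ← Finset.sum_neg_distrib, ← Finset.sum_add_distrib]
    refine Finset.sum_congr rfl fun c _ => ?_
    rw [cotKernel, show p c - p a + η = -(p a - p c - η) by ring,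
      show p c - p a + -η = -(p a - p c + η) by ring, cot_neg', cot_neg']
    ring
  simp only [mul_one] at h2
  have hsi := hs a i hai
  have hsj := hs a j haj
  have hsij := hs i j hij
  have c1 : cos (p a - p j) = cot (p a - p j) * sin (p a - p j) := (cot_mul_sin hsj).symm
  have c2 : (cot (p a - p i) - cot (p a - p j)) = sin (p i - p j) /
      (sin (p a - p i) * sin (p a - p j)) := by
    rw [cot_sub_cot hsi hsj]; congr 2; ring
  -- The number 1 as a difference of cotangents: this distributes `L i * v i` over the poles at `p
  -- i` and `p j`.
  have c3 : 1 = (cot (p a - p i) - cot (p a - p j)) * (sin (p a - p i) * sin (p a - p j)) /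
      sin (p i - p j) := by
    rw [c2]; field_simp
  have e1 : cot (p i - p a + -η) = -cot (p a - p i + η) := by rw [← cot_neg']; congr 1; ring
  have e2 : cot (p j - p a + -η) = -cot (p a - p j + η) := by rw [← cot_neg']; congr 1; ring
  rw [h5, h1, h2, h3, e1, e2, c1]
  have h6 : w * (∑ c, columnWeight p η η i j al v c) - w⁻¹ * ((∑ c, columnWeight p η η i j al v c) -
      v i * Λi / sin (p i - p j) + v j * Λj / sin (p i - p j)) =
      (v i * L i - v j * L j) / sin (p i - p j) := by
    linear_combination h4
  rw [h6]
  simp only [source]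
  generalize ∑ c, columnWeight p η η i j al v c * cot (p c - p a + η) = S₁
  generalize ∑ c, columnWeight p η η i j al v c * cot (p c - p a + -η) = S₂
  have h7 : L i * v i = L i * v i * ((cot (p a - p i) - cot (p a - p j)) *
      (sin (p a - p i) * sin (p a - p j)) / sin (p i - p j)) := by rw [← c3, mul_one]
  rw [h7]
  field_simp
  ring

end Column

end XXZ

/-! ### Two-point data and the rank of the overlap matrix -/

namespace XXZ

open Complex Finset

namespace BetheOperators

variable {V : Type*} [AddCommGroup V] [Module ℂ V] {η : ℂ} {reg : ℂ → Prop}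
  (O : BetheOperators V η reg) {ι : Type*} [Fintype ι] [DecidableEq ι] (p : ι → ℂ)

omit [Fintype ι] in
/-- The vector of Bethe roots is an eigenvector of `A + D`. -/
theorem apply_add_apply_betheVector {p : ι → ℂ} (hp : ∀ c, reg (p c))
    (hs : ∀ c d, c ≠ d → sin (p c - p d) ≠ 0) (hη : ∀ c d, sin (p c - p d + η) ≠ 0)
    {S : Finset ι} {i : ι} (hi : i ∈ S)
    (hb : ∀ c ∈ S.erase i, actionCoeff p η O.a (S.erase i) c =
      actionCoeff p (-η) O.d (S.erase i) c) :
    O.A (p i) (O.betheVector p hp (S.erase i)) + O.D (p i) (O.betheVector p hp (S.erase i)) =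
      (actionCoeff p η O.a S i + actionCoeff p (-η) O.d S i) •
        O.betheVector p hp (S.erase i) := by
  have hη' : ∀ c d, sin (p c - p d + -η) ≠ 0 := by
    intro c d h0
    apply hη d c
    rw [← neg_eq_zero, ← Complex.sin_neg, ← h0]; congr 1; ring
  have h0 : sin η ≠ 0 := by simpa using hη i i
  rw [action hp O.isDiagonalEntry_A hs hη hi, action hp O.isDiagonalEntry_D hs hη' hi,
    ← sum_add_distrib, ← add_sum_erase _ _ hi, sum_eq_zero, add_zero, ← add_smul]
  · congr 1
    rw [sub_self, zero_add, zero_add, div_self h0,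
      div_self (by rw [Complex.sin_neg]; exact neg_ne_zero.2 h0)]
    ring
  · intro c hc
    have h1 := hb c hc
    have hci := (mem_erase.1 hc).1
    rw [actionCoeff_erase hs hη _ hi hci, actionCoeff_erase hs hη' _ hi hci] at h1
    have b1 := hη c i
    have b2 := hη' c i
    have b3 := hs c i hci
    rw [← add_smul]
    convert zero_smul ℂ _
    rw [Complex.sin_neg]
    field_simp at h1 ⊢
    linear_combination (sin η) * h1

/-- The eigenvalue at `p i` of `A + D` on the Bethe vector of all points but `p i`, `p j`. -/
noncomputable def rightEigenvalue (i j : ι) : ℂ :=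
  actionCoeff p η O.a (univ.erase j) i + actionCoeff p (-η) O.d (univ.erase j) i

/-- The residues of the density divided by the kernel coefficients. -/
noncomputable def residueCoeff (i j : ι) (L : ι → ℂ) (c : ι) : ℂ :=
  actionCoeff p η O.a ((univ.erase i).erase j) c * sin η / L c

/-- The data that enter a form factor with two spectral parameters `p i`, `p j`: the remaining
points are Bethe roots of the right vector, and `φ` is an eigenvector of the dual space of the
twisted transfer matrix with eigenvalues `L`. -/
structure IsTwoPoint (w : ℂ) (i j : ι) (φ : V →ₗ[ℂ] ℂ) (L : ι → ℂ) : Prop where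
  reg : ∀ c, reg (p c)
  ne : i ≠ j
  w_ne : w ≠ 0
  sin_ne : ∀ c d, c ≠ d → sin (p c - p d) ≠ 0
  shift_ne : ∀ c d, sin (p c - p d + η) ≠ 0
  left_eigen : ∀ a v, φ (w • O.A (p a) v + w⁻¹ • O.D (p a) v) = L a * φ v
  left_ne : ∀ a, L a ≠ 0
  bethe : ∀ c, c ≠ i → c ≠ j → actionCoeff p η O.a ((univ.erase i).erase j) c =
    actionCoeff p (-η) O.d ((univ.erase i).erase j) c
  coeff_ne : ∀ c, c ≠ i → c ≠ j → actionCoeff p η O.a ((univ.erase i).erase j) c ≠ 0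
  right_ne₁ : O.rightEigenvalue p i j ≠ 0
  right_ne₂ : O.rightEigenvalue p j i ≠ 0
  overlap_ne : φ (O.betheVector p reg ((univ.erase i).erase j)) ≠ 0
  unique : ∀ u : ι → ℂ, u i = 0 → u j = 0 → (∀ c, c ≠ i → c ≠ j → u c =
    -(O.residueCoeff p i j L c * ∑ d, cotKernel w η (p c - p d) * u d)) → u = 0

variable {O p} {w : ℂ} {i j : ι} {φ : V →ₗ[ℂ] ℂ} {L : ι → ℂ}

namespace IsTwoPoint

theorem symm (h : O.IsTwoPoint p w i j φ L) : O.IsTwoPoint p w j i φ L where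
  reg := h.reg
  ne := h.ne.symm
  w_ne := h.w_ne
  sin_ne := h.sin_ne
  shift_ne := h.shift_ne
  left_eigen := h.left_eigen
  left_ne := h.left_ne
  bethe c hj hi := by rw [erase_right_comm]; exact h.bethe c hi hj
  coeff_ne c hj hi := by rw [erase_right_comm]; exact h.coeff_ne c hi hj
  right_ne₁ := h.right_ne₂
  right_ne₂ := h.right_ne₁
  overlap_ne := by simpa only [erase_right_comm (a := j)] using h.overlap_ne
  unique u hj hi hu := h.unique u hi hj fun c hci hcj => by
    rw [hu c hcj hci, residueCoeff, residueCoeff, erase_right_comm]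

variable (h : O.IsTwoPoint p w i j φ L)

/-- The matrix `sin (p a - p b) φ(V_{ab})`, where `V_{ab}` is the Bethe vector of all points but
`p a` and `p b`. -/
noncomputable def overlapMatrix (_ : O.IsTwoPoint p w i j φ L) (hr : ∀ c, reg (p c))
    (a b : ι) : ℂ :=
  sin (p a - p b) * φ (O.betheVector p hr ((univ.erase b).erase a))

include h

theorem shift_ne' (c d : ι) : sin (p c - p d + -η) ≠ 0 := by
  intro h0
  apply h.shift_ne d c
  rw [← neg_eq_zero, ← Complex.sin_neg, ← h0]; congr 1; ring

theorem sin_eta_ne : sin η ≠ 0 := by simpa using h.shift_ne i i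

theorem actionCoeff_univ_erase {ε : ℂ} (hε : ∀ c d, sin (p c - p d + ε) ≠ 0) (x : ℂ → ℂ) {b c : ι}
    (hbc : c ≠ b) : actionCoeff p ε x (univ.erase b) c =
      actionCoeff p ε x univ c * (sin (p c - p b) / sin (p c - p b + ε)) :=
  actionCoeff_erase h.sin_ne hε x (mem_univ b) hbc

theorem actionCoeff_univ_erase_erase {ε : ℂ} (hε : ∀ c d, sin (p c - p d + ε) ≠ 0) (x : ℂ → ℂ)
    {c : ι} (hci : c ≠ i) (hcj : c ≠ j) : actionCoeff p ε x ((univ.erase i).erase j) c =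
      actionCoeff p ε x univ c * (sin (p c - p i) / sin (p c - p i + ε)) *
        (sin (p c - p j) / sin (p c - p j + ε)) := by
  rw [actionCoeff_erase h.sin_ne hε x (mem_erase.2 ⟨h.ne.symm, mem_univ j⟩) hcj,
    h.actionCoeff_univ_erase hε x hci]

theorem bethe_univ (c : ι) (hci : c ≠ i) (hcj : c ≠ j) :
    actionCoeff p η O.a univ c / (sin (p c - p i + η) * sin (p c - p j + η)) =
      actionCoeff p (-η) O.d univ c / (sin (p c - p i + -η) * sin (p c - p j + -η)) := by
  have h1 := h.bethe c hci hcj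
  rw [h.actionCoeff_univ_erase_erase h.shift_ne _ hci hcj,
    h.actionCoeff_univ_erase_erase h.shift_ne' _ hci hcj] at h1
  have e1 := h.sin_ne c i hci
  have e2 := h.sin_ne c j hcj
  have a1 := h.shift_ne c i
  have a2 := h.shift_ne c j
  have a3 := h.shift_ne' c i
  have a4 := h.shift_ne' c j
  field_simp at h1 ⊢
  linear_combination h1

theorem right_univ₁ : actionCoeff p η O.a univ i / sin (p i - p j + η) +
    actionCoeff p (-η) O.d univ i / sin (p i - p j + -η) =
      O.rightEigenvalue p i j / sin (p i - p j) := by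
  have e1 := h.sin_ne i j h.ne
  rw [rightEigenvalue, h.actionCoeff_univ_erase h.shift_ne _ h.ne,
    h.actionCoeff_univ_erase h.shift_ne' _ h.ne]
  field_simp

theorem right_univ₂ : actionCoeff p η O.a univ j / sin (p j - p i + η) +
    actionCoeff p (-η) O.d univ j / sin (p j - p i + -η) =
      -(O.rightEigenvalue p j i / sin (p i - p j)) := by
  rw [h.symm.right_univ₁, ← neg_sub (p i), Complex.sin_neg, div_neg]

theorem overlapMatrix_swap (a b : ι) :
    h.overlapMatrix h.reg b a = -h.overlapMatrix h.reg a b := by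
  rw [overlapMatrix, overlapMatrix, erase_right_comm, ← neg_sub (p a), Complex.sin_neg, neg_mul]

theorem overlapMatrix_self (a : ι) : h.overlapMatrix h.reg a a = 0 := by
  rw [overlapMatrix, sub_self, Complex.sin_zero, zero_mul]

/-- The solutions of the linear relations that the columns of the overlap matrix satisfy. -/
def IsColumn (_ : O.IsTwoPoint p w i j φ L) (v : ι → ℂ) (t : ℂ) : Prop :=
  ∀ a, L a * v a = sin η * (∑ c, (w * actionCoeff p η O.a univ c * cot (p c - p a + η) -
      w⁻¹ * actionCoeff p (-η) O.d univ c * cot (p c - p a + -η)) * v c) + t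

/-- The left eigenvector property at `p a`, applied to the Bethe vector without `p a` and `p b`.
After multiplication by `sin (p a - p b)` each coefficient is a difference of a cotangent at `a` and
the same cotangent at `b`. The second part does not depend on `a` and forms the constant `t`; the
factor `sin (p c - p b)` completes the overlap to a matrix element. -/
theorem isColumn_overlapMatrix (b : ι) : ∃ t, h.IsColumn (fun c => h.overlapMatrix h.reg c b) t := by
  refine ⟨-(sin η * (∑ c, (w * actionCoeff p η O.a univ c * cot (p c - p b + η) -
      w⁻¹ * actionCoeff p (-η) O.d univ c * cot (p c - p b + -η)) *
        h.overlapMatrix h.reg c b)), fun a => ?_⟩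
  beta_reduce
  rcases eq_or_ne a b with rfl | hab
  · rw [overlapMatrix_self]; ring
  have h1 := h.left_eigen a (O.betheVector p h.reg ((univ.erase b).erase a))
  rw [action_erase h.reg O.isDiagonalEntry_A h.sin_ne h.shift_ne (mem_univ a) (mem_univ b) hab,
    action_erase h.reg O.isDiagonalEntry_D h.sin_ne h.shift_ne' (mem_univ a) (mem_univ b) hab,
    smul_sum, smul_sum, ← sum_add_distrib, map_sum] at h1
  have h2 : L a * h.overlapMatrix h.reg a b = sin (p a - p b) *
      (L a * φ (O.betheVector p h.reg ((univ.erase b).erase a))) := by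
    rw [overlapMatrix]; ring
  rw [h2, ← h1, ← sub_eq_add_neg, ← mul_sub, ← sum_sub_distrib, mul_sum, mul_sum]
  refine sum_congr rfl fun c _ => ?_
  have a1 := h.shift_ne c a
  have a2 := h.shift_ne c b
  have a3 := h.shift_ne' c a
  have a4 := h.shift_ne' c b
  have c1 := cot_sub_cot a1 a2
  have c2 := cot_sub_cot a3 a4
  rw [show p c - p b + η - (p c - p a + η) = p a - p b by ring] at c1
  rw [show p c - p b + -η - (p c - p a + -η) = p a - p b by ring] at c2
  have c3 : (w * actionCoeff p η O.a univ c * cot (p c - p a + η) -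
      w⁻¹ * actionCoeff p (-η) O.d univ c * cot (p c - p a + -η)) * h.overlapMatrix h.reg c b -
      (w * actionCoeff p η O.a univ c * cot (p c - p b + η) -
      w⁻¹ * actionCoeff p (-η) O.d univ c * cot (p c - p b + -η)) * h.overlapMatrix h.reg c b =
      (w * actionCoeff p η O.a univ c * (cot (p c - p a + η) - cot (p c - p b + η)) -
      w⁻¹ * actionCoeff p (-η) O.d univ c * (cot (p c - p a + -η) - cot (p c - p b + -η))) *
        h.overlapMatrix h.reg c b := by ring
  rw [c3, c1, c2, overlapMatrix]
  simp only [map_add, map_smul, smul_eq_mul, Complex.sin_neg]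
  field_simp
  ring

theorem IsColumn.combination {v₁ v₂ v₃ : ι → ℂ} {t₁ t₂ t₃ : ℂ} (h₁ : h.IsColumn v₁ t₁)
    (h₂ : h.IsColumn v₂ t₂) (h₃ : h.IsColumn v₃ t₃) (x₁ x₂ x₃ : ℂ) :
    h.IsColumn (fun c => x₁ * v₁ c + x₂ * v₂ c + x₃ * v₃ c) (x₁ * t₁ + x₂ * t₂ + x₃ * t₃) := by
  intro a
  have e : L a * (x₁ * v₁ a + x₂ * v₂ a + x₃ * v₃ a) =
      x₁ * (L a * v₁ a) + x₂ * (L a * v₂ a) + x₃ * (L a * v₃ a) := by ring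
  simp only [e, h₁ a, h₂ a, h₃ a, mul_add, sum_add_distrib]
  have e' : ∀ (x : ℂ) (v : ι → ℂ), ∑ c, (w * actionCoeff p η O.a univ c * cot (p c - p a + η) -
      w⁻¹ * actionCoeff p (-η) O.d univ c * cot (p c - p a + -η)) * (x * v c) =
      x * ∑ c, (w * actionCoeff p η O.a univ c * cot (p c - p a + η) -
      w⁻¹ * actionCoeff p (-η) O.d univ c * cot (p c - p a + -η)) * v c := by
    intro x v
    rw [mul_sum]
    exact sum_congr rfl fun c _ => by ring
  rw [e', e', e']
  ring

theorem columnWeight_eq {v : ι → ℂ} {c : ι} (hci : c ≠ i) (hcj : c ≠ j) :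
    columnWeight p η η i j (actionCoeff p η O.a univ) v c =
      O.residueCoeff p i j L c * (L c * v c / (sin (p c - p i) * sin (p c - p j))) := by
  have e1 := h.sin_ne c i hci
  have e2 := h.sin_ne c j hcj
  have a1 := h.shift_ne c i
  have a2 := h.shift_ne c j
  have a3 := h.left_ne c
  rw [columnWeight, residueCoeff, h.actionCoeff_univ_erase_erase h.shift_ne _ hci hcj]
  field_simp

theorem column_main {v : ι → ℂ} {t : ℂ} (hv : h.IsColumn v t) {c : ι} (hci : c ≠ i)
    (hcj : c ≠ j) :
    columnWeight p η η i j (actionCoeff p η O.a univ) v c = O.residueCoeff p i j L c *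
      (-(v i * O.rightEigenvalue p i j / sin (p i - p j)) *
          source w η (L i / O.rightEigenvalue p i j) (p i) (p c) +
        v j * O.rightEigenvalue p j i / sin (p i - p j) *
          source w η (L j / O.rightEigenvalue p j i) (p j) (p c) -
        ∑ d, cotKernel w η (p c - p d) *
          columnWeight p η η i j (actionCoeff p η O.a univ) v d) := by
  rw [h.columnWeight_eq hci hcj, column_eq h.shift_ne h.shift_ne' h.ne h.sin_ne h.bethe_univ
    h.right_univ₁ h.right_univ₂ hv hci hcj h.right_ne₁ h.right_ne₂]

/-- If `v i = v j = 0`, both sources disappear and the weights solve the homogeneous finite system,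
so they vanish. The coefficients at the Bethe roots are non-zero, which carries the conclusion over
to `v`. -/
theorem eq_zero_of_isColumn {v : ι → ℂ} {t : ℂ} (hv : h.IsColumn v t) (hi : v i = 0)
    (hj : v j = 0) : v = 0 := by
  have h1 := h.unique (columnWeight p η η i j (actionCoeff p η O.a univ) v)
    (by simp [columnWeight, hi]) (by simp [columnWeight, hj]) fun c hci hcj => by
      rw [h.column_main hv hci hcj, hi, hj]; ring
  funext c
  rcases eq_or_ne c i with rfl | hci
  · exact hi
  rcases eq_or_ne c j with rfl | hcj
  · exact hj
  have h2 := congrFun h1 c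
  have h3 := h.coeff_ne c hci hcj
  rw [h.actionCoeff_univ_erase_erase h.shift_ne _ hci hcj] at h3
  have h4 := left_ne_zero_of_mul (left_ne_zero_of_mul h3)
  rw [columnWeight, Pi.zero_apply, div_eq_zero_iff] at h2
  rcases h2 with h2 | h2
  · have := h.sin_eta_ne
    rw [mul_eq_zero, mul_eq_zero] at h2
    tauto
  · exact absurd h2 (mul_ne_zero (h.shift_ne c i) (h.shift_ne c j))

/-- The overlap matrix has rank two. -/
theorem overlapMatrix_plucker (a b : ι) :
    h.overlapMatrix h.reg a b * h.overlapMatrix h.reg i j =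
      h.overlapMatrix h.reg a i * h.overlapMatrix h.reg b j -
        h.overlapMatrix h.reg a j * h.overlapMatrix h.reg b i := by
  obtain ⟨t₁, h₁⟩ := h.isColumn_overlapMatrix b
  obtain ⟨t₂, h₂⟩ := h.isColumn_overlapMatrix i
  obtain ⟨t₃, h₃⟩ := h.isColumn_overlapMatrix j
  -- The coefficients are chosen so that this combination of the columns `b`, `i`, `j` vanishes at
  -- `i` and at `j`, and hence everywhere.
  have h4 := h.eq_zero_of_isColumn (IsColumn.combination h h₁ h₂ h₃ (h.overlapMatrix h.reg i j)
    (-h.overlapMatrix h.reg b j) (h.overlapMatrix h.reg b i))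
    (by rw [h.overlapMatrix_self, h.overlapMatrix_swap b i]; ring)
    (by rw [h.overlapMatrix_self, h.overlapMatrix_swap b j, h.overlapMatrix_swap i j]; ring)
  have h5 := congrFun h4 a
  simp only [Pi.zero_apply] at h5
  linear_combination h5

end IsTwoPoint

end BetheOperators

end XXZ

/-! ### Matrix elements of `A A` and `C B` in terms of residues -/

namespace XXZ

open Complex Finset

namespace BetheOperators.IsTwoPoint

variable {V : Type*} [AddCommGroup V] [Module ℂ V] {η : ℂ} {reg : ℂ → Prop}
  {O : BetheOperators V η reg} {ι : Type*} [Fintype ι] [DecidableEq ι] {p : ι → ℂ}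
  {w : ℂ} {i j : ι} {φ : V →ₗ[ℂ] ℂ} {L : ι → ℂ} (h : O.IsTwoPoint p w i j φ L)

/-- The overlap of the left and right vectors. -/
noncomputable def overlap (h : O.IsTwoPoint p w i j φ L) : ℂ :=
  φ (O.betheVector p h.reg ((univ.erase i).erase j))

/-- The residues of the solution of the equation for `G` that belongs to the point `p i`. -/
noncomputable def residue (h : O.IsTwoPoint p w i j φ L) (c : ι) : ℂ :=
  columnWeight p η η i j (actionCoeff p η O.a univ) (fun c => h.overlapMatrix h.reg c j) c /
    (-(h.overlap * O.rightEigenvalue p i j))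

include h

theorem overlap_symm : h.symm.overlap = h.overlap := by
  rw [overlap, overlap, erase_right_comm]

omit h [AddCommGroup V] [Module ℂ V] [Fintype ι] [DecidableEq ι] in
theorem columnWeight_symm (x v : ι → ℂ) (ε : ℂ) :
    columnWeight p η ε j i x v = columnWeight p η ε i j x v := by
  funext c
  rw [columnWeight, columnWeight, mul_comm (sin (p c - p j + ε))]

theorem overlapMatrix_eq : h.overlapMatrix h.reg i j = sin (p i - p j) * h.overlap := by
  rw [overlapMatrix, overlap, erase_right_comm]

theorem normalization_ne : -(h.overlap * O.rightEigenvalue p i j) ≠ 0 :=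
  neg_ne_zero.2 (mul_ne_zero h.overlap_ne h.right_ne₁)

theorem weight_residue (c : ι) :
    columnWeight p η η i j (actionCoeff p η O.a univ) (fun c => h.overlapMatrix h.reg c j) c =
      -(h.overlap * O.rightEigenvalue p i j) * h.residue c := by
  rw [residue, mul_div_cancel₀ _ h.normalization_ne]

theorem weight_residue_symm (c : ι) :
    columnWeight p η η i j (actionCoeff p η O.a univ) (fun c => h.overlapMatrix h.reg c i) c =
      -(h.overlap * O.rightEigenvalue p j i) * h.symm.residue c := by
  rw [← h.overlap_symm, ← h.symm.weight_residue c, columnWeight_symm]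
  rfl

/-- Column `j` of the overlap matrix vanishes at `j`, so only the source belonging to `p i`
survives. The normalization in `residue` gives this source the coefficient 1. -/
theorem residue_eq {c : ι} (hci : c ≠ i) (hcj : c ≠ j) : h.residue c =
    O.residueCoeff p i j L c *
      residueG w η (L i / O.rightEigenvalue p i j) (p i) p h.residue (p c) := by
  obtain ⟨t, ht⟩ := h.isColumn_overlapMatrix j
  have h1 := h.column_main ht hci hcj
  simp only [h.weight_residue, overlapMatrix_self, overlapMatrix_eq] at h1
  have hs := h.sin_ne i j h.ne
  have e1 : sin (p i - p j) * h.overlap * O.rightEigenvalue p i j / sin (p i - p j) =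
      h.overlap * O.rightEigenvalue p i j := by field_simp
  have e2 : ∑ d, cotKernel w η (p c - p d) * (-(h.overlap * O.rightEigenvalue p i j) * h.residue d) =
      -(h.overlap * O.rightEigenvalue p i j) * ∑ d, cotKernel w η (p c - p d) * h.residue d := by
    rw [mul_sum]
    exact sum_congr rfl fun d _ => by ring
  rw [e1, e2] at h1
  refine mul_left_cancel₀ h.normalization_ne ?_
  rw [h1, residueG]
  ring

theorem residue_left :
    h.residue i = -(actionCoeff p η O.a (univ.erase j) i / O.rightEigenvalue p i j) := by
  have hs := h.sin_ne i j h.ne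
  have hη := h.sin_eta_ne
  have a1 := h.shift_ne i j
  have a2 := h.overlap_ne
  have a3 := h.right_ne₁
  rw [residue, columnWeight, h.overlapMatrix_eq, h.actionCoeff_univ_erase h.shift_ne _ h.ne,
    sub_self, zero_add]
  change h.overlap ≠ 0 at a2
  field_simp

theorem residue_right : h.residue j = 0 := by
  rw [residue, columnWeight, overlapMatrix_self]; simp

theorem residue_sum :
    (w - w⁻¹) * ∑ c, h.residue c = w⁻¹ - L i / O.rightEigenvalue p i j := by
  obtain ⟨t, ht⟩ := h.isColumn_overlapMatrix j
  have h1 := column_sum h.shift_ne h.shift_ne' h.ne h.sin_ne h.bethe_univ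
    h.right_univ₁ h.right_univ₂ ht
  simp only [h.weight_residue, overlapMatrix_self, overlapMatrix_eq, ← mul_sum] at h1
  have hs := h.sin_ne i j h.ne
  have a2 := h.overlap_ne
  have a3 := h.right_ne₁
  change h.overlap ≠ 0 at a2
  rw [zero_mul, sub_zero, mul_assoc, mul_div_cancel_left₀ _ hs] at h1
  refine mul_left_cancel₀ (h.normalization_ne) ?_
  have e : -(h.overlap * O.rightEigenvalue p i j) * (w⁻¹ - L i / O.rightEigenvalue p i j) =
      h.overlap * (L i - w⁻¹ * O.rightEigenvalue p i j) := by field_simp; ring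
  rw [e, ← h1]; ring

theorem isResiduePair : IsResiduePair p w η i j (L i / O.rightEigenvalue p i j)
    (L j / O.rightEigenvalue p j i)
    (actionCoeff p η O.a (univ.erase j) i / O.rightEigenvalue p i j)
    (actionCoeff p η O.a (univ.erase i) j / O.rightEigenvalue p j i)
    (O.residueCoeff p i j L) h.residue h.symm.residue where
  eq₁ c := h.residue_eq
  eq₂ c hci hcj := by
    rw [h.symm.residue_eq hcj hci, residueCoeff, residueCoeff, erase_right_comm]
  left₁ := h.residue_left
  right₁ := h.residue_right
  left₂ := h.symm.residue_right
  right₂ := h.symm.residue_left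
  sum₁ := h.residue_sum
  sum₂ := h.symm.residue_sum

/-- An overlap in which `c` and `d` are both replaced by `i` and `j` is a `2 × 2` determinant of
overlaps with one replacement. Up to weights these are the residues of the two solutions. -/
theorem plucker_overlap (c d : ι) :
    sin (p i - p j) * h.overlap *
      (sin (p c - p d) * φ (O.betheVector p h.reg ((univ.erase c).erase d))) =
      h.overlapMatrix h.reg c i * h.overlapMatrix h.reg d j -
        h.overlapMatrix h.reg c j * h.overlapMatrix h.reg d i := by
  have e : h.overlapMatrix h.reg c d =
      sin (p c - p d) * φ (O.betheVector p h.reg ((univ.erase c).erase d)) := by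
    rw [overlapMatrix, erase_right_comm]
  rw [← h.overlapMatrix_plucker, ← h.overlapMatrix_eq, mul_comm, e]

/-- The matrix element of `A A`. -/
theorem apply_A_A : φ (O.A (p i) (O.A (p j) (O.betheVector p h.reg ((univ.erase i).erase j)))) =
    h.overlap * (O.rightEigenvalue p i j * O.rightEigenvalue p j i) *
      entrySumA p η i j h.residue h.symm.residue := by
  have hs := h.sin_ne i j h.ne
  have a2 := h.overlap_ne
  change h.overlap ≠ 0 at a2
  rw [action_action h.reg O.isDiagonalEntry_A O.isDiagonalEntry_A h.sin_ne h.shift_ne h.shift_ne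
    (mem_univ i) (mem_univ j) h.ne, map_sum]
  refine mul_left_cancel₀ (mul_ne_zero hs a2) ?_
  have e1 : sin (p i - p j) * h.overlap * (h.overlap * (O.rightEigenvalue p i j *
      O.rightEigenvalue p j i) * entrySumA p η i j h.residue h.symm.residue) =
      ∑ c, ∑ d, ((-(h.overlap * O.rightEigenvalue p j i) * h.symm.residue c) *
        (-(h.overlap * O.rightEigenvalue p i j) * h.residue d) -
        (-(h.overlap * O.rightEigenvalue p i j) * h.residue c) *
        (-(h.overlap * O.rightEigenvalue p j i) * h.symm.residue d)) *
        (sin (p d - p i) * sin (p c - p j + η) / sin (p c - p d + η)) := by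
    rw [entrySumA]
    have : sin (p i - p j) * h.overlap * (h.overlap * (O.rightEigenvalue p i j *
      O.rightEigenvalue p j i) * ((sin (p i - p j))⁻¹ *
        ∑ c, ∑ d, (h.symm.residue c * h.residue d - h.residue c * h.symm.residue d) *
          (sin (p d - p i) * sin (p c - p j + η) / sin (p c - p d + η)))) =
      (h.overlap * h.overlap * (O.rightEigenvalue p i j * O.rightEigenvalue p j i)) *
        ∑ c, ∑ d, (h.symm.residue c * h.residue d - h.residue c * h.symm.residue d) *
          (sin (p d - p i) * sin (p c - p j + η) / sin (p c - p d + η)) := by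
      field_simp
    rw [this, mul_sum]
    refine sum_congr rfl fun c _ => ?_
    rw [mul_sum]
    exact sum_congr rfl fun d _ => by ring
  rw [e1]
  simp only [map_sum, map_smul, smul_eq_mul, mul_sum]
  rw [sum_comm]
  refine sum_congr rfl fun c _ => sum_congr rfl fun d _ => ?_
  -- The coefficient from `action_action` contains `sin (p c - p d)`, which is the factor that the
  -- Plücker relation requires.
  have pl := h.plucker_overlap c d
  rw [← h.weight_residue, ← h.weight_residue, ← h.weight_residue_symm, ← h.weight_residue_symm]
  simp only [columnWeight]
  have b1 := h.shift_ne c i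
  have b2 := h.shift_ne c j
  have b3 := h.shift_ne d i
  have b4 := h.shift_ne d j
  have b5 := h.shift_ne c d
  have e2 : ∀ x y z f : ℂ, sin (p i - p j) * h.overlap * (x * y * (sin (p d - p i) /
      sin (p d - p i + η) * (sin η / sin (p d - p j + η)) * (sin (p c - p d) /
      sin (p c - p d + η) * (sin η / sin (p c - p i + η)))) * f) =
      x * y * (sin (p d - p i) / sin (p d - p i + η) * (sin η / sin (p d - p j + η)) * (1 /
      sin (p c - p d + η) * (sin η / sin (p c - p i + η)))) *
        (sin (p i - p j) * h.overlap * (sin (p c - p d) * f)) := by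
    intro x y z f; ring
  rw [e2 _ _ 0, pl]
  field_simp

/-- The lower left entries of the columns. -/
theorem column_diff_apply (c : ι) :
    columnWeight p η (-η) i j (actionCoeff p (-η) O.d univ)
      (fun c => h.overlapMatrix h.reg c j) c =
      -(h.overlap * O.rightEigenvalue p i j) * (h.residue c + if c = i then 1 else 0) := by
  have hs := h.sin_ne i j h.ne
  -- The indicator function of `c` as test function makes `column_diff` a pointwise relation; the
  -- eigenvalue term at `i` becomes the Kronecker symbol.
  have h1 := column_diff (v := fun c => h.overlapMatrix h.reg c j) h.shift_ne h.shift_ne' h.ne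
    h.bethe_univ h.right_univ₁ h.right_univ₂ fun d => if d = c then 1 else 0
  simp only [mul_ite, mul_one, mul_zero, sum_ite_eq', mem_univ, if_true, overlapMatrix_self,
    zero_mul, zero_div, ite_self, add_zero, h.weight_residue, overlapMatrix_eq] at h1
  rw [h1, mul_assoc (sin _), mul_div_cancel_left₀ _ hs]
  by_cases hc : c = i
  · rw [if_pos hc, if_pos hc.symm]; ring
  · rw [if_neg hc, if_neg (Ne.symm hc)]; ring

theorem column_diff_apply_symm (c : ι) :
    columnWeight p η (-η) i j (actionCoeff p (-η) O.d univ)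
      (fun c => h.overlapMatrix h.reg c i) c =
      -(h.overlap * O.rightEigenvalue p j i) * (h.symm.residue c + if c = j then 1 else 0) := by
  rw [← h.overlap_symm, ← h.symm.column_diff_apply c, columnWeight_symm]
  rfl

/-- The matrix element of `C B`. -/
theorem apply_C_B : φ (O.C (p i) (O.B (p j) (O.betheVector p h.reg ((univ.erase i).erase j)))) =
    h.overlap * (O.rightEigenvalue p i j * O.rightEigenvalue p j i) *
      entrySumC p η i j h.residue h.symm.residue := by
  have hs := h.sin_ne i j h.ne
  have a2 := h.overlap_ne
  change h.overlap ≠ 0 at a2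
  rw [O.B_betheVector_erase h.reg (mem_erase.2 ⟨h.ne.symm, mem_univ j⟩),
    action_C h.reg h.sin_ne h.shift_ne h.shift_ne' (mem_univ i), map_neg, map_sum]
  refine mul_left_cancel₀ (mul_ne_zero hs a2) ?_
  have e1 : sin (p i - p j) * h.overlap * (h.overlap * (O.rightEigenvalue p i j *
      O.rightEigenvalue p j i) * entrySumC p η i j h.residue h.symm.residue) =
      -∑ c, ∑ d, ((-(h.overlap * O.rightEigenvalue p j i) * h.symm.residue c) *
        (-(h.overlap * O.rightEigenvalue p i j) * (h.residue d + if d = i then 1 else 0)) -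
        (-(h.overlap * O.rightEigenvalue p i j) * h.residue c) *
        (-(h.overlap * O.rightEigenvalue p j i) *
          (h.symm.residue d + if d = j then 1 else 0))) *
        (sin (p c - p j + η) * sin (p d - p j - η) / sin (p c - p d + η)) := by
    rw [entrySumC]
    have : ∀ S : ℂ, sin (p i - p j) * h.overlap * (h.overlap * (O.rightEigenvalue p i j *
      O.rightEigenvalue p j i) * -((sin (p i - p j))⁻¹ * S)) =
      -((h.overlap * h.overlap * (O.rightEigenvalue p i j * O.rightEigenvalue p j i)) * S) := by
      intro S; field_simp
    rw [this, mul_sum]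
    congr 1
    refine sum_congr rfl fun c _ => ?_
    rw [mul_sum]
    exact sum_congr rfl fun d _ => by ring
  rw [e1, mul_neg]
  congr 1
  simp only [map_sum, map_smul, smul_eq_mul, mul_sum]
  refine sum_congr rfl fun c _ => sum_congr rfl fun d _ => ?_
  have pl := h.plucker_overlap c d
  rw [← h.weight_residue, ← h.column_diff_apply, ← h.weight_residue_symm,
    ← h.column_diff_apply_symm]
  simp only [columnWeight]
  have b1 := h.shift_ne c i
  have b2 := h.shift_ne c j
  have b3 := h.shift_ne' d i
  have b4 := h.shift_ne' d j
  have b5 := h.shift_ne c d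
  have e2 : ∀ x y f : ℂ, sin (p i - p j) * h.overlap * (x * y * (sin η ^ 2 * sin (p c - p d) /
      (sin (p c - p d + η) * sin (p c - p i + η) * sin (p d - p i + -η))) * f) =
      x * y * (sin η ^ 2 / (sin (p c - p d + η) * sin (p c - p i + η) * sin (p d - p i + -η))) *
        (sin (p i - p j) * h.overlap * (sin (p c - p d) * f)) := by
    intro x y f; ring
  rw [e2, pl, sub_eq_add_neg (p d - p j) η]
  field_simp

/-- The right vector is an eigenvector of `A + D` at the two points. -/
theorem right_eigen : O.A (p i) (O.betheVector p h.reg ((univ.erase i).erase j)) +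
    O.D (p i) (O.betheVector p h.reg ((univ.erase i).erase j)) =
    O.rightEigenvalue p i j • O.betheVector p h.reg ((univ.erase i).erase j) := by
  rw [erase_right_comm]
  refine O.apply_add_apply_betheVector h.reg h.sin_ne h.shift_ne
    (mem_erase.2 ⟨h.ne, mem_univ i⟩) fun c hc => ?_
  rw [mem_erase, mem_erase] at hc
  rw [erase_right_comm]
  exact h.bethe c hc.1 hc.2.1

end BetheOperators.IsTwoPoint

end XXZ

/-! ### The remaining matrix elements -/

namespace XXZ

open Complex Finset

namespace BetheOperators.IsTwoPoint

variable {V : Type*} [AddCommGroup V] [Module ℂ V] {η : ℂ} {reg : ℂ → Prop}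
  {O : BetheOperators V η reg} {ι : Type*} [Fintype ι] [DecidableEq ι] {p : ι → ℂ}
  {w : ℂ} {i j : ι} {φ : V →ₗ[ℂ] ℂ} {L : ι → ℂ} (h : O.IsTwoPoint p w i j φ L)

/-- The right vector. -/
noncomputable def ket (h : O.IsTwoPoint p w i j φ L) : V :=
  O.betheVector p h.reg ((univ.erase i).erase j)

theorem ket_symm : h.symm.ket = h.ket := by rw [ket, ket, erase_right_comm]

include h

theorem left_eigen' (a : ι) (v : V) :
    φ (O.D (p a) v) = w * L a * φ v - w ^ 2 * φ (O.A (p a) v) := by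
  have h1 := h.left_eigen a v
  have hw := h.w_ne
  rw [map_add, map_smul, map_smul, smul_eq_mul, smul_eq_mul] at h1
  field_simp at h1
  linear_combination h1

variable (hw1 : w ^ 2 - 1 ≠ 0)

include hw1

/-- The matrix element of `A`. -/
theorem apply_A : φ (O.A (p i) h.ket) = -(h.overlap * O.rightEigenvalue p i j * ∑ c, h.residue c) := by
  have h1 := congrArg φ h.right_eigen
  have h2 := h.left_eigen' i h.ket
  have h3 := h.residue_sum
  have hw := h.w_ne
  have hΛ := h.right_ne₁
  rw [map_add, map_smul, smul_eq_mul] at h1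
  change φ (O.A (p i) h.ket) + φ (O.D (p i) h.ket) = O.rightEigenvalue p i j * h.overlap at h1
  change _ = w * L i * h.overlap - _ at h2
  refine mul_left_cancel₀ hw1 ?_
  field_simp at h3
  linear_combination (-1 : ℂ) * h1 + h2 + h.overlap * h3

omit hw1 in
theorem apply_D : φ (O.D (p i) h.ket) =
    h.overlap * O.rightEigenvalue p i j - φ (O.A (p i) h.ket) := by
  have h1 := congrArg φ h.right_eigen
  rw [map_add, map_smul, smul_eq_mul] at h1
  change φ (O.A (p i) h.ket) + φ (O.D (p i) h.ket) = O.rightEigenvalue p i j * h.overlap at h1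
  linear_combination h1

omit hw1 in
theorem right_eigen_symm (f : V →ₗ[ℂ] ℂ) : f (O.A (p j) h.ket) + f (O.D (p j) h.ket) =
    O.rightEigenvalue p j i * f h.ket := by
  have h1 := congrArg f h.symm.right_eigen
  rw [map_add, map_smul, smul_eq_mul] at h1
  rw [← h.ket_symm]
  exact h1

/-- The right vector is an eigenvector of `A + D` at `p j`, so the element of `A D` follows from
those of `A` and `A A`. -/
theorem apply_A_D : φ (O.A (p i) (O.D (p j) h.ket)) =
    h.overlap * (O.rightEigenvalue p i j * O.rightEigenvalue p j i) *
      (-(∑ c, h.residue c) - entrySumA p η i j h.residue h.symm.residue) := by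
  have h1 := h.right_eigen_symm (φ ∘ₗ O.A (p i))
  simp only [LinearMap.comp_apply] at h1
  have h2 := h.apply_A_A
  change φ (O.A (p i) (O.A (p j) h.ket)) = _ at h2
  rw [h2, h.apply_A hw1] at h1
  linear_combination h1

/-- The left eigenvector property trades `D` at `p i` for `A` at `p i`. The eigenvalue of the left
state that appears is eliminated by the sum rule for the residues. -/
theorem apply_D_A : φ (O.D (p i) (O.A (p j) h.ket)) =
    h.overlap * (O.rightEigenvalue p i j * O.rightEigenvalue p j i) *
      (-(w ^ 2 * entrySumA p η i j h.residue h.symm.residue) -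
        (1 - (w ^ 2 - 1) * ∑ c, h.residue c) * ∑ c, h.symm.residue c) := by
  have h1 := h.left_eigen' i (O.A (p j) h.ket)
  have h2 := h.apply_A_A
  change φ (O.A (p i) (O.A (p j) h.ket)) = _ at h2
  have h3 := h.symm.apply_A hw1
  rw [h.ket_symm, h.overlap_symm] at h3
  have h4 := h.residue_sum
  have hw := h.w_ne
  have hΛ := h.right_ne₁
  rw [h1, h2, h3]
  field_simp at h4
  linear_combination -(h.overlap * O.rightEigenvalue p j i * ∑ c, h.symm.residue c) * h4

theorem apply_D_D : φ (O.D (p i) (O.D (p j) h.ket)) =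
    h.overlap * (O.rightEigenvalue p i j * O.rightEigenvalue p j i) *
      (1 + (∑ c, h.residue c) + w ^ 2 * entrySumA p η i j h.residue h.symm.residue +
        (1 - (w ^ 2 - 1) * ∑ c, h.residue c) * ∑ c, h.symm.residue c) := by
  have h1 := h.right_eigen_symm (φ ∘ₗ O.D (p i))
  simp only [LinearMap.comp_apply] at h1
  rw [h.apply_D_A hw1, h.apply_D, h.apply_A hw1] at h1
  linear_combination h1

/-- The commutator of `C` at `p j` and `B` at `p i` reduces the claim to the element of `C B` with
the two points exchanged and to two elements of `A D`. The two double sums for `A A` are equal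
because `A` commutes with itself, so they cancel. -/
theorem apply_B_C : φ (O.B (p i) (O.C (p j) h.ket)) =
    h.overlap * (O.rightEigenvalue p i j * O.rightEigenvalue p j i) *
      (entrySumC p η j i h.symm.residue h.residue - sin η / sin (p i - p j) *
        ((∑ c, h.symm.residue c) - ∑ c, h.residue c)) := by
  have h1 := LinearMap.congr_fun (O.CB (p j) (p i) (h.reg j) (h.reg i)) h.ket
  have h2 := congrArg φ h1
  simp only [LinearMap.smul_apply, LinearMap.sub_apply, Module.End.mul_apply, map_smul, map_sub,
    smul_eq_mul] at h2
  have h3 := h.symm.apply_C_B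
  change φ (O.C (p j) (O.B (p i) h.symm.ket)) = _ at h3
  have h4 := h.apply_A_D hw1
  have h5 := h.symm.apply_A_D hw1
  have h6 := h.apply_A_A
  change φ (O.A (p i) (O.A (p j) h.ket)) = _ at h6
  have h7 := h.symm.apply_A_A
  change φ (O.A (p j) (O.A (p i) h.symm.ket)) = _ at h7
  have h8 := LinearMap.congr_fun (O.AA (p i) (p j) (h.reg i) (h.reg j)).eq h.ket
  simp only [Module.End.mul_apply] at h8
  rw [h.ket_symm, h.overlap_symm] at h3 h5 h7
  rw [h8, h7] at h6
  have hs := h.sin_ne i j h.ne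
  change φ (O.B (p i) (O.C (p j) h.ket)) = _
  rw [h3, h4, h5] at h2
  refine mul_left_cancel₀ hs ?_
  field_simp
  linear_combination (-1 : ℂ) * h2 - sin η * h6

/-- The factorized form of the nonzero matrix elements. -/
theorem factorizedMatrix_eq {q u v : ℂ} (hq : q = exp (I * η)) (hu : u = exp (I * p i))
    (hv : v = exp (I * p j)) (hp0 : w ^ 2 * q ^ 2 - 1 ≠ 0) (hm0 : w ^ 2 - q ^ 2 ≠ 0) {N : ℂ}
    (hN : N = h.overlap * (O.rightEigenvalue p i j * O.rightEigenvalue p j i)) :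
    factorizedMatrix q (u / v) (w * q - w⁻¹ * q⁻¹) (w - w⁻¹) (q * w⁻¹ - q⁻¹ * w)
      (∑ c, h.residue c) (∑ c, h.symm.residue c)
      (-I * residuePsi w η (L i / O.rightEigenvalue p i j) (L j / O.rightEigenvalue p j i)
        (actionCoeff p η O.a (univ.erase j) i / O.rightEigenvalue p i j) (p i) (p j) p
        h.symm.residue)
      (-I * residuePsi w η (L j / O.rightEigenvalue p j i) (L i / O.rightEigenvalue p i j)
        (actionCoeff p η O.a (univ.erase i) j / O.rightEigenvalue p j i) (p j) (p i) p
        h.residue) =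
    ofArray !![φ (O.A (p i) (O.A (p j) h.ket)) / N, 0, 0, 0;
      0, φ (O.A (p i) (O.D (p j) h.ket)) / N, φ (O.B (p i) (O.C (p j) h.ket)) / N, 0;
      0, φ (O.C (p i) (O.B (p j) h.ket)) / N, φ (O.D (p i) (O.A (p j) h.ket)) / N, 0;
      0, 0, 0, φ (O.D (p i) (O.D (p j) h.ket)) / N] := by
  have hs := h.sin_ne i j h.ne
  have hu0 : u ≠ 0 := hu ▸ exp_ne_zero _
  have hv0 : v ≠ 0 := hv ▸ exp_ne_zero _
  have hq0 : q ≠ 0 := hq ▸ exp_ne_zero _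
  have hsin : sin (p i - p j) = -I / 2 * (u / v - v / u) := by
    rw [sin_sub_eq_exp, hu, hv]; ring
  have hsη : sin η = -I / 2 * (q - q⁻¹) := by
    have := sin_sub_eq_exp η 0
    rw [sub_zero, mul_zero, Complex.exp_zero, ← hq] at this
    rw [this]; ring
  have hI2 : -I / 2 ≠ 0 := div_ne_zero (neg_ne_zero.2 I_ne_zero) two_ne_zero
  have hratio : sin η / sin (p i - p j) = (q - q⁻¹) / (u / v - v / u) := by
    rw [hsη, hsin, mul_div_mul_left _ _ hI2]
  have huv : u ^ 2 - v ^ 2 ≠ 0 := by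
    intro h0
    apply hs
    rw [hsin, show u / v - v / u = (u ^ 2 - v ^ 2) / (u * v) by field_simp, h0]
    ring
  have hN0 : N ≠ 0 := by
    rw [hN]; exact mul_ne_zero h.overlap_ne (mul_ne_zero h.right_ne₁ h.right_ne₂)
  have hdata := h.isResiduePair.isEntryData h.ne h.w_ne h.sin_ne h.shift_ne hq hu hv
  have hAA := h.apply_A_A
  change φ (O.A (p i) (O.A (p j) h.ket)) = _ at hAA
  have hCB := h.apply_C_B
  change φ (O.C (p i) (O.B (p j) h.ket)) = _ at hCB
  rw [hdata.factorizedMatrix_eq hq0 h.w_ne hu0 hv0 huv hw1 hp0 hm0, hAA, hCB, h.apply_A_D hw1,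
    h.apply_D_A hw1, h.apply_D_D hw1, h.apply_B_C hw1, hratio, ← hN]
  simp only [mul_div_cancel_left₀ _ hN0]

end BetheOperators.IsTwoPoint

end XXZ

/-! ### From contour integrals to sums over residues -/

namespace XXZ

open Complex Finset

theorem analyticAt_cot {z : ℂ} (hz : sin z ≠ 0) : AnalyticAt ℂ cot z := by
  have : (cot : ℂ → ℂ) = fun z => cos z / sin z := funext fun z => Complex.cot_eq_cos_div_sin z
  rw [this]
  exact analyticAt_cos.div analyticAt_sin hz

theorem analyticAt_cot_comp {f : ℂ → ℂ} {z : ℂ} (hf : AnalyticAt ℂ f z) (hz : sin (f z) ≠ 0) :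
    AnalyticAt ℂ (fun z => cot (f z)) z :=
  (analyticAt_cot hz).comp hf

theorem tendsto_sub_div_sin (p : ℂ) :
    Tendsto (fun z => (z - p) / sin (z - p)) (𝓝[≠] p) (𝓝 1) := by
  have h1 : HasDerivAt (fun z => sin (z - p)) 1 p := by
    have := (((hasDerivAt_id' p).sub_const p).csin)
    simpa using this
  have h2 := (hasDerivAt_iff_tendsto_slope.1 h1).inv₀ one_ne_zero
  rw [inv_one] at h2
  refine h2.congr fun z => ?_
  rw [slope_def_field, sub_self, Complex.sin_zero, sub_zero, inv_div]

theorem tendsto_sub_mul_cot (p : ℂ) :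
    Tendsto (fun z => (z - p) * cot (z - p)) (𝓝[≠] p) (𝓝 1) := by
  have h1 : Tendsto (fun z => cos (z - p)) (𝓝[≠] p) (𝓝 1) := by
    have : ContinuousAt (fun z => cos (z - p)) p := by fun_prop
    have := this.tendsto.mono_left (nhdsWithin_le_nhds (s := {p}ᶜ))
    simpa using this
  have h2 := (tendsto_sub_div_sin p).mul h1
  rw [mul_one] at h2
  refine h2.congr fun z => ?_
  rw [Complex.cot_eq_cos_div_sin]; ring

theorem _root_.AnalyticAt.tendsto_punctured {f : ℂ → ℂ} {p : ℂ} (hf : AnalyticAt ℂ f p) :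
    Tendsto f (𝓝[≠] p) (𝓝 (f p)) :=
  hf.continuousAt.tendsto.mono_left nhdsWithin_le_nhds

theorem tendsto_sub_mul_analyticAt {f : ℂ → ℂ} {p : ℂ} (hf : AnalyticAt ℂ f p) :
    Tendsto (fun z => (z - p) * f z) (𝓝[≠] p) (𝓝 0) := by
  have h : AnalyticAt ℂ (fun z => (z - p) * f z) p :=
    (analyticAt_id.sub analyticAt_const).mul hf
  simpa using h.tendsto_punctured

variable {ι : Type*}

theorem Contour.integral_eq_sum [Fintype ι] {C : Contour} {f : ℂ → ℂ} {p res : ι → ℂ}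
    (hp : Function.Injective p) (hP : ∀ c, p c ∈ C.inside) (hne : C.inside.Nonempty)
    (hf : ∀ z ∈ C.trace ∪ C.inside, (∀ c, z ≠ p c) → AnalyticAt ℂ f z)
    (hres : ∀ c, Tendsto (fun z => (z - p c) * f z) (𝓝[≠] p c) (𝓝 (res c))) :
    C.integral f = 2 * Real.pi * I * ∑ c, res c := by
  have hinv : ∀ c, Function.extend p res 0 (p c) = res c := fun c => hp.extend_apply _ _ _
  rw [C.integral_eq_sum_residues (univ.image p) (Function.extend p res 0) _ hne,
    sum_image hp.injOn]
  · simp only [hinv]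
  · intro z hz hzP
    exact hf z hz fun c hc => hzP (hc ▸ mem_image_of_mem p (mem_univ c))
  · intro z hz
    obtain ⟨c, -, rfl⟩ := mem_image.1 hz
    rw [hinv]; exact hres c
  · intro z hz
    obtain ⟨c, -, rfl⟩ := mem_image.1 hz
    exact hP c

/-- The function `E` is meromorphic on and inside `C`, with simple poles with residues `r` at those
of the points `p` that differ from `p i`, `p j`. -/
structure IsMeromorphicDensity (C : Contour) (η : ℂ) (p : ι → ℂ) (i j : ι) (E : ℂ → ℂ)
    (r : ι → ℂ) : Prop where
  inside : ∀ c, p c ∈ C.inside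
  injective : Function.Injective p
  ne : i ≠ j
  shift : ∀ z ∈ C.trace ∪ C.inside, ∀ v ∈ C.trace ∪ C.inside, sin (z - v + η) ≠ 0
  period : ∀ z ∈ C.inside, ∀ v ∈ C.trace ∪ C.inside, sin (z - v) = 0 → z = v
  analytic : ∀ z ∈ C.trace ∪ C.inside, (∀ c, c ≠ i → c ≠ j → z ≠ p c) → AnalyticAt ℂ E z
  residue : ∀ c, c ≠ i → c ≠ j → Tendsto (fun z => (z - p c) * E z) (𝓝[≠] p c) (𝓝 (r c))

namespace IsMeromorphicDensity

variable {C : Contour} {η : ℂ} {p : ι → ℂ} {i j : ι} {E : ℂ → ℂ} {r : ι → ℂ}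

theorem symm (h : IsMeromorphicDensity C η p i j E r) : IsMeromorphicDensity C η p j i E r where
  inside := h.inside
  injective := h.injective
  ne := h.ne.symm
  shift := h.shift
  period := h.period
  analytic z hz hc := h.analytic z hz fun c hi hj => hc c hj hi
  residue c hj hi := h.residue c hi hj

variable (h : IsMeromorphicDensity C η p i j E r)

include h

theorem shift' {z v : ℂ} (hz : z ∈ C.trace ∪ C.inside) (hv : v ∈ C.trace ∪ C.inside) :
    sin (z - v - η) ≠ 0 := by
  intro h0
  apply h.shift v hv z hz
  rw [← neg_eq_zero, ← Complex.sin_neg, ← h0]; congr 1; ring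

theorem sin_ne {z : ℂ} (hz : z ∈ C.trace ∪ C.inside) {c : ι} (hc : z ≠ p c) : sin (z - p c) ≠ 0 := by
  intro h0
  refine hc (h.period _ (h.inside c) z hz ?_).symm
  rw [← neg_sub, Complex.sin_neg, h0, neg_zero]

theorem analyticAt_left : AnalyticAt ℂ E (p i) :=
  h.analytic _ (Or.inr (h.inside i)) fun _ hci _ hc => hci (h.injective hc).symm

/-- The density has its poles away from `p i` and `p j`, the function `f` only at these two points.
Every pole of the product is simple, and its residue is a residue of one factor times a value of the
other. -/
theorem integral_mul_eq [Fintype ι] {δ f : ℂ → ℂ} {si sj : ℂ} {y : ι → ℂ}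
    (hδ : ∀ z ∈ C.trace, δ z = E z / (2 * Real.pi * I))
    (hf : ∀ z ∈ C.trace ∪ C.inside, z ≠ p i → z ≠ p j → AnalyticAt ℂ f z)
    (hi : Tendsto (fun z => (z - p i) * f z) (𝓝[≠] p i) (𝓝 si))
    (hj : Tendsto (fun z => (z - p j) * f z) (𝓝[≠] p j) (𝓝 sj))
    (hy : ∀ c, c ≠ i → c ≠ j → y c = r c * f (p c)) (hyi : y i = E (p i) * si)
    (hyj : y j = E (p j) * sj) : C.integral (fun z => δ z * f z) = ∑ c, y c := by
  have hI := two_pi_I_ne_zero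
  have e : Set.EqOn (fun z => δ z * f z) (fun z => (2 * Real.pi * I)⁻¹ * (E z * f z)) C.trace := by
    intro z hz
    simp only [hδ z hz]; ring
  rw [C.integral_congr e, C.integral_eq_sum (res := fun c => (2 * Real.pi * I)⁻¹ * y c) h.injective
    h.inside ⟨_, h.inside i⟩, ← mul_sum, mul_inv_cancel_left₀ hI]
  · intro z hz hc
    exact analyticAt_const.mul ((h.analytic z hz fun c _ _ => hc c).mul (hf z hz (hc i) (hc j)))
  · intro c
    have key : Tendsto (fun z => (z - p c) * (E z * f z)) (𝓝[≠] p c) (𝓝 (y c)) := by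
      by_cases hci : c = i
      · subst hci
        rw [hyi]
        refine (h.analyticAt_left.tendsto_punctured.mul hi).congr fun z => by ring
      by_cases hcj : c = j
      · subst hcj
        rw [hyj]
        refine (h.symm.analyticAt_left.tendsto_punctured.mul hj).congr fun z => by ring
      · rw [hy c hci hcj]
        refine ((h.residue c hci hcj).mul (hf (p c) (Or.inr (h.inside c)) (h.injective.ne hci)
          (h.injective.ne hcj)).tendsto_punctured).congr fun z => by ring
    exact (key.const_mul _).congr fun z => by ring

variable {w : ℂ}

theorem analyticAt_cotKernel_left {v : ℂ} (hv : v ∈ C.trace ∪ C.inside) {z : ℂ}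
    (hz : z ∈ C.trace ∪ C.inside) : AnalyticAt ℂ (fun z => cotKernel w η (z - v)) z :=
  (analyticAt_const.mul (analyticAt_cot_comp ((analyticAt_id.sub analyticAt_const).sub
    analyticAt_const) (h.shift' hz hv))).sub
    (analyticAt_const.mul (analyticAt_cot_comp ((analyticAt_id.sub analyticAt_const).add
    analyticAt_const) (h.shift z hz v hv)))

theorem analyticAt_cotKernel_right {v : ℂ} (hv : v ∈ C.trace ∪ C.inside) {z : ℂ}
    (hz : z ∈ C.trace ∪ C.inside) : AnalyticAt ℂ (fun z => cotKernel w η (v - z)) z :=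
  (analyticAt_const.mul (analyticAt_cot_comp ((analyticAt_const.sub analyticAt_id).sub
    analyticAt_const) (h.shift' hv hz))).sub
    (analyticAt_const.mul (analyticAt_cot_comp ((analyticAt_const.sub analyticAt_id).add
    analyticAt_const) (h.shift v hv z hz)))

variable [Fintype ι]

theorem analyticAt_sum_cotKernel (u : ι → ℂ) {z : ℂ} (hz : z ∈ C.trace ∪ C.inside) :
    AnalyticAt ℂ (fun z => ∑ d, cotKernel w η (z - p d) * u d) z :=
  Finset.analyticAt_fun_sum _ fun d _ =>
    (h.analyticAt_cotKernel_left (Or.inr (h.inside d)) hz).mul analyticAt_const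

/-- The finite homogeneous system has only the trivial solution if the integral equation has a
unique solution. -/
theorem eq_zero_of_unique {δ f g : ℂ → ℂ} (hδ : ∀ z ∈ C.trace, δ z = E z / (2 * Real.pi * I))
    (hg : C.IsSolution (fun lam mu => cotKernel w η (lam - mu)) δ f g)
    (huniq : ∀ g', C.IsSolution (fun lam mu => cotKernel w η (lam - mu)) δ f g' →
      Set.EqOn g' g C.trace) {u : ι → ℂ} (hi : u i = 0) (hj : u j = 0)
    (hu : ∀ c, c ≠ i → c ≠ j → u c = -(r c * ∑ d, cotKernel w η (p c - p d) * u d)) : u = 0 := by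
  -- The extension of `u` to a function of `z`: by residues it solves the homogeneous integral
  -- equation, so it can be added to `g`.
  set v : ℂ → ℂ := fun z => -∑ d, cotKernel w η (z - p d) * u d with hv
  have hva : ∀ z ∈ C.trace ∪ C.inside, AnalyticAt ℂ v z := fun z hz =>
    (h.analyticAt_sum_cotKernel u hz).neg
  have hvc : ContinuousOn v C.trace := fun z hz =>
    (hva z (Or.inl hz)).continuousAt.continuousWithinAt
  have hδc : ContinuousOn δ C.trace := by
    refine ContinuousOn.congr (f := fun z => E z / (2 * Real.pi * I)) (fun z hz => ?_) hδ
    refine ((h.analytic z (Or.inl hz) fun c _ _ hc => ?_).div_const.continuousAt).continuousWithinAt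
    exact (hc ▸ h.inside c).1 hz
  have hint : ∀ lam ∈ C.trace,
      C.integral (fun mu => δ mu * cotKernel w η (lam - mu) * v mu) = -v lam := by
    intro lam hlam
    have hk : ∀ z ∈ C.trace ∪ C.inside, AnalyticAt ℂ (fun z => cotKernel w η (lam - z) * v z) z :=
      fun z hz => (h.analyticAt_cotKernel_right (Or.inl hlam) hz).mul (hva z hz)
    simp only [mul_assoc]
    rw [h.integral_mul_eq (y := fun c => cotKernel w η (lam - p c) * u c) hδ
      (fun z hz _ _ => hk z hz)
      (tendsto_sub_mul_analyticAt (hk _ (Or.inr (h.inside i))))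
      (tendsto_sub_mul_analyticAt (hk _ (Or.inr (h.inside j)))) _ (by simp [hi]) (by simp [hj]),
      hv, neg_neg]
    intro c hci hcj
    simp only [hv]
    rw [hu c hci hcj]; ring
  have hv0 : ∀ z ∈ C.trace, v z = 0 := by
    have h1 : C.IsSolution (fun lam mu => cotKernel w η (lam - mu)) δ f (fun z => g z + v z) := by
      refine ⟨hg.1.add hvc, fun lam hlam => ?_⟩
      have hkc : ContinuousOn (fun mu => δ mu * cotKernel w η (lam - mu)) C.trace :=
        hδc.mul fun z hz => (h.analyticAt_cotKernel_right (Or.inl hlam)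
          (Or.inl hz)).continuousAt.continuousWithinAt
      simp only [mul_add]
      rw [C.integral_add (f := fun mu => δ mu * cotKernel w η (lam - mu) * g mu)
        (g := fun mu => δ mu * cotKernel w η (lam - mu) * v mu) (hkc.mul hg.1) (hkc.mul hvc), hint lam hlam, hg.2 lam hlam]
      ring
    intro z hz
    have := huniq _ h1 hz
    simpa using this
  -- Uniqueness gives only that `v` vanishes on the contour. As `v` is holomorphic inside, Cauchy's
  -- formula transports this to the points of the finite system.
  have hvin : ∀ c, v (p c) = 0 := by
    intro c
    have h1 := C.integral_div_sub hva (h.inside c)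
    have h2 : C.integral (fun z => v z / (z - p c)) = C.integral fun z => (0 : ℂ) * 0 :=
      C.integral_congr fun z hz => by simp [hv0 z hz]
    rw [h2, C.integral_const_mul, zero_mul] at h1
    exact (mul_eq_zero.1 h1.symm).resolve_left two_pi_I_ne_zero
  funext c
  by_cases hci : c = i
  · rw [hci, hi]; rfl
  by_cases hcj : c = j
  · rw [hcj, hj]; rfl
  have := hvin c
  rw [hv, neg_eq_zero] at this
  rw [hu c hci hcj, this]; simp

omit [Fintype ι] in
theorem analyticAt_source {ρ z : ℂ} (hz : z ∈ C.trace ∪ C.inside) (hi : z ≠ p i) :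
    AnalyticAt ℂ (source w η ρ (p i)) z :=
  (analyticAt_const.mul (analyticAt_cot_comp ((analyticAt_id.sub analyticAt_const).add
    analyticAt_const) (h.shift z hz _ (Or.inr (h.inside i))))).sub
    (analyticAt_const.mul (analyticAt_cot_comp (analyticAt_id.sub analyticAt_const)
    (h.sin_ne hz hi)))

theorem analyticAt_residueG {ρ z : ℂ} {y : ι → ℂ} (hz : z ∈ C.trace ∪ C.inside) (hi : z ≠ p i) :
    AnalyticAt ℂ (residueG w η ρ (p i) p y) z :=
  (h.analyticAt_source hz hi).sub (h.analyticAt_sum_cotKernel y hz)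

omit [Fintype ι] h in
theorem tendsto_sub_mul_add_cot {f g : ℂ → ℂ} {ρ z₀ : ℂ} (hf : AnalyticAt ℂ f z₀)
    (hg : ∀ z, g z = f z - ρ * cot (z - z₀)) :
    Tendsto (fun z => (z - z₀) * g z) (𝓝[≠] z₀) (𝓝 (-ρ)) := by
  have h1 := (tendsto_sub_mul_analyticAt hf).sub ((tendsto_sub_mul_cot z₀).const_mul ρ)
  rw [mul_one, zero_sub] at h1
  refine h1.congr fun z => ?_
  rw [hg]; ring

theorem tendsto_sub_mul_residueG {ρ : ℂ} {y : ι → ℂ} :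
    Tendsto (fun z => (z - p i) * residueG w η ρ (p i) p y z) (𝓝[≠] p i) (𝓝 (-ρ)) := by
  have hi : p i ∈ C.trace ∪ C.inside := Or.inr (h.inside i)
  refine tendsto_sub_mul_add_cot (f := fun z => w⁻¹ * cot (z - p i + η) -
    ∑ d, cotKernel w η (z - p d) * y d) ?_ fun z => ?_
  · exact (analyticAt_const.mul (analyticAt_cot_comp ((analyticAt_id.sub analyticAt_const).add
      analyticAt_const) (h.shift _ hi _ hi))).sub (h.analyticAt_sum_cotKernel y hi)
  · rw [residueG, source]; ring

section

variable {δ : ℂ → ℂ} (hδ : ∀ z ∈ C.trace, δ z = E z / (2 * Real.pi * I)) {ρ : ℂ} {y : ι → ℂ}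
  (hy : ∀ c, c ≠ i → c ≠ j → y c = r c * residueG w η ρ (p i) p y (p c))
  (hi : y i = -(E (p i) * ρ)) (hj : y j = 0)

include hδ hy hi hj

/-- At `p i` the pole is that of `G`, with residue `-ρ`; at `p j` nothing is singular. This explains
the values `-(E (p i) * ρ)` and `0` prescribed for `y`. -/
theorem integral_mul_residueG {f : ℂ → ℂ} (hf : ∀ z ∈ C.trace ∪ C.inside, AnalyticAt ℂ f z) :
    C.integral (fun z => δ z * (f z * residueG w η ρ (p i) p y z)) = ∑ c, f (p c) * y c := by
  have hpi : p i ∈ C.trace ∪ C.inside := Or.inr (h.inside i)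
  have hpj : p j ∈ C.trace ∪ C.inside := Or.inr (h.inside j)
  refine h.integral_mul_eq (si := f (p i) * -ρ) (sj := 0) hδ
    (fun z hz hzi _ => (hf z hz).mul (h.analyticAt_residueG hz hzi)) ?_
    (tendsto_sub_mul_analyticAt ((hf _ hpj).mul
      (h.analyticAt_residueG hpj (h.injective.ne h.ne.symm)))) ?_ ?_ ?_
  · exact ((hf _ hpi).tendsto_punctured.mul h.tendsto_sub_mul_residueG).congr fun z => by ring
  · intro c hci hcj
    rw [hy c hci hcj]; ring
  · rw [hi]; ring
  · rw [hj]; ring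

/-- The finite system yields a solution of the integral equation. -/
theorem isSolution_residueG : C.IsSolution (fun lam mu => cotKernel w η (lam - mu)) δ
    (source w η ρ (p i)) (residueG w η ρ (p i) p y) := by
  refine ⟨fun z hz => ?_, fun lam hlam => ?_⟩
  · refine (h.analyticAt_residueG (Or.inl hz) ?_).continuousAt.continuousWithinAt
    rintro rfl
    exact (h.inside i).1 hz
  · simp only [mul_assoc]
    rw [h.integral_mul_residueG hδ hy hi hj fun z hz =>
      h.analyticAt_cotKernel_right (Or.inl hlam) hz, residueG]

theorem integral_residueG : C.integral (fun z => δ z * residueG w η ρ (p i) p y z) = ∑ c, y c := by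
  have := h.integral_mul_residueG hδ hy hi hj (f := fun _ => 1) fun z _ => analyticAt_const
  simpa using this

/-- The unshifted cotangent adds a simple pole at `p j`, whose residue is the last term of
`residuePsi`. In the sum the summand at `j` is harmless because `y j = 0`. -/
theorem integral_psi {ρ' : ℂ} : C.integral (fun z => δ z *
    (w * cot (z - p j + η) - ρ' * cot (z - p j)) * residueG w η ρ (p i) p y z) =
    residuePsi w η ρ' ρ (E (p j) * ρ') (p j) (p i) p y := by
  have hpi : p i ∈ C.trace ∪ C.inside := Or.inr (h.inside i)
  have hpj : p j ∈ C.trace ∪ C.inside := Or.inr (h.inside j)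
  classical
  have hw : ∀ z ∈ C.trace ∪ C.inside, AnalyticAt ℂ (fun z => w * cot (z - p j + η)) z :=
    fun z hz => analyticAt_const.mul (analyticAt_cot_comp ((analyticAt_id.sub
      analyticAt_const).add analyticAt_const) (h.shift z hz _ hpj))
  have hpsi : ∀ z ∈ C.trace ∪ C.inside, z ≠ p j →
      AnalyticAt ℂ (fun z => w * cot (z - p j + η) - ρ' * cot (z - p j)) z :=
    fun z hz hzj => (hw z hz).sub (analyticAt_const.mul (analyticAt_cot_comp
      (analyticAt_id.sub analyticAt_const) (h.sin_ne hz hzj)))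
  simp only [mul_assoc]
  rw [h.integral_mul_eq (si := (w * cot (p i - p j + η) - ρ' * cot (p i - p j)) * -ρ)
    (sj := -ρ' * residueG w η ρ (p i) p y (p j))
    (y := fun c => y c * (w * cot (p c - p j + η) - ρ' * cot (p c - p j)) -
      if c = j then E (p j) * ρ' * residueG w η ρ (p i) p y (p j) else 0) hδ, sum_sub_distrib,
    sum_ite_eq' univ j, if_pos (mem_univ j), residuePsi]
  · exact fun z hz hzi hzj => (hpsi z hz hzj).mul (h.analyticAt_residueG hz hzi)
  · exact ((hpsi _ hpi (h.injective.ne h.ne)).tendsto_punctured.mul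
      h.tendsto_sub_mul_residueG).congr fun z => by ring
  · exact ((tendsto_sub_mul_add_cot (hw _ hpj) fun z => rfl).mul
      (h.analyticAt_residueG hpj (h.injective.ne h.ne.symm)).tendsto_punctured).congr
        fun z => by ring
  · intro c hci hcj
    rw [if_neg hcj, hy c hci hcj]; ring
  · rw [if_neg h.ne, hi]; ring
  · rw [if_pos rfl, hj]; ring

end

end IsMeromorphicDensity

end XXZ

/-! ### Two-point data inside a contour -/

namespace XXZ

open Complex Finset

namespace BetheOperators

variable {V : Type*} [AddCommGroup V] [Module ℂ V] {η : ℂ} {C : Contour}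
  (O : BetheOperators V η (· ∈ C.trace ∪ C.inside)) {ι : Type*} [Fintype ι] [DecidableEq ι]
  (p : ι → ℂ)

/-- The function whose residues at the Bethe roots enter the finite linear systems. -/
noncomputable def contourDensity (L : ℂ → ℂ) (i j : ι) (z : ℂ) : ℂ :=
  O.a z * (∏ l ∈ (univ.erase i).erase j, (sin (z - p l + η) / sin (z - p l))) / L z

/-- The data of a form factor whose spectral parameters and Bethe roots are inside a contour: the
functions `L` and `Λ` are the eigenvalues of the left vector and of the right vector. -/
structure IsContourTwoPoint (w : ℂ) (i j : ι) (φ : V →ₗ[ℂ] ℂ) (L Λ : ℂ → ℂ) : Prop where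
  inside : ∀ c, p c ∈ C.inside
  injective : Function.Injective p
  ne : i ≠ j
  shift : ∀ z ∈ C.trace ∪ C.inside, ∀ v ∈ C.trace ∪ C.inside, sin (z - v + η) ≠ 0
  period : ∀ z ∈ C.inside, ∀ v ∈ C.trace ∪ C.inside, sin (z - v) = 0 → z = v
  w_ne : w ≠ 0
  a_analytic : ∀ z ∈ C.trace ∪ C.inside, AnalyticAt ℂ O.a z
  left_analytic : ∀ z ∈ C.trace ∪ C.inside, AnalyticAt ℂ L z
  left_ne : ∀ z ∈ C.trace ∪ C.inside, L z ≠ 0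
  left_eigen : ∀ z ∈ C.trace ∪ C.inside, ∀ v, φ (w • O.A z v + w⁻¹ • O.D z v) = L z * φ v
  bethe : ∀ c, c ≠ i → c ≠ j → actionCoeff p η O.a ((univ.erase i).erase j) c =
    actionCoeff p (-η) O.d ((univ.erase i).erase j) c
  coeff_ne : ∀ c, c ≠ i → c ≠ j → actionCoeff p η O.a ((univ.erase i).erase j) c ≠ 0
  right_eigen : ∀ hp : (∀ c, p c ∈ C.trace ∪ C.inside), ∀ z ∈ C.trace ∪ C.inside,
    O.A z (O.betheVector p hp ((univ.erase i).erase j)) +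
      O.D z (O.betheVector p hp ((univ.erase i).erase j)) =
      Λ z • O.betheVector p hp ((univ.erase i).erase j)
  right_ne₁ : Λ (p i) ≠ 0
  right_ne₂ : Λ (p j) ≠ 0
  overlap_ne : ∀ hp : (∀ c, p c ∈ C.trace ∪ C.inside),
    φ (O.betheVector p hp ((univ.erase i).erase j)) ≠ 0

namespace IsContourTwoPoint

variable {O p} {w : ℂ} {i j : ι} {φ : V →ₗ[ℂ] ℂ} {L Λ : ℂ → ℂ}

theorem symm (h : O.IsContourTwoPoint p w i j φ L Λ) : O.IsContourTwoPoint p w j i φ L Λ where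
  inside := h.inside
  injective := h.injective
  ne := h.ne.symm
  shift := h.shift
  period := h.period
  w_ne := h.w_ne
  a_analytic := h.a_analytic
  left_analytic := h.left_analytic
  left_ne := h.left_ne
  left_eigen := h.left_eigen
  bethe c hj hi := by rw [erase_right_comm]; exact h.bethe c hi hj
  coeff_ne c hj hi := by rw [erase_right_comm]; exact h.coeff_ne c hi hj
  right_eigen := by rw [erase_right_comm]; exact h.right_eigen
  right_ne₁ := h.right_ne₂
  right_ne₂ := h.right_ne₁
  overlap_ne := by rw [erase_right_comm]; exact h.overlap_ne

variable (h : O.IsContourTwoPoint p w i j φ L Λ)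

include h

theorem mem (c : ι) : p c ∈ C.trace ∪ C.inside := Or.inr (h.inside c)

theorem sin_ne (c d : ι) (hcd : c ≠ d) : sin (p c - p d) ≠ 0 := fun h0 =>
  hcd (h.injective (h.period _ (h.inside c) _ (h.mem d) h0))

theorem isMeromorphicDensity : IsMeromorphicDensity C η p i j (O.contourDensity p L i j)
    (O.residueCoeff p i j fun c => L (p c)) where
  inside := h.inside
  injective := h.injective
  ne := h.ne
  shift := h.shift
  period := h.period
  analytic z hz hc := by
    refine ((h.a_analytic z hz).mul (Finset.analyticAt_fun_prod _ fun l hl => ?_)).div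
      (h.left_analytic z hz) (h.left_ne z hz)
    rw [mem_erase, mem_erase] at hl
    refine (analyticAt_sin.comp ((analyticAt_id.sub analyticAt_const).add analyticAt_const)).div
      (analyticAt_sin.comp (analyticAt_id.sub analyticAt_const)) fun h0 => hc l hl.2.1 hl.1 ?_
    refine (h.period _ (h.inside l) z hz ?_).symm
    rw [← neg_sub, Complex.sin_neg]
    exact neg_eq_zero.2 h0
  residue c hci hcj := by
    have hcR : c ∈ (univ.erase i).erase j := mem_erase.2 ⟨hcj, mem_erase.2 ⟨hci, mem_univ c⟩⟩
    have h1 : AnalyticAt ℂ (fun z => O.a z * (∏ l ∈ ((univ.erase i).erase j).erase c,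
        (sin (z - p l + η) / sin (z - p l))) * sin (z - p c + η) / L z) (p c) := by
      refine (((h.a_analytic _ (h.mem c)).mul
        (Finset.analyticAt_fun_prod _ fun l hl => ?_)).mul ?_).div
        (h.left_analytic _ (h.mem c)) (h.left_ne _ (h.mem c))
      · exact (analyticAt_sin.comp ((analyticAt_id.sub analyticAt_const).add analyticAt_const)).div
          (analyticAt_sin.comp (analyticAt_id.sub analyticAt_const))
          (h.sin_ne c l (mem_erase.1 hl).1.symm)
      · exact analyticAt_sin.comp ((analyticAt_id.sub analyticAt_const).add analyticAt_const)
    have h2 := (tendsto_sub_div_sin (p c)).mul h1.tendsto_punctured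
    simp only [sub_self, zero_add, one_mul] at h2
    rw [residueCoeff, actionCoeff]
    refine h2.congr fun z => ?_
    rw [contourDensity, ← mul_prod_erase _ _ hcR]
    ring

/-- Both numbers are eigenvalues of `A + D` at `p i` on the same vector, which is non-zero because
its overlap with `φ` is. -/
theorem rightEigenvalue_eq : O.rightEigenvalue p i j = Λ (p i) := by
  have h1 := O.apply_add_apply_betheVector h.mem h.sin_ne
    (fun c d => h.shift _ (h.mem c) _ (h.mem d)) (S := univ.erase j) (i := i)
    (mem_erase.2 ⟨h.ne, mem_univ i⟩) fun c hc => by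
      rw [mem_erase, mem_erase] at hc
      rw [erase_right_comm]
      exact h.bethe c hc.1 hc.2.1
  have h2 := h.right_eigen h.mem (p i) (h.mem i)
  have h3 := h.overlap_ne h.mem
  rw [erase_right_comm] at h2 h3
  rw [h2] at h1
  have h4 := congrArg φ h1
  rw [map_smul, map_smul, smul_eq_mul, smul_eq_mul] at h4
  exact (mul_right_cancel₀ h3 h4).symm

omit h in
theorem contourDensity_left : O.contourDensity p L i j (p i) =
    actionCoeff p η O.a (univ.erase j) i / L (p i) := by
  rw [contourDensity, actionCoeff, erase_right_comm]

omit h in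
theorem contourDensity_symm : O.contourDensity p L j i = O.contourDensity p L i j := by
  funext z; rw [contourDensity, contourDensity, erase_right_comm]

variable {δ g₁ g₂ : ℂ → ℂ}
  (hδ : ∀ z ∈ C.trace, δ z = O.contourDensity p L i j z / (2 * Real.pi * I))
  (hg₁ : C.IsSolution (fun lam mu => cotKernel w η (lam - mu)) δ
    (source w η (L (p i) / Λ (p i)) (p i)) g₁)
  (hu₁ : ∀ g', C.IsSolution (fun lam mu => cotKernel w η (lam - mu)) δ
    (source w η (L (p i) / Λ (p i)) (p i)) g' → Set.EqOn g' g₁ C.trace)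
  (hu₂ : ∀ g', C.IsSolution (fun lam mu => cotKernel w η (lam - mu)) δ
    (source w η (L (p j) / Λ (p j)) (p j)) g' → Set.EqOn g' g₂ C.trace)

-- Uniqueness for one source already gives uniqueness for the finite system, since only the
-- homogeneous equation matters.
include hδ hg₁ hu₁ in
theorem isTwoPoint : O.IsTwoPoint p w i j φ fun c => L (p c) where
  reg := h.mem
  ne := h.ne
  w_ne := h.w_ne
  sin_ne := h.sin_ne
  shift_ne c d := h.shift _ (h.mem c) _ (h.mem d)
  left_eigen a v := h.left_eigen _ (h.mem a) v
  left_ne a := h.left_ne _ (h.mem a)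
  bethe := h.bethe
  coeff_ne := h.coeff_ne
  right_ne₁ := by rw [h.rightEigenvalue_eq]; exact h.right_ne₁
  right_ne₂ := by rw [h.symm.rightEigenvalue_eq]; exact h.right_ne₂
  overlap_ne := h.overlap_ne h.mem
  unique u hi hj hu := h.isMeromorphicDensity.eq_zero_of_unique hδ hg₁ hu₁ hi hj hu

theorem residue_left_eq (h' : O.IsTwoPoint p w i j φ fun c => L (p c)) :
    h'.residue i = -(O.contourDensity p L i j (p i) * (L (p i) / Λ (p i))) := by
  have h1 := h.left_ne _ (h.mem i)
  rw [h'.residue_left, contourDensity_left, h.rightEigenvalue_eq]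
  field_simp

include hδ hu₁

/-- The residues built from overlaps solve the finite system and hence produce a solution of the
integral equation. By uniqueness this solution is `g₁`, which connects overlaps with contour
integrals. -/
theorem eqOn_residueG (h' : O.IsTwoPoint p w i j φ fun c => L (p c)) :
    Set.EqOn (residueG w η (L (p i) / Λ (p i)) (p i) p h'.residue) g₁ C.trace := by
  refine hu₁ _ (h.isMeromorphicDensity.isSolution_residueG hδ (fun c hci hcj => ?_)
    (h.residue_left_eq h') h'.residue_right)
  rw [h'.residue_eq hci hcj, h.rightEigenvalue_eq]

theorem integral_solution (h' : O.IsTwoPoint p w i j φ fun c => L (p c)) :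
    C.integral (fun z => δ z * g₁ z) = ∑ c, h'.residue c := by
  rw [← h.isMeromorphicDensity.integral_residueG (w := w) hδ (fun c hci hcj => ?_)
    (h.residue_left_eq h') h'.residue_right]
  · exact C.integral_congr fun z hz => by
      simp only [h.eqOn_residueG hδ hu₁ h' hz]
  · rw [h'.residue_eq hci hcj, h.rightEigenvalue_eq]

theorem integral_psi_solution (h' : O.IsTwoPoint p w i j φ fun c => L (p c)) :
    C.integral (fun z => δ z * (w * cot (z - p j + η) - L (p j) / Λ (p j) * cot (z - p j)) *
      g₁ z) = residuePsi w η (L (p j) / O.rightEigenvalue p j i)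
        (L (p i) / O.rightEigenvalue p i j)
        (actionCoeff p η O.a (univ.erase i) j / O.rightEigenvalue p j i) (p j) (p i) p
        h'.residue := by
  have h1 := h.left_ne _ (h.mem j)
  have e : actionCoeff p η O.a (univ.erase i) j / O.rightEigenvalue p j i =
      O.contourDensity p L i j (p j) * (L (p j) / Λ (p j)) := by
    rw [← contourDensity_symm, contourDensity_left, h.symm.rightEigenvalue_eq]
    field_simp
  rw [e, h.symm.rightEigenvalue_eq, h.rightEigenvalue_eq,
    ← h.isMeromorphicDensity.integral_psi (w := w) hδ (fun c hci hcj => ?_)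
    (h.residue_left_eq h') h'.residue_right]
  · exact C.integral_congr fun z hz => by
      simp only [h.eqOn_residueG hδ hu₁ h' hz]
  · rw [h'.residue_eq hci hcj, h.rightEigenvalue_eq]

include hg₁ hu₂

/-- The factorization of the two-site matrix elements in terms of contour integrals. -/
theorem factorizedMatrix_eq (hp : ∀ c, p c ∈ C.trace ∪ C.inside) {q u v X₁ X₂ : ℂ}
    (hw1 : w ^ 2 - 1 ≠ 0)
    (hq : q = exp (I * η)) (hu : u = exp (I * p i)) (hv : v = exp (I * p j))
    (hp0 : w ^ 2 * q ^ 2 - 1 ≠ 0) (hm0 : w ^ 2 - q ^ 2 ≠ 0)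
    (ket : V) (hket : ket = O.betheVector p hp ((univ.erase i).erase j))
    (N : ℂ) (hN : N = φ ket * (Λ (p i) * Λ (p j)))
    (hX₁ : X₁ = C.integral fun z => δ z *
      (w * cot (z - p i + η) - L (p i) / Λ (p i) * cot (z - p i)) * g₂ z)
    (hX₂ : X₂ = C.integral fun z => δ z *
      (w * cot (z - p j + η) - L (p j) / Λ (p j) * cot (z - p j)) * g₁ z) :
    factorizedMatrix q (u / v) (w * q - w⁻¹ * q⁻¹) (w - w⁻¹) (q * w⁻¹ - q⁻¹ * w)
      (C.integral fun z => δ z * g₁ z) (C.integral fun z => δ z * g₂ z) (-I * X₁) (-I * X₂) =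
    ofArray !![φ (O.A (p i) (O.A (p j) ket)) / N, 0, 0, 0;
      0, φ (O.A (p i) (O.D (p j) ket)) / N, φ (O.B (p i) (O.C (p j) ket)) / N, 0;
      0, φ (O.C (p i) (O.B (p j) ket)) / N, φ (O.D (p i) (O.A (p j) ket)) / N, 0;
      0, 0, 0, φ (O.D (p i) (O.D (p j) ket)) / N] := by
  have h' := h.isTwoPoint hδ hg₁ hu₁
  have hδ' : ∀ z ∈ C.trace, δ z = O.contourDensity p L j i z / (2 * Real.pi * I) := by
    rw [contourDensity_symm]; exact hδ
  have h1 := h'.factorizedMatrix_eq hw1 hq hu hv hp0 hm0 (N := N) (by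
    rw [h.rightEigenvalue_eq, h.symm.rightEigenvalue_eq, hN, hket]; rfl)
  rw [hX₁, hX₂, h.integral_psi_solution hδ hu₁ h', h.symm.integral_psi_solution hδ' hu₂ h'.symm,
    h.integral_solution hδ hu₁ h', h.symm.integral_solution hδ' hu₂ h'.symm, h1, hket]
  rfl

end IsContourTwoPoint

end BetheOperators

end XXZ

/-! ### Matrix elements of the six-vertex monodromy matrix -/

namespace XXZ

open Complex Finset

theorem actionCoeff_map {κ ι : Type*} [DecidableEq κ] [DecidableEq ι] (e : κ ↪ ι) (p : ι → ℂ)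
    (ε : ℂ) (x : ℂ → ℂ) (S : Finset κ) (k : κ) :
    actionCoeff p ε x (S.map e) (e k) = actionCoeff (fun k => p (e k)) ε x S k := by
  rw [actionCoeff, actionCoeff, ← map_erase, prod_map]

theorem erase_inl_erase_inl (K : ℕ) : ((univ : Finset (Fin 2 ⊕ Fin K)).erase (Sum.inl 0)).erase
    (Sum.inl 1) = univ.map Function.Embedding.inr := by
  ext c
  rcases c with c | c
  · fin_cases c <;> simp
  · simp

theorem univ_erase_none (K : ℕ) :
    (univ : Finset (Option (Fin K))).erase none = univ.map Function.Embedding.some := by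
  ext c
  cases c <;> simp

/-- A matrix element between the left eigenvector of a state `left` at twist `τ'` and the right
eigenvector of a state `right` at twist `τ`, and a contour for it. -/
structure IsMatrixElement {K : ℕ} (γ : ℂ) (σ : Fin (2 * K) → ℤˣ) (ν : Fin (2 * K) → ℂ) (τ τ' : ℂ)
    (right left : StateData K) (C : Contour) : Prop where
  right_state : IsBetheEigenstate γ σ ν τ right
  left_state : IsBetheEigenstate γ σ ν τ' left
  overlap_ne : dotProduct left.bra right.ket ≠ 0
  shift : ∀ z ∈ C.trace ∪ C.inside, ∀ w ∈ C.trace ∪ C.inside, sin (z - w + I * γ) ≠ 0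
  period : ∀ z ∈ C.inside, ∀ w ∈ C.trace ∪ C.inside, sin (z - w) = 0 → z = w
  inhom : ∀ j, ν j ∈ C.inside
  roots : ∀ j, right.roots j ∈ C.inside
  aux_ne : ∀ z ∈ C.trace, 1 + auxFun γ σ ν τ right.roots z ≠ 0
  left_ne : ∀ z ∈ C.trace ∪ C.inside, left.eigenvalue z ≠ 0

namespace IsMatrixElement

variable {K : ℕ} {γ : ℂ} {σ : Fin (2 * K) → ℤˣ} {ν : Fin (2 * K) → ℂ} {τ τ' : ℂ}
  {right left : StateData K} {C : Contour}
  (h : IsMatrixElement γ σ ν τ τ' right left C)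

include h

theorem shift' {z v : ℂ} (hz : z ∈ C.trace ∪ C.inside) (hv : v ∈ C.trace ∪ C.inside) :
    sin (z - v - I * γ) ≠ 0 := by
  intro h0
  apply h.shift v hv z hz
  rw [← neg_eq_zero, ← Complex.sin_neg, ← h0]; congr 1; ring

theorem isRegularPoint (z : ℂ) (hz : z ∈ C.trace ∪ C.inside) : IsRegularPoint γ ν z := fun j =>
  ⟨h.shift z hz _ (Or.inr (h.inhom j)), h.shift' hz (Or.inr (h.inhom j))⟩

theorem sin_ne {z v : ℂ} (hz : z ∈ C.trace ∪ C.inside) (hv : v ∈ C.inside) (hzv : z ≠ v) :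
    sin (z - v) ≠ 0 := by
  intro h0
  refine hzv (h.period v hv z hz ?_).symm
  rw [← neg_sub, Complex.sin_neg, h0, neg_zero]

/-- The operators of the algebraic Bethe ansatz at the twist of the right state. -/
noncomputable def operators (h : IsMatrixElement γ σ ν τ τ' right left C) :
    BetheOperators ((Fin (2 * K) → Fin 2) → ℂ) (I * γ) (· ∈ C.trace ∪ C.inside) :=
  betheOperators γ σ ν τ (C.trace ∪ C.inside) h.isRegularPoint h.shift

theorem analyticAt_left {z : ℂ} (hz : z ∈ C.trace ∪ C.inside) : AnalyticAt ℂ left.eigenvalue z :=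
  analyticAt_eigenvalue_of_bra h.left_state.bra_ne h.left_state.bra_eigen (h.isRegularPoint z hz)

theorem analyticAt_right {z : ℂ} (hz : z ∈ C.trace ∪ C.inside) : AnalyticAt ℂ right.eigenvalue z :=
  analyticAt_eigenvalue_of_ket h.right_state.ket_ne h.right_state.ket_eigen (h.isRegularPoint z hz)

theorem analyticAt_vacA {z : ℂ} (hz : z ∈ C.trace ∪ C.inside) : AnalyticAt ℂ (vacA γ σ ν τ) z := by
  refine analyticAt_const.mul (Finset.analyticAt_fun_prod _ fun j _ => ?_)
  by_cases hj : σ j = 1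
  · simp only [hj, if_true]; exact analyticAt_const
  · simp only [hj, if_false]
    exact (analyticAt_sin.comp (analyticAt_id.sub analyticAt_const)).div
      (analyticAt_sin.comp ((analyticAt_id.sub analyticAt_const).add analyticAt_const))
      (h.isRegularPoint z hz j).1

theorem vacA_ne {z : ℂ} (hz : z ∈ C.trace) : vacA γ σ ν τ z ≠ 0 := by
  refine mul_ne_zero (Complex.exp_ne_zero _) (prod_ne_zero_iff.2 fun j _ => ?_)
  by_cases hj : σ j = 1
  · simp [hj]
  · simp only [hj, if_false]
    refine div_ne_zero (h.sin_ne (Or.inl hz) (h.inhom j) ?_) (h.isRegularPoint z (Or.inl hz) j).1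
    rintro rfl
    exact (h.inhom j).1 hz

theorem roots_injective : Function.Injective right.roots := by
  intro j k hjk
  by_contra hne
  exact h.right_state.distinct j k hne (by rw [hjk, sub_self, Complex.sin_zero])

/-- If the denominator of `𝔞` vanished at a root, the convention `x / 0 = 0` would give `𝔞 = 0`
instead of `-1`. Hence the denominator is non-zero and can be cleared. The factor with `l = k` is
`sin (-iγ)` on one side and `sin (iγ)` on the other, and its cancellation absorbs the sign of `-1`.
-/
theorem bethe_product (k : Fin K) :
    vacD γ σ ν τ (right.roots k) * ∏ l ∈ univ.erase k,
      sin (right.roots k - right.roots l + -(I * γ)) =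
      vacA γ σ ν τ (right.roots k) * ∏ l ∈ univ.erase k,
        sin (right.roots k - right.roots l + I * γ) ∧
    vacA γ σ ν τ (right.roots k) ≠ 0 := by
  have hk : right.roots k ∈ C.trace ∪ C.inside := Or.inr (h.roots k)
  have h0 : sin (I * γ) ≠ 0 := by simpa using h.shift _ hk _ hk
  have h1 := h.right_state.bethe k
  have hden : vacA γ σ ν τ (right.roots k) *
      ∏ l, sin (right.roots k - right.roots l + I * γ) ≠ 0 := by
    intro hden
    rw [auxFun, hden, div_zero] at h1
    norm_num at h1
  refine ⟨?_, left_ne_zero_of_mul hden⟩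
  rw [auxFun, div_eq_iff hden, ← mul_prod_erase _ _ (mem_univ k),
    ← mul_prod_erase _ _ (mem_univ k)] at h1
  simp only [sub_self, zero_sub, zero_add, Complex.sin_neg] at h1
  simp only [← sub_eq_add_neg]
  refine mul_left_cancel₀ h0 ?_
  linear_combination -h1

theorem bethe (k : Fin K) : actionCoeff right.roots (I * γ) (vacA γ σ ν τ) univ k =
    actionCoeff right.roots (-(I * γ)) (vacD γ σ ν τ) univ k := by
  rw [actionCoeff, actionCoeff, prod_div_distrib, prod_div_distrib, ← mul_div_assoc,
    ← mul_div_assoc, (h.bethe_product k).1]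

theorem coeff_ne (k : Fin K) : actionCoeff right.roots (I * γ) (vacA γ σ ν τ) univ k ≠ 0 := by
  refine mul_ne_zero (h.bethe_product k).2 (prod_ne_zero_iff.2 fun l hl => div_ne_zero ?_ ?_)
  · exact h.shift _ (Or.inr (h.roots k)) _ (Or.inr (h.roots l))
  · exact h.right_state.distinct k l (mem_erase.1 hl).1.symm

theorem betheVector_map {ι : Type*} [DecidableEq ι] (e : Fin K ↪ ι) (p : ι → ℂ)
    (hp : ∀ c, p c ∈ C.trace ∪ C.inside) :
    h.operators.betheVector p hp (univ.map e) = Matrix.mulVec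
      (List.ofFn fun k => monodromyEntry γ σ ν τ (p (e k)) 0 1).prod (refState σ) := by
  have h1 : univ.map e = ((List.finRange K).map e).toFinset := by ext; simp
  rw [h1, operators, betheVector_eq_mulVec _ _ hp ((List.nodup_finRange K).map e.injective),
    List.map_map, List.ofFn_eq_map]
  rfl

/-- The right eigenvector up to normalization. -/
noncomputable def vector (_ : IsMatrixElement γ σ ν τ τ' right left C) :
    (Fin (2 * K) → Fin 2) → ℂ :=
  Matrix.mulVec (List.ofFn fun j => monodromyEntry γ σ ν τ (right.roots j) 0 1).prod (refState σ)

theorem exists_ket_eq : ∃ c : ℂ, c ≠ 0 ∧ right.ket = c • h.vector := by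
  obtain ⟨c, hc⟩ := h.right_state.ket_bethe
  refine ⟨c, ?_, hc⟩
  rintro rfl
  exact h.right_state.ket_ne (by rw [hc, zero_smul])

theorem vector_ne : h.vector ≠ 0 := by
  obtain ⟨c, -, hc⟩ := h.exists_ket_eq
  intro h0
  exact h.right_state.ket_ne (by rw [hc, h0, smul_zero])

theorem overlap_vector_ne : dotProduct left.bra h.vector ≠ 0 := by
  obtain ⟨c, -, hc⟩ := h.exists_ket_eq
  intro h0
  exact h.overlap_ne (by rw [hc, dotProduct_smul, h0, smul_zero])

theorem vector_eigen (z : ℂ) (hz : z ∈ C.trace ∪ C.inside) :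
    h.operators.A z h.vector + h.operators.D z h.vector = right.eigenvalue z • h.vector := by
  obtain ⟨c, hc0, hc⟩ := h.exists_ket_eq
  have h1 := h.right_state.ket_eigen z (h.isRegularPoint z hz)
  rw [hc, Matrix.mulVec_smul, transferMatrix_mulVec, smul_comm] at h1
  exact smul_right_injective _ hc0 h1

/-- The eigenvalue of the right state in terms of its Bethe roots. -/
theorem right_eigenvalue_eq {z : ℂ} (hz : z ∈ C.trace) : right.eigenvalue z =
    vacA γ σ ν τ z * (∏ k, (sin (z - right.roots k + I * γ) / sin (z - right.roots k))) +
    vacD γ σ ν τ z * ∏ k, (sin (z - right.roots k + -(I * γ)) / sin (z - right.roots k)) := by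
  -- The point `z` of the contour is joined to the Bethe roots. The eigenvalue is the coefficient of
  -- the wanted term in the action of `A + D`, the unwanted terms being cancelled by the Bethe
  -- equations.
  set p : Option (Fin K) → ℂ := fun c => c.elim z right.roots with hp
  have hmem : ∀ c, p c ∈ C.trace ∪ C.inside := by
    rintro (_ | k)
    · exact Or.inl hz
    · exact Or.inr (h.roots k)
  have hne : ∀ k, z ≠ right.roots k := by
    rintro k rfl
    exact (h.roots k).1 hz
  have hs : ∀ c d, c ≠ d → sin (p c - p d) ≠ 0 := by
    rintro (_ | k) (_ | l) hcd
    · exact absurd rfl hcd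
    · exact h.sin_ne (Or.inl hz) (h.roots l) (hne l)
    · rw [← neg_sub, Complex.sin_neg]
      exact neg_ne_zero.2 (h.sin_ne (Or.inl hz) (h.roots k) (hne k))
    · exact h.right_state.distinct k l fun e => hcd (by rw [e])
  have h1 := h.operators.apply_add_apply_betheVector hmem hs
    (fun c d => h.shift _ (hmem c) _ (hmem d)) (S := univ) (i := none) (mem_univ _) (by
      intro c hc
      rw [univ_erase_none] at hc ⊢
      obtain ⟨k, -, rfl⟩ := mem_map.1 hc
      rw [actionCoeff_map, actionCoeff_map]
      exact h.bethe k)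
  rw [univ_erase_none, h.betheVector_map] at h1
  have h2 := h1.symm.trans (h.vector_eigen z (Or.inl hz))
  have h3 := smul_left_injective ℂ h.vector_ne h2
  rw [← h3, actionCoeff, actionCoeff, univ_erase_none, prod_map, prod_map]
  rfl

/-- In the eigenvalue the ratio of the contribution of `D` to that of `A` is `𝔞`. Therefore `Λ / (1
+ 𝔞)` continues from the contour to the interior as an explicit product whose only poles there are
the Bethe roots, wherever else `1 + 𝔞` may vanish. -/
theorem one_add_auxFun {z : ℂ} (hz : z ∈ C.trace) :
    (1 + auxFun γ σ ν τ right.roots z) *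
      (vacA γ σ ν τ z * ∏ k, (sin (z - right.roots k + I * γ) / sin (z - right.roots k))) =
      right.eigenvalue z := by
  have h1 := h.vacA_ne hz
  have h2 : ∏ k, sin (z - right.roots k + I * γ) ≠ 0 :=
    prod_ne_zero_iff.2 fun k _ => h.shift _ (Or.inl hz) _ (Or.inr (h.roots k))
  have h3 : ∏ k, sin (z - right.roots k) ≠ 0 := prod_ne_zero_iff.2 fun k _ =>
    h.sin_ne (Or.inl hz) (h.roots k) (by rintro rfl; exact (h.roots k).1 hz)
  rw [h.right_eigenvalue_eq hz, prod_div_distrib, prod_div_distrib, auxFun]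
  simp only [← sub_eq_add_neg]
  field_simp

theorem right_ne {z : ℂ} (hz : z ∈ C.trace) : right.eigenvalue z ≠ 0 := by
  rw [← h.one_add_auxFun hz]
  refine mul_ne_zero (h.aux_ne z hz) (mul_ne_zero (h.vacA_ne hz) (prod_ne_zero_iff.2 fun k _ =>
    div_ne_zero (h.shift _ (Or.inl hz) _ (Or.inr (h.roots k))) (h.sin_ne (Or.inl hz) (h.roots k) ?_)))
  rintro rfl
  exact (h.roots k).1 hz

/-- The spectral parameters and the Bethe roots of the right state. -/
def points (_ : IsMatrixElement γ σ ν τ τ' right left C) (ξ₁ ξ₂ : ℂ) : Fin 2 ⊕ Fin K → ℂ :=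
  Sum.elim ![ξ₁, ξ₂] right.roots

theorem contourDensity_eq {ξ₁ ξ₂ z : ℂ} (hz : z ∈ C.trace) :
    h.operators.contourDensity (h.points ξ₁ ξ₂) left.eigenvalue (Sum.inl 0) (Sum.inl 1) z =
      right.eigenvalue z / (left.eigenvalue z * (1 + auxFun γ σ ν τ right.roots z)) := by
  have h1 := h.left_ne z (Or.inl hz)
  have h2 := h.aux_ne z hz
  rw [BetheOperators.contourDensity, erase_inl_erase_inl, prod_map, ← h.one_add_auxFun hz]
  change vacA γ σ ν τ z * (∏ k, (sin (z - right.roots k + I * γ) / sin (z - right.roots k))) /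
    _ = _
  field_simp

/-- The matrix element as a linear functional. -/
noncomputable def functional (_ : IsMatrixElement γ σ ν τ τ' right left C) :
    ((Fin (2 * K) → Fin 2) → ℂ) →ₗ[ℂ] ℂ where
  toFun := dotProduct left.bra
  map_add' := dotProduct_add _
  map_smul' c v := dotProduct_smul c _ v

theorem isContourTwoPoint {ξ₁ ξ₂ : ℂ} (h₁ : ξ₁ ∈ C.inside) (h₂ : ξ₂ ∈ C.inside) (h₁₂ : ξ₁ ≠ ξ₂)
    (hr₁ : ∀ k, ξ₁ ≠ right.roots k) (hr₂ : ∀ k, ξ₂ ≠ right.roots k)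
    (he₁ : right.eigenvalue ξ₁ ≠ 0) (he₂ : right.eigenvalue ξ₂ ≠ 0) :
    h.operators.IsContourTwoPoint (h.points ξ₁ ξ₂) (exp ((τ' - τ) / 2)) (Sum.inl 0) (Sum.inl 1)
      h.functional left.eigenvalue right.eigenvalue where
  inside := by
    rintro (c | k)
    · fin_cases c
      exacts [h₁, h₂]
    · exact h.roots k
  injective := by
    refine Function.Injective.sumElim ?_ h.roots_injective ?_
    · intro a b hab
      fin_cases a <;> fin_cases b <;> simp_all
    · intro a k
      fin_cases a
      exacts [hr₁ k, hr₂ k]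
  ne := by simp
  shift := h.shift
  period := h.period
  w_ne := Complex.exp_ne_zero _
  a_analytic z hz := h.analyticAt_vacA hz
  left_analytic z hz := h.analyticAt_left hz
  left_ne := h.left_ne
  left_eigen z hz v := by
    -- The left state diagonalizes the transfer matrix at the twist `τ'`. Written with the operators
    -- at the twist `τ`, that transfer matrix is `w A + w⁻¹ D` with `w = exp((τ' - τ)/2)`.
    have h1 := congrArg (dotProduct · v) (h.left_state.bra_eigen z (h.isRegularPoint z hz))
    simp only [smul_dotProduct, smul_eq_mul] at h1
    rw [← Matrix.dotProduct_mulVec, transferMatrix_mulVec,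
      (blocks_monodromy_twist γ σ ν τ τ' z).1, (blocks_monodromy_twist γ σ ν τ τ' z).2] at h1
    exact h1
  bethe := by
    rintro (c | k) h0 h1
    · fin_cases c
      · exact absurd rfl h0
      · exact absurd rfl h1
    · rw [erase_inl_erase_inl]
      change actionCoeff _ _ _ _ (Function.Embedding.inr k) =
        actionCoeff _ _ _ _ (Function.Embedding.inr k)
      rw [actionCoeff_map, actionCoeff_map]
      exact h.bethe k
  coeff_ne := by
    rintro (c | k) h0 h1
    · fin_cases c
      · exact absurd rfl h0
      · exact absurd rfl h1
    · rw [erase_inl_erase_inl]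
      change actionCoeff _ _ _ _ (Function.Embedding.inr k) ≠ 0
      rw [actionCoeff_map]
      exact h.coeff_ne k
  right_eigen hp z hz := by
    rw [erase_inl_erase_inl, h.betheVector_map]
    exact h.vector_eigen z hz
  right_ne₁ := he₁
  right_ne₂ := he₂
  overlap_ne hp := by
    rw [erase_inl_erase_inl, h.betheVector_map]
    exact h.overlap_vector_ne

theorem charge_ket (s : Fin (2 * K) → Fin 2) (hs : right.ket s ≠ 0) : charge σ s = K := by
  obtain ⟨c, hc⟩ := h.right_state.ket_bethe
  rw [hc, Pi.smul_apply] at hs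
  have e : (List.ofFn fun j => monodromyEntry γ σ ν τ (right.roots j) 0 1) =
      (List.ofFn right.roots).map fun z => monodromyEntry γ σ ν τ z 0 1 := by
    rw [List.map_ofFn]; rfl
  rw [e] at hs
  have := charge_mulVec_prod γ ν τ _ s (right_ne_zero_of_mul hs)
  simpa using this

theorem charge_bra (s : Fin (2 * K) → Fin 2) (hs : left.bra s ≠ 0) : charge σ s = K := by
  obtain ⟨c, hc⟩ := h.left_state.bra_bethe
  rw [hc, Pi.smul_apply] at hs
  have e : (List.ofFn fun j => monodromyEntry γ σ ν τ' (left.roots j) 1 0) =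
      (List.ofFn left.roots).map fun z => monodromyEntry γ σ ν τ' z 1 0 := by
    rw [List.map_ofFn]; rfl
  rw [e] at hs
  have := charge_vecMul_prod γ ν τ' _ s (right_ne_zero_of_mul hs)
  simpa using this

/-- Both vectors have charge `K`, so the ice rule leaves six of the sixteen entries. The
normalization of the right vector cancels in the quotient. -/
theorem normalizedElement_eq (ξ₁ ξ₂ N : ℂ)
    (hN : N = h.functional h.vector * (right.eigenvalue ξ₁ * right.eigenvalue ξ₂)) :
    normalizedElement γ σ ν τ left.bra right.ket right.eigenvalue ξ₁ ξ₂ =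
    ofArray !![
      h.functional (h.operators.A ξ₁ (h.operators.A ξ₂ h.vector)) / N, 0, 0, 0;
      0, h.functional (h.operators.A ξ₁ (h.operators.D ξ₂ h.vector)) / N,
        h.functional (h.operators.B ξ₁ (h.operators.C ξ₂ h.vector)) / N, 0;
      0, h.functional (h.operators.C ξ₁ (h.operators.B ξ₂ h.vector)) / N,
        h.functional (h.operators.D ξ₁ (h.operators.A ξ₂ h.vector)) / N, 0;
      0, 0, 0, h.functional (h.operators.D ξ₁ (h.operators.D ξ₂ h.vector)) / N] := by
  obtain ⟨c, hc0, hc⟩ := h.exists_ket_eq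
  have h0 : ∀ a₁ b₁ a₂ b₂ : Fin 2, (a₁ : ℕ) + a₂ ≠ b₁ + b₂ →
      normalizedElement γ σ ν τ left.bra right.ket right.eigenvalue ξ₁ ξ₂ (a₁, a₂) (b₁, b₂) = 0 :=
    fun a₁ b₁ a₂ b₂ hab => by
      rw [normalizedElement, dotProduct_monodromy_eq_zero γ ν τ h.charge_bra h.charge_ket ξ₁ ξ₂ hab,
        zero_div]
  have h1 : ∀ a₁ b₁ a₂ b₂ : Fin 2,
      normalizedElement γ σ ν τ left.bra right.ket right.eigenvalue ξ₁ ξ₂ (a₁, a₂) (b₁, b₂) =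
      h.functional (blocks (monodromy γ σ ν τ ξ₁) a₁ b₁
        (blocks (monodromy γ σ ν τ ξ₂) a₂ b₂ h.vector)) / N := by
    intro a₁ b₁ a₂ b₂
    rw [normalizedElement, hN, hc, Matrix.mulVec_smul, dotProduct_smul, dotProduct_smul,
      smul_eq_mul, smul_eq_mul, mul_assoc c, mul_div_mul_left _ _ hc0, ← Matrix.mulVec_mulVec]
    rfl
  ext ⟨a₁, a₂⟩ ⟨b₁, b₂⟩
  fin_cases a₁ <;> fin_cases a₂ <;> fin_cases b₁ <;> fin_cases b₂ <;>
    first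
    | exact h0 _ _ _ _ (by decide)
    | exact h1 _ _ _ _

end IsMatrixElement

end XXZ

/-! ### Continuous dependence of the factorized expression on its data -/

namespace XXZ

open Complex

theorem continuous_factorizedMatrix (q ζ dp d0 dm : ℂ) :
    Continuous fun y : (ℂ × ℂ) × (ℂ × ℂ) =>
      factorizedMatrix q ζ dp d0 dm y.1.1 y.1.2 y.2.1 y.2.2 := by
  have h : Continuous fun y : (ℂ × ℂ) × (ℂ × ℂ) => ofArray !![-y.1.1, 0, 0, 0;
      0, 0, 0, 0;
      0, 0, 0, 0;
      0, 0, 0, 1 + y.1.1] := by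
    refine continuous_pi fun a => continuous_pi fun b => ?_
    fin_cases a <;> fin_cases b <;> simp [ofArray, finProdFinEquiv] <;> fun_prop
  unfold factorizedMatrix
  refine Continuous.add (Continuous.add (Continuous.add ?_ ?_) ?_) h <;> fun_prop

namespace Contour

variable {C : Contour}

/-- The solution of an integral equation on `C` if there is only one. -/
def IsUniqueSolution (C : Contour) (k : ℂ → ℂ → ℂ) (δ f g : ℂ → ℂ) : Prop :=
  C.IsSolution k δ f g ∧ ∀ g', C.IsSolution k δ f g' → Set.EqOn g' g C.trace

/-- The factorized two-site expression in terms of contour integrals; here `w = q^α` and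
`η = iγ`. -/
noncomputable def factorized (C : Contour) (w η q ζ : ℂ) (δ : ℂ → ℂ) (ρ₁ ρ₂ ξ₁ ξ₂ : ℂ)
    (g₁ g₂ : ℂ → ℂ) : Matrix (Fin 2 × Fin 2) (Fin 2 × Fin 2) ℂ :=
  factorizedMatrix q ζ (w * q - w⁻¹ * q⁻¹) (w - w⁻¹) (q * w⁻¹ - q⁻¹ * w)
    (C.integral fun z => δ z * g₁ z) (C.integral fun z => δ z * g₂ z)
    (-I * C.integral fun z => δ z * (w * cot (z - ξ₁ + η) - ρ₁ * cot (z - ξ₁)) * g₂ z)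
    (-I * C.integral fun z => δ z * (w * cot (z - ξ₂ + η) - ρ₂ * cot (z - ξ₂)) * g₁ z)

/-- Joint continuity along `{x₀}` times the compact contour gives uniform convergence, by the tube
argument. -/
theorem tendstoUniformlyOn_of_continuousAt {X ι : Type*} [TopologicalSpace X] {l : Filter ι}
    {F : X → ℂ → ℂ} {x : ι → X} {x₀ : X}
    (hF : ∀ z ∈ C.trace, ContinuousAt (Function.uncurry F) (x₀, z)) (hx : Tendsto x l (𝓝 x₀)) :
    TendstoUniformlyOn (fun i => F (x i)) (F x₀) l C.trace := by
  rw [← tendstoLocallyUniformlyOn_iff_tendstoUniformlyOn_of_compact C.isCompact_trace,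
    Metric.tendstoLocallyUniformlyOn_iff]
  intro ε hε z hz
  have h1 := Metric.tendsto_nhds.1 (hF z hz).tendsto (ε / 2) (half_pos hε)
  rw [nhds_prod_eq, eventually_prod_iff] at h1
  obtain ⟨P, hP, Q, hQ, hPQ⟩ := h1
  refine ⟨{y | Q y}, mem_nhdsWithin_of_mem_nhds hQ, ?_⟩
  filter_upwards [hx.eventually hP] with i hi y hy
  have a1 : dist (F (x i) y) (F x₀ z) < ε / 2 := hPQ hi hy
  have a2 : dist (F x₀ y) (F x₀ z) < ε / 2 := hPQ hP.self_of_nhds hy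
  calc dist (F x₀ y) (F (x i) y) ≤ dist (F x₀ y) (F x₀ z) + dist (F (x i) y) (F x₀ z) :=
        dist_triangle_right _ _ _
    _ < ε := by linarith

theorem continuousAt_cot_pair {w η ρ ξ z : ℂ} (h1 : sin (z - ξ + η) ≠ 0) (h2 : sin (z - ξ) ≠ 0) :
    ContinuousAt (Function.uncurry fun (x : ℂ × ℂ) (z : ℂ) =>
      w * cot (z - x.2 + η) - x.1 * cot (z - x.2)) ((ρ, ξ), z) := by
  have c1 : ContinuousAt (fun y : (ℂ × ℂ) × ℂ => cot (y.2 - y.1.2 + η)) ((ρ, ξ), z) :=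
    ContinuousAt.comp (g := cot) (analyticAt_cot h1).continuousAt
      (by fun_prop : ContinuousAt (fun y : (ℂ × ℂ) × ℂ => y.2 - y.1.2 + η) ((ρ, ξ), z))
  have c2 : ContinuousAt (fun y : (ℂ × ℂ) × ℂ => cot (y.2 - y.1.2)) ((ρ, ξ), z) :=
    ContinuousAt.comp (g := cot) (analyticAt_cot h2).continuousAt
      (by fun_prop : ContinuousAt (fun y : (ℂ × ℂ) × ℂ => y.2 - y.1.2) ((ρ, ξ), z))
  have c3 : ContinuousAt (fun y : (ℂ × ℂ) × ℂ => y.1.1) ((ρ, ξ), z) := by fun_prop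
  exact (continuousAt_const.mul c1).sub (c3.mul c2)

section Limit

variable {w η : ℂ}
  (shift : ∀ z ∈ C.trace ∪ C.inside, ∀ v ∈ C.trace ∪ C.inside, sin (z - v + η) ≠ 0)
  (period : ∀ z ∈ C.inside, ∀ v ∈ C.trace ∪ C.inside, sin (z - v) = 0 → z = v)

include shift in
theorem continuousOn_cotKernel : ContinuousOn
    (Function.uncurry fun lam mu => cotKernel w η (lam - mu)) (C.trace ×ˢ C.trace) := by
  rintro ⟨z, v⟩ ⟨hz, hv⟩
  have h1 := shift z (Or.inl hz) v (Or.inl hv)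
  have h2 : sin (z - v - η) ≠ 0 := by
    intro h0
    apply shift v (Or.inl hv) z (Or.inl hz)
    rw [← neg_eq_zero, ← Complex.sin_neg, ← h0]; congr 1; ring
  have c1 : ContinuousAt (fun y : ℂ × ℂ => cot (y.1 - y.2 + η)) (z, v) :=
    ContinuousAt.comp (g := cot) (analyticAt_cot h1).continuousAt
      (by fun_prop : ContinuousAt (fun y : ℂ × ℂ => y.1 - y.2 + η) (z, v))
  have c2 : ContinuousAt (fun y : ℂ × ℂ => cot (y.1 - y.2 - η)) (z, v) :=
    ContinuousAt.comp (g := cot) (analyticAt_cot h2).continuousAt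
      (by fun_prop : ContinuousAt (fun y : ℂ × ℂ => y.1 - y.2 - η) (z, v))
  exact ((continuousAt_const.mul c2).sub (continuousAt_const.mul c1)).continuousWithinAt

include period in
theorem sin_sub_ne {z ξ : ℂ} (hz : z ∈ C.trace) (hξ : ξ ∈ C.inside) : sin (z - ξ) ≠ 0 := by
  intro h0
  have : ξ = z := by
    refine period ξ hξ z (Or.inl hz) ?_
    rw [← neg_sub, Complex.sin_neg, h0, neg_zero]
  exact hξ.1 (this ▸ hz)

variable {ι : Type*} {l : Filter ι} {ρ ξ : ι → ℂ} {ρ₀ ξ₀ : ℂ}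

include shift period

theorem continuousOn_cot_pair {ξ ρ : ℂ} (hξ : ξ ∈ C.inside) :
    ContinuousOn (fun z => w * cot (z - ξ + η) - ρ * cot (z - ξ)) C.trace := fun z hz =>
  ((continuousAt_cot_pair (w := w) (ρ := ρ) (shift z (Or.inl hz) ξ (Or.inr hξ))
    (sin_sub_ne period hz hξ)).comp (f := fun z => ((ρ, ξ), z))
      (by fun_prop : ContinuousAt (fun z : ℂ => ((ρ, ξ), z)) z)).continuousWithinAt

theorem tendstoUniformlyOn_cot_pair (hξ₀ : ξ₀ ∈ C.inside) (hξ : Tendsto ξ l (𝓝 ξ₀))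
    (hρ : Tendsto ρ l (𝓝 ρ₀)) : TendstoUniformlyOn
      (fun i z => w * cot (z - ξ i + η) - ρ i * cot (z - ξ i))
      (fun z => w * cot (z - ξ₀ + η) - ρ₀ * cot (z - ξ₀)) l C.trace :=
  tendstoUniformlyOn_of_continuousAt
    (F := fun (x : ℂ × ℂ) (z : ℂ) => w * cot (z - x.2 + η) - x.1 * cot (z - x.2))
    (x := fun i => (ρ i, ξ i)) (x₀ := (ρ₀, ξ₀)) (fun z hz => continuousAt_cot_pair
      (shift z (Or.inl hz) ξ₀ (Or.inr hξ₀)) (sin_sub_ne period hz hξ₀)) (hρ.prodMk_nhds hξ)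

variable [l.NeBot] {δ : ι → ℂ → ℂ} {δ₀ : ℂ → ℂ} (hδ : ∀ᶠ i in l, ContinuousOn (δ i) C.trace)
  (hδ₀ : TendstoUniformlyOn δ δ₀ l C.trace)

include hδ hδ₀

theorem exists_tendsto_source (hξ₀ : ξ₀ ∈ C.inside) (hξ : Tendsto ξ l (𝓝 ξ₀))
    (hρ : Tendsto ρ l (𝓝 ρ₀)) {g₀ : ℂ → ℂ}
    (hg : C.IsUniqueSolution (fun lam mu => cotKernel w η (lam - mu)) δ₀ (source w η ρ₀ ξ₀) g₀) :
    ∃ g : ι → ℂ → ℂ, (∀ᶠ i in l, C.IsUniqueSolution (fun lam mu => cotKernel w η (lam - mu)) (δ i)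
      (source w η (ρ i) (ξ i)) (g i)) ∧ TendstoUniformlyOn g g₀ l C.trace := by
  refine exists_tendsto_solution (continuousOn_cotKernel shift) hδ hδ₀ ?_
    (tendstoUniformlyOn_cot_pair shift period hξ₀ hξ hρ) hg.1 hg.2
  filter_upwards [hξ.eventually (C.isOpen_inside.mem_nhds hξ₀)] with i hi
  exact continuousOn_cot_pair shift period hi

/-- Continuity of the factorized expression in its data. -/
theorem exists_tendsto_factorized {ρ₁ ρ₂ ξ₁ ξ₂ : ι → ℂ} {r₁ r₂ x₁ x₂ : ℂ} (q ζ : ℂ)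
    (hx₁ : x₁ ∈ C.inside) (hx₂ : x₂ ∈ C.inside) (hξ₁ : Tendsto ξ₁ l (𝓝 x₁))
    (hξ₂ : Tendsto ξ₂ l (𝓝 x₂)) (hρ₁ : Tendsto ρ₁ l (𝓝 r₁)) (hρ₂ : Tendsto ρ₂ l (𝓝 r₂))
    {g₁ g₂ : ℂ → ℂ}
    (hg₁ : C.IsUniqueSolution (fun lam mu => cotKernel w η (lam - mu)) δ₀ (source w η r₁ x₁) g₁)
    (hg₂ : C.IsUniqueSolution (fun lam mu => cotKernel w η (lam - mu)) δ₀ (source w η r₂ x₂) g₂) :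
    ∃ G₁ G₂ : ι → ℂ → ℂ, (∀ᶠ i in l,
      C.IsUniqueSolution (fun lam mu => cotKernel w η (lam - mu)) (δ i)
        (source w η (ρ₁ i) (ξ₁ i)) (G₁ i) ∧
      C.IsUniqueSolution (fun lam mu => cotKernel w η (lam - mu)) (δ i)
        (source w η (ρ₂ i) (ξ₂ i)) (G₂ i)) ∧
      Tendsto (fun i => C.factorized w η q ζ (δ i) (ρ₁ i) (ρ₂ i) (ξ₁ i) (ξ₂ i) (G₁ i) (G₂ i)) l
        (𝓝 (C.factorized w η q ζ δ₀ r₁ r₂ x₁ x₂ g₁ g₂)) := by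
  have hδ₀c : ContinuousOn δ₀ C.trace := hδ₀.continuousOn hδ.frequently
  obtain ⟨G₁, hG₁, hG₁'⟩ := exists_tendsto_source shift period hδ hδ₀ hx₁ hξ₁ hρ₁ hg₁
  obtain ⟨G₂, hG₂, hG₂'⟩ := exists_tendsto_source shift period hδ hδ₀ hx₂ hξ₂ hρ₂ hg₂
  refine ⟨G₁, G₂, hG₁.and hG₂, ?_⟩
  have phi : ∀ {G : ι → ℂ → ℂ} {g : ℂ → ℂ}, (∀ᶠ i in l, ContinuousOn (G i) C.trace) →
      ContinuousOn g C.trace → TendstoUniformlyOn G g l C.trace →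
      Tendsto (fun i => C.integral fun z => δ i z * G i z) l
        (𝓝 (C.integral fun z => δ₀ z * g z)) := fun hG hg hGg =>
    tendsto_integral (by filter_upwards [hδ, hG] with i h1 h2 using h1.mul h2)
      (tendstoUniformlyOn_mul hδ₀ hδ₀c hGg hg)
  have psi : ∀ {G : ι → ℂ → ℂ} {g : ℂ → ℂ} {ρ ξ : ι → ℂ} {r x : ℂ},
      (∀ᶠ i in l, ContinuousOn (G i) C.trace) → ContinuousOn g C.trace →
      TendstoUniformlyOn G g l C.trace → x ∈ C.inside → Tendsto ξ l (𝓝 x) →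
      Tendsto ρ l (𝓝 r) →
      Tendsto (fun i => C.integral fun z =>
          δ i z * (w * cot (z - ξ i + η) - ρ i * cot (z - ξ i)) * G i z) l
        (𝓝 (C.integral fun z => δ₀ z * (w * cot (z - x + η) - r * cot (z - x)) * g z)) := by
    intro G g ρ ξ r x hG hg hGg hx hξ hρ
    have hc := continuousOn_cot_pair (w := w) (ρ := r) shift period hx
    refine tendsto_integral ?_ (tendstoUniformlyOn_mul
      (tendstoUniformlyOn_mul hδ₀ hδ₀c
        (tendstoUniformlyOn_cot_pair shift period hx hξ hρ) hc) (hδ₀c.mul hc) hGg hg)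
    filter_upwards [hδ, hG, hξ.eventually (C.isOpen_inside.mem_nhds hx)] with i h1 h2 h3
    exact (h1.mul (continuousOn_cot_pair shift period h3)).mul h2
  have c₁ : ∀ᶠ i in l, ContinuousOn (G₁ i) C.trace := hG₁.mono fun i hi => hi.1.1
  have c₂ : ∀ᶠ i in l, ContinuousOn (G₂ i) C.trace := hG₂.mono fun i hi => hi.1.1
  have p₁ := phi c₁ hg₁.1.1 hG₁'
  have p₂ := phi c₂ hg₂.1.1 hG₂'
  have q₁ := (psi c₂ hg₂.1.1 hG₂' hx₁ hξ₁ hρ₁).const_mul (-I)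
  have q₂ := (psi c₁ hg₁.1.1 hG₁' hx₂ hξ₂ hρ₂).const_mul (-I)
  have hcont := continuous_factorizedMatrix q ζ (w * q - w⁻¹ * q⁻¹) (w - w⁻¹)
    (q * w⁻¹ - q⁻¹ * w)
  have hT := (hcont.tendsto ((C.integral fun z => δ₀ z * g₁ z, C.integral fun z => δ₀ z * g₂ z),
    (-I * C.integral fun z => δ₀ z * (w * cot (z - x₁ + η) - r₁ * cot (z - x₁)) * g₂ z,
      -I * C.integral fun z => δ₀ z * (w * cot (z - x₂ + η) - r₂ * cot (z - x₂)) * g₁ z))).comp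
    ((p₁.prodMk_nhds p₂).prodMk_nhds (q₁.prodMk_nhds q₂))
  simp only [Function.comp_def] at hT
  simp only [factorized]
  exact hT

end Limit

end Contour

end XXZ

/-! ### Factorization of the normalized matrix elements -/

namespace XXZ

open Complex

namespace IsMatrixElement

variable {K : ℕ} {γ : ℂ} {σ : Fin (2 * K) → ℤˣ} {ν : Fin (2 * K) → ℂ} {τ τ' : ℂ}
  {right left : StateData K} {C : Contour}
  (h : IsMatrixElement γ σ ν τ τ' right left C) {δ : ℂ → ℂ}
  (hδ : ∀ z ∈ C.trace, δ z = right.eigenvalue z /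
    (left.eigenvalue z * (1 + auxFun γ σ ν τ right.roots z)) / (2 * Real.pi * I))

include h hδ

/-- On the contour the density is a product of vacuum eigenvalue and sine quotients divided by the
left eigenvalue, and in this form it is visibly analytic there. -/
theorem continuousOn_density : ContinuousOn δ C.trace := by
  have hne : ∀ z ∈ C.trace, ∀ k, sin (z - right.roots k) ≠ 0 := fun z hz k =>
    h.sin_ne (Or.inl hz) (h.roots k) (by rintro rfl; exact (h.roots k).1 hz)
  refine ContinuousOn.congr (f := fun z => vacA γ σ ν τ z *
    (∏ k, (sin (z - right.roots k + I * γ) / sin (z - right.roots k))) / left.eigenvalue z /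
      (2 * Real.pi * I)) (fun z hz => ?_) fun z hz => ?_
  · have h1 : AnalyticAt ℂ (fun z => vacA γ σ ν τ z *
        (∏ k, (sin (z - right.roots k + I * γ) / sin (z - right.roots k))) / left.eigenvalue z /
          (2 * Real.pi * I)) z := by
      refine (((h.analyticAt_vacA (Or.inl hz)).mul
        (Finset.analyticAt_fun_prod _ fun k _ => ?_)).div (h.analyticAt_left (Or.inl hz))
        (h.left_ne z (Or.inl hz))).div_const
      exact (analyticAt_sin.comp ((analyticAt_id.sub analyticAt_const).add analyticAt_const)).div
        (analyticAt_sin.comp (analyticAt_id.sub analyticAt_const)) (hne z hz k)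
    exact h1.continuousAt.continuousWithinAt
  · have h1 := h.left_ne z (Or.inl hz)
    have h2 := h.aux_ne z hz
    rw [hδ z hz, ← h.one_add_auxFun hz]
    congr 1
    field_simp

variable {q : ℂ} (hq : q = exp (I * (I * γ))) (hw1 : exp ((τ' - τ) / 2) ^ 2 - 1 ≠ 0)
  (hp0 : exp ((τ' - τ) / 2) ^ 2 * q ^ 2 - 1 ≠ 0) (hm0 : exp ((τ' - τ) / 2) ^ 2 - q ^ 2 ≠ 0)

include hq hw1 hp0 hm0

/-- The factorization for spectral parameters that differ from the Bethe roots. -/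
theorem normalizedElement_eq_of_ne {ξ₁ ξ₂ : ℂ} (h₁ : ξ₁ ∈ C.inside) (h₂ : ξ₂ ∈ C.inside)
    (h₁₂ : ξ₁ ≠ ξ₂) (hr₁ : ∀ k, ξ₁ ≠ right.roots k) (hr₂ : ∀ k, ξ₂ ≠ right.roots k)
    (he₁ : right.eigenvalue ξ₁ ≠ 0) (he₂ : right.eigenvalue ξ₂ ≠ 0) {g₁ g₂ : ℂ → ℂ}
    (hg₁ : C.IsUniqueSolution (fun lam mu => cotKernel (exp ((τ' - τ) / 2)) (I * γ) (lam - mu)) δ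
      (source (exp ((τ' - τ) / 2)) (I * γ) (left.eigenvalue ξ₁ / right.eigenvalue ξ₁) ξ₁) g₁)
    (hg₂ : C.IsUniqueSolution (fun lam mu => cotKernel (exp ((τ' - τ) / 2)) (I * γ) (lam - mu)) δ
      (source (exp ((τ' - τ) / 2)) (I * γ) (left.eigenvalue ξ₂ / right.eigenvalue ξ₂) ξ₂) g₂) :
    normalizedElement γ σ ν τ left.bra right.ket right.eigenvalue ξ₁ ξ₂ =
      C.factorized (exp ((τ' - τ) / 2)) (I * γ) q (exp (I * (ξ₁ - ξ₂))) δ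
        (left.eigenvalue ξ₁ / right.eigenvalue ξ₁) (left.eigenvalue ξ₂ / right.eigenvalue ξ₂)
        ξ₁ ξ₂ g₁ g₂ := by
  have hc := h.isContourTwoPoint h₁ h₂ h₁₂ hr₁ hr₂ he₁ he₂
  have hδ' : ∀ z ∈ C.trace, δ z = h.operators.contourDensity (h.points ξ₁ ξ₂) left.eigenvalue
      (Sum.inl 0) (Sum.inl 1) z / (2 * Real.pi * I) := fun z hz => by
    rw [hδ z hz, h.contourDensity_eq hz]
  have hket : h.vector = h.operators.betheVector (h.points ξ₁ ξ₂) hc.mem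
      ((Finset.univ.erase (Sum.inl 0)).erase (Sum.inl 1)) := by
    rw [erase_inl_erase_inl, h.betheVector_map]; rfl
  rw [h.normalizedElement_eq ξ₁ ξ₂ _ rfl, Contour.factorized,
    show exp (I * (ξ₁ - ξ₂)) = exp (I * ξ₁) / exp (I * ξ₂) by rw [mul_sub, Complex.exp_sub]]
  exact (hc.factorizedMatrix_eq hδ' hg₁.1 hg₁.2 hg₂.2 hc.mem hw1 hq rfl rfl hp0 hm0 h.vector hket _
    rfl rfl rfl).symm

/-- The factorization of the two-site matrix elements. -/
theorem normalizedElement_eq_factorized {ξ₁ ξ₂ : ℂ} (h₁ : ξ₁ ∈ C.inside) (h₂ : ξ₂ ∈ C.inside)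
    (h₁₂ : ξ₁ ≠ ξ₂) (he₁ : right.eigenvalue ξ₁ ≠ 0) (he₂ : right.eigenvalue ξ₂ ≠ 0)
    {g₁ g₂ : ℂ → ℂ}
    (hg₁ : C.IsUniqueSolution (fun lam mu => cotKernel (exp ((τ' - τ) / 2)) (I * γ) (lam - mu)) δ
      (source (exp ((τ' - τ) / 2)) (I * γ) (left.eigenvalue ξ₁ / right.eigenvalue ξ₁) ξ₁) g₁)
    (hg₂ : C.IsUniqueSolution (fun lam mu => cotKernel (exp ((τ' - τ) / 2)) (I * γ) (lam - mu)) δ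
      (source (exp ((τ' - τ) / 2)) (I * γ) (left.eigenvalue ξ₂ / right.eigenvalue ξ₂) ξ₂) g₂) :
    normalizedElement γ σ ν τ left.bra right.ket right.eigenvalue ξ₁ ξ₂ =
      C.factorized (exp ((τ' - τ) / 2)) (I * γ) q (exp (I * (ξ₁ - ξ₂))) δ
        (left.eigenvalue ξ₁ / right.eigenvalue ξ₁) (left.eigenvalue ξ₂ / right.eigenvalue ξ₂)
        ξ₁ ξ₂ g₁ g₂ := by
  -- If a spectral parameter is a Bethe root, the points of the two-point data are not distinct.
  -- Both parameters are moved by the same small `ε ≠ 0`, which leaves `ζ` unchanged and avoids the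
  -- roots; unique solvability persists for small `ε`, and both sides are continuous.
  have hlim : ∀ ξ : ℂ, Tendsto (fun ε => ξ + ε) (𝓝[≠] 0) (𝓝 ξ) := fun ξ => by
    have : ContinuousAt (fun ε => ξ + ε) 0 := by fun_prop
    simpa using this.tendsto.mono_left (nhdsWithin_le_nhds (s := {0}ᶜ))
  have hin : ∀ {ξ : ℂ}, ξ ∈ C.inside → ∀ᶠ ε in 𝓝[≠] (0 : ℂ), ξ + ε ∈ C.inside := fun hξ =>
    (hlim _).eventually (C.isOpen_inside.mem_nhds hξ)
  have hroot : ∀ ξ : ℂ, ∀ᶠ ε in 𝓝[≠] (0 : ℂ), ∀ k, ξ + ε ≠ right.roots k := by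
    intro ξ
    rw [eventually_all]
    intro k
    by_cases hk : ξ = right.roots k
    · filter_upwards [self_mem_nhdsWithin] with ε hε h0
      exact hε (by simpa [hk] using h0)
    · exact (hlim ξ).eventually_ne hk
  have hev : ∀ {ξ : ℂ}, ξ ∈ C.inside →
      Tendsto (fun ε => right.eigenvalue (ξ + ε)) (𝓝[≠] 0) (𝓝 (right.eigenvalue ξ)) := fun hξ =>
    (h.analyticAt_right (Or.inr hξ)).continuousAt.tendsto.comp (hlim _)
  have hev' : ∀ {ξ : ℂ}, ξ ∈ C.inside →
      Tendsto (fun ε => left.eigenvalue (ξ + ε)) (𝓝[≠] 0) (𝓝 (left.eigenvalue ξ)) := fun hξ =>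
    (h.analyticAt_left (Or.inr hξ)).continuousAt.tendsto.comp (hlim _)
  obtain ⟨G₁, G₂, hG, hlimG⟩ := Contour.exists_tendsto_factorized (l := 𝓝[≠] (0 : ℂ)) h.shift
    h.period (δ := fun _ => δ) (Eventually.of_forall fun _ => h.continuousOn_density hδ)
    (fun u hu => Eventually.of_forall fun _ z _ => refl_mem_uniformity hu) q
    (exp (I * (ξ₁ - ξ₂))) h₁ h₂ (hlim ξ₁) (hlim ξ₂) ((hev' h₁).div (hev h₁) he₁)
    ((hev' h₂).div (hev h₂) he₂) hg₁ hg₂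
  have hnorm := Tendsto.comp (g := fun ξ : ℂ × ℂ => normalizedElement γ σ ν τ left.bra right.ket
    right.eigenvalue ξ.1 ξ.2) (f := fun ε => (ξ₁ + ε, ξ₂ + ε))
    (continuousAt_normalizedElement τ (h.isRegularPoint _ (Or.inr h₁))
      (h.isRegularPoint _ (Or.inr h₂)) (h.analyticAt_right (Or.inr h₁)).continuousAt
      (h.analyticAt_right (Or.inr h₂)).continuousAt h.overlap_ne he₁ he₂).tendsto
      ((hlim ξ₁).prodMk_nhds (hlim ξ₂))
  simp only [Function.comp_def] at hnorm
  refine tendsto_nhds_unique (hnorm.congr' ?_) hlimG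
  filter_upwards [hG, hin h₁, hin h₂, hroot ξ₁, hroot ξ₂, (hev h₁).eventually_ne he₁,
    (hev h₂).eventually_ne he₂] with ε hGε i₁ i₂ r₁ r₂ e₁ e₂
  have := h.normalizedElement_eq_of_ne hδ hq hw1 hp0 hm0 i₁ i₂ (by simpa using h₁₂) r₁ r₂ e₁ e₂
    hGε.1 hGε.2
  rwa [add_sub_add_right_eq_sub] at this

end IsMatrixElement

end XXZ

/-! ### The two signs and the final assembly -/

namespace XXZ

open Complex

theorem qPow_neg (γ x : ℂ) : qPow γ (-x) = (qPow γ x)⁻¹ := by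
  rw [qPow, qPow, ← Complex.exp_neg]; congr 1; ring

theorem qPow_add (γ x y : ℂ) : qPow γ (x + y) = qPow γ x * qPow γ y := by
  rw [qPow, qPow, qPow, ← Complex.exp_add]; congr 1; ring

theorem qPow_one (γ : ℂ) : qPow γ 1 = exp (I * (I * γ)) := by
  rw [qPow, ← mul_assoc, I_mul_I]; congr 1; ring

/-- The power `q^{±α}` is the exponential of half the difference of the left and the right twist.
Reversing the sign exchanges the two states, and so both form factors are instances of one matrix
element. -/
theorem qPow_sgn_mul_alpha (s : Sgn) {γ : ℂ} (hγ : γ ≠ 0) {T : ℝ} (hT : T ≠ 0) (h h' : ℝ) :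
    qPow γ (s.toComplex * alpha γ T h h') =
      exp ((s.left (h / T : ℂ) (h' / T) - s.right (h / T : ℂ) (h' / T)) / 2) := by
  have hT' : (T : ℂ) ≠ 0 := by exact_mod_cast hT
  have h1 : γ * alpha γ T h h' = (h / T - h' / T) / 2 := by
    rw [alpha]; field_simp
  rw [qPow, mul_left_comm, h1]
  cases s <;> simp only [Sgn.toComplex, Sgn.left, Sgn.right] <;> congr 1 <;> ring

/-- The square is the exponential of a non-zero real number, because the fields are real and
different. -/
theorem exp_sq_sub_one_ne (s : Sgn) {T h h' : ℝ} (hT : T ≠ 0) (hh : h ≠ h') :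
    exp ((s.left (h / T : ℂ) (h' / T) - s.right (h / T : ℂ) (h' / T)) / 2) ^ 2 - 1 ≠ 0 := by
  rw [← Complex.exp_nat_mul, sub_ne_zero]
  have hx : h / T - h' / T ≠ 0 := by
    rw [← sub_div]
    exact div_ne_zero (sub_ne_zero.2 hh) hT
  have key : ∀ x : ℝ, x ≠ 0 → exp (x : ℂ) ≠ 1 := by
    intro x hx h1
    rw [← Complex.ofReal_exp, ← Complex.ofReal_one, Complex.ofReal_inj, Real.exp_eq_one_iff] at h1
    exact hx h1
  cases s
  · have := key (-(h / T - h' / T)) (neg_ne_zero.2 hx)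
    convert this using 2
    simp only [Sgn.left, Sgn.right]; push_cast; ring
  · have := key (h / T - h' / T) hx
    convert this using 2
    simp only [Sgn.left, Sgn.right]; push_cast; ring

theorem kernel_eq (γ β u : ℂ) : kernel γ (-β) u = cotKernel (qPow γ β) (I * γ) u := by
  rw [kernel, cotKernel, neg_neg, qPow_neg]

theorem isGSolution_iff (s : Sgn) (γ α : ℂ) (C : Contour) (ρ 𝔞 : ℂ → ℂ) (ξ : ℂ) (g : ℂ → ℂ) :
    IsGSolution s γ α C ρ 𝔞 ξ g ↔
      C.IsSolution (fun lam mu => cotKernel (qPow γ (s.toComplex * α)) (I * γ) (lam - mu))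
        (density s ρ 𝔞) (source (qPow γ (s.toComplex * α)) (I * γ) (s.ratio (ρ ξ)) ξ) g := by
  simp only [IsGSolution, Contour.IsSolution, source, kernel_eq, qPow_neg]

theorem isG_iff (s : Sgn) (γ α : ℂ) (C : Contour) (ρ 𝔞 : ℂ → ℂ) (ξ : ℂ) (g : ℂ → ℂ) :
    IsG s γ α C ρ 𝔞 ξ g ↔
      C.IsUniqueSolution (fun lam mu => cotKernel (qPow γ (s.toComplex * α)) (I * γ) (lam - mu))
        (density s ρ 𝔞) (source (qPow γ (s.toComplex * α)) (I * γ) (s.ratio (ρ ξ)) ξ) g := by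
  simp only [IsG, Contour.IsUniqueSolution, isGSolution_iff]

theorem factorizedFormFactor_eq (s : Sgn) (γ α : ℂ) (C : Contour) (ρ 𝔞 : ℂ → ℂ) (G : ℂ → ℂ → ℂ)
    (ξ₁ ξ₂ : ℂ) : factorizedFormFactor s γ α C ρ 𝔞 G ξ₁ ξ₂ =
      C.factorized (qPow γ (s.toComplex * α)) (I * γ) (qPow γ 1) (exp (I * (ξ₁ - ξ₂)))
        (density s ρ 𝔞) (s.ratio (ρ ξ₁)) (s.ratio (ρ ξ₂)) ξ₁ ξ₂ (fun lam => G lam ξ₁)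
        (fun lam => G lam ξ₂) := by
  have e1 : qPow γ (1 + s.toComplex * α) - qPow γ (-1 - s.toComplex * α) =
      qPow γ (s.toComplex * α) * qPow γ 1 - (qPow γ (s.toComplex * α))⁻¹ * (qPow γ 1)⁻¹ := by
    rw [show -1 - s.toComplex * α = -(s.toComplex * α + 1) by ring, qPow_neg, add_comm, qPow_add,
      mul_inv]
  have e2 : qPow γ (1 - s.toComplex * α) - qPow γ (-1 + s.toComplex * α) =
      qPow γ 1 * (qPow γ (s.toComplex * α))⁻¹ - (qPow γ 1)⁻¹ * qPow γ (s.toComplex * α) := by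
    rw [sub_eq_add_neg 1, qPow_add, qPow_add, qPow_neg, qPow_neg]
  rw [factorizedFormFactor, e1, e2, qPow_neg]
  rfl

theorem formFactor_eq {K : ℕ} (s : Sgn) (γ : ℂ) (σ : Fin (2 * K) → ℤˣ) (ν : Fin (2 * K) → ℂ)
    (τ τ' : ℂ) (S₀ Sn : StateData K) (ξ₁ ξ₂ : ℂ) : formFactor s γ σ ν τ τ' S₀ Sn ξ₁ ξ₂ =
      normalizedElement γ σ ν (s.right τ τ') (s.left S₀ Sn).bra (s.right S₀ Sn).ket
        (s.right S₀ Sn).eigenvalue ξ₁ ξ₂ := by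
  cases s <;> rfl

theorem ratio_eigenvalueRatio {K : ℕ} (s : Sgn) (S₀ Sn : StateData K) (z : ℂ) :
    s.ratio (eigenvalueRatio S₀ Sn z) =
      (s.left S₀ Sn).eigenvalue z / (s.right S₀ Sn).eigenvalue z := by
  cases s
  · rfl
  · exact inv_div _ _

theorem density_eq (s : Sgn) (ρ 𝔞 : ℂ → ℂ) (z : ℂ) :
    density s ρ 𝔞 z = (2 * Real.pi * I)⁻¹ * ((s.ratio (ρ z))⁻¹ * (1 + 𝔞 z)⁻¹) := by
  cases s
  · simp only [density, Sgn.ratio, one_div, mul_inv, mul_assoc]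
  · simp only [density, Sgn.ratio, inv_inv, div_eq_mul_inv, mul_inv]; ring

theorem Sgn.tendsto_ratio (s : Sgn) {ι : Type*} {l : Filter ι} {r : ι → ℂ} {r₀ : ℂ}
    (hr : Tendsto r l (𝓝 r₀)) (h0 : r₀ ≠ 0) :
    Tendsto (fun i => s.ratio (r i)) l (𝓝 (s.ratio r₀)) := by
  cases s
  · exact hr
  · exact hr.inv₀ h0

theorem tendstoUniformlyOn_density (s : Sgn) {ι : Type*} {l : Filter ι} {C : Contour}
    {ρ 𝔞 : ι → ℂ → ℂ} {ρ₀ 𝔞₀ : ℂ → ℂ} (hρ : TendstoUniformlyOn ρ ρ₀ l C.trace)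
    (h𝔞 : TendstoUniformlyOn 𝔞 𝔞₀ l C.trace) (hρc : ContinuousOn ρ₀ C.trace)
    (h𝔞c : ContinuousOn 𝔞₀ C.trace) (hne : ∀ z ∈ C.trace, ρ₀ z ≠ 0 ∧ 1 + 𝔞₀ z ≠ 0) :
    TendstoUniformlyOn (fun i => density s (ρ i) (𝔞 i)) (density s ρ₀ 𝔞₀) l C.trace := by
  have hconst : ∀ c : ℂ, TendstoUniformlyOn (fun (_ : ι) (_ : ℂ) => c) (fun _ => c) l C.trace :=
    fun c u hu => Eventually.of_forall fun _ z _ => refl_mem_uniformity hu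
  have hinv := Contour.tendstoUniformlyOn_inv hρ hρc fun z hz => (hne z hz).1
  have hinvc : ContinuousOn (fun z => (ρ₀ z)⁻¹) C.trace := hρc.inv₀ fun z hz => (hne z hz).1
  have h1 : TendstoUniformlyOn (fun i z => (s.ratio (ρ i z))⁻¹) (fun z => (s.ratio (ρ₀ z))⁻¹) l
      C.trace ∧ ContinuousOn (fun z => (s.ratio (ρ₀ z))⁻¹) C.trace := by
    cases s
    · exact ⟨hinv, hinvc⟩
    · simp only [Sgn.ratio, inv_inv]; exact ⟨hρ, hρc⟩
  have hadd : TendstoUniformlyOn (fun i z => 1 + 𝔞 i z) (fun z => 1 + 𝔞₀ z) l C.trace :=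
    (hconst 1).add h𝔞
  have haddc : ContinuousOn (fun z => 1 + 𝔞₀ z) C.trace := continuousOn_const.add h𝔞c
  have h2 := Contour.tendstoUniformlyOn_inv hadd haddc fun z hz => (hne z hz).2
  have h2c := haddc.inv₀ fun z hz => (hne z hz).2
  have h3 := Contour.tendstoUniformlyOn_mul (hconst (2 * Real.pi * I)⁻¹) continuousOn_const
    (Contour.tendstoUniformlyOn_mul h1.1 h1.2 h2 h2c) (h1.2.mul h2c)
  exact (h3.congr (Eventually.of_forall fun i z _ => (density_eq s (ρ i) (𝔞 i) z).symm)).congr_right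
    fun z _ => (density_eq s ρ₀ 𝔞₀ z).symm

/-- The auxiliary function is recovered from the density: `1 + 𝔞` is a quotient of the two
eigenvalues and of `δ`, all of which are continuous and non-zero on the contour. -/
theorem IsMatrixElement.continuousOn_auxFun {K : ℕ} {γ : ℂ} {σ : Fin (2 * K) → ℤˣ}
    {ν : Fin (2 * K) → ℂ} {τ τ' : ℂ} {right left : StateData K} {C : Contour}
    (h : IsMatrixElement γ σ ν τ τ' right left C) :
    ContinuousOn (auxFun γ σ ν τ right.roots) C.trace := by
  have hδ := h.continuousOn_density (δ := fun z => right.eigenvalue z /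
    (left.eigenvalue z * (1 + auxFun γ σ ν τ right.roots z)) / (2 * Real.pi * I))
    fun z _ => rfl
  have hR : ContinuousOn right.eigenvalue C.trace := fun z hz =>
    (h.analyticAt_right (Or.inl hz)).continuousAt.continuousWithinAt
  have hL : ContinuousOn left.eigenvalue C.trace := fun z hz =>
    (h.analyticAt_left (Or.inl hz)).continuousAt.continuousWithinAt
  have hI := two_pi_I_ne_zero
  have hδ0 : ∀ z ∈ C.trace, right.eigenvalue z /
      (left.eigenvalue z * (1 + auxFun γ σ ν τ right.roots z)) / (2 * Real.pi * I) ≠ 0 :=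
    fun z hz => div_ne_zero (div_ne_zero (h.right_ne hz)
      (mul_ne_zero (h.left_ne z (Or.inl hz)) (h.aux_ne z hz))) hI
  refine ContinuousOn.congr (((hR.div hL fun z hz => h.left_ne z (Or.inl hz)).div
    (hδ.mul continuousOn_const) fun z hz => mul_ne_zero (hδ0 z hz) hI).sub
    (continuousOn_const (c := (1 : ℂ)))) fun z hz => ?_
  have h1 := h.left_ne z (Or.inl hz)
  have h2 := h.aux_ne z hz
  have h3 := h.right_ne hz
  simp only [Pi.div_apply, Pi.mul_apply, Pi.sub_apply]
  field_simp
  ring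

/-- The matrix element that defines a form factor. -/
theorem isMatrixElement (s : Sgn) {K : ℕ} {γ : ℂ} {σ : Fin (2 * K) → ℤˣ} {ν : Fin (2 * K) → ℂ}
    {τ τ' : ℂ} {S₀ Sn : StateData K} {C : Contour} (h₀ : IsBetheEigenstate γ σ ν τ S₀)
    (hn : IsBetheEigenstate γ σ ν τ' Sn)
    (hov : dotProduct (s.left S₀ Sn).bra (s.right S₀ Sn).ket ≠ 0)
    (hC : IsAdmissibleContour s γ σ ν τ τ' S₀ Sn C) :
    IsMatrixElement γ σ ν (s.right τ τ') (s.left τ τ') (s.right S₀ Sn) (s.left S₀ Sn) C where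
  right_state := by cases s; exacts [h₀, hn]
  left_state := by cases s; exacts [hn, h₀]
  overlap_ne := hov
  shift := hC.shift
  period := hC.period
  inhom := hC.inhom
  roots := hC.roots
  aux_ne := hC.aux_ne
  left_ne := hC.ratio_ne

theorem density_eigenvalueRatio (s : Sgn) {K : ℕ} (S₀ Sn : StateData K) (𝔞 : ℂ → ℂ) (z : ℂ) :
    density s (eigenvalueRatio S₀ Sn) 𝔞 z = (s.right S₀ Sn).eigenvalue z /
      ((s.left S₀ Sn).eigenvalue z * (1 + 𝔞 z)) / (2 * Real.pi * I) := by
  rw [density_eq, ratio_eigenvalueRatio, inv_div]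
  simp only [div_eq_mul_inv, mul_inv]
  ring

/-- The factorization for a finite number of sites, in terms of `w = q^α`. -/
theorem formFactor_eq_factorized (s : Sgn) {γ : ℂ} {T h h' : ℝ} (hT : 0 < T) (hh : h ≠ h')
    (hq₁ : qPow γ (1 + alpha γ T h h') ≠ qPow γ (-1 - alpha γ T h h'))
    (hq₂ : qPow γ (1 - alpha γ T h h') ≠ qPow γ (-1 + alpha γ T h h'))
    {C : Contour} {ξ₁ ξ₂ : ℂ} (hξ₁ : ξ₁ ∈ C.inside) (hξ₂ : ξ₂ ∈ C.inside) (hξ : ξ₁ ≠ ξ₂)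
    {K : ℕ} {σ : Fin (2 * K) → ℤˣ} {ν : Fin (2 * K) → ℂ} {S₀ Sn : StateData K}
    (hM : IsMatrixElement γ σ ν (s.right (h / T : ℂ) (h' / T)) (s.left (h / T : ℂ) (h' / T))
      (s.right S₀ Sn) (s.left S₀ Sn) C)
    (he₁ : (s.right S₀ Sn).eigenvalue ξ₁ ≠ 0) (he₂ : (s.right S₀ Sn).eigenvalue ξ₂ ≠ 0)
    {g₁ g₂ : ℂ → ℂ} (ρ 𝔞 : ℂ → ℂ) (hρ : ρ = eigenvalueRatio S₀ Sn)
    (h𝔞 : 𝔞 = auxFun γ σ ν (s.right (h / T : ℂ) (h' / T)) (s.right S₀ Sn).roots)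
    (hg₁ : C.IsUniqueSolution (fun lam mu => cotKernel (qPow γ (s.toComplex * alpha γ T h h'))
      (I * γ) (lam - mu)) (density s ρ 𝔞)
      (source (qPow γ (s.toComplex * alpha γ T h h')) (I * γ) (s.ratio (ρ ξ₁)) ξ₁) g₁)
    (hg₂ : C.IsUniqueSolution (fun lam mu => cotKernel (qPow γ (s.toComplex * alpha γ T h h'))
      (I * γ) (lam - mu)) (density s ρ 𝔞)
      (source (qPow γ (s.toComplex * alpha γ T h h')) (I * γ) (s.ratio (ρ ξ₂)) ξ₂) g₂) :
    formFactor s γ σ ν (h / T) (h' / T) S₀ Sn ξ₁ ξ₂ =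
      C.factorized (qPow γ (s.toComplex * alpha γ T h h')) (I * γ) (qPow γ 1)
        (exp (I * (ξ₁ - ξ₂))) (density s ρ 𝔞) (s.ratio (ρ ξ₁)) (s.ratio (ρ ξ₂)) ξ₁ ξ₂ g₁ g₂ := by
  subst hρ h𝔞
  -- For `γ = 0` all powers of `q` are 1, contrary to `hq₁`.
  have hγ : γ ≠ 0 := by
    rintro rfl
    exact hq₁ (by simp [qPow])
  set a := alpha γ T h h' with ha
  -- Changing the sign of `α` merely interchanges the two conditions on `q`.
  have hne : qPow γ (1 + s.toComplex * a) ≠ qPow γ (-(1 + s.toComplex * a)) ∧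
      qPow γ (1 - s.toComplex * a) ≠ qPow γ (-(1 - s.toComplex * a)) := by
    have e1 : -(1 + a) = -1 - a := by ring
    have e2 : -(1 - a) = -1 + a := by ring
    cases s
    · simp only [Sgn.toComplex, one_mul, e1, e2]; exact ⟨hq₁, hq₂⟩
    · simp only [Sgn.toComplex, neg_mul, one_mul, sub_neg_eq_add, ← sub_eq_add_neg, e1, e2]
      exact ⟨hq₂, hq₁⟩
  have hw0 : qPow γ (s.toComplex * a) ≠ 0 := Complex.exp_ne_zero _
  have hq0 : qPow γ 1 ≠ 0 := Complex.exp_ne_zero _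
  have hp0 : qPow γ (s.toComplex * a) ^ 2 * qPow γ 1 ^ 2 - 1 ≠ 0 := by
    intro h0
    apply hne.1
    rw [qPow_neg, qPow_add]
    field_simp
    linear_combination h0
  have hm0 : qPow γ (s.toComplex * a) ^ 2 - qPow γ 1 ^ 2 ≠ 0 := by
    intro h0
    apply hne.2
    rw [qPow_neg, sub_eq_add_neg, qPow_add, qPow_neg]
    field_simp
    linear_combination -h0
  have hw := qPow_sgn_mul_alpha s hγ hT.ne' h h'
  rw [← ha] at hw
  simp only [ratio_eigenvalueRatio] at hg₁ hg₂ ⊢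
  rw [hw] at hg₁ hg₂ hp0 hm0 ⊢
  rw [formFactor_eq]
  exact hM.normalizedElement_eq_factorized (fun z _ => density_eigenvalueRatio s S₀ Sn _ z)
    (qPow_one γ) (exp_sq_sub_one_ne s hT.ne' hh) hp0 hm0 hξ₁ hξ₂ hξ he₁ he₂ hg₁ hg₂

end XXZ

theorem mainTheorem4 (s : XXZ.Sgn) (γ : ℂ) (T h h' : ℝ) (hT : 0 < T) (hh : h ≠ h')
    (hq₁ : XXZ.qPow γ (1 + XXZ.alpha γ T h h') ≠ XXZ.qPow γ (-1 - XXZ.alpha γ T h h'))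
    (hq₂ : XXZ.qPow γ (1 - XXZ.alpha γ T h h') ≠ XXZ.qPow γ (-1 + XXZ.alpha γ T h h'))
    (C : XXZ.Contour) (ξ₁ ξ₂ : ℂ) (hξ₁ : ξ₁ ∈ C.inside) (hξ₂ : ξ₂ ∈ C.inside) (hξ : ξ₁ ≠ ξ₂) :
    -- Finite number of sites, arbitrary staggering and inhomogeneities.
    (∀ (K : ℕ) (σ : Fin (2 * K) → ℤˣ) (ν : Fin (2 * K) → ℂ) (S₀ Sn : XXZ.StateData K),
      0 < K →
      XXZ.IsBetheEigenstate γ σ ν (h / T) S₀ →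
      XXZ.IsBetheEigenstate γ σ ν (h' / T) Sn →
      dotProduct (s.left S₀ Sn).bra (s.right S₀ Sn).ket ≠ 0 →
      (s.right S₀ Sn).eigenvalue ξ₁ ≠ 0 →
      (s.right S₀ Sn).eigenvalue ξ₂ ≠ 0 →
      XXZ.IsAdmissibleContour s γ σ ν (h / T) (h' / T) S₀ Sn C →
      ∀ (ρ 𝔞 : ℂ → ℂ) (G : ℂ → ℂ → ℂ),
      ρ = XXZ.eigenvalueRatio S₀ Sn →
      𝔞 = XXZ.auxFun γ σ ν (s.right (h / T : ℂ) (h' / T)) (s.right S₀ Sn).roots →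
      (∀ ξ ∈ ({ξ₁, ξ₂} : Set ℂ),
        XXZ.IsG s γ (XXZ.alpha γ T h h') C ρ 𝔞 ξ fun lam => G lam ξ) →
      XXZ.formFactor s γ σ ν (h / T) (h' / T) S₀ Sn ξ₁ ξ₂ =
        XXZ.factorizedFormFactor s γ (XXZ.alpha γ T h h') C ρ 𝔞 G ξ₁ ξ₂) ∧
    -- The Trotter limit, for the dynamical and for the static quantum transfer matrix.
    (∀ (J : ℝ) (W : ℕ → XXZ.Columns) (S₀ Sn : ∀ N : ℕ, XXZ.StateData (W N).K)
      (ρ 𝔞 : ℂ → ℂ) (G : ℂ → ℂ → ℂ),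
      0 < J →
      (∃ t : ℝ, W = XXZ.dynamicalColumns γ J T t) ∨ W = XXZ.staticColumns γ J T →
      (∀ᶠ N in XXZ.trotter,
        XXZ.IsBetheEigenstate γ (W N).σ (W N).ν (h / T) (S₀ N) ∧
        XXZ.IsBetheEigenstate γ (W N).σ (W N).ν (h' / T) (Sn N) ∧
        dotProduct (s.left (S₀ N) (Sn N)).bra (s.right (S₀ N) (Sn N)).ket ≠ 0 ∧
        (s.right (S₀ N) (Sn N)).eigenvalue ξ₁ ≠ 0 ∧
        (s.right (S₀ N) (Sn N)).eigenvalue ξ₂ ≠ 0 ∧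
        XXZ.IsAdmissibleContour s γ (W N).σ (W N).ν (h / T) (h' / T) (S₀ N) (Sn N) C) →
      -- convergence of the eigenvalue ratio and of the auxiliary function of the right state
      TendstoUniformlyOn (fun N => XXZ.eigenvalueRatio (S₀ N) (Sn N)) ρ XXZ.trotter C.trace →
      (∀ ξ ∈ ({ξ₁, ξ₂} : Set ℂ),
        Filter.Tendsto (fun N => XXZ.eigenvalueRatio (S₀ N) (Sn N) ξ) XXZ.trotter
          (nhds (ρ ξ))) →
      TendstoUniformlyOn
        (fun N => XXZ.auxFun γ (W N).σ (W N).ν (s.right (h / T : ℂ) (h' / T))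
          (s.right (S₀ N) (Sn N)).roots)
        𝔞 XXZ.trotter C.trace →
      (∀ z ∈ C.trace, ρ z ≠ 0 ∧ 1 + 𝔞 z ≠ 0) →
      ρ ξ₁ ≠ 0 → ρ ξ₂ ≠ 0 →
      (∀ ξ ∈ ({ξ₁, ξ₂} : Set ℂ),
        XXZ.IsG s γ (XXZ.alpha γ T h h') C ρ 𝔞 ξ fun lam => G lam ξ) →
      Filter.Tendsto
        (fun N => XXZ.formFactor s γ (W N).σ (W N).ν (h / T) (h' / T) (S₀ N) (Sn N) ξ₁ ξ₂)
        XXZ.trotter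
        (nhds (XXZ.factorizedFormFactor s γ (XXZ.alpha γ T h h') C ρ 𝔞 G ξ₁ ξ₂))) := by
  constructor
  · intro K σ ν S₀ Sn _ h₀ hn hov he₁ he₂ hC ρ 𝔞 G hρ h𝔞 hG
    rw [XXZ.factorizedFormFactor_eq]
    exact XXZ.formFactor_eq_factorized s hT hh hq₁ hq₂ hξ₁ hξ₂ hξ
      (XXZ.isMatrixElement s h₀ hn hov hC) he₁ he₂ ρ 𝔞 hρ h𝔞
      ((XXZ.isG_iff s _ _ C ρ 𝔞 ξ₁ _).1 (hG ξ₁ (by simp)))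
      ((XXZ.isG_iff s _ _ C ρ 𝔞 ξ₂ _).1 (hG ξ₂ (by simp)))
  · intro J W S₀ Sn ρ 𝔞 G _ _ hev hρ hρξ h𝔞 hne hρ₁ hρ₂ hG
    -- The limit lemmas require a proper filter; along the trivial filter every limit statement
    -- holds.
    rcases Filter.eq_or_neBot XXZ.trotter with hbot | _
    · rw [hbot]; exact Filter.tendsto_bot
    have hM : ∀ᶠ N in XXZ.trotter, XXZ.IsMatrixElement γ (W N).σ (W N).ν
        (s.right (h / T : ℂ) (h' / T)) (s.left (h / T : ℂ) (h' / T)) (s.right (S₀ N) (Sn N))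
        (s.left (S₀ N) (Sn N)) C := hev.mono fun N hN =>
      XXZ.isMatrixElement s hN.1 hN.2.1 hN.2.2.1 hN.2.2.2.2.2
    have hρc : ∀ᶠ N in XXZ.trotter,
        ContinuousOn (XXZ.eigenvalueRatio (S₀ N) (Sn N)) C.trace := by
      filter_upwards [hM] with N hN
      have hR : ContinuousOn (s.right (S₀ N) (Sn N)).eigenvalue C.trace := fun z hz =>
        (hN.analyticAt_right (Or.inl hz)).continuousAt.continuousWithinAt
      have hL : ContinuousOn (s.left (S₀ N) (Sn N)).eigenvalue C.trace := fun z hz =>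
        (hN.analyticAt_left (Or.inl hz)).continuousAt.continuousWithinAt
      have hR0 := fun z (hz : z ∈ C.trace) => hN.right_ne hz
      have hL0 := fun z (hz : z ∈ C.trace) => hN.left_ne z (Or.inl hz)
      cases s
      · exact hL.div hR hR0
      · exact hR.div hL hL0
    have h𝔞c := hM.mono fun N hN => hN.continuousOn_auxFun
    have hδ : ∀ᶠ N in XXZ.trotter, ContinuousOn (XXZ.density s (XXZ.eigenvalueRatio (S₀ N) (Sn N))
        (XXZ.auxFun γ (W N).σ (W N).ν (s.right (h / T : ℂ) (h' / T))
          (s.right (S₀ N) (Sn N)).roots)) C.trace := hM.mono fun N hN =>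
      hN.continuousOn_density fun z _ => XXZ.density_eigenvalueRatio s (S₀ N) (Sn N) _ z
    have hδ₀ := XXZ.tendstoUniformlyOn_density s hρ h𝔞 (hρ.continuousOn hρc.frequently)
      (h𝔞.continuousOn h𝔞c.frequently) hne
    -- The geometric conditions on the contour do not depend on the Trotter number, so a single `N`
    -- provides them.
    obtain ⟨_, hN₀⟩ := hM.exists
    -- Unique solvability of the limit equations carries over to all large `N`. The formula for
    -- finitely many sites applies to the solutions `G₁ N`, `G₂ N`, and its right-hand side
    -- converges to the expression formed with the limit functions.
    obtain ⟨G₁, G₂, hU, hlim⟩ := XXZ.Contour.exists_tendsto_factorized hN₀.shift hN₀.period hδ hδ₀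
      (XXZ.qPow γ 1) (Complex.exp (Complex.I * (ξ₁ - ξ₂))) hξ₁ hξ₂ tendsto_const_nhds
      tendsto_const_nhds (s.tendsto_ratio (hρξ ξ₁ (by simp)) hρ₁)
      (s.tendsto_ratio (hρξ ξ₂ (by simp)) hρ₂)
      ((XXZ.isG_iff s _ _ C ρ 𝔞 ξ₁ _).1 (hG ξ₁ (by simp)))
      ((XXZ.isG_iff s _ _ C ρ 𝔞 ξ₂ _).1 (hG ξ₂ (by simp)))
    rw [XXZ.factorizedFormFactor_eq]
    refine hlim.congr' ?_
    filter_upwards [hM, hev, hU] with N hN hN' hUN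
    exact (XXZ.formFactor_eq_factorized s hT hh hq₁ hq₂ hξ₁ hξ₂ hξ hN hN'.2.2.2.1
      hN'.2.2.2.2.1 _ _ rfl rfl hUN.1 hUN.2).symm
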